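/- **Setting.** A quadratic-like map $f:U'\to U$ is a proper holomorphic map of degree two between topological disks $U'\Subset U\subset\mathbb C$, with critical point normalized to be $0$. Its filled Julia set is $K(f)=\{z: f^n z\in U' \text{ for all } n\ge 0\}$ and its Julia set is $J(f)=\partial K(f)$; $\omega(0)$ is the $\omega$-limit set of $0$. Let $f:U'\to U$ and $\tilde f:\tilde U'\to\tilde U$ be infinitely renormalizable quadratic-like maps. Let $F_m=f^{p_m}:V'_m\to V_m$ be the $m$-fold renormalization of $f$ ($F_0=f$ and $F_{m+1}$ is the first renormalization of $F_m$ in the sense of Douady–Hubbard), and let $\mathbb J^m=\bigcup_{0\le i<p_m} f^i(J(F_m))$ be the orbit of little Julia sets of level $m$; its connected components $B^m_j$ are the Julia bouquets. Let $\mathbb U^m$ be open neighborhoods of $\mathbb J^m$ with $\overline{\mathbb U^m}\subset U'$, such that, for some $\delta>0$ and $l\in\mathbb N$ independent of $m$: the components $U^m_j$ of $\mathbb U^m$ are topological disks, each containing exactly one bouquet $B^m_j$; the annuli $U^m_j\setminus B^m_j$ have modulus at least $\delta$; and the closure of each component $U^{m+l}_i$ of $\mathbb U^{m+l}$ is contained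 in a component $U^{m}_j$ of $\mathbb U^{m}$, the annulus $U^{m}_j\setminus \overline{U^{m+l}_i}$ having modulus at least $\delta$. Put $\mathbb U^n=U'$ for $n<0$. The corresponding objects for $\tilde f$, marked with a tilde, are assumed to have the same properties, with the same $l$ and $\delta$. Two maps $g_0,g_1$ are called homotopic on $X$ rel $A\subset X$ if there is a homotopy $g_t$ on $X$ between them that is constant on $A$ and satisfies $g_t(X\setminus A)\subset g_0(X\setminus A)$ for all $t$. $\operatorname{Dil}(g|\Omega)\in[1,\infty]$ is the smallest $K$ such that $g$ is $K$-quasiconformal on the open set $\Omega$ ($\infty$ if there is none). A Thurston conjugacy between $f:U'\to U$ and $\tilde f:\tilde U'\to\tilde U$ is a homeomorphism $h$, quasiconformal on $U$, which maps $(U,U',\omega(0))$ onto $(\tilde U,\tilde U',\tilde\omega(0))$ and which is homotopic on $\overline U$ rel $\partial U\cup\partial U'\cup\omega(0)$ to a topological conjugacy $\psi:(U,U',\omega(0))\to(\tilde U,\tilde U',\tilde\omega(0))$ between $f$ and $\tilde f$. **Lemma.** Let $h_m:(\mathbb C,\mathbb U^m,\mathbb J^m)\to(\mathbb C,\tilde{\mathbb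 U}^m,\tilde{\mathbb J}^m)$, $m\ge 0$, be homeomorphisms and $K_*$ a constant such that (i) $h_0$ is a topological conjugacy between $f:U'\to U$ and $\tilde f:\tilde U'\to\tilde U$; (ii) $h_{m+1}$ is homotopic to $h_m$ on $\mathbb C$ rel $\mathbb J^{m+1}\cup(\mathbb C\setminus\mathbb U^{m-l})$ for all $m\ge 0$; (iii) $h_m$ is $K_*$-quasiconformal on $\mathbb U^{m-1}\setminus\mathbb J^m$ for all $m\ge 0$; (iv) $\operatorname{Dil}(h_{m+1}|\,\mathbb U^{n}\setminus\mathbb J^{m+1})\le 4K_*^4\operatorname{Dil}(h_{m}|\,\mathbb U^{n}\setminus\mathbb J^{m})$ for all $m\ge0$ and all integers $n$ with $m-l\le n\le m$. Then $h_m$ converges uniformly on $\mathbb C$ to a homeomorphism $h$ of $\mathbb C$ which is a Thurston conjugacy between $f$ and $\tilde f$ (in particular $h$ is quasiconformal on $U$) and which is homotopic to $h_0$ on $\mathbb C$ rel $\omega(0)$. If moreover $h_0$ is quasiconformal on $\mathbb C\setminus J(f)$, then $h$ is quasiconformal on $\mathbb C$. -/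

import Mathlib

open Set Filter Topology MeasureTheory
open scoped ContDiff ENNReal

noncomputable section

namespace Lyubich

/-! ### Quasiconformal maps -/

/-- `D` is a weak (distributional) differential of `g : ℂ → ℂ` on the open set `Ω`. -/
def IsWeakDifferential (g : ℂ → ℂ) (D : ℂ → ℂ →L[ℝ] ℂ) (Ω : Set ℂ) : Prop :=
  ∀ φ : ℂ → ℝ, ContDiff ℝ ∞ φ → HasCompactSupport φ → tsupport φ ⊆ Ω →
    ∀ v : ℂ, ∫ z, (fderiv ℝ φ z v) • g z = - ∫ z, φ z • D z v

/-- `g` is `K`-quasiconformal on the open set `Ω` (analytic definition): it is continuous and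
injective on `Ω`, it lies in `W^{1,2}_loc(Ω)`, and `‖Dg‖² ≤ K · det Dg` almost everywhere in `Ω`
(equivalently `|∂̄g| ≤ ((K - 1) / (K + 1)) |∂g|`). -/
def IsQC (K : ℝ) (g : ℂ → ℂ) (Ω : Set ℂ) : Prop :=
  1 ≤ K ∧ IsOpen Ω ∧ ContinuousOn g Ω ∧ InjOn g Ω ∧
    ∃ D : ℂ → ℂ →L[ℝ] ℂ,
      (∀ C ⊆ Ω, IsCompact C → MemLp D 2 (volume.restrict C)) ∧
      IsWeakDifferential g D Ω ∧
      ∀ᵐ z ∂volume.restrict Ω, ‖D z‖ ^ 2 ≤ K * (D z).det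

/-- The dilatation of `g` on `Ω`: the least `K` such that `g` is `K`-quasiconformal on `Ω`, and
`∞` if `g` is not quasiconformal on `Ω`. -/
def Dil (g : ℂ → ℂ) (Ω : Set ℂ) : ℝ≥0∞ :=
  ⨅ (K : ℝ) (_ : IsQC K g Ω), ENNReal.ofReal K

/-! ### Moduli of annuli -/

/-- `A` is an annulus of (finite) modulus at least `δ`: it is the image of a round annulus
`{1 < |z| < R}` with `log R / (2π) ≥ δ` under an injective holomorphic map. -/
def IsAnnulusOfModulusGE (A : Set ℂ) (δ : ℝ) : Prop :=
  ∃ R : ℝ, 1 < R ∧ δ ≤ Real.log R / (2 * Real.pi) ∧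
    ∃ φ : ℂ → ℂ, DifferentiableOn ℂ φ {z | 1 < ‖z‖ ∧ ‖z‖ < R} ∧
      InjOn φ {z | 1 < ‖z‖ ∧ ‖z‖ < R} ∧ φ '' {z | 1 < ‖z‖ ∧ ‖z‖ < R} = A

/-! ### Homotopies relative to a set -/

/-- `g₀` and `g₁` are homotopic on `X` rel `A ⊆ X`, as maps of pairs `(X, A)`: there is a homotopy
`H_t` on `X` from `g₀` to `g₁` that is constant on `A` and along which `X \ A` never leaves its
image `g₀ (X \ A)`, so that it never hits `g₀ (A)` when `g₀` is injective.
(Without the last clause any two maps into `ℂ` that agree on `A` would be homotopic rel `A`.) -/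
def HomotopicRel (X A : Set ℂ) (g₀ g₁ : ℂ → ℂ) : Prop :=
  ∃ H : ℝ × ℂ → ℂ, ContinuousOn H (Icc 0 1 ×ˢ X) ∧
    (∀ z ∈ X, H (0, z) = g₀ z) ∧ (∀ z ∈ X, H (1, z) = g₁ z) ∧
    (∀ t ∈ Icc (0 : ℝ) 1, ∀ z ∈ A, H (t, z) = g₀ z) ∧
    ∀ t ∈ Icc (0 : ℝ) 1, ∀ z ∈ X \ A, H (t, z) ∈ g₀ '' (X \ A)

/-! ### Quadratic-like maps and their renormalizations -/

/-- `f : U' → U` is a quadratic-like map, with critical point normalized to be `0`: `U'` and `U`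
are topological disks, `U'` is relatively compact in `U`, and `f : U' → U` is a proper holomorphic
map of degree two. -/
structure IsQuadraticLike (f : ℂ → ℂ) (U' U : Set ℂ) : Prop where
  isOpen_dom : IsOpen U'
  isOpen_cod : IsOpen U
  disk_dom : IsSimplyConnected U'
  disk_cod : IsSimplyConnected U
  isCompact_closure : IsCompact (closure U')
  closure_subset : closure U' ⊆ U
  holo : DifferentiableOn ℂ f U'
  mapsTo : MapsTo f U' U
  proper : ∀ C ⊆ U, IsCompact C → IsCompact (U' ∩ f ⁻¹' C)
  degree_two : ∀ w ∈ U,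
    ∑ᶠ z ∈ {z | z ∈ U' ∧ f z = w}, analyticOrderNatAt (fun x => f x - w) z = 2
  zero_mem : (0 : ℂ) ∈ U'
  crit : deriv f 0 = 0

/-- The filled Julia set of `f : U' → U`: the points that never escape from `U'`. -/
def filledJulia (f : ℂ → ℂ) (U' : Set ℂ) : Set ℂ := {z | ∀ n : ℕ, f^[n] z ∈ U'}

/-- The Julia set of `f : U' → U`. -/
def julia (f : ℂ → ℂ) (U' : Set ℂ) : Set ℂ := frontier (filledJulia f U')

/-- The `ω`-limit set `ω(0)` of the critical point. -/
def omegaZero (f : ℂ → ℂ) : Set ℂ := omegaLimit atTop (fun (n : ℕ) z => f^[n] z) {0}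

/-- `g^q : V' → V` is a (Douady-Hubbard) renormalization of period `q ≥ 2` of the quadratic-like
map `g : W' → W`: it is quadratic-like with non-escaping critical point (that is, with connected
Julia set), and the little filled Julia sets `g^i(K)`, `0 ≤ i < q`, pairwise meet in at most one
point and do not cross each other. -/
structure IsRenormalization (g : ℂ → ℂ) (W' : Set ℂ) (q : ℕ) (V' V : Set ℂ) : Prop where
  two_le : 2 ≤ q
  quadraticLike : IsQuadraticLike g^[q] V' V
  mapsTo : ∀ i < q, MapsTo g^[i] V' W'
  nonescaping : (0 : ℂ) ∈ filledJulia g^[q] V'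
  touch : ∀ i < q, ∀ j < q, i ≠ j →
    (g^[i] '' filledJulia g^[q] V' ∩ g^[j] '' filledJulia g^[q] V').Subsingleton
  not_cross : ∀ i < q, ∀ j < q, i ≠ j →
    IsConnected (g^[i] '' filledJulia g^[q] V' \ g^[j] '' filledJulia g^[q] V')

/-- The infinite sequence of renormalizations of an infinitely renormalizable quadratic-like map
`f : U' → U`. The `m`-fold renormalization is `F_m = f^{p_m} : V'_m → V_m`, where
`p_m = q_0 ⋯ q_{m-1}`, and `F_{m+1}` is the first renormalization (that is, the one of smallest
period) of `F_m`. -/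
structure RenormalizationTower (f : ℂ → ℂ) (U' U : Set ℂ) where
  quadraticLike : IsQuadraticLike f U' U
  q : ℕ → ℕ
  V' : ℕ → Set ℂ
  V : ℕ → Set ℂ
  V'_zero : V' 0 = U'
  V_zero : V 0 = U
  renorm : ∀ m, IsRenormalization f^[∏ i ∈ Finset.range m, q i] (V' m) (q m)
    (V' (m + 1)) (V (m + 1))
  first : ∀ m r W' W, IsRenormalization f^[∏ i ∈ Finset.range m, q i] (V' m) r W' W → q m ≤ r

/-- The period `p_m`. -/
def RenormalizationTower.period {f : ℂ → ℂ} {U' U : Set ℂ} (T : RenormalizationTower f U' U)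
    (m : ℕ) : ℕ := ∏ i ∈ Finset.range m, T.q i

/-- The little Julia orbit `𝕁^m`: the union of the little Julia sets
`J^m_i = f^i (J(F_m))`, `0 ≤ i < p_m`. Its connected components are the Julia bouquets. -/
def RenormalizationTower.juliaOrbit {f : ℂ → ℂ} {U' U : Set ℂ} (T : RenormalizationTower f U' U)
    (m : ℕ) : Set ℂ :=
  ⋃ i ∈ Finset.range (T.period m), f^[i] '' julia f^[T.period m] (T.V' m)

/-- The sets `N m = 𝕌^m` are neighborhoods of the little Julia orbits `𝕁^m` with definite annuli:
the components `U^m_j` of `𝕌^m` are topological disks, each of them contains exactly one bouquet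
`B^m_j`, the annuli `U^m_j \ B^m_j` have modulus at least `δ`, and every component of `𝕌^m` is
well inside a component of `𝕌^{m-l}`, the annulus in between having modulus at least `δ`. -/
structure IsNeighborhoodSystem {f : ℂ → ℂ} {U' U : Set ℂ} (T : RenormalizationTower f U' U)
    (l : ℕ) (δ : ℝ) (N : ℕ → Set ℂ) : Prop where
  isOpen : ∀ m, IsOpen (N m)
  closure_subset : ∀ m, closure (N m) ⊆ U'
  julia_subset : ∀ m, T.juliaOrbit m ⊆ N m
  disk : ∀ m, ∀ z ∈ N m, IsSimplyConnected (connectedComponentIn (N m) z)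
  bouquet : ∀ m, ∀ z ∈ N m, IsConnected (connectedComponentIn (N m) z ∩ T.juliaOrbit m)
  annulus : ∀ m, ∀ z ∈ N m,
    IsAnnulusOfModulusGE (connectedComponentIn (N m) z \ T.juliaOrbit m) δ
  closure_inside : ∀ m, ∀ z ∈ N (m + l),
    closure (connectedComponentIn (N (m + l)) z) ⊆ connectedComponentIn (N m) z
  well_inside : ∀ m, ∀ z ∈ N (m + l),
    IsAnnulusOfModulusGE
      (connectedComponentIn (N m) z \ closure (connectedComponentIn (N (m + l)) z)) δ

/-- The neighborhood `𝕌^n` for an integer `n`, where `𝕌^n = U'` is the whole domain of `f` for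
negative `n`. -/
def level (U' : Set ℂ) (N : ℕ → Set ℂ) (n : ℤ) : Set ℂ := if n < 0 then U' else N n.toNat

/-! ### Conjugacies -/

/-- The homeomorphism `ψ` is a topological conjugacy between `f : U' → U` and `f₁ : U₁' → U₁`. -/
def IsTopConjugacy (f : ℂ → ℂ) (U' U : Set ℂ) (f₁ : ℂ → ℂ) (U₁' U₁ : Set ℂ) (ψ : ℂ ≃ₜ ℂ) : Prop :=
  ψ '' U = U₁ ∧ ψ '' U' = U₁' ∧ ∀ z ∈ U', ψ (f z) = f₁ (ψ z)

/-- `h : (U, U', ω(0)) → (U₁, U₁', ω₁(0))` is a Thurston conjugacy between `f : U' → U` and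
`f₁ : U₁' → U₁`: it is quasiconformal, and homotopic rel `(∂U, ∂U', ω(0))` to a topological
conjugacy `ψ : (U, U', ω(0)) → (U₁, U₁', ω₁(0))`. -/
def IsThurstonConjugacy (f : ℂ → ℂ) (U' U : Set ℂ) (f₁ : ℂ → ℂ) (U₁' U₁ : Set ℂ)
    (h : ℂ ≃ₜ ℂ) : Prop :=
  (∃ K : ℝ, IsQC K h U) ∧
  h '' U = U₁ ∧ h '' U' = U₁' ∧ h '' omegaZero f = omegaZero f₁ ∧
  ∃ ψ : ℂ ≃ₜ ℂ, IsTopConjugacy f U' U f₁ U₁' U₁ ψ ∧ ψ '' omegaZero f = omegaZero f₁ ∧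
    HomotopicRel (closure U) (frontier U ∪ frontier U' ∪ omegaZero f) ψ h

end Lyubich

end

namespace Lyubich

/-! ### Mollification in `L²` -/

/-! All the maps `h m` agree on ω(0) and outside U', and away from any neighborhood of ω(0) the
sequence is eventually constant, because the 𝕌^m shrink to ω(0). So a pointwise limit exists for
soft reasons. What needs proof is that the convergence is uniform, that the limit is quasiconformal
across ω(0), and that the homotopies can be composed. This rests on estimates that do not depend on
m.

Dilatation. `h (m + 1)` differs from `h m` only inside 𝕌^{m-l}, and there, off 𝕁^{m+1}, iterating
(iv) l times from (iii) bounds its dilatation by (4K⁴)^l K. Quasiconformal homeomorphisms that agree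
off an open set can be glued without loss in the constant (`IsQC.glue`): their difference vanishes
off the open set, so truncating small values shows that it is Sobolev
(`HasWeakDiff.extend_by_zero`), and the finite energy this needs comes from the area inequality
(`HasWeakDiff.lintegral_det_le`). Induction gives one constant M for all `h m` off 𝕁^m
(`IsDeformation.exists_isQC`).

Smallness. By the length-area inequality (`length_area`), a homeomorphism of bounded energy shrinks
any set surrounded by many disjoint annuli of definite modulus. The annuli have to avoid the Julia
orbits, where no bound is available. The annuli between 𝕌^n and 𝕌^{n+l} may meet 𝕁^n, while those
around the bouquets need not surround the deeper components. `IsNeighborhoodSystem.exists_depth`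
reconciles the two: after boundedly many levels the deeper components lie inside of a definite
annulus off 𝕁^n, since otherwise a cutoff function of bounded energy would be crossed too often.
Hence components of 𝕌^n have small images under all `h m`, m ≥ n. As each of them meets ω(0) when n
≥ 1, the sequence is uniformly Cauchy. The same estimate for the identity shows that 𝕌^n shrinks to
ω(0).

Removability. Near ω(0) there are cutoff functions, one for each bouquet, of bounded energy. Their
gradients paired with the limit map are controlled by the area and the energy of the components,
which tend to zero since ω(0) has zero area; so ω(0) is removable
(`IsNeighborhoodSystem.isQC_of_diff_omegaZero`).

Two facts about the dynamics enter. The Julia orbits coincide with the filled ones, hence are nested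
(`IsNeighborhoodSystem.filledOrbit_eq`), and the little filled Julia sets are connected
(`IsQuadraticLike.isolated_eq_empty` is the main point), so every component of 𝕌^n, n ≥ 1, meets
ω(0). Finally the functional equation carries quasiconformality of `h 0` from U' to U
(`IsTopConjugacy.isQC_cod`), and the homotopies, whose tracks shrink, are concatenated over a
half-line (`exists_concat_homotopy`). -/

theorem lintegral_mul_sq_le {α : Type*} [MeasurableSpace α] {μ : Measure α} {u v : α → ℝ≥0∞}
    (hu : AEMeasurable u μ) (hv : AEMeasurable v μ) :
    (∫⁻ a, u a * v a ∂μ) ^ 2 ≤ (∫⁻ a, u a ^ 2 ∂μ) * ∫⁻ a, v a ^ 2 ∂μ := by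
  have h := ENNReal.lintegral_mul_le_Lp_mul_Lq μ Real.HolderConjugate.two_two hu hv
  simp only [Pi.mul_apply, ENNReal.rpow_ofNat] at h
  calc (∫⁻ a, u a * v a ∂μ) ^ 2
      ≤ ((∫⁻ a, u a ^ 2 ∂μ) ^ (1 / 2 : ℝ) * (∫⁻ a, v a ^ 2 ∂μ) ^ (1 / 2 : ℝ)) ^ 2 := by gcongr
    _ = _ := by
      rw [mul_pow, ← ENNReal.rpow_natCast, ← ENNReal.rpow_natCast, ← ENNReal.rpow_mul,
        ← ENNReal.rpow_mul]
      norm_num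

theorem eLpNorm_two_sq {α E : Type*} [MeasurableSpace α] [NormedAddCommGroup E] {μ : Measure α}
    (f : α → E) : eLpNorm f 2 μ ^ 2 = ∫⁻ a, ‖f a‖ₑ ^ 2 ∂μ := by
  rw [eLpNorm_eq_lintegral_rpow_enorm_toReal (by norm_num) (by norm_num),
    ← ENNReal.rpow_natCast, ← ENNReal.rpow_mul]
  norm_num

open scoped Convolution

section

variable {E : Type*} [NormedAddCommGroup E] [NormedSpace ℝ E]

theorem lintegral_enorm_normed (φ : ContDiffBump (0 : ℂ)) :
    ∫⁻ x, ‖φ.normed volume x‖ₑ = 1 := by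
  have h1 := φ.integral_normed (μ := (volume : Measure ℂ))
  have h2 : ∫⁻ x, ‖φ.normed volume x‖ₑ = ENNReal.ofReal (∫ x, φ.normed volume x) := by
    rw [ofReal_integral_eq_lintegral_ofReal φ.integrable_normed
      (Eventually.of_forall φ.nonneg_normed)]
    refine lintegral_congr fun x => ?_
    exact Real.enorm_of_nonneg (φ.nonneg_normed x)
  rw [h2, h1, ENNReal.ofReal_one]

/-- Averaging against a probability density ρ: Cauchy-Schwarz gives `|ρ * f|² ≤ ρ * |f|²` pointwise,
and integrating in `x` uses only Tonelli and translation invariance. -/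
theorem eLpNorm_normed_convolution_le (φ : ContDiffBump (0 : ℂ)) {f : ℂ → E}
    (hf : AEStronglyMeasurable f volume) :
    eLpNorm (φ.normed volume ⋆[ContinuousLinearMap.lsmul ℝ ℝ, volume] f) 2 volume
      ≤ eLpNorm f 2 volume := by
  rw [← ENNReal.pow_le_pow_left_iff (n := 2) (by norm_num), eLpNorm_two_sq, eLpNorm_two_sq]
  set ρ := φ.normed (volume : Measure ℂ) with hρ
  have hρm : Measurable fun x => ‖ρ x‖ₑ := φ.continuous_normed.measurable.enorm
  have key : ∀ x, ‖(ρ ⋆[ContinuousLinearMap.lsmul ℝ ℝ, volume] f) x‖ₑ ^ 2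
      ≤ ∫⁻ t, ‖ρ t‖ₑ * ‖f (x - t)‖ₑ ^ 2 := by
    intro x
    have hfx : AEMeasurable (fun t => ‖f (x - t)‖ₑ) volume :=
      (hf.comp_quasiMeasurePreserving
        (quasiMeasurePreserving_sub_left_of_right_invariant volume x)).enorm
    have e : ∀ a : ℝ≥0∞, (a ^ (1/2 : ℝ)) ^ 2 = a := fun a => by
      rw [← ENNReal.rpow_natCast, ← ENNReal.rpow_mul]; norm_num
    calc ‖(ρ ⋆[ContinuousLinearMap.lsmul ℝ ℝ, volume] f) x‖ₑ ^ 2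
        ≤ (∫⁻ t, ‖ρ t‖ₑ * ‖f (x - t)‖ₑ) ^ 2 := by
          gcongr
          refine (enorm_integral_le_lintegral_enorm _).trans (lintegral_mono fun t => ?_)
          simp [enorm_smul]
      -- The density is split evenly between the two factors, so that one of them contributes only
      -- the total mass 1.
      _ = (∫⁻ t, (‖ρ t‖ₑ ^ (1/2 : ℝ)) * (‖ρ t‖ₑ ^ (1/2 : ℝ) * ‖f (x - t)‖ₑ)) ^ 2 := by
          congr 1
          refine lintegral_congr fun t => ?_
          rw [← mul_assoc, ← sq, e]
      _ ≤ (∫⁻ t, (‖ρ t‖ₑ ^ (1/2 : ℝ)) ^ 2) * ∫⁻ t, (‖ρ t‖ₑ ^ (1/2 : ℝ) * ‖f (x - t)‖ₑ) ^ 2 :=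
          lintegral_mul_sq_le (hρm.pow_const _).aemeasurable
            ((hρm.pow_const _).aemeasurable.mul hfx)
      _ = ∫⁻ t, ‖ρ t‖ₑ * ‖f (x - t)‖ₑ ^ 2 := by
          simp only [mul_pow, e]
          rw [hρ, lintegral_enorm_normed, one_mul]
  calc ∫⁻ x, ‖(ρ ⋆[ContinuousLinearMap.lsmul ℝ ℝ, volume] f) x‖ₑ ^ 2
      ≤ ∫⁻ x, ∫⁻ t, ‖ρ t‖ₑ * ‖f (x - t)‖ₑ ^ 2 := lintegral_mono key
    _ = ∫⁻ t, ∫⁻ x, ‖ρ t‖ₑ * ‖f (x - t)‖ₑ ^ 2 := by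
        refine lintegral_lintegral_swap ?_
        refine (hρm.comp measurable_snd).aemeasurable.mul ?_
        have : Measure.QuasiMeasurePreserving (fun p : ℂ × ℂ => p.1 - p.2) (volume.prod volume) volume :=
          quasiMeasurePreserving_sub_of_right_invariant volume volume
        exact (hf.comp_quasiMeasurePreserving this).enorm.pow_const 2
    _ = ∫⁻ t, ‖ρ t‖ₑ * ∫⁻ x, ‖f x‖ₑ ^ 2 := by
        refine lintegral_congr fun t => ?_
        rw [lintegral_const_mul' _ _ enorm_ne_top,
          lintegral_sub_right_eq_self (fun x => ‖f x‖ₑ ^ 2) t]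
    _ = ∫⁻ x, ‖f x‖ₑ ^ 2 := by
        rw [lintegral_mul_const _ hρm, hρ, lintegral_enorm_normed, one_mul]

/-- Replacing `f` by a compactly supported continuous `u` costs ε/3 before mollification and, by the
contraction property, at most ε/3 after it; for `u` itself uniform continuity suffices. -/
theorem tendsto_eLpNorm_normed_convolution_sub [CompleteSpace E] {φ : ℕ → ContDiffBump (0 : ℂ)}
    (hφ : Tendsto (fun n => (φ n).rOut) atTop (𝓝 0)) {f : ℂ → E} (hf : MemLp f 2 volume)
    (hfi : LocallyIntegrable f) :
    Tendsto (fun n => eLpNorm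
      ((φ n).normed volume ⋆[ContinuousLinearMap.lsmul ℝ ℝ, volume] f - f) 2 volume)
      atTop (𝓝 0) := by
  rw [ENNReal.tendsto_atTop_zero]
  intro ε hε
  by_cases hεt : ε = ⊤
  · exact ⟨0, fun n _ => by simp [hεt]⟩
  obtain ⟨u, hus, hu, huc, hum⟩ :=
    hf.exists_hasCompactSupport_eLpNorm_sub_le (by norm_num) (ε := ε / 3)
      (ENNReal.div_pos hε.ne' (by norm_num)).ne'
  have hui : LocallyIntegrable u := huc.locallyIntegrable
  -- the smooth part
  set K := Metric.cthickening 1 (tsupport u) with hK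
  have hKc : IsCompact K := hus.isCompact.cthickening
  have hKv : volume K ≠ ⊤ := hKc.measure_lt_top.ne
  have hunif : UniformContinuous u := hus.uniformContinuous_of_continuous huc
  obtain ⟨η, hη, hηb⟩ : ∃ η : ℝ, 0 < η ∧
      ENNReal.ofReal η * (volume K) ^ (1 / 2 : ℝ) ≤ ε / 3 := by
    have hv : (volume K) ^ (1 / 2 : ℝ) ≠ ⊤ := ENNReal.rpow_ne_top_of_nonneg (by norm_num) hKv
    have ht : Tendsto (fun η : ℝ => ENNReal.ofReal η * (volume K) ^ (1 / 2 : ℝ)) (𝓝[>] 0)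
        (𝓝 (ENNReal.ofReal 0 * (volume K) ^ (1 / 2 : ℝ))) :=
      ENNReal.Tendsto.mul_const
        ((ENNReal.continuous_ofReal.tendsto 0).mono_left nhdsWithin_le_nhds) (Or.inr hv)
    rw [ENNReal.ofReal_zero, zero_mul] at ht
    have h3 : (0 : ℝ≥0∞) < ε / 3 := ENNReal.div_pos hε.ne' (by norm_num)
    obtain ⟨η, h1, h2⟩ := ((ht.eventually (ge_mem_nhds h3)).and self_mem_nhdsWithin).exists
    exact ⟨η, h2, h1⟩
  obtain ⟨r, hr, hru⟩ := Metric.uniformContinuous_iff.1 hunif η hη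
  have hev : ∀ᶠ n in atTop, (φ n).rOut < min r 1 :=
    (tendsto_order.1 hφ).2 _ (lt_min hr one_pos)
  obtain ⟨n₀, hn₀⟩ := eventually_atTop.1 hev
  refine ⟨n₀, fun n hn => ?_⟩
  have hn1 := hn₀ n hn
  set ρ := (φ n).normed (volume : Measure ℂ) with hρ
  have conv_sub : (ρ ⋆[ContinuousLinearMap.lsmul ℝ ℝ, volume] f)
      = (ρ ⋆[ContinuousLinearMap.lsmul ℝ ℝ, volume] (f - u))
        + (ρ ⋆[ContinuousLinearMap.lsmul ℝ ℝ, volume] u) := by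
    have hfu : f = (f - u) + u := by simp
    conv_lhs => rw [hfu]
    refine ConvolutionExists.distrib_add ?_ ?_
    · exact ((φ n).hasCompactSupport_normed).convolutionExists_left _ (φ n).continuous_normed
        (hfi.sub hui)
    · exact ((φ n).hasCompactSupport_normed).convolutionExists_left _ (φ n).continuous_normed hui
  have hdecomp : (ρ ⋆[ContinuousLinearMap.lsmul ℝ ℝ, volume] f) - f
      = (ρ ⋆[ContinuousLinearMap.lsmul ℝ ℝ, volume] (f - u))
        + (((ρ ⋆[ContinuousLinearMap.lsmul ℝ ℝ, volume] u) - u) + (u - f)) := by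
    rw [conv_sub]; abel
  have hm1 : AEStronglyMeasurable (ρ ⋆[ContinuousLinearMap.lsmul ℝ ℝ, volume] (f - u)) volume :=
    (((φ n).hasCompactSupport_normed).continuous_convolution_left _ (φ n).continuous_normed
      (hfi.sub hui)).aestronglyMeasurable
  have hcu : Continuous (ρ ⋆[ContinuousLinearMap.lsmul ℝ ℝ, volume] u) :=
    ((φ n).hasCompactSupport_normed).continuous_convolution_left _ (φ n).continuous_normed hui
  have hmid : eLpNorm ((ρ ⋆[ContinuousLinearMap.lsmul ℝ ℝ, volume] u) - u) 2 volume ≤ ε / 3 := by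
    have hb : ∀ x, ‖((ρ ⋆[ContinuousLinearMap.lsmul ℝ ℝ, volume] u) - u) x‖ ≤ η := by
      intro x
      rw [Pi.sub_apply, ← dist_eq_norm]
      refine (φ n).dist_normed_convolution_le huc.aestronglyMeasurable fun y hy => ?_
      exact (hru (lt_trans hy (lt_of_lt_of_le hn1 (min_le_left _ _)))).le
    -- Mollifiers of radius less than 1 do not push the support of `u` out of its 1-thickening `K`;
    -- on this set of finite area uniform smallness is smallness in L².
    have hz : ∀ x ∉ K, ((ρ ⋆[ContinuousLinearMap.lsmul ℝ ℝ, volume] u) - u) x = 0 := by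
      intro x hx
      have hball : ∀ y ∈ Metric.ball x (φ n).rOut, u y = 0 := by
        intro y hy
        by_contra hne
        refine hx (Metric.mem_cthickening_of_dist_le x y 1 _ (subset_tsupport _ hne) ?_)
        rw [dist_comm]
        exact (lt_trans (Metric.mem_ball.1 hy) (lt_of_lt_of_le hn1 (min_le_right _ _))).le
      have hx0 : u x = 0 := hball x (Metric.mem_ball_self (φ n).rOut_pos)
      rw [Pi.sub_apply, hρ, (φ n).normed_convolution_eq_right
        (fun y hy => by rw [hball y hy, hx0]), sub_self]
    have hr : eLpNorm ((ρ ⋆[ContinuousLinearMap.lsmul ℝ ℝ, volume] u) - u) 2 volume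
        = eLpNorm ((ρ ⋆[ContinuousLinearMap.lsmul ℝ ℝ, volume] u) - u) 2 (volume.restrict K) := by
      rw [← eLpNorm_indicator_eq_eLpNorm_restrict hKc.isClosed.measurableSet]
      congr 1
      ext x
      by_cases hx : x ∈ K
      · rw [indicator_of_mem hx]
      · rw [indicator_of_notMem hx, hz x hx]
    rw [hr]
    refine (eLpNorm_le_of_ae_bound (C := η) (Eventually.of_forall hb)).trans ?_
    rw [mul_comm]
    simpa using hηb
  have e3 : ε = ε / 3 + (ε / 3 + ε / 3) := by
    rw [← add_assoc, ENNReal.add_thirds]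
  rw [hdecomp, e3]
  refine (eLpNorm_add_le hm1 ?_ (by norm_num)).trans (add_le_add ?_ ?_)
  · exact (hcu.sub huc).aestronglyMeasurable.add
      (huc.aestronglyMeasurable.sub hf.aestronglyMeasurable)
  · exact (eLpNorm_normed_convolution_le (φ n)
      (hf.aestronglyMeasurable.sub huc.aestronglyMeasurable)).trans hu
  · refine (eLpNorm_add_le (hcu.sub huc).aestronglyMeasurable
      (huc.aestronglyMeasurable.sub hf.aestronglyMeasurable) (by norm_num)).trans
      (add_le_add hmid ?_)
    rw [eLpNorm_sub_comm]; exact hu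

end

end Lyubich

namespace Lyubich

/-! ### Continuous Sobolev maps -/

/-- `g` is continuous on the open set `Ω` and lies in `W^{1,2}_loc(Ω)`, with weak differential the
measurable field `D`. -/
structure HasWeakDiff (g : ℂ → ℂ) (D : ℂ → ℂ →L[ℝ] ℂ) (Ω : Set ℂ) : Prop where
  isOpen : IsOpen Ω
  cont : ContinuousOn g Ω
  meas : StronglyMeasurable D
  memLp : ∀ C ⊆ Ω, IsCompact C → MemLp D 2 (volume.restrict C)
  weak : IsWeakDifferential g D Ω

theorem integrable_of_continuousOn_of_eq_zero {E : Type*} [NormedAddCommGroup E] {f : ℂ → E}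
    {C : Set ℂ} (hC : IsCompact C) (hf : ContinuousOn f C) (h0 : ∀ z ∉ C, f z = 0) :
    Integrable f := by
  have h1 : IntegrableOn f C := hf.integrableOn_compact hC
  exact h1.integrable_of_forall_notMem_eq_zero h0

theorem integrable_indicator_of_integrableOn {E : Type*} [NormedAddCommGroup E] {f : ℂ → E}
    {C : Set ℂ} (hC : MeasurableSet C) (hf : IntegrableOn f C) : Integrable (C.indicator f) :=
  (integrable_indicator_iff hC).2 hf

theorem memLp_indicator_of_restrict {E : Type*} [NormedAddCommGroup E] {f : ℂ → E}
    {C : Set ℂ} (hC : MeasurableSet C) (hf : MemLp f 2 (volume.restrict C)) :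
    MemLp (C.indicator f) 2 volume :=
  (memLp_indicator_iff_restrict hC).2 hf

theorem memLp_add {E : Type*} [NormedAddCommGroup E] {f f' : ℂ → E} {μ : Measure ℂ}
    (hf : MemLp f 2 μ) (hf' : MemLp f' 2 μ) : MemLp (f + f') 2 μ :=
  hf.add hf'

theorem fderiv_eq_zero_of_notMem_tsupport {E : Type*} [NormedAddCommGroup E] [NormedSpace ℝ E]
    {φ : ℂ → E} {z : ℂ} (hz : z ∉ tsupport φ) : fderiv ℝ φ z = 0 := by
  by_contra h
  exact hz (support_fderiv_subset ℝ h)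

namespace HasWeakDiff

variable {g : ℂ → ℂ} {D : ℂ → ℂ →L[ℝ] ℂ} {Ω : Set ℂ}

theorem integrableOn (h : HasWeakDiff g D Ω) {C : Set ℂ} (hC : IsCompact C) (hCΩ : C ⊆ Ω) :
    IntegrableOn D C := by
  have : IsFiniteMeasure (volume.restrict C) := ⟨by simpa using hC.measure_lt_top⟩
  exact (h.memLp C hCΩ hC).integrable (by norm_num)

theorem integrable_smul (h : HasWeakDiff g D Ω) {φ : ℂ → ℝ} (hφ : Continuous φ)
    (hφc : HasCompactSupport φ) (hφΩ : tsupport φ ⊆ Ω) (v : ℂ) :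
    Integrable fun z => φ z • D z v := by
  have h1 : IntegrableOn (fun z => φ z • D z v) (tsupport φ) := by
    refine IntegrableOn.continuousOn_smul ?_ hφ.continuousOn hφc
    exact ((ContinuousLinearMap.apply ℝ ℂ v).integrable_comp (h.integrableOn hφc hφΩ))
  exact h1.integrable_of_forall_notMem_eq_zero fun z hz => by
    rw [image_eq_zero_of_notMem_tsupport hz, zero_smul]

theorem integrable_fderiv_smul (h : HasWeakDiff g D Ω) {φ : ℂ → ℝ} (hφ : ContDiff ℝ ∞ φ)
    (hφc : HasCompactSupport φ) (hφΩ : tsupport φ ⊆ Ω) (v : ℂ) :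
    Integrable fun z => (fderiv ℝ φ z v) • g z := by
  refine integrable_of_continuousOn_of_eq_zero hφc ?_ fun z hz => by
    rw [fderiv_eq_zero_of_notMem_tsupport hz]; simp
  have h1 : Continuous fun z => fderiv ℝ φ z v :=
    (hφ.continuous_fderiv (by simp)).clm_apply continuous_const
  exact h1.continuousOn.smul (h.cont.mono hφΩ)

theorem mono (h : HasWeakDiff g D Ω) {Ω' : Set ℂ} (hΩ' : IsOpen Ω') (hsub : Ω' ⊆ Ω) :
    HasWeakDiff g D Ω' :=
  ⟨hΩ', h.cont.mono hsub, h.meas, fun C hC => h.memLp C (hC.trans hsub),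
    fun φ hφ hc ht => h.weak φ hφ hc (ht.trans hsub)⟩

theorem congr (h : HasWeakDiff g D Ω) {g' : ℂ → ℂ} (hg : EqOn g' g Ω) : HasWeakDiff g' D Ω := by
  refine ⟨h.isOpen, h.cont.congr hg, h.meas, h.memLp, fun φ hφ hc ht v => ?_⟩
  rw [← h.weak φ hφ hc ht v]
  refine integral_congr_ae (Eventually.of_forall fun z => ?_)
  by_cases hz : z ∈ tsupport φ
  · simp only [hg (ht hz)]
  · simp [fderiv_eq_zero_of_notMem_tsupport hz]

theorem congr_ae (h : HasWeakDiff g D Ω) {D' : ℂ → ℂ →L[ℝ] ℂ} (hD' : StronglyMeasurable D')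
    (hD : ∀ᵐ z, z ∈ Ω → D' z = D z) : HasWeakDiff g D' Ω := by
  refine ⟨h.isOpen, h.cont, hD', fun C hC hCc => ?_, fun φ hφ hc ht v => ?_⟩
  · refine (h.memLp C hC hCc).ae_eq ?_
    rw [EventuallyEq, ae_restrict_iff' hCc.isClosed.measurableSet]
    filter_upwards [hD] with z hz hzC using (hz (hC hzC)).symm
  · rw [h.weak φ hφ hc ht v]
    congr 1
    refine integral_congr_ae ?_
    filter_upwards [hD] with z hz
    by_cases hzt : z ∈ tsupport φ
    · rw [hz (ht hzt)]
    · rw [image_eq_zero_of_notMem_tsupport hzt]; simp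

theorem add (h : HasWeakDiff g D Ω) {g' : ℂ → ℂ} {D' : ℂ → ℂ →L[ℝ] ℂ}
    (h' : HasWeakDiff g' D' Ω) : HasWeakDiff (g + g') (D + D') Ω := by
  refine ⟨h.isOpen, h.cont.add h'.cont, h.meas.add h'.meas,
    fun C hC hCc => memLp_add (h.memLp C hC hCc) (h'.memLp C hC hCc), fun φ hφ hc ht v => ?_⟩
  have e1 := integral_add (h.integrable_fderiv_smul hφ hc ht v)
    (h'.integrable_fderiv_smul hφ hc ht v)
  have e2 := integral_add (h.integrable_smul hφ.continuous hc ht v)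
    (h'.integrable_smul hφ.continuous hc ht v)
  have e3 : ∀ z, (fderiv ℝ φ z v) • (g + g') z
      = (fderiv ℝ φ z v) • g z + (fderiv ℝ φ z v) • g' z := fun z => smul_add _ _ _
  have e4 : ∀ z, φ z • (D + D') z v = φ z • D z v + φ z • D' z v := fun z => smul_add _ _ _
  simp only [e3, e4]
  rw [e1, e2, h.weak φ hφ hc ht v, h'.weak φ hφ hc ht v, neg_add]

theorem neg (h : HasWeakDiff g D Ω) : HasWeakDiff (-g) (-D) Ω := by
  refine ⟨h.isOpen, h.cont.neg, h.meas.neg, fun C hC hCc => (h.memLp C hC hCc).neg,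
    fun φ hφ hc ht v => ?_⟩
  simp only [Pi.neg_apply, smul_neg, neg_apply, integral_neg]
  rw [h.weak φ hφ hc ht v]

theorem sub (h : HasWeakDiff g D Ω) {g' : ℂ → ℂ} {D' : ℂ → ℂ →L[ℝ] ℂ}
    (h' : HasWeakDiff g' D' Ω) : HasWeakDiff (g - g') (D - D') Ω := by
  rw [sub_eq_add_neg, sub_eq_add_neg]; exact h.add h'.neg

theorem clm_ext {A B : ℂ →L[ℝ] ℂ} (h1 : A 1 = B 1) (hI : A Complex.I = B Complex.I) : A = B := by
  ext z
  have hz : z = z.re • (1 : ℂ) + z.im • Complex.I := by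
    simp
  rw [hz, map_add, map_add, map_smul, map_smul, map_smul, map_smul, h1, hI]

/-- Weak differentials are unique almost everywhere. -/
theorem ae_eq (h : HasWeakDiff g D Ω) {D' : ℂ → ℂ →L[ℝ] ℂ} (h' : HasWeakDiff g D' Ω) :
    ∀ᵐ z, z ∈ Ω → D z = D' z := by
  have key : ∀ v : ℂ, ∀ᵐ z, z ∈ Ω → D z v - D' z v = 0 := by
    intro v
    refine h.isOpen.ae_eq_zero_of_integral_contDiff_smul_eq_zero ?_ ?_
    · rw [locallyIntegrableOn_iff h.isOpen.isLocallyClosed]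
      intro C hC hCc
      exact (((ContinuousLinearMap.apply ℝ ℂ v).integrable_comp (h.integrableOn hCc hC))).sub
        ((ContinuousLinearMap.apply ℝ ℂ v).integrable_comp (h'.integrableOn hCc hC))
    · intro φ hφ hc ht
      simp only [smul_sub]
      rw [integral_sub (h.integrable_smul hφ.continuous hc ht v)
        (h'.integrable_smul hφ.continuous hc ht v)]
      have e1 := h.weak φ hφ hc ht v
      have e2 := h'.weak φ hφ hc ht v
      rw [e1] at e2
      exact sub_eq_zero.2 (neg_injective e2)
  filter_upwards [key 1, key Complex.I] with z h1 h2 hz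
  exact clm_ext (sub_eq_zero.1 (h1 hz)) (sub_eq_zero.1 (h2 hz))

/-- A map of class `C^1` near `Ω` has its differential as weak differential. -/
theorem of_hasFDerivAt (hΩ : IsOpen Ω) (hD : StronglyMeasurable D) (hDc : ContinuousOn D Ω)
    (hg : ∀ z ∈ Ω, HasFDerivAt g (D z) z) : HasWeakDiff g D Ω := by
  have hgc : ContinuousOn g Ω := fun z hz => (hg z hz).continuousAt.continuousWithinAt
  refine ⟨hΩ, hgc, hD, fun C hC hCc => ?_, fun φ hφ hc ht v => ?_⟩
  · obtain ⟨B, hB⟩ := hCc.exists_bound_of_continuousOn (hDc.mono hC)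
    have : IsFiniteMeasure (volume.restrict C) := ⟨by simpa using hCc.measure_lt_top⟩
    refine MemLp.of_bound hD.aestronglyMeasurable B ?_
    filter_upwards [ae_restrict_mem hCc.isClosed.measurableSet] with z hz using hB z hz
  · have e := integral_bilinear_hasFDerivAt_right_eq_neg_left_of_integrable (μ := volume)
      (f := φ) (f' := fderiv ℝ φ) (g := g) (g' := D) (v := v)
      (B := ContinuousLinearMap.lsmul ℝ ℝ) ?_ ?_ ?_
      (fun x _ => ((hφ.differentiable (by simp)) x).hasFDerivAt) (fun x hx => hg x (ht hx))
    · simp only [ContinuousLinearMap.lsmul_apply] at e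
      rw [e, neg_neg]
    · refine integrable_of_continuousOn_of_eq_zero hc ?_ fun z hz => by
        rw [fderiv_eq_zero_of_notMem_tsupport hz]; simp
      exact ((hφ.continuous_fderiv (by simp)).clm_apply continuous_const).continuousOn.smul
        (hgc.mono ht)
    · refine integrable_of_continuousOn_of_eq_zero hc ?_ fun z hz => by
        rw [image_eq_zero_of_notMem_tsupport hz]; simp
      exact hφ.continuous.continuousOn.smul ((hDc.mono ht).clm_apply continuousOn_const)
    · refine integrable_of_continuousOn_of_eq_zero hc ?_ fun z hz => by
        rw [image_eq_zero_of_notMem_tsupport hz]; simp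
      exact hφ.continuous.continuousOn.smul (hgc.mono ht)

open scoped Convolution in
/-- Local approximation of a continuous Sobolev map by smooth maps. -/
theorem exists_smooth_approx (h : HasWeakDiff g D Ω) {C : Set ℂ} (hC : IsCompact C)
    (hCΩ : C ⊆ Ω) :
    ∃ G : ℕ → ℂ → ℂ, (∀ n, ContDiff ℝ ∞ (G n)) ∧ TendstoUniformlyOn G g atTop C ∧
      Tendsto (fun n => eLpNorm (fun z => fderiv ℝ (G n) z - D z) 2 (volume.restrict C))
        atTop (𝓝 0) := by
  -- A margin δ is kept around `C`. Outside it `g` and `D` are cut off sharply, which mollifiers of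
  -- radius less than δ do not notice at points of `C`.
  obtain ⟨δ, hδ, hδΩ⟩ := hC.exists_cthickening_subset_open h.isOpen hCΩ
  set C' := Metric.cthickening δ C with hC'
  have hC'c : IsCompact C' := hC.cthickening
  have hC'm : MeasurableSet C' := hC'c.isClosed.measurableSet
  set g' := C'.indicator g with hg'
  set D' := C'.indicator D with hD'
  have hg'i : Integrable g' := by
    rw [hg', integrable_indicator_iff hC'm]
    exact (h.cont.mono hδΩ).integrableOn_compact hC'c
  have hD'i : Integrable D' := by
    exact integrable_indicator_of_integrableOn hC'm (h.integrableOn hC'c hδΩ)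
  have hD'2 : MemLp D' 2 volume := by
    exact memLp_indicator_of_restrict hC'm (h.memLp C' hδΩ hC'c)
  let φ : ℕ → ContDiffBump (0 : ℂ) := fun n =>
    ⟨1 / (n + 2), 1 / (n + 1), by positivity, by
      apply one_div_lt_one_div_of_lt <;> [positivity; linarith]⟩
  have hφ : Tendsto (fun n => (φ n).rOut) atTop (𝓝 0) := tendsto_one_div_add_atTop_nhds_zero_nat
  have hφδ : ∀ᶠ n in atTop, (φ n).rOut < δ := (tendsto_order.1 hφ).2 _ hδ
  have hball : ∀ x ∈ C, ∀ n, (φ n).rOut < δ → Metric.closedBall x (φ n).rOut ⊆ C' := by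
    intro x hx n hn y hy
    exact Metric.mem_cthickening_of_dist_le y x δ C hx ((Metric.mem_closedBall.1 hy).trans hn.le)
  have hCC' : C ⊆ C' := Metric.self_subset_cthickening C
  refine ⟨fun n => (φ n).normed volume ⋆[ContinuousLinearMap.lsmul ℝ ℝ, volume] g', ?_, ?_, ?_⟩
  · intro n
    exact (φ n).hasCompactSupport_normed.contDiff_convolution_left _ (φ n).contDiff_normed
      hg'i.locallyIntegrable
  · rw [Metric.tendstoUniformlyOn_iff]
    intro ε hε
    obtain ⟨r, hr, hru⟩ := Metric.uniformContinuousOn_iff.1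
      (hC'c.uniformContinuousOn_of_continuous (h.cont.mono hδΩ)) (ε / 2) (by linarith)
    filter_upwards [hφδ, (tendsto_order.1 hφ).2 _ hr] with n hn1 hn2 x hx
    have hgx : g' x = g x := indicator_of_mem (hCC' hx) g
    rw [dist_comm, ← hgx]
    refine lt_of_le_of_lt ((φ n).dist_normed_convolution_le (ε := ε / 2)
      hg'i.aestronglyMeasurable fun y hy => ?_) (by linarith)
    have hyC : y ∈ C' := hball x hx n hn1 (Metric.ball_subset_closedBall hy)
    rw [hgx, hg', indicator_of_mem hyC]
    exact (hru y hyC x (hCC' hx) (lt_trans hy hn2)).le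
  · have hconv := tendsto_eLpNorm_normed_convolution_sub hφ hD'2 hD'i.locallyIntegrable
    refine tendsto_of_tendsto_of_tendsto_of_le_of_le' tendsto_const_nhds hconv
      (Eventually.of_forall fun _ => zero_le) ?_
    filter_upwards [hφδ] with n hn
    -- On `C` differentiation commutes with mollification: the weak identity is tested against y ↦
    -- ρ(x - y), whose support stays where the cutoffs change nothing.
    have hder : ∀ x ∈ C, fderiv ℝ
        ((φ n).normed volume ⋆[ContinuousLinearMap.lsmul ℝ ℝ, volume] g') x - D x
        = ((φ n).normed volume ⋆[ContinuousLinearMap.lsmul ℝ ℝ, volume] D' - D') x := by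
      intro x hx
      have hDx : D' x = D x := indicator_of_mem (hCC' hx) D
      rw [Pi.sub_apply, hDx]
      congr 1
      set ρ := (φ n).normed (volume : Measure ℂ) with hρ
      have hρs : ContDiff ℝ ∞ ρ := (φ n).contDiff_normed
      have hρc : HasCompactSupport ρ := (φ n).hasCompactSupport_normed
      have hfd := hρc.hasFDerivAt_convolution_left (μ := volume)
        (ContinuousLinearMap.lsmul ℝ ℝ) (hρs.of_le (by simp))
        hg'i.locallyIntegrable x
      rw [hfd.fderiv]
      ext v
      -- the test function
      set η : ℂ → ℝ := fun y => ρ (x - y) with hη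
      have hηs : ContDiff ℝ ∞ η := hρs.comp (contDiff_const.sub contDiff_id)
      have hηsupp : tsupport η ⊆ Metric.closedBall x (φ n).rOut := by
        refine closure_minimal (fun y hy => ?_) Metric.isClosed_closedBall
        have : x - y ∈ Function.support ρ := hy
        rw [hρ, (φ n).support_normed_eq, mem_ball_zero_iff] at this
        rw [Metric.mem_closedBall, dist_comm, dist_eq_norm]; exact this.le
      have hηc : HasCompactSupport η :=
        HasCompactSupport.of_support_subset_isCompact (isCompact_closedBall x (φ n).rOut)
          ((subset_tsupport _).trans hηsupp)
      have hηC : tsupport η ⊆ C' := hηsupp.trans (hball x hx n hn)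
      have hfη : ∀ y, fderiv ℝ η y v = - fderiv ℝ ρ (x - y) v := by
        intro y
        have h1 : HasFDerivAt η ((fderiv ℝ ρ (x - y)).comp
            (-ContinuousLinearMap.id ℝ ℂ)) y := by
          refine HasFDerivAt.comp y (hρs.differentiable (by simp) (x - y)).hasFDerivAt ?_
          simpa using (hasFDerivAt_id y).const_sub x
        rw [h1.fderiv]; simp
      have hw := h.weak η hηs hηc (hηC.trans hδΩ) v
      have hexist : ConvolutionExistsAt (fderiv ℝ ρ) g' x
          (ContinuousLinearMap.precompL ℂ (ContinuousLinearMap.lsmul ℝ ℝ)) volume :=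
        (hρc.fderiv ℝ).convolutionExists_left _ (hρs.continuous_fderiv (by simp))
          hg'i.locallyIntegrable x
      have hexist2 : ConvolutionExistsAt ρ D' x (ContinuousLinearMap.lsmul ℝ ℝ) volume :=
        hρc.convolutionExists_left _ hρs.continuous hD'i.locallyIntegrable x
      have hL : (fderiv ℝ ρ ⋆[ContinuousLinearMap.precompL ℂ (ContinuousLinearMap.lsmul ℝ ℝ),
          volume] g') x v = ∫ y, (fderiv ℝ ρ (x - y) v) • g' y := by
        have h2 : Integrable fun y => (ContinuousLinearMap.precompL ℂ
            (ContinuousLinearMap.lsmul ℝ ℝ)) (fderiv ℝ ρ (x - y)) (g' y) := by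
          exact (convolutionExistsAt_iff_integrable_swap).1 hexist
        rw [convolution_eq_swap, ContinuousLinearMap.integral_apply h2]
        simp
      have hR : (ρ ⋆[ContinuousLinearMap.lsmul ℝ ℝ, volume] D') x v = ∫ y, η y • D' y v := by
        have h2 : Integrable fun y => (ContinuousLinearMap.lsmul ℝ ℝ) (ρ (x - y)) (D' y) :=
          (convolutionExistsAt_iff_integrable_swap).1 hexist2
        rw [convolution_eq_swap, ContinuousLinearMap.integral_apply h2]
        simp [hη]
      rw [hL, hR]
      have e1 : ∫ y, (fderiv ℝ ρ (x - y) v) • g' y = - ∫ y, (fderiv ℝ η y v) • g y := by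
        rw [← integral_neg]
        refine integral_congr_ae (Eventually.of_forall fun y => ?_)
        by_cases hy : y ∈ C'
        · simp only [hfη, hg', indicator_of_mem hy, neg_smul, neg_neg]
        · have : fderiv ℝ ρ (x - y) v = 0 := by
            have h3 := hfη y
            rw [fderiv_eq_zero_of_notMem_tsupport (fun hh => hy (hηC hh))] at h3
            simpa using h3.symm
          simp [hfη, this]
      have e2 : ∫ y, η y • D' y v = ∫ y, η y • D y v := by
        refine integral_congr_ae (Eventually.of_forall fun y => ?_)
        by_cases hy : y ∈ C'
        · simp only [hD', indicator_of_mem hy]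
        · simp [image_eq_zero_of_notMem_tsupport (fun hh => hy (hηC hh))]
      rw [e1, e2, hw, neg_neg]
    calc eLpNorm _ 2 (volume.restrict C)
        = eLpNorm ((φ n).normed volume ⋆[ContinuousLinearMap.lsmul ℝ ℝ, volume] D' - D') 2
            (volume.restrict C) := by
          refine eLpNorm_congr_ae ?_
          filter_upwards [ae_restrict_mem hC.isClosed.measurableSet] with x hx using hder x hx
      _ ≤ _ := eLpNorm_mono_measure _ Measure.restrict_le_self

end HasWeakDiff

end Lyubich

/-! ### Locality of weak differentials and passage to the limit. -/

namespace Lyubich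

theorem eLpNorm_two_lt_top_iff {α E : Type*} [MeasurableSpace α] [NormedAddCommGroup E]
    {μ : Measure α} {f : α → E} : eLpNorm f 2 μ < ⊤ ↔ ∫⁻ a, ‖f a‖ₑ ^ 2 ∂μ < ⊤ := by
  rw [← eLpNorm_two_sq]; simp

namespace HasWeakDiff

variable {g : ℂ → ℂ} {D : ℂ → ℂ →L[ℝ] ℂ} {Ω : Set ℂ}

open scoped Manifold in
/-- Having a weak differential is a local property. -/
theorem of_local (hΩ : IsOpen Ω) (hloc : ∀ z ∈ Ω, ∃ V, z ∈ V ∧ HasWeakDiff g D V)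
    (hD : StronglyMeasurable D) : HasWeakDiff g D Ω := by
  have hcont : ContinuousOn g Ω := fun z hz => by
    obtain ⟨V, hzV, hV⟩ := hloc z hz
    exact (hV.cont.continuousAt (hV.isOpen.mem_nhds hzV)).continuousWithinAt
  have hmem : ∀ C ⊆ Ω, IsCompact C → MemLp D 2 (volume.restrict C) := by
    intro C hC hCc
    have hloc2 : ∀ z ∈ C, ∃ W ∈ 𝓝[C] z, MemLp D 2 (volume.restrict W) := by
      intro z hz
      obtain ⟨V, hzV, hV⟩ := hloc z (hC hz)
      obtain ⟨W, hWz, hWV, hWc⟩ := local_compact_nhds (hV.isOpen.mem_nhds hzV)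
      exact ⟨W, mem_nhdsWithin_of_mem_nhds hWz, hV.memLp W hWV hWc⟩
    refine hCc.induction_on (p := fun s => MemLp D 2 (volume.restrict s)) ?_ ?_ ?_ hloc2
    · simp
    · intro s t hst ht
      exact ht.mono_measure (Measure.restrict_mono hst le_rfl)
    · intro s t hs ht
      refine ⟨hD.aestronglyMeasurable, ?_⟩
      have hs2 := eLpNorm_two_lt_top_iff.1 hs.2
      have ht2 := eLpNorm_two_lt_top_iff.1 ht.2
      exact eLpNorm_two_lt_top_iff.2
        ((lintegral_union_le _ s t).trans_lt (ENNReal.add_lt_top.2 ⟨hs2, ht2⟩))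
  refine ⟨hΩ, hcont, hD, hmem, fun φ hφ hc ht v => ?_⟩
  choose! V hzV hV using hloc
  -- The test function is split by a partition of unity; by local finiteness only finitely many
  -- pieces meet its compact support.
  obtain ⟨ρ, hρ⟩ := SmoothPartitionOfUnity.exists_isSubordinate 𝓘(ℝ, ℂ)
    (isClosed_tsupport φ) (fun i : Ω => V i) (fun i => (hV i i.2).isOpen)
    (fun z hz => mem_iUnion.2 ⟨⟨z, ht hz⟩, hzV z (ht hz)⟩)
  have hfin := ρ.locallyFinite.finite_nonempty_inter_compact hc
  set S := hfin.toFinset with hS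
  have hsum : ∀ z, φ z = ∑ i ∈ S, ρ i z * φ z := by
    intro z
    by_cases hz : z ∈ tsupport φ
    · have h1 : ∑ i ∈ S, ρ i z = 1 := by
        rw [← ρ.sum_eq_one hz]
        refine (finsum_eq_sum_of_support_subset _ fun i hi => ?_).symm
        rw [hS, Finite.coe_toFinset]
        exact ⟨z, hi, hz⟩
      rw [← Finset.sum_mul, h1, one_mul]
    · simp [image_eq_zero_of_notMem_tsupport hz]
  have hs : ∀ i, ContDiff ℝ ∞ fun z => ρ i z * φ z := fun i => (ρ i).contMDiff.contDiff.mul hφ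
  have hsupp : ∀ i, tsupport (fun z => ρ i z * φ z) ⊆ tsupport φ := fun i =>
    closure_mono fun z hz => right_ne_zero_of_mul hz
  have hsupp2 : ∀ i, tsupport (fun z => ρ i z * φ z) ⊆ V i := fun i =>
    (closure_mono fun z hz => left_ne_zero_of_mul hz).trans (hρ i)
  have hcs : ∀ i, HasCompactSupport fun z => ρ i z * φ z := fun i => hc.mul_left
  have hi : ∀ i, ∫ z, (fderiv ℝ (fun z => ρ i z * φ z) z v) • g z
      = - ∫ z, (ρ i z * φ z) • D z v := fun i =>
    (hV i i.2).weak _ (hs i) (hcs i) (hsupp2 i) v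
  have hfd : ∀ z, fderiv ℝ φ z v = ∑ i ∈ S, fderiv ℝ (fun z => ρ i z * φ z) z v := by
    intro z
    have h1 : φ = fun z => ∑ i ∈ S, ρ i z * φ z := funext hsum
    conv_lhs => rw [h1]
    rw [fderiv_fun_sum fun i _ => (hs i).differentiable (by simp) z]
    simp
  calc ∫ z, (fderiv ℝ φ z v) • g z
      = ∫ z, ∑ i ∈ S, (fderiv ℝ (fun z => ρ i z * φ z) z v) • g z := by
        simp_rw [hfd, Finset.sum_smul]
    _ = ∑ i ∈ S, ∫ z, (fderiv ℝ (fun z => ρ i z * φ z) z v) • g z :=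
        integral_finsetSum _ fun i _ =>
          (hV i i.2).integrable_fderiv_smul (hs i) (hcs i) (hsupp2 i) v
    _ = - ∑ i ∈ S, ∫ z, (ρ i z * φ z) • D z v := by
        rw [← Finset.sum_neg_distrib]; exact Finset.sum_congr rfl fun i _ => hi i
    _ = - ∫ z, ∑ i ∈ S, (ρ i z * φ z) • D z v := by
        rw [integral_finsetSum S fun (i : Ω) _ =>
          (hV i i.2).integrable_smul (hs i).continuous (hcs i) (hsupp2 i) v]
    _ = _ := by
        simp_rw [← Finset.sum_smul, ← hsum]

/-- The fields agree almost everywhere on overlaps by uniqueness, so any of them may be used at a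
given point; taking the least admissible index makes the choice measurable. The last clause holds at
every point, so that a pointwise inequality satisfied by 0 and by all the `D n` is inherited. -/
theorem exists_iUnion {Ω : ℕ → Set ℂ} {D : ℕ → ℂ → ℂ →L[ℝ] ℂ}
    (h : ∀ n, HasWeakDiff g (D n) (Ω n)) :
    ∃ D' : ℂ → ℂ →L[ℝ] ℂ, HasWeakDiff g D' (⋃ n, Ω n) ∧
      ∀ z, D' z = 0 ∨ ∃ n, z ∈ Ω n ∧ D' z = D n z := by
  classical
  set U := ⋃ n, Ω n with hU
  have hUo : IsOpen U := isOpen_iUnion fun n => (h n).isOpen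
  -- Adding `Uᶜ` makes an index available at every point of the plane; there the indicator puts the
  -- field equal to 0.
  let p : ℕ → ℂ → Prop := fun n z => z ∈ Ω n ∪ Uᶜ
  have hp : ∀ z, ∃ n, p n z := by
    intro z
    by_cases hz : z ∈ U
    · obtain ⟨n, hn⟩ := mem_iUnion.1 hz
      exact ⟨n, Or.inl hn⟩
    · exact ⟨0, Or.inr hz⟩
  let D' : ℂ → ℂ →L[ℝ] ℂ := fun z => (U.indicator (D (Nat.find (hp z)))) z
  have hD'm : Measurable D' := by
    refine Measurable.find (f := fun n => U.indicator (D n)) (p := p) (fun n => ?_) (fun n => ?_) hp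
    · exact (h n).meas.measurable.indicator hUo.measurableSet
    · exact (h n).isOpen.measurableSet.union hUo.measurableSet.compl
  have hprop : ∀ z, D' z = 0 ∨ ∃ n, z ∈ Ω n ∧ D' z = D n z := by
    intro z
    by_cases hz : z ∈ U
    · refine Or.inr ⟨Nat.find (hp z), ?_, indicator_of_mem hz _⟩
      exact (Nat.find_spec (hp z)).resolve_right (not_not_intro hz)
    · exact Or.inl (indicator_of_notMem hz _)
  have hmem : ∀ z ∈ U, ∃ n, z ∈ Ω n ∧ D' z = D n z := fun z hz =>
    ⟨Nat.find (hp z), (Nat.find_spec (hp z)).resolve_right (not_not_intro hz),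
      indicator_of_mem hz _⟩
  have hae : ∀ᵐ z, ∀ i j, z ∈ Ω i ∩ Ω j → D i z = D j z := by
    rw [ae_all_iff]; intro i
    rw [ae_all_iff]; intro j
    have ho := (h i).isOpen.inter (h j).isOpen
    exact ((h i).mono ho inter_subset_left).ae_eq ((h j).mono ho inter_subset_right)
  refine ⟨D', of_local hUo (fun z hz => ?_) hD'm.stronglyMeasurable, hprop⟩
  obtain ⟨n, hn⟩ := mem_iUnion.1 hz
  refine ⟨Ω n, hn, (h n).congr_ae hD'm.stronglyMeasurable ?_⟩
  filter_upwards [hae] with w hw hwn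
  obtain ⟨k, hk, hk2⟩ := hmem w (mem_iUnion.2 ⟨n, hwn⟩)
  rw [hk2, hw k n ⟨hk, hwn⟩]

/-- Passage to the limit in the definition of the weak differential. -/
theorem weak_of_tendsto {φ : ℂ → ℝ} (hφ : ContDiff ℝ ∞ φ) (hc : HasCompactSupport φ) (v : ℂ)
    {u : ℕ → ℂ → ℂ} {A : ℕ → ℂ → ℂ →L[ℝ] ℂ}
    (hu : TendstoUniformlyOn u g atTop (tsupport φ))
    (huc : ∀ n, ContinuousOn (u n) (tsupport φ)) (hg : ContinuousOn g (tsupport φ))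
    (hA : ∀ n, IntegrableOn (A n) (tsupport φ)) (hD : IntegrableOn D (tsupport φ))
    (hAD : Tendsto (fun n => eLpNorm (fun z => A n z - D z) 1 (volume.restrict (tsupport φ)))
      atTop (𝓝 0))
    (hw : ∀ n, ∫ z, (fderiv ℝ φ z v) • u n z = - ∫ z, φ z • A n z v) :
    ∫ z, (fderiv ℝ φ z v) • g z = - ∫ z, φ z • D z v := by
  have hφ' : Continuous fun z => fderiv ℝ φ z v :=
    (hφ.continuous_fderiv (by simp)).clm_apply continuous_const
  have hi : ∀ {w : ℂ → ℂ}, ContinuousOn w (tsupport φ) →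
      Integrable fun z => (fderiv ℝ φ z v) • w z := fun {w} hwc =>
    integrable_of_continuousOn_of_eq_zero hc (hφ'.continuousOn.smul hwc) fun z hz => by
      rw [fderiv_eq_zero_of_notMem_tsupport hz]; simp
  have hj : ∀ {B : ℂ → ℂ →L[ℝ] ℂ}, IntegrableOn B (tsupport φ) →
      Integrable fun z => φ z • B z v := fun {B} hB => by
    have h1 : IntegrableOn (fun z => φ z • B z v) (tsupport φ) := by
      refine IntegrableOn.continuousOn_smul ?_ hφ.continuous.continuousOn hc
      exact (ContinuousLinearMap.apply ℝ ℂ v).integrable_comp hB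
    exact h1.integrable_of_forall_notMem_eq_zero fun z hz => by
      rw [image_eq_zero_of_notMem_tsupport hz, zero_smul]
  have t1 : Tendsto (fun n => ∫ z, (fderiv ℝ φ z v) • u n z) atTop
      (𝓝 (∫ z, (fderiv ℝ φ z v) • g z)) := by
    have hab : Integrable fun z => ‖fderiv ℝ φ z v‖ := by
      refine integrable_of_continuousOn_of_eq_zero hc hφ'.norm.continuousOn fun z hz => by
        rw [fderiv_eq_zero_of_notMem_tsupport hz]; simp
    rw [Metric.tendsto_atTop]
    intro ε hε
    set I := ∫ z, ‖fderiv ℝ φ z v‖ with hI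
    have hI0 : 0 ≤ I := integral_nonneg fun _ => norm_nonneg _
    have hη : 0 < ε / (I + 1) := by positivity
    obtain ⟨n₀, hn₀⟩ := eventually_atTop.1 (Metric.tendstoUniformlyOn_iff.1 hu _ hη)
    refine ⟨n₀, fun n hn => ?_⟩
    rw [dist_eq_norm, ← integral_sub (hi (huc n)) (hi hg)]
    calc ‖∫ z, ((fderiv ℝ φ z v) • u n z - (fderiv ℝ φ z v) • g z)‖
        ≤ ∫ z, ‖fderiv ℝ φ z v‖ * (ε / (I + 1)) := by
          refine norm_integral_le_of_norm_le (hab.mul_const _) (Eventually.of_forall fun z => ?_)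
          rw [← smul_sub, norm_smul]
          by_cases hz : z ∈ tsupport φ
          · have := hn₀ n hn z hz
            rw [dist_comm, dist_eq_norm] at this
            gcongr
          · rw [fderiv_eq_zero_of_notMem_tsupport hz]; simp
      _ = I * (ε / (I + 1)) := by rw [integral_mul_const]
      _ < ε := by
          rw [mul_div_assoc', div_lt_iff₀ (by positivity)]
          nlinarith
  have t2 : Tendsto (fun n => ∫ z, φ z • A n z v) atTop (𝓝 (∫ z, φ z • D z v)) := by
    refine tendsto_integral_of_L1' _ (hj hD).aestronglyMeasurable
      (Eventually.of_forall fun n => hj (hA n)) ?_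
    obtain ⟨B, hB⟩ := hφ.continuous.bounded_above_of_compact_support hc
    have hb : ∀ n, eLpNorm ((fun z => φ z • A n z v) - fun z => φ z • D z v) 1 volume
        ≤ ENNReal.ofReal (B * ‖v‖) *
          eLpNorm (fun z => A n z - D z) 1 (volume.restrict (tsupport φ)) := by
      intro n
      have e : eLpNorm ((fun z => φ z • A n z v) - fun z => φ z • D z v) 1 volume
          = eLpNorm ((fun z => φ z • A n z v) - fun z => φ z • D z v) 1
            (volume.restrict (tsupport φ)) := by
        rw [← eLpNorm_indicator_eq_eLpNorm_restrict (isClosed_tsupport φ).measurableSet]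
        congr 1
        ext z
        by_cases hz : z ∈ tsupport φ
        · rw [indicator_of_mem hz]
        · rw [indicator_of_notMem hz]; simp [image_eq_zero_of_notMem_tsupport hz]
      rw [e]
      refine eLpNorm_le_mul_eLpNorm_of_ae_le_mul (Eventually.of_forall fun z => ?_) 1
      simp only [Pi.sub_apply]
      rw [← smul_sub, norm_smul, ← sub_apply]
      calc ‖φ z‖ * ‖(A n z - D z) v‖ ≤ B * (‖A n z - D z‖ * ‖v‖) := by
            gcongr
            · exact (norm_nonneg _).trans (hB z)
            · exact hB z
            · exact (A n z - D z).le_opNorm v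
        _ = B * ‖v‖ * ‖A n z - D z‖ := by ring
    have h0 : Tendsto (fun n => ENNReal.ofReal (B * ‖v‖) *
          eLpNorm (fun z => A n z - D z) 1 (volume.restrict (tsupport φ))) atTop (𝓝 0) := by
      simpa using ENNReal.Tendsto.const_mul hAD (Or.inr ENNReal.ofReal_ne_top)
    exact tendsto_of_tendsto_of_tendsto_of_le_of_le tendsto_const_nhds h0
      (fun _ => zero_le) hb
  simp_rw [hw] at t1
  exact tendsto_nhds_unique t1 t2.neg

end HasWeakDiff

end Lyubich

namespace Lyubich

/-! ### Chain rules -/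

theorem det_mul_clm (c : ℂ) : (ContinuousLinearMap.mul ℝ ℂ c).det = ‖c‖ ^ 2 := by
  have h : (ContinuousLinearMap.mul ℝ ℂ c).det = Algebra.norm ℝ c := rfl
  rw [h, Algebra.norm_complex_apply, Complex.normSq_eq_norm_sq]

/-- Multiplication by `c` is a similarity of ratio |c|, so the usual bound is attained; the reverse
inequality comes from composing with `c⁻¹`. -/
theorem norm_comp_mul_clm (A : ℂ →L[ℝ] ℂ) (c : ℂ) :
    ‖A.comp (ContinuousLinearMap.mul ℝ ℂ c)‖ = ‖A‖ * ‖c‖ := by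
  have h1 : ∀ (B : ℂ →L[ℝ] ℂ) (a : ℂ), ‖B.comp (ContinuousLinearMap.mul ℝ ℂ a)‖ ≤ ‖B‖ * ‖a‖ := by
    intro B a
    refine (B.opNorm_comp_le _).trans ?_
    gcongr
    exact ContinuousLinearMap.opNorm_mul_apply_le ℝ ℂ a
  refine le_antisymm (h1 A c) ?_
  by_cases hc : c = 0
  · simp [hc]
  have h2 : A = (A.comp (ContinuousLinearMap.mul ℝ ℂ c)).comp (ContinuousLinearMap.mul ℝ ℂ c⁻¹) := by
    ext z; simp [hc]
  have h3 := h1 (A.comp (ContinuousLinearMap.mul ℝ ℂ c)) c⁻¹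
  rw [← h2, norm_inv] at h3
  have hc' : 0 < ‖c‖ := norm_pos_iff.2 hc
  calc ‖A‖ * ‖c‖ ≤ (‖A.comp (ContinuousLinearMap.mul ℝ ℂ c)‖ * ‖c‖⁻¹) * ‖c‖ := by gcongr
    _ = _ := by field_simp

theorem norm_mul_clm_comp (A : ℂ →L[ℝ] ℂ) (c : ℂ) :
    ‖(ContinuousLinearMap.mul ℝ ℂ c).comp A‖ ≤ ‖c‖ * ‖A‖ := by
  refine (ContinuousLinearMap.opNorm_comp_le _ _).trans ?_
  gcongr
  exact ContinuousLinearMap.opNorm_mul_apply_le ℝ ℂ c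

theorem hasFDerivAt_real_of_differentiableAt {k : ℂ → ℂ} {z : ℂ} (h : DifferentiableAt ℂ k z) :
    HasFDerivAt k (ContinuousLinearMap.mul ℝ ℂ (deriv k z)) z := by
  have h1 := h.hasDerivAt.hasFDerivAt.restrictScalars ℝ
  have e : ContinuousLinearMap.restrictScalars ℝ (ContinuousLinearMap.toSpanSingleton ℂ (deriv k z))
      = ContinuousLinearMap.mul ℝ ℂ (deriv k z) := by
    ext w; simp [mul_comm]
  rwa [e] at h1

/-- Change of variables under an injective holomorphic map. -/
theorem lintegral_image_holomorphic {k : ℂ → ℂ} {s : Set ℂ} (hs : MeasurableSet s)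
    (hk : ∀ z ∈ s, DifferentiableAt ℂ k z) (hinj : InjOn k s) (F : ℂ → ℝ≥0∞) :
    ∫⁻ w in k '' s, F w = ∫⁻ z in s, ‖deriv k z‖ₑ ^ 2 * F (k z) := by
  rw [lintegral_image_eq_lintegral_abs_det_fderiv_mul volume hs
    (fun z hz => (hasFDerivAt_real_of_differentiableAt (hk z hz)).hasFDerivWithinAt) hinj]
  refine lintegral_congr fun z => ?_
  rw [det_mul_clm, abs_of_nonneg (by positivity), ENNReal.ofReal_pow (norm_nonneg _),
    ofReal_norm]

/-- Conformal invariance of the Dirichlet integral. -/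
theorem lintegral_sq_comp_holomorphic {k : ℂ → ℂ} {s : Set ℂ} (hs : MeasurableSet s)
    (hk : ∀ z ∈ s, DifferentiableAt ℂ k z) (hinj : InjOn k s) (A : ℂ → ℂ →L[ℝ] ℂ) :
    ∫⁻ z in s, ‖(A (k z)).comp (ContinuousLinearMap.mul ℝ ℂ (deriv k z))‖ₑ ^ 2
      = ∫⁻ w in k '' s, ‖A w‖ₑ ^ 2 := by
  rw [lintegral_image_holomorphic hs hk hinj]
  refine lintegral_congr fun z => ?_
  rw [← ofReal_norm, norm_comp_mul_clm, ENNReal.ofReal_mul (norm_nonneg _),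
    ofReal_norm, ofReal_norm, mul_pow, mul_comm]

theorem tendsto_eLpNorm_one_of_two {E : Type*} [NormedAddCommGroup E] {C : Set ℂ}
    (hC : IsCompact C) {f : ℕ → ℂ → E}
    (hf : ∀ n, AEStronglyMeasurable (f n) (volume.restrict C))
    (h : Tendsto (fun n => eLpNorm (f n) 2 (volume.restrict C)) atTop (𝓝 0)) :
    Tendsto (fun n => eLpNorm (f n) 1 (volume.restrict C)) atTop (𝓝 0) := by
  have hb := fun n => eLpNorm_le_eLpNorm_mul_rpow_measure_univ (p := 1) (q := 2)
    (by norm_num) (hf n)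
  refine tendsto_of_tendsto_of_tendsto_of_le_of_le tendsto_const_nhds ?_ (fun _ => zero_le) hb
  have h2 : (volume.restrict C) univ ^ (1 / (1 : ℝ≥0∞).toReal - 1 / (2 : ℝ≥0∞).toReal) ≠ ⊤ := by
    refine ENNReal.rpow_ne_top_of_nonneg (by norm_num) ?_
    simpa using hC.measure_lt_top.ne
  simpa using ENNReal.Tendsto.mul_const h (Or.inr h2)

theorem tendstoUniformlyOn_comp {E : Type*} [NormedAddCommGroup E] {C : Set ℂ} (hC : IsCompact C)
    {G : ℕ → ℂ → ℂ} {g : ℂ → ℂ} (hg : ContinuousOn g C) (hG : TendstoUniformlyOn G g atTop C)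
    {F : ℂ → E} (hF : Continuous F) :
    TendstoUniformlyOn (fun n z => F (G n z)) (fun z => F (g z)) atTop C := by
  have hK : IsCompact (Metric.cthickening 1 (g '' C)) := (hC.image_of_continuousOn hg).cthickening
  refine UniformContinuousOn.comp_tendstoUniformlyOn_eventually
    (s := Metric.cthickening 1 (g '' C)) ?_ ?_
    (hK.uniformContinuousOn_of_continuous hF.continuousOn) hG
  · filter_upwards [Metric.tendstoUniformlyOn_iff.1 hG 1 one_pos] with n hn z hz
    refine Metric.mem_cthickening_of_dist_le _ (g z) 1 _ (mem_image_of_mem g hz) ?_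
    rw [dist_comm]; exact (hn z hz).le
  · exact fun z hz => Metric.self_subset_cthickening _ (mem_image_of_mem g hz)

theorem exists_ofReal_mul_le {a δ : ℝ≥0∞} (ha : a ≠ ⊤) (hδ : 0 < δ) :
    ∃ ε : ℝ, 0 < ε ∧ ENNReal.ofReal ε * a ≤ δ := by
  have ht : Tendsto (fun η : ℝ => ENNReal.ofReal η * a) (𝓝[>] 0)
      (𝓝 (ENNReal.ofReal 0 * a)) :=
    ENNReal.Tendsto.mul_const
      ((ENNReal.continuous_ofReal.tendsto 0).mono_left nhdsWithin_le_nhds) (Or.inr ha)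
  rw [ENNReal.ofReal_zero, zero_mul] at ht
  obtain ⟨η, h1, h2⟩ := ((ht.eventually (ge_mem_nhds hδ)).and self_mem_nhdsWithin).exists
  exact ⟨η, h2, h1⟩

/-- A uniformly convergent factor against an L¹-convergent one: the difference is `A n (B n - B') +
(A n - A') B'`, with `A n` bounded by `M + ε`. -/
theorem tendsto_eLpNorm_one_clm_comp {C : Set ℂ} (hC : MeasurableSet C)
    {A : ℕ → ℂ → ℂ →L[ℝ] ℂ} {A' : ℂ → ℂ →L[ℝ] ℂ} {B : ℕ → ℂ → ℂ →L[ℝ] ℂ} {B' : ℂ → ℂ →L[ℝ] ℂ}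
    {M : ℝ} (hM0 : 0 ≤ M) (hM : ∀ z ∈ C, ‖A' z‖ ≤ M) (hA : TendstoUniformlyOn A A' atTop C)
    (hBm : ∀ n, AEStronglyMeasurable (fun z => B n z - B' z) (volume.restrict C))
    (hB : Tendsto (fun n => eLpNorm (fun z => B n z - B' z) 1 (volume.restrict C)) atTop (𝓝 0))
    (hB' : IntegrableOn B' C) :
    Tendsto (fun n => eLpNorm (fun z => (A n z).comp (B n z) - (A' z).comp (B' z)) 1
      (volume.restrict C)) atTop (𝓝 0) := by
  rw [ENNReal.tendsto_atTop_zero]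
  intro δ hδ
  have hδ2 : 0 < δ / 2 := ENNReal.div_pos hδ.ne' (by norm_num)
  have hB'n : eLpNorm B' 1 (volume.restrict C) ≠ ⊤ := (memLp_one_iff_integrable.2 hB').2.ne
  obtain ⟨ε, hε, hεb⟩ := exists_ofReal_mul_le hB'n hδ2
  have hB2 : Tendsto (fun n => ENNReal.ofReal (M + ε) *
      eLpNorm (fun z => B n z - B' z) 1 (volume.restrict C)) atTop (𝓝 0) := by
    simpa using ENNReal.Tendsto.const_mul hB (Or.inr ENNReal.ofReal_ne_top)
  obtain ⟨n₁, hn₁⟩ := ENNReal.tendsto_atTop_zero.1 hB2 _ hδ2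
  obtain ⟨n₂, hn₂⟩ := eventually_atTop.1 (Metric.tendstoUniformlyOn_iff.1 hA ε hε)
  refine ⟨max n₁ n₂, fun n hn => ?_⟩
  have hs : ∀ᵐ z ∂(volume.restrict C), ‖(A n z).comp (B n z) - (A' z).comp (B' z)‖
      ≤ ‖(M + ε) * ‖B n z - B' z‖ + ε * ‖B' z‖‖ := by
    filter_upwards [ae_restrict_mem hC] with z hz
    have h1 : ‖A n z - A' z‖ ≤ ε := by
      have := hn₂ n (le_of_max_le_right hn) z hz
      rw [dist_comm, dist_eq_norm] at this; exact this.le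
    have h2 : ‖A n z‖ ≤ M + ε := by
      calc ‖A n z‖ = ‖A' z + (A n z - A' z)‖ := by congr 1; abel
        _ ≤ _ := (norm_add_le _ _).trans (add_le_add (hM z hz) h1)
    have e : (A n z).comp (B n z) - (A' z).comp (B' z)
        = (A n z).comp (B n z - B' z) + (A n z - A' z).comp (B' z) := by
      ext; simp
    rw [e]
    refine le_trans ?_ (le_abs_self _)
    refine (norm_add_le _ _).trans (add_le_add ?_ ?_)
    · exact ((A n z).opNorm_comp_le _).trans (by gcongr)
    · exact ((A n z - A' z).opNorm_comp_le _).trans (by gcongr)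
  refine (eLpNorm_mono_ae hs).trans ?_
  refine (eLpNorm_add_le ((hBm n).norm.const_mul _) (hB'.aestronglyMeasurable.norm.const_mul _)
    le_rfl).trans ?_
  rw [← ENNReal.add_halves δ]
  refine add_le_add (le_trans ?_ (hn₁ n (le_of_max_le_left hn))) (le_trans ?_ hεb)
  · refine eLpNorm_le_mul_eLpNorm_of_ae_le_mul (Eventually.of_forall fun z => ?_) 1
    rw [norm_mul, norm_norm]
    rw [Real.norm_of_nonneg (add_nonneg hM0 hε.le)]
  · refine eLpNorm_le_mul_eLpNorm_of_ae_le_mul (Eventually.of_forall fun z => ?_) 1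
    rw [norm_mul, norm_norm, Real.norm_of_nonneg hε.le]

namespace HasWeakDiff

variable {g : ℂ → ℂ} {D : ℂ → ℂ →L[ℝ] ℂ} {Ω : Set ℂ}

theorem measurable_indicator (h : HasWeakDiff g D Ω) : Measurable (Ω.indicator g) := by
  classical
  have := h.cont.measurable_piecewise (g := fun _ => (0 : ℂ)) continuousOn_const
    h.isOpen.measurableSet
  exact this

/-- The chain rule holds for smooth approximations of `g` and survives the limit, the outer
differentials converging uniformly on compact sets and the inner ones in L¹. The indicator only
serves to make the field measurable on the whole plane. -/
theorem comp_left (h : HasWeakDiff g D Ω) {F : ℂ → ℂ} (hF : ContDiff ℝ ∞ F) :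
    HasWeakDiff (fun z => F (g z)) (fun z => (fderiv ℝ F (Ω.indicator g z)).comp (D z)) Ω := by
  have hF' : Continuous (fderiv ℝ F) := hF.continuous_fderiv (by simp)
  have hmeas : StronglyMeasurable fun z => (fderiv ℝ F (Ω.indicator g z)).comp (D z) := by
    have h1 : StronglyMeasurable fun z => fderiv ℝ F (Ω.indicator g z) :=
      (hF'.measurable.comp h.measurable_indicator).stronglyMeasurable
    exact (continuous_fst.clm_comp continuous_snd).comp_stronglyMeasurable (h1.prodMk h.meas)
  have hbd : ∀ C ⊆ Ω, IsCompact C → ∃ M : ℝ, 0 ≤ M ∧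
      ∀ z ∈ C, ‖fderiv ℝ F (Ω.indicator g z)‖ ≤ M := by
    intro C hC hCc
    obtain ⟨M, hM⟩ := hCc.exists_bound_of_continuousOn
      (hF'.comp_continuousOn (h.cont.mono hC))
    refine ⟨max M 0, le_max_right _ _, fun z hz => ?_⟩
    rw [indicator_of_mem (hC hz)]; exact (hM z hz).trans (le_max_left _ _)
  have hmem : ∀ C ⊆ Ω, IsCompact C →
      MemLp (fun z => (fderiv ℝ F (Ω.indicator g z)).comp (D z)) 2 (volume.restrict C) := by
    intro C hC hCc
    obtain ⟨M, hM0, hM⟩ := hbd C hC hCc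
    refine (h.memLp C hC hCc).of_le_mul (c := M) hmeas.aestronglyMeasurable ?_
    filter_upwards [ae_restrict_mem hCc.isClosed.measurableSet] with z hz
    exact (ContinuousLinearMap.opNorm_comp_le _ _).trans (by gcongr; exact hM z hz)
  refine ⟨h.isOpen, hF.continuous.comp_continuousOn h.cont, hmeas, hmem,
    fun φ hφ hc ht v => ?_⟩
  obtain ⟨G, hGs, hGu, hGL⟩ := h.exists_smooth_approx hc ht
  have hgC := h.cont.mono ht
  obtain ⟨M, hM0, hM⟩ := hbd _ ht hc
  have hGc : ∀ n, Continuous (fderiv ℝ (G n)) := fun n => (hGs n).continuous_fderiv (by simp)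
  have hcomp : ∀ n z, HasFDerivAt (fun z => F (G n z))
      ((fderiv ℝ F (G n z)).comp (fderiv ℝ (G n) z)) z := fun n z =>
    HasFDerivAt.comp z (hF.differentiable (by simp) _).hasFDerivAt
      ((hGs n).differentiable (by simp) z).hasFDerivAt
  have hcc : ∀ n, Continuous fun z => (fderiv ℝ F (G n z)).comp (fderiv ℝ (G n) z) := fun n =>
    (hF'.comp (hGs n).continuous).clm_comp (hGc n)
  have hDi := h.integrableOn hc ht
  refine weak_of_tendsto (u := fun n z => F (G n z))
    (A := fun n z => (fderiv ℝ F (G n z)).comp (fderiv ℝ (G n) z)) hφ hc v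
    (tendstoUniformlyOn_comp hc hgC hGu hF.continuous)
    (fun n => (hF.continuous.comp (hGs n).continuous).continuousOn)
    (hF.continuous.comp_continuousOn hgC)
    (fun n => (hcc n).continuousOn.integrableOn_compact hc) ?_ ?_ ?_
  · have : IsFiniteMeasure (volume.restrict (tsupport φ)) := ⟨by simpa using hc.measure_lt_top⟩
    exact (hmem _ ht hc).integrable (by norm_num)
  · refine tendsto_eLpNorm_one_clm_comp hc.isClosed.measurableSet hM0 hM ?_ ?_ ?_ hDi
    · refine (tendstoUniformlyOn_comp hc hgC hGu hF').congr_right fun z hz => ?_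
      simp only [indicator_of_mem (ht hz)]
    · exact fun n => (hGc n).aestronglyMeasurable.sub h.meas.aestronglyMeasurable
    · exact tendsto_eLpNorm_one_of_two hc
        (fun n => (hGc n).aestronglyMeasurable.sub h.meas.aestronglyMeasurable) hGL
  · intro n
    exact (of_hasFDerivAt isOpen_univ (hcc n).stronglyMeasurable (hcc n).continuousOn
      (fun z _ => hcomp n z)).weak φ hφ hc (subset_univ _) v

/-- Conformal invariance of the energy transports L² approximation from k(C) back to C without any
loss, so that no lower bound on |k'| is needed. -/
theorem comp_right (h : HasWeakDiff g D Ω) {k : ℂ → ℂ} {V : Set ℂ} (hV : IsOpen V)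
    (hk : DifferentiableOn ℂ k V) (hinj : InjOn k V) (hmaps : MapsTo k V Ω) :
    HasWeakDiff (fun z => g (k z)) (fun z => (D (V.indicator k z)).comp
      (ContinuousLinearMap.mul ℝ ℂ (deriv k z))) V := by
  classical
  have hkd : ∀ z ∈ V, DifferentiableAt ℂ k z := fun z hz => hk.differentiableAt (hV.mem_nhds hz)
  have hkc : ContinuousOn k V := hk.continuousOn
  have hk'c : ContinuousOn (deriv k) V := (hk.deriv hV).continuousOn
  have hkm : Measurable (V.indicator k) :=
    hkc.measurable_piecewise (g := fun _ => (0 : ℂ)) continuousOn_const hV.measurableSet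
  have hmul : Continuous fun c : ℂ => ContinuousLinearMap.mul ℝ ℂ c :=
    (ContinuousLinearMap.mul ℝ ℂ).continuous
  have hmeas' : ∀ {B : ℂ → ℂ →L[ℝ] ℂ}, StronglyMeasurable B → StronglyMeasurable fun z =>
      (B (V.indicator k z)).comp (ContinuousLinearMap.mul ℝ ℂ (deriv k z)) := by
    intro B hB
    have h1 : StronglyMeasurable fun z => B (V.indicator k z) := hB.comp_measurable hkm
    have h2 : StronglyMeasurable fun z => ContinuousLinearMap.mul ℝ ℂ (deriv k z) :=
      hmul.comp_stronglyMeasurable (measurable_deriv k).stronglyMeasurable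
    exact (continuous_fst.clm_comp continuous_snd).comp_stronglyMeasurable (h1.prodMk h2)
  have hL2 : ∀ C ⊆ V, IsCompact C → ∀ B : ℂ → ℂ →L[ℝ] ℂ,
      eLpNorm (fun z => (B (V.indicator k z)).comp
        (ContinuousLinearMap.mul ℝ ℂ (deriv k z))) 2 (volume.restrict C)
      = eLpNorm B 2 (volume.restrict (k '' C)) := by
    intro C hC hCc B
    refine (ENNReal.pow_right_strictMono (n := 2) (by norm_num)).injective ?_
    rw [eLpNorm_two_sq, eLpNorm_two_sq, ← lintegral_sq_comp_holomorphic hCc.isClosed.measurableSet (fun z hz => hkd z (hC hz))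
        (hinj.mono hC)]
    refine setLIntegral_congr_fun hCc.isClosed.measurableSet fun z hz => ?_
    simp only [indicator_of_mem (hC hz)]
  have hkC : ∀ C ⊆ V, IsCompact C → IsCompact (k '' C) ∧ k '' C ⊆ Ω := fun C hC hCc =>
    ⟨hCc.image_of_continuousOn (hkc.mono hC), (hmaps.mono_left hC).image_subset⟩
  have hmem : ∀ C ⊆ V, IsCompact C → MemLp (fun z => (D (V.indicator k z)).comp
      (ContinuousLinearMap.mul ℝ ℂ (deriv k z))) 2 (volume.restrict C) := by
    intro C hC hCc
    refine ⟨(hmeas' h.meas).aestronglyMeasurable, ?_⟩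
    rw [hL2 C hC hCc]
    exact (h.memLp _ (hkC C hC hCc).2 (hkC C hC hCc).1).2
  refine ⟨hV, h.cont.comp hkc hmaps, hmeas' h.meas, hmem, fun φ hφ hc ht v => ?_⟩
  obtain ⟨hC1, hC2⟩ := hkC _ ht hc
  obtain ⟨G, hGs, hGu, hGL⟩ := h.exists_smooth_approx hC1 hC2
  have hGc : ∀ n, Continuous (fderiv ℝ (G n)) := fun n => (hGs n).continuous_fderiv (by simp)
  have hAm : ∀ n, StronglyMeasurable fun z => (fderiv ℝ (G n) (V.indicator k z)).comp
      (ContinuousLinearMap.mul ℝ ℂ (deriv k z)) := fun n => hmeas' (hGc n).stronglyMeasurable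
  have hAc : ∀ n, ContinuousOn (fun z => (fderiv ℝ (G n) (V.indicator k z)).comp
      (ContinuousLinearMap.mul ℝ ℂ (deriv k z))) V := by
    intro n
    refine (((hGc n).comp_continuousOn hkc).congr fun z hz => ?_).clm_comp
      (hmul.comp_continuousOn hk'c)
    simp only [indicator_of_mem hz, Function.comp]
  refine weak_of_tendsto (u := fun n z => G n (k z)) (A := fun n z =>
    (fderiv ℝ (G n) (V.indicator k z)).comp (ContinuousLinearMap.mul ℝ ℂ (deriv k z)))
    hφ hc v ?_ (fun n => (hGs n).continuous.comp_continuousOn (hkc.mono ht))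
    ((h.cont.comp hkc hmaps).mono ht)
    (fun n => ((hAc n).mono ht).integrableOn_compact hc) ?_ ?_ ?_
  · have := hGu.comp k
    exact this.mono fun z hz => mem_image_of_mem k hz
  · have : IsFiniteMeasure (volume.restrict (tsupport φ)) := ⟨by simpa using hc.measure_lt_top⟩
    exact (hmem _ ht hc).integrable (by norm_num)
  · refine tendsto_eLpNorm_one_of_two hc (fun n => (hAm n).aestronglyMeasurable.sub
      (hmeas' h.meas).aestronglyMeasurable) (hGL.congr fun n => ?_)
    rw [← hL2 _ ht hc (fun z => fderiv ℝ (G n) z - D z)]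
    congr 1
  · intro n
    refine (of_hasFDerivAt hV (hAm n) (hAc n) fun z hz => ?_).weak φ hφ hc ht v
    rw [indicator_of_mem hz]
    exact HasFDerivAt.comp z ((hGs n).differentiable (by simp) _).hasFDerivAt
      (hasFDerivAt_real_of_differentiableAt (hkd z hz))

end HasWeakDiff

end Lyubich

namespace Lyubich

/-! ### Truncation and gluing -/

/-- A smooth map of the plane that collapses the unit disk and is the identity far away. -/
theorem exists_collapse : ∃ (F : ℂ → ℂ) (B : ℝ), ContDiff ℝ ∞ F ∧ (∀ w, ‖w‖ ≤ 1 → F w = 0) ∧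
    (∀ w, ‖F w - w‖ ≤ 2) ∧ (∀ w, ‖fderiv ℝ F w‖ ≤ B) ∧
    (∀ w, 2 < ‖w‖ → fderiv ℝ F w = ContinuousLinearMap.id ℝ ℂ) := by
  let b : ContDiffBump (0 : ℂ) := ⟨1, 2, one_pos, by norm_num⟩
  let u : ℂ → ℂ := fun w => b w • w
  have hu : ContDiff ℝ ∞ u := b.contDiff.smul contDiff_id
  have huc : HasCompactSupport u := b.hasCompactSupport.smul_right
  obtain ⟨B, hB⟩ := (hu.continuous_fderiv (by simp)).bounded_above_of_compact_support
    (huc.fderiv ℝ)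
  have hfd : ∀ w, fderiv ℝ (fun w => w - u w) w = ContinuousLinearMap.id ℝ ℂ - fderiv ℝ u w := by
    intro w
    exact ((hasFDerivAt_id w).sub (hu.differentiable (by simp) w).hasFDerivAt).fderiv
  refine ⟨fun w => w - u w, 1 + B, contDiff_id.sub hu, ?_, ?_, ?_, ?_⟩
  · intro w hw
    have : b w = 1 := b.one_of_mem_closedBall (by simpa using hw)
    simp [u, this]
  · intro w
    have h1 : w - u w - w = - u w := by ring
    rw [h1, norm_neg]
    simp only [u]
    rw [norm_smul, Real.norm_of_nonneg b.nonneg]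
    by_cases hw : ‖w‖ ≤ 2
    · calc b w * ‖w‖ ≤ 1 * 2 := by gcongr; exact b.le_one
        _ = 2 := by norm_num
    · have : b w = 0 := b.zero_of_le_dist (by simpa using (not_le.1 hw).le)
      rw [this]; simp
  · intro w
    rw [hfd]
    exact (norm_sub_le _ _).trans (add_le_add ContinuousLinearMap.norm_id_le (hB w))
  · intro w hw
    rw [hfd]
    have : fderiv ℝ u w = 0 := by
      refine fderiv_eq_zero_of_notMem_tsupport fun hmem => ?_
      have h2 : tsupport u ⊆ Metric.closedBall 0 2 := by
        refine (tsupport_smul_subset_left _ _).trans ?_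
        rw [b.tsupport_eq]
      have := h2 hmem
      rw [mem_closedBall_zero_iff] at this
      linarith
    rw [this, sub_zero]

theorem enorm_zero_clm : ‖(0 : ℂ →L[ℝ] ℂ)‖ₑ = 0 := by
  rw [← ofReal_norm, norm_zero, ENNReal.ofReal_zero]

namespace HasWeakDiff

variable {g : ℂ → ℂ} {D : ℂ → ℂ →L[ℝ] ℂ} {Ω : Set ℂ}

theorem zero (hΩ : IsOpen Ω) : HasWeakDiff (fun _ => 0) (fun _ => 0) Ω :=
  of_hasFDerivAt hΩ stronglyMeasurable_const continuousOn_const fun z _ => hasFDerivAt_const 0 z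

/-- A continuous function that vanishes off an open set `V` and is Sobolev in `V` with square
integrable differential is Sobolev. -/
theorem extend_by_zero {u : ℂ → ℂ} {E : ℂ → ℂ →L[ℝ] ℂ} {V : Set ℂ} (hu : HasWeakDiff u E V)
    (hΩ : IsOpen Ω) (huc : ContinuousOn u Ω) (h0 : ∀ z ∈ Ω \ V, u z = 0)
    (hL2 : ∀ C ⊆ Ω, IsCompact C → ∫⁻ z in C ∩ V, ‖E z‖ₑ ^ 2 < ⊤) :
    HasWeakDiff u ({z | z ∈ V ∧ u z ≠ 0}.indicator E) Ω := by
  obtain ⟨F, B, hFs, hF0, hF2, hFB, hFid⟩ := exists_collapse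
  set V₀ : Set ℂ := {z | z ∈ V ∧ u z ≠ 0} with hV₀
  have hV₀o : IsOpen V₀ := hu.cont.isOpen_inter_preimage hu.isOpen isOpen_ne
  have hEm : StronglyMeasurable (V₀.indicator E) := hu.meas.indicator hV₀o.measurableSet
  have hmem : ∀ C ⊆ Ω, IsCompact C → MemLp (V₀.indicator E) 2 (volume.restrict C) := by
    intro C hC hCc
    refine ⟨hEm.aestronglyMeasurable, eLpNorm_two_lt_top_iff.2 ?_⟩
    refine lt_of_le_of_lt ?_ (hL2 C hC hCc)
    rw [← lintegral_indicator hCc.isClosed.measurableSet,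
      ← lintegral_indicator (hCc.isClosed.measurableSet.inter hu.isOpen.measurableSet)]
    refine lintegral_mono fun z => ?_
    by_cases hz : z ∈ C
    · by_cases hz2 : z ∈ V₀
      · rw [indicator_of_mem hz, indicator_of_mem hz2, indicator_of_mem (show z ∈ C ∩ V from ⟨hz, hz2.1⟩)]
      · rw [indicator_of_mem hz, indicator_of_notMem hz2, enorm_zero_clm]; simp
    · rw [indicator_of_notMem hz]; exact zero_le
  refine ⟨hΩ, huc, hEm, hmem, fun φ hφ hc ht v => ?_⟩
  -- the truncations
  have hpos : ∀ n : ℕ, (0 : ℝ) < n + 1 := fun n => by positivity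
  let Fn : ℕ → ℂ → ℂ := fun n w => ((n : ℝ) + 1)⁻¹ • F (((n : ℝ) + 1) • w)
  have hFns : ∀ n, ContDiff ℝ ∞ (Fn n) := fun n =>
    (hFs.comp (contDiff_const_smul _)).const_smul _
  have hFn' : ∀ n w, fderiv ℝ (Fn n) w = fderiv ℝ F (((n : ℝ) + 1) • w) := by
    intro n w
    have h1 : HasFDerivAt (fun w => F (((n : ℝ) + 1) • w))
        ((fderiv ℝ F (((n : ℝ) + 1) • w)).comp (((n : ℝ) + 1) • ContinuousLinearMap.id ℝ ℂ)) w :=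
      HasFDerivAt.comp w (hFs.differentiable (by simp) _).hasFDerivAt
        ((((n : ℝ) + 1) • ContinuousLinearMap.id ℝ ℂ).hasFDerivAt)
    have h2 := (h1.const_smul (((n : ℝ) + 1)⁻¹)).fderiv
    have h3 : fderiv ℝ (Fn n) w = fderiv ℝ (((n : ℝ) + 1)⁻¹ • fun w => F (((n : ℝ) + 1) • w)) w :=
      rfl
    rw [h3, h2]
    ext x
    have := (hpos n).ne'
    simp only [smul_apply, ContinuousLinearMap.comp_apply, ContinuousLinearMap.id_apply, map_smul]
    rw [smul_smul, inv_mul_cancel₀ this, one_smul]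
  have hFn0 : ∀ (n : ℕ) (w : ℂ), ‖w‖ ≤ ((n : ℝ) + 1)⁻¹ → Fn n w = 0 := by
    intro n w hw
    have : ‖((n : ℝ) + 1) • w‖ ≤ 1 := by
      rw [norm_smul, Real.norm_of_nonneg (hpos n).le]
      calc ((n : ℝ) + 1) * ‖w‖ ≤ ((n : ℝ) + 1) * ((n : ℝ) + 1)⁻¹ := by gcongr
        _ = 1 := mul_inv_cancel₀ (hpos n).ne'
    simp only [Fn, hF0 _ this, smul_zero]
  have hFn0' : ∀ (n : ℕ) (w : ℂ), ‖w‖ < ((n : ℝ) + 1)⁻¹ → fderiv ℝ (Fn n) w = 0 := by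
    intro n w hw
    have : Fn n =ᶠ[𝓝 w] fun _ => 0 := by
      filter_upwards [(continuous_norm.tendsto w).eventually (gt_mem_nhds hw)] with y hy
      exact hFn0 n y (le_of_lt hy)
    rw [this.fderiv_eq]; simp
  have hFn2 : ∀ n w, ‖Fn n w - w‖ ≤ 2 * ((n : ℝ) + 1)⁻¹ := by
    intro n w
    have h1 : Fn n w - w = ((n : ℝ) + 1)⁻¹ • (F (((n : ℝ) + 1) • w) - ((n : ℝ) + 1) • w) := by
      simp only [Fn]
      rw [smul_sub, smul_smul, inv_mul_cancel₀ (hpos n).ne', one_smul]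
    rw [h1, norm_smul, Real.norm_of_nonneg (inv_pos.2 (hpos n)).le, mul_comm]
    gcongr
    exact hF2 _
  let A : ℕ → ℂ → ℂ →L[ℝ] ℂ := fun n =>
    V.indicator fun z => (fderiv ℝ (Fn n) (V.indicator u z)).comp (E z)
  have hAm : ∀ n, StronglyMeasurable (A n) := fun n =>
    (hu.comp_left (hFns n)).meas.indicator hu.isOpen.measurableSet
  -- Near a point of Ω outside `V` one has |u| < 1/(n+1), where the truncation vanishes identically;
  -- so the truncated function is Sobolev across the boundary of `V`.
  have hAW : ∀ n, HasWeakDiff (fun z => Fn n (u z)) (A n) Ω := by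
    intro n
    refine of_local hΩ (fun z hz => ?_) (hAm n)
    by_cases hzV : z ∈ V
    · refine ⟨V, hzV, (hu.comp_left (hFns n)).congr_ae (hAm n) (Eventually.of_forall
        fun w hw => indicator_of_mem hw _)⟩
    · set W : Set ℂ := Ω ∩ u ⁻¹' Metric.ball 0 ((n : ℝ) + 1)⁻¹ with hW
      have hWo : IsOpen W := huc.isOpen_inter_preimage hΩ Metric.isOpen_ball
      refine ⟨W, ⟨hz, ?_⟩, ?_⟩
      · rw [mem_preimage, h0 z ⟨hz, hzV⟩]
        exact Metric.mem_ball_self (inv_pos.2 (hpos n))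
      · refine ((zero hWo).congr fun w hw => ?_).congr_ae (hAm n)
          (Eventually.of_forall fun w hw => ?_)
        · exact hFn0 n _ (mem_ball_zero_iff.1 hw.2).le
        · by_cases hwV : w ∈ V
          · simp only [A, indicator_of_mem hwV]
            rw [hFn0' n _ (mem_ball_zero_iff.1 hw.2)]; simp
          · simp only [A, indicator_of_notMem hwV]
  have hB0 : 0 ≤ B := (norm_nonneg _).trans (hFB 0)
  refine weak_of_tendsto (u := fun n z => Fn n (u z)) (A := A) hφ hc v ?_
    (fun n => (hAW n).cont.mono ht) (huc.mono ht) (fun n => (hAW n).integrableOn hc ht) ?_ ?_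
    (fun n => (hAW n).weak φ hφ hc ht v)
  · rw [Metric.tendstoUniformlyOn_iff]
    intro ε hε
    have : Tendsto (fun n : ℕ => 2 * ((n : ℝ) + 1)⁻¹) atTop (𝓝 0) := by
      have := (tendsto_one_div_add_atTop_nhds_zero_nat (𝕜 := ℝ)).const_mul 2
      simpa using this
    filter_upwards [(tendsto_order.1 this).2 _ hε] with n hn z _
    rw [dist_comm, dist_eq_norm]
    exact (hFn2 n _).trans_lt hn
  · have : IsFiniteMeasure (volume.restrict (tsupport φ)) := ⟨by simpa using hc.measure_lt_top⟩
    exact (hmem _ ht hc).integrable (by norm_num)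
  · simp_rw [eLpNorm_one_eq_lintegral_enorm]
    have hb : ∀ n z, ‖A n z - V₀.indicator E z‖ₑ
        ≤ ENNReal.ofReal (B + 1) * V.indicator (fun z => ‖E z‖ₑ) z := by
      intro n z
      by_cases hz : z ∈ V
      · have e1 : ‖A n z‖ ≤ B * ‖E z‖ := by
          simp only [A, indicator_of_mem hz]
          refine (ContinuousLinearMap.opNorm_comp_le _ _).trans ?_
          gcongr
          rw [hFn']; exact hFB _
        have e2 : ‖V₀.indicator E z‖ ≤ ‖E z‖ := norm_indicator_le_norm_self E z
        rw [indicator_of_mem hz, ← ofReal_norm, ← ofReal_norm,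
          ← ENNReal.ofReal_mul (by linarith)]
        refine ENNReal.ofReal_le_ofReal ((norm_sub_le _ _).trans ?_)
        linarith
      · have hz2 : z ∉ V₀ := fun h => hz h.1
        simp only [A, indicator_of_notMem hz, indicator_of_notMem hz2, sub_zero, enorm_zero_clm]
        simp
    have hfin : ∫⁻ z in tsupport φ, ENNReal.ofReal (B + 1) * V.indicator (fun z => ‖E z‖ₑ) z
        ≠ ⊤ := by
      rw [lintegral_const_mul' _ _ ENNReal.ofReal_ne_top]
      refine ENNReal.mul_ne_top ENNReal.ofReal_ne_top ?_
      rw [lintegral_indicator hu.isOpen.measurableSet, Measure.restrict_restrict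
        hu.isOpen.measurableSet]
      have h1 : ∫⁻ z in V ∩ tsupport φ, ‖E z‖ₑ ≤
          ∫⁻ z in V ∩ tsupport φ, (1 + ‖E z‖ₑ ^ 2) := by
        refine lintegral_mono fun z => ?_
        rcases le_total (‖E z‖ₑ) 1 with h | h
        · exact h.trans le_self_add
        · calc ‖E z‖ₑ = ‖E z‖ₑ * 1 := (mul_one _).symm
            _ ≤ ‖E z‖ₑ * ‖E z‖ₑ := by gcongr
            _ = ‖E z‖ₑ ^ 2 := (sq _).symm
            _ ≤ _ := le_add_self
      refine (h1.trans_lt ?_).ne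
      rw [lintegral_add_left measurable_const, lintegral_one, Measure.restrict_apply_univ]
      refine ENNReal.add_lt_top.2 ⟨?_, ?_⟩
      · exact (measure_mono inter_subset_right).trans_lt hc.measure_lt_top
      · rw [inter_comm]; exact hL2 _ ht hc
    -- Where u = 0 the truncated differentials are all 0; where u ≠ 0 they equal `E` once (n+1)|u| >
    -- 2. This is why `E` appears cut down to {u ≠ 0}.
    have hlim : ∀ z, Tendsto (fun n => ‖A n z - V₀.indicator E z‖ₑ) atTop (𝓝 0) := by
      intro z
      refine tendsto_const_nhds.congr' ?_
      by_cases hz : z ∈ V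
      · by_cases hz0 : u z = 0
        · have hz2 : z ∉ V₀ := fun h => h.2 hz0
          refine Eventually.of_forall fun n => ?_
          simp only [A, indicator_of_mem hz, indicator_of_notMem hz2]
          rw [hz0, hFn0' n 0 (by rw [norm_zero]; exact inv_pos.2 (hpos n)),
            ContinuousLinearMap.zero_comp, sub_zero, enorm_zero_clm]
        · have hz2 : z ∈ V₀ := ⟨hz, hz0⟩
          have hn0 : 0 < ‖u z‖ := norm_pos_iff.2 hz0
          obtain ⟨N, hN⟩ := exists_nat_gt (2 / ‖u z‖)
          filter_upwards [eventually_ge_atTop N] with n hn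
          simp only [A, indicator_of_mem hz, indicator_of_mem hz2]
          rw [hFn', hFid]
          · rw [ContinuousLinearMap.id_comp, sub_self, enorm_zero_clm]
          · rw [norm_smul, Real.norm_of_nonneg (hpos n).le, ← div_lt_iff₀ hn0]
            have : (N : ℝ) ≤ n := by exact_mod_cast hn
            linarith
      · have hz2 : z ∉ V₀ := fun h => hz h.1
        refine Eventually.of_forall fun n => ?_
        simp only [A, indicator_of_notMem hz, indicator_of_notMem hz2, sub_self, enorm_zero_clm]
    have := tendsto_lintegral_of_dominated_convergence' (μ := volume.restrict (tsupport φ))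
      (F := fun n z => ‖A n z - V₀.indicator E z‖ₑ) (f := fun _ => 0)
      (fun z => ENNReal.ofReal (B + 1) * V.indicator (fun z => ‖E z‖ₑ) z)
      (fun n => ((hAm n).sub hEm).aestronglyMeasurable.enorm)
      (fun n => Eventually.of_forall (hb n)) hfin (Eventually.of_forall hlim)
    simpa using this

/-- The weak differential vanishes almost everywhere on the zero set. -/
theorem ae_eq_zero_of_eq_zero (h : HasWeakDiff g D Ω) : ∀ᵐ z, z ∈ Ω → g z = 0 → D z = 0 := by
  -- With V = Ω, the field `D` cut down to {g ≠ 0} is again a weak differential of `g`; uniqueness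
  -- then forces `D` to vanish on {g = 0}.
  have h2 := h.extend_by_zero h.isOpen h.cont (by simp) (fun C hC hCc => by
    rw [inter_eq_self_of_subset_left hC]
    exact eLpNorm_two_lt_top_iff.1 (h.memLp C hC hCc).2)
  filter_upwards [h.ae_eq h2] with z hz hzΩ hg
  rw [hz hzΩ, indicator_of_notMem]
  exact fun hh => hh.2 hg

/-- Gluing of Sobolev maps. -/
theorem glue {g₀ : ℂ → ℂ} {D₀ : ℂ → ℂ →L[ℝ] ℂ} {Ω₀ V : Set ℂ} (h₀ : HasWeakDiff g₀ D₀ Ω₀)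
    (h : HasWeakDiff g D V) (hgc : ContinuousOn g Ω₀) (heq : ∀ z ∈ Ω₀ \ V, g z = g₀ z)
    (hL2 : ∀ C ⊆ Ω₀, IsCompact C → ∫⁻ z in C ∩ V, ‖D z‖ₑ ^ 2 < ⊤) :
    ∃ D' : ℂ → ℂ →L[ℝ] ℂ, HasWeakDiff g D' (Ω₀ ∪ V) ∧
      ∀ z, D' z = 0 ∨ D' z = D₀ z ∨ D' z = D z := by
  classical
  have ho : IsOpen (V ∩ Ω₀) := h.isOpen.inter h₀.isOpen
  -- The difference g - g₀ vanishes on Ω₀ outside `V`, so it extends as a Sobolev function to all of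
  -- Ω₀; adding g₀ back shows that `g` is Sobolev across the boundary of `V`.
  have h1 := (h.mono ho inter_subset_left).sub (h₀.mono ho inter_subset_right)
  have h2 := h1.extend_by_zero h₀.isOpen (hgc.sub h₀.cont)
    (fun z hz => sub_eq_zero.2 (heq z ⟨hz.1, fun hV => hz.2 ⟨hV, hz.1⟩⟩)) ?_
  · have h3 : HasWeakDiff g (D₀ + {z | z ∈ V ∩ Ω₀ ∧ (g - g₀) z ≠ 0}.indicator (D - D₀)) Ω₀ :=
      (h₀.add h2).congr fun z _ => by simp
    obtain ⟨D', hD', hp⟩ := exists_iUnion (g := g) (Ω := fun n => if n = 0 then Ω₀ else V)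
      (D := fun n => if n = 0 then
        (D₀ + {z | z ∈ V ∩ Ω₀ ∧ (g - g₀) z ≠ 0}.indicator (D - D₀)) else D) (fun n => by
        by_cases hn : n = 0
        · simp only [hn, if_true]; exact h3
        · simp only [hn, if_false]; exact h)
    have hun : (⋃ n : ℕ, if n = 0 then Ω₀ else V) = Ω₀ ∪ V := by
      ext z
      simp only [mem_iUnion, mem_union]
      constructor
      · rintro ⟨n, hn⟩
        by_cases h0 : n = 0
        · left; simpa [h0] using hn
        · right; simpa [h0] using hn
      · rintro (hz | hz)
        · exact ⟨0, by simpa using hz⟩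
        · exact ⟨1, by simpa using hz⟩
    rw [hun] at hD'
    refine ⟨D', hD', fun z => ?_⟩
    rcases hp z with h0 | ⟨n, hzn, hn⟩
    · exact Or.inl h0
    · by_cases h0 : n = 0
      · simp only [h0, if_true, Pi.add_apply] at hn
        by_cases hz : z ∈ {z | z ∈ V ∩ Ω₀ ∧ (g - g₀) z ≠ 0}
        · rw [indicator_of_mem hz] at hn
          right; right
          rw [hn]; simp
        · rw [indicator_of_notMem hz, add_zero] at hn
          exact Or.inr (Or.inl hn)
      · simp only [h0, if_false] at hn
        exact Or.inr (Or.inr hn)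
  · intro C hC hCc
    have hd0 : ∫⁻ z in C, ‖D₀ z‖ₑ ^ 2 < ⊤ := eLpNorm_two_lt_top_iff.1 (h₀.memLp C hC hCc).2
    have hd := hL2 C hC hCc
    have hb : ∀ z, ‖(D - D₀) z‖ₑ ^ 2 ≤ 2 * ‖D z‖ₑ ^ 2 + 2 * ‖D₀ z‖ₑ ^ 2 := by
      intro z
      rw [← ofReal_norm, ← ofReal_norm, ← ofReal_norm, ← ENNReal.ofReal_pow (norm_nonneg _),
        ← ENNReal.ofReal_pow (norm_nonneg _), ← ENNReal.ofReal_pow (norm_nonneg _),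
        ← ENNReal.ofReal_ofNat 2, ← ENNReal.ofReal_mul (by norm_num),
        ← ENNReal.ofReal_mul (by norm_num), ← ENNReal.ofReal_add (by positivity) (by positivity)]
      refine ENNReal.ofReal_le_ofReal ?_
      have h5 : ‖(D - D₀) z‖ ≤ ‖D z‖ + ‖D₀ z‖ := norm_sub_le _ _
      nlinarith [norm_nonneg ((D - D₀) z), sq_nonneg (‖D z‖ - ‖D₀ z‖)]
    have hm : Measurable fun z => ‖D z‖ₑ ^ 2 := (h.meas.enorm).pow_const 2
    calc ∫⁻ z in C ∩ (V ∩ Ω₀), ‖(D - D₀) z‖ₑ ^ 2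
        ≤ ∫⁻ z in C ∩ V, ‖(D - D₀) z‖ₑ ^ 2 := lintegral_mono_set (by
          intro z hz; exact ⟨hz.1, hz.2.1⟩)
      _ ≤ ∫⁻ z in C ∩ V, (2 * ‖D z‖ₑ ^ 2 + 2 * ‖D₀ z‖ₑ ^ 2) := lintegral_mono fun z => hb z
      _ = 2 * (∫⁻ z in C ∩ V, ‖D z‖ₑ ^ 2) + 2 * ∫⁻ z in C ∩ V, ‖D₀ z‖ₑ ^ 2 := by
          rw [lintegral_add_left (hm.const_mul 2), lintegral_const_mul' _ _ ENNReal.ofNat_ne_top,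
            lintegral_const_mul' _ _ ENNReal.ofNat_ne_top]
      _ < ⊤ := by
          refine ENNReal.add_lt_top.2 ⟨ENNReal.mul_lt_top ENNReal.ofNat_lt_top hd,
            ENNReal.mul_lt_top ENNReal.ofNat_lt_top ?_⟩
          exact (lintegral_mono_set inter_subset_left).trans_lt hd0

end HasWeakDiff

end Lyubich

namespace Lyubich

/-! ### The length-area inequality -/

/-- The round annulus `{a < |z| < b}`. -/
def ann (a b : ℝ) : Set ℂ := {z | a < ‖z‖ ∧ ‖z‖ < b}

theorem isOpen_ann (a b : ℝ) : IsOpen (ann a b) :=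
  (isOpen_lt continuous_const continuous_norm).inter (isOpen_lt continuous_norm continuous_const)

theorem ann_mono {a b a' b' : ℝ} (ha : a' ≤ a) (hb : b ≤ b') : ann a b ⊆ ann a' b' :=
  fun _ hz => ⟨ha.trans_lt hz.1, hz.2.trans_le hb⟩

theorem isCompact_closed_ann (a b : ℝ) : IsCompact {z : ℂ | a ≤ ‖z‖ ∧ ‖z‖ ≤ b} := by
  have : {z : ℂ | a ≤ ‖z‖ ∧ ‖z‖ ≤ b} = Metric.closedBall 0 b ∩ {z | a ≤ ‖z‖} := by
    ext z; simp [and_comm]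
  rw [this]
  exact (isCompact_closedBall 0 b).inter_right (isClosed_le continuous_const continuous_norm)

/-- The length-area inequality for a smooth map. -/
theorem length_area_smooth {G φ : ℂ → ℂ} {a b s t d : ℝ} (hG : ContDiff ℝ ∞ G) (hs0 : 0 < s)
    (has : a < s) (hst : s < t) (htb : t < b) (hφ : DifferentiableOn ℂ φ (ann a b))
    (hinj : InjOn φ (ann a b))
    (hd : ∀ r, s < r → r < t → ∃ x y : ℂ, ‖x‖ = r ∧ ‖y‖ = r ∧ d ≤ dist (G (φ x)) (G (φ y))) :
    ENNReal.ofReal d ^ 2 * ENNReal.ofReal (Real.log t - Real.log s) ≤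
      ENNReal.ofReal (2 * Real.pi) *
        ∫⁻ w in φ '' {z : ℂ | s ≤ ‖z‖ ∧ ‖z‖ ≤ t}, ‖fderiv ℝ G w‖ₑ ^ 2 := by
  -- Logarithmic coordinates: circles become vertical segments of length 2π, and the annulus becomes
  -- a rectangle of width log t - log s on which Φ is injective.
  set Φ : ℂ → ℂ := fun w => φ (Complex.exp w) with hΦ
  set X : Set ℝ := Ioo (Real.log s) (Real.log t) with hX
  set Y : Set ℝ := Ioc (-Real.pi) Real.pi with hY
  have hnorm : ∀ w : ℂ, w.re ∈ X → s < ‖Complex.exp w‖ ∧ ‖Complex.exp w‖ < t := by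
    intro w hw
    rw [Complex.norm_exp]
    exact ⟨(Real.log_lt_iff_lt_exp hs0).1 hw.1, (Real.lt_log_iff_exp_lt (hs0.trans hst)).1 hw.2⟩
  have hmem : ∀ w : ℂ, w.re ∈ X → Complex.exp w ∈ ann a b := fun w hw =>
    ⟨has.trans (hnorm w hw).1, (hnorm w hw).2.trans htb⟩
  have hφd : ∀ z ∈ ann a b, DifferentiableAt ℂ φ z := fun z hz =>
    hφ.differentiableAt ((isOpen_ann a b).mem_nhds hz)
  have hΦd : ∀ w : ℂ, w.re ∈ X → DifferentiableAt ℂ Φ w := fun w hw =>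
    (hφd _ (hmem w hw)).comp w Complex.differentiableAt_exp
  set S' : Set ℂ := {w | w.re ∈ X} with hS'
  have hS'o : IsOpen S' := isOpen_Ioo.preimage Complex.continuous_re
  have hΦon : DifferentiableOn ℂ Φ S' := fun w hw => (hΦd w hw).differentiableWithinAt
  set S : Set ℂ := {w | w.re ∈ X ∧ w.im ∈ Y} with hS
  have hSm : MeasurableSet S :=
    (Complex.measurable_re measurableSet_Ioo).inter (Complex.measurable_im measurableSet_Ioc)
  have hΦinj : InjOn Φ S := by
    intro w hw w' hw' h
    have h1 := hinj (hmem w hw.1) (hmem w' hw'.1) h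
    exact Complex.exp_inj_of_neg_pi_lt_of_le_pi hw.2.1 hw.2.2 hw'.2.1 hw'.2.2 h1
  set L : ℂ → ℝ≥0∞ := fun w =>
    ‖(fderiv ℝ G (Φ w)).comp (ContinuousLinearMap.mul ℝ ℂ (deriv Φ w))‖ₑ ^ 2 with hL
  have hGc : Continuous (fderiv ℝ G) := hG.continuous_fderiv (by simp)
  have hTc : ContinuousOn (fun w => (fderiv ℝ G (Φ w)).comp
      (ContinuousLinearMap.mul ℝ ℂ (deriv Φ w))) S' := by
    refine (hGc.comp_continuousOn hΦon.continuousOn).clm_comp ?_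
    exact (ContinuousLinearMap.mul ℝ ℂ).continuous.comp_continuousOn
      (hΦon.deriv hS'o).continuousOn
  have hLc : ContinuousOn L S' := by
    have := (hTc.norm.pow 2)
    refine (ENNReal.continuous_ofReal.comp_continuousOn this).congr fun w _ => ?_
    simp only [hL, Function.comp, Pi.pow_apply]
    rw [ENNReal.ofReal_pow (norm_nonneg _), ofReal_norm]
  -- fibrewise estimate
  have hfib : ∀ x ∈ X, ENNReal.ofReal d ^ 2 ≤
      ENNReal.ofReal (2 * Real.pi) * ∫⁻ y in Y, L (⟨x, y⟩ : ℂ) := by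
    intro x hx
    set c : ℝ → ℂ := fun y => G (Φ (⟨x, y⟩ : ℂ)) with hc
    set c' : ℝ → ℂ := fun y => (fderiv ℝ G (Φ (⟨x, y⟩ : ℂ))).comp
      (ContinuousLinearMap.mul ℝ ℂ (deriv Φ (⟨x, y⟩ : ℂ))) Complex.I with hc'
    have hline : Continuous fun y : ℝ => (⟨x, y⟩ : ℂ) := by
      have : (fun y : ℝ => (⟨x, y⟩ : ℂ)) = fun y : ℝ => (x : ℂ) + y * Complex.I := by
        ext y; simp [Complex.ext_iff]
      rw [this]; fun_prop
    have hlineS : ∀ y, (⟨x, y⟩ : ℂ) ∈ S' := fun y => hx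
    have hder : ∀ y, HasDerivAt c (c' y) y := by
      intro y
      have h1 : HasFDerivAt (fun w => G (Φ w)) ((fderiv ℝ G (Φ (⟨x, y⟩ : ℂ))).comp
          (ContinuousLinearMap.mul ℝ ℂ (deriv Φ (⟨x, y⟩ : ℂ)))) (⟨x, y⟩ : ℂ) :=
        HasFDerivAt.comp _ (hG.differentiable (by simp) _).hasFDerivAt
          (hasFDerivAt_real_of_differentiableAt (hΦd _ hx))
      have h2 : HasDerivAt (fun y : ℝ => (⟨x, y⟩ : ℂ)) Complex.I y := by
        have : (fun y : ℝ => (⟨x, y⟩ : ℂ)) = fun y : ℝ => (x : ℂ) + y * Complex.I := by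
          ext y; simp [Complex.ext_iff]
        rw [this]
        simpa using ((Complex.ofRealCLM.hasDerivAt (x := y)).mul_const Complex.I).const_add (x : ℂ)
      exact h1.comp_hasDerivAt y h2
    have hTline : Continuous fun y : ℝ => (fderiv ℝ G (Φ (⟨x, y⟩ : ℂ))).comp
        (ContinuousLinearMap.mul ℝ ℂ (deriv Φ (⟨x, y⟩ : ℂ))) :=
      hTc.comp_continuous hline hlineS
    have hc'c : Continuous c' := hTline.clm_apply continuous_const
    have hr : ‖Complex.exp (⟨x, 0⟩ : ℂ)‖ = Real.exp x := by rw [Complex.norm_exp]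
    obtain ⟨p, q, hp, hq, hpq⟩ := hd (Real.exp x)
      (by rw [← hr]; exact (hnorm _ hx).1) (by rw [← hr]; exact (hnorm _ hx).2)
    have hpol : ∀ z : ℂ, ‖z‖ = Real.exp x → z = Complex.exp (⟨x, z.arg⟩ : ℂ) := by
      intro z hz
      have h1 : (⟨x, z.arg⟩ : ℂ) = (x : ℂ) + z.arg * Complex.I := by simp [Complex.ext_iff]
      rw [h1, Complex.exp_add, ← Complex.ofReal_exp, ← hz, Complex.norm_mul_exp_arg_mul_I]
    have hpc : G (φ p) = c p.arg := by
      simp only [hc, hΦ]; rw [← hpol p hp]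
    have hqc : G (φ q) = c q.arg := by
      simp only [hc, hΦ]; rw [← hpol q hq]
    -- The two points bound an arc of the circle, and the image of the arc is at least as long as
    -- the distance of its endpoints.
    have hlen : ENNReal.ofReal d ≤ ∫⁻ y in Y, ‖c' y‖ₑ := by
      have h1 : c p.arg - c q.arg = ∫ y in q.arg..p.arg, c' y :=
        (intervalIntegral.integral_eq_sub_of_hasDerivAt (fun y _ => hder y)
          (hc'c.intervalIntegrable _ _)).symm
      calc ENNReal.ofReal d ≤ ENNReal.ofReal ‖c p.arg - c q.arg‖ := by
            refine ENNReal.ofReal_le_ofReal ?_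
            rw [← dist_eq_norm, ← hpc, ← hqc]; exact hpq
        _ = ENNReal.ofReal ‖∫ y in Set.uIoc q.arg p.arg, c' y‖ := by
            rw [h1, intervalIntegral.norm_intervalIntegral_eq]
        _ ≤ ∫⁻ y in Set.uIoc q.arg p.arg, ‖c' y‖ₑ := by
            rw [ofReal_norm]; exact enorm_integral_le_lintegral_enorm _
        _ ≤ ∫⁻ y in Y, ‖c' y‖ₑ := by
            refine lintegral_mono_set ?_
            intro y hy
            rw [Set.uIoc, mem_Ioc] at hy
            refine ⟨lt_of_le_of_lt ?_ hy.1, hy.2.trans ?_⟩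
            · exact le_min (Complex.neg_pi_lt_arg q).le (Complex.neg_pi_lt_arg p).le
            · exact max_le (Complex.arg_le_pi q) (Complex.arg_le_pi p)
    -- Cauchy-Schwarz on a fibre of length 2π turns squared length into energy.
    have hcs := lintegral_mul_sq_le (μ := volume.restrict Y) (u := fun _ => 1)
      (v := fun y => ‖c' y‖ₑ) aemeasurable_const hc'c.measurable.enorm.aemeasurable
    simp only [one_mul, one_pow, lintegral_one, Measure.restrict_apply_univ] at hcs
    have hvol : volume Y = ENNReal.ofReal (2 * Real.pi) := by
      rw [hY, Real.volume_Ioc]; congr 1; ring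
    rw [hvol] at hcs
    calc ENNReal.ofReal d ^ 2 ≤ (∫⁻ y in Y, ‖c' y‖ₑ) ^ 2 := by gcongr
      _ ≤ _ := hcs
      _ ≤ _ := by
        gcongr with y
        simp only [hL]
        rw [← ofReal_norm, ← ofReal_norm]
        gcongr
        refine (ContinuousLinearMap.le_opNorm _ _).trans ?_
        rw [Complex.norm_I, mul_one]
  -- integrate over the base
  have hprod : ∫⁻ w in S, L w = ∫⁻ x in X, ∫⁻ y in Y, L (⟨x, y⟩ : ℂ) := by
    have h1 := (Complex.volume_preserving_equiv_real_prod.symm).setLIntegral_comp_preimage_emb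
      Complex.measurableEquivRealProd.symm.measurableEmbedding L S
    have hpre : Complex.measurableEquivRealProd.symm ⁻¹' S = X ×ˢ Y := by
      ext p; rfl
    rw [← h1, hpre, Measure.volume_eq_prod, setLIntegral_prod]
    · rfl
    · have hcs : Continuous fun p : ℝ × ℝ => (⟨p.1, p.2⟩ : ℂ) :=
        Complex.equivRealProdCLM.symm.continuous
      have hco : ContinuousOn (fun p : ℝ × ℝ => L (Complex.measurableEquivRealProd.symm p))
          (X ×ˢ Y) := hLc.comp hcs.continuousOn fun p hp => hp.1
      exact hco.aemeasurable (measurableSet_Ioo.prod measurableSet_Ioc)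
  have hvolX : volume X = ENNReal.ofReal (Real.log t - Real.log s) := Real.volume_Ioo
  calc ENNReal.ofReal d ^ 2 * ENNReal.ofReal (Real.log t - Real.log s)
      = ∫⁻ _ in X, ENNReal.ofReal d ^ 2 := by
        rw [lintegral_const, Measure.restrict_apply_univ, hvolX]
    _ ≤ ∫⁻ x in X, ENNReal.ofReal (2 * Real.pi) * ∫⁻ y in Y, L (⟨x, y⟩ : ℂ) :=
        setLIntegral_mono' measurableSet_Ioo hfib
    _ = ENNReal.ofReal (2 * Real.pi) * ∫⁻ w in S, L w := by
        rw [lintegral_const_mul' _ _ ENNReal.ofReal_ne_top, hprod]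
    _ = ENNReal.ofReal (2 * Real.pi) * ∫⁻ w in Φ '' S, ‖fderiv ℝ G w‖ₑ ^ 2 := by
        rw [← lintegral_sq_comp_holomorphic hSm (fun w hw => hΦd w hw.1) hΦinj]
    _ ≤ _ := by
        gcongr
        rintro _ ⟨w, hw, rfl⟩
        exact ⟨Complex.exp w, ⟨(hnorm w hw.1).1.le, (hnorm w hw.1).2.le⟩, rfl⟩

/-- The length-area inequality: if all the circles of the annulus `φ(ann a b)` have images of
diameter at least `d` under the Sobolev map `g`, then `d² log (b/a)` is bounded by the Dirichlet
integral of `g` over the annulus. -/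
theorem length_area {g : ℂ → ℂ} {D : ℂ → ℂ →L[ℝ] ℂ} {Ω : Set ℂ} (h : HasWeakDiff g D Ω)
    {φ : ℂ → ℂ} {a b d : ℝ} (ha : 0 < a) (hab : a < b) (hφ : DifferentiableOn ℂ φ (ann a b))
    (hinj : InjOn φ (ann a b)) (hmaps : φ '' ann a b ⊆ Ω)
    (hd : ∀ r, a < r → r < b → ∃ x y : ℂ, ‖x‖ = r ∧ ‖y‖ = r ∧ d ≤ dist (g (φ x)) (g (φ y))) :
    ENNReal.ofReal d ^ 2 * ENNReal.ofReal (Real.log b - Real.log a) ≤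
      ENNReal.ofReal (2 * Real.pi) * ∫⁻ w in φ '' ann a b, ‖D w‖ₑ ^ 2 := by
  -- compactly contained subannuli
  have hsub : ∀ s t, a < s → s < t → t < b →
      ENNReal.ofReal d ^ 2 * ENNReal.ofReal (Real.log t - Real.log s) ≤
      ENNReal.ofReal (2 * Real.pi) * ∫⁻ w in φ '' ann a b, ‖D w‖ₑ ^ 2 := by
    intro s t has hst htb
    set C := φ '' {z : ℂ | s ≤ ‖z‖ ∧ ‖z‖ ≤ t} with hC
    have hCs : {z : ℂ | s ≤ ‖z‖ ∧ ‖z‖ ≤ t} ⊆ ann a b := fun z hz =>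
      ⟨has.trans_le hz.1, hz.2.trans_lt htb⟩
    have hCc : IsCompact C :=
      (isCompact_closed_ann s t).image_of_continuousOn (hφ.continuousOn.mono hCs)
    have hCA : C ⊆ φ '' ann a b := image_mono hCs
    obtain ⟨G, hGs, hGu, hGL⟩ := h.exists_smooth_approx hCc (hCA.trans hmaps)
    have hGc : ∀ n, Continuous (fderiv ℝ (G n)) := fun n => (hGs n).continuous_fderiv (by simp)
    have hDn : eLpNorm D 2 (volume.restrict C) ≠ ⊤ := (h.memLp C (hCA.trans hmaps) hCc).2.ne
    have hupper : Tendsto (fun n => ENNReal.ofReal (2 * Real.pi) *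
        (eLpNorm (fun z => fderiv ℝ (G n) z - D z) 2 (volume.restrict C)
          + eLpNorm D 2 (volume.restrict C)) ^ 2) atTop
        (𝓝 (ENNReal.ofReal (2 * Real.pi) * (0 + eLpNorm D 2 (volume.restrict C)) ^ 2)) := by
      refine ENNReal.Tendsto.const_mul (ENNReal.Tendsto.pow (hGL.add_const _))
        (Or.inr ENNReal.ofReal_ne_top)
    have hG2 : ∀ n, ∫⁻ w in C, ‖fderiv ℝ (G n) w‖ₑ ^ 2 ≤
        (eLpNorm (fun z => fderiv ℝ (G n) z - D z) 2 (volume.restrict C)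
          + eLpNorm D 2 (volume.restrict C)) ^ 2 := by
      intro n
      rw [← eLpNorm_two_sq]
      gcongr
      have e : fderiv ℝ (G n) = (fun z => fderiv ℝ (G n) z - D z) + D := by
        ext z; simp
      conv_lhs => rw [e]
      exact eLpNorm_add_le ((hGc n).aestronglyMeasurable.sub h.meas.aestronglyMeasurable)
        h.meas.aestronglyMeasurable (by norm_num)
    -- Uniform approximation moves each of the two image points by less than η; the loss 2η
    -- disappears as η → 0.
    have hη : ∀ η : ℝ, 0 < η → ENNReal.ofReal (d - 2 * η) ^ 2 *
        ENNReal.ofReal (Real.log t - Real.log s) ≤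
        ENNReal.ofReal (2 * Real.pi) * ∫⁻ w in φ '' ann a b, ‖D w‖ₑ ^ 2 := by
      intro η hη
      have hfin : ENNReal.ofReal (2 * Real.pi) * (0 + eLpNorm D 2 (volume.restrict C)) ^ 2 ≤
          ENNReal.ofReal (2 * Real.pi) * ∫⁻ w in φ '' ann a b, ‖D w‖ₑ ^ 2 := by
        rw [zero_add, eLpNorm_two_sq]
        gcongr
      refine le_trans (ge_of_tendsto hupper ?_) hfin
      filter_upwards [Metric.tendstoUniformlyOn_iff.1 hGu η hη] with n hn
      refine le_trans (length_area_smooth (hGs n) (ha.trans has) has hst htb hφ hinj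
        (fun r hr1 hr2 => ?_)) (by gcongr; exact hG2 n)
      obtain ⟨x, y, hx, hy, hxy⟩ := hd r (has.trans hr1) (hr2.trans htb)
      refine ⟨x, y, hx, hy, ?_⟩
      have hx' := hn (φ x) ⟨x, ⟨by rw [hx]; exact hr1.le, by rw [hx]; exact hr2.le⟩, rfl⟩
      have hy' := hn (φ y) ⟨y, ⟨by rw [hy]; exact hr1.le, by rw [hy]; exact hr2.le⟩, rfl⟩
      have t1 := dist_triangle4 (g (φ x)) (G n (φ x)) (G n (φ y)) (g (φ y))
      rw [dist_comm (G n (φ y)) (g (φ y))] at t1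
      linarith
    have hlim : Tendsto (fun η : ℝ => ENNReal.ofReal (d - 2 * η) ^ 2 *
        ENNReal.ofReal (Real.log t - Real.log s)) (𝓝[>] 0)
        (𝓝 (ENNReal.ofReal (d - 2 * 0) ^ 2 * ENNReal.ofReal (Real.log t - Real.log s))) := by
      refine ENNReal.Tendsto.mul_const (ENNReal.Tendsto.pow ?_) (Or.inr ENNReal.ofReal_ne_top)
      refine (ENNReal.continuous_ofReal.tendsto _).comp ?_
      have : Continuous fun η : ℝ => d - 2 * η := by fun_prop
      exact (this.tendsto 0).mono_left nhdsWithin_le_nhds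
    rw [mul_zero, sub_zero] at hlim
    exact le_of_tendsto hlim (eventually_mem_nhdsWithin.mono fun η hη' => hη η hη')
  -- exhaustion
  have hc : ContinuousAt (fun ε : ℝ => Real.log (b - ε) - Real.log (a + ε)) 0 := by
    refine ContinuousAt.sub ?_ ?_
    · exact ContinuousAt.log (by fun_prop) (by simpa using (ha.trans hab).ne')
    · exact ContinuousAt.log (by fun_prop) (by simpa using ha.ne')
  have hlim : Tendsto (fun ε : ℝ => ENNReal.ofReal d ^ 2 *
      ENNReal.ofReal (Real.log (b - ε) - Real.log (a + ε))) (𝓝[>] 0)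
      (𝓝 (ENNReal.ofReal d ^ 2 * ENNReal.ofReal (Real.log b - Real.log a))) := by
    refine ENNReal.Tendsto.const_mul ?_ (Or.inr (by simp))
    have := (ENNReal.continuous_ofReal.tendsto _).comp (hc.tendsto.mono_left
      (nhdsWithin_le_nhds (s := Ioi 0)))
    simpa [Function.comp_def] using this
  refine le_of_tendsto hlim ?_
  have hpos : 0 < (b - a) / 2 := by linarith
  filter_upwards [Ioo_mem_nhdsGT hpos] with ε hε
  exact hsub _ _ (by linarith [hε.1]) (by linarith [hε.2]) (by linarith [hε.1])

end Lyubich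

namespace Lyubich

/-! ### Quasiconformal maps: normal form and locality -/

variable {g : ℂ → ℂ} {D : ℂ → ℂ →L[ℝ] ℂ} {Ω : Set ℂ} {K : ℝ}

theorem continuous_clm_det : Continuous fun A : ℂ →L[ℝ] ℂ => A.det :=
  ContinuousLinearMap.continuous_det

theorem det_zero_clm : (0 : ℂ →L[ℝ] ℂ).det = 0 := by
  rw [ContinuousLinearMap.det, ContinuousLinearMap.toLinearMap_zero, LinearMap.det_zero]
  simp

/-- Only null sets are changed. Measurability on Ω comes from a σ-compact exhaustion, and the field
is replaced by 0 wherever the distortion inequality fails, so that it holds at every point and can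
be carried through the gluing constructions. -/
theorem IsQC.exists_hasWeakDiff (h : IsQC K g Ω) :
    ∃ D, HasWeakDiff g D Ω ∧ ∀ z, ‖D z‖ ^ 2 ≤ K * (D z).det := by
  obtain ⟨hK, hΩ, hc, hinj, D, hL2, hw, hd⟩ := h
  obtain ⟨C, hC, hCΩ⟩ : IsSigmaCompact Ω := by
    have := hΩ.isLocallyClosed.locallyCompactSpace
    exact isSigmaCompact_iff_sigmaCompactSpace.2 inferInstance
  have hm : AEStronglyMeasurable D (volume.restrict Ω) := by
    rw [← hCΩ, aestronglyMeasurable_iUnion_iff]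
    exact fun n => (hL2 _ (hCΩ ▸ subset_iUnion C n) (hC n)).1
  set D₁ := hm.mk D with hD₁
  have hD₁m : StronglyMeasurable D₁ := hm.stronglyMeasurable_mk
  have hS : MeasurableSet {z | ‖D₁ z‖ ^ 2 ≤ K * (D₁ z).det} :=
    measurableSet_le (by fun_prop) ((continuous_clm_det.measurable.comp hD₁m.measurable).const_mul K)
  set D₂ := {z | ‖D₁ z‖ ^ 2 ≤ K * (D₁ z).det}.indicator D₁ with hD₂
  have hD₂m : StronglyMeasurable D₂ := hD₁m.indicator hS
  have hae : ∀ᵐ z, z ∈ Ω → D₂ z = D z := by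
    rw [← ae_restrict_iff' hΩ.measurableSet]
    filter_upwards [hm.ae_eq_mk, hd] with z h1 h2
    rw [hD₂, indicator_of_mem, hD₁, ← h1]
    rw [mem_ofPred_eq, hD₁, ← h1]; exact h2
  refine ⟨D₂, ⟨hΩ, hc, hD₂m, fun C hC hCc => ?_, fun φ hφ hcs ht v => ?_⟩, fun z => ?_⟩
  · refine (hL2 C hC hCc).ae_eq ?_
    rw [EventuallyEq, ae_restrict_iff' hCc.isClosed.measurableSet]
    filter_upwards [hae] with z hz hzC using (hz (hC hzC)).symm
  · rw [hw φ hφ hcs ht v]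
    congr 1
    refine integral_congr_ae ?_
    filter_upwards [hae] with z hz
    by_cases hzt : z ∈ tsupport φ
    · rw [hz (ht hzt)]
    · rw [image_eq_zero_of_notMem_tsupport hzt]; simp
  · by_cases hz : ‖D₁ z‖ ^ 2 ≤ K * (D₁ z).det
    · rw [hD₂, indicator_of_mem (by exact hz)]; exact hz
    · rw [hD₂, indicator_of_notMem (by exact hz)]
      rw [det_zero_clm, norm_zero]; simp

theorem HasWeakDiff.isQC (h : HasWeakDiff g D Ω) (hK : 1 ≤ K) (hinj : InjOn g Ω)
    (hD : ∀ z ∈ Ω, ‖D z‖ ^ 2 ≤ K * (D z).det) : IsQC K g Ω :=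
  ⟨hK, h.isOpen, h.cont, hinj, D, h.memLp, h.weak,
    (ae_restrict_mem h.isOpen.measurableSet).mono hD⟩

theorem det_nonneg_of_norm_sq_le {A : ℂ →L[ℝ] ℂ} (hK : 1 ≤ K) (h : ‖A‖ ^ 2 ≤ K * A.det) :
    0 ≤ A.det := by
  by_contra hneg
  have : K * A.det < 0 := mul_neg_of_pos_of_neg (by linarith) (not_le.1 hneg)
  nlinarith [sq_nonneg ‖A‖]

namespace IsQC

theorem mono_const (h : IsQC K g Ω) {K' : ℝ} (hK : K ≤ K') : IsQC K' g Ω := by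
  obtain ⟨D, hD, hdet⟩ := h.exists_hasWeakDiff
  refine hD.isQC (h.1.trans hK) h.2.2.2.1 fun z _ => (hdet z).trans ?_
  exact mul_le_mul_of_nonneg_right hK (det_nonneg_of_norm_sq_le h.1 (hdet z))

theorem mono (h : IsQC K g Ω) {Ω' : Set ℂ} (hΩ' : IsOpen Ω') (hsub : Ω' ⊆ Ω) : IsQC K g Ω' := by
  obtain ⟨D, hD, hdet⟩ := h.exists_hasWeakDiff
  exact (hD.mono hΩ' hsub).isQC h.1 (h.2.2.2.1.mono hsub) fun z _ => hdet z

theorem congr (h : IsQC K g Ω) {g' : ℂ → ℂ} (hg : EqOn g' g Ω) : IsQC K g' Ω := by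
  obtain ⟨D, hD, hdet⟩ := h.exists_hasWeakDiff
  exact (hD.congr hg).isQC h.1 (fun x hx y hy hxy => h.2.2.2.1 hx hy (by
    rw [← hg hx, ← hg hy, hxy])) fun z _ => hdet z

/-- Quasiconformality of an injective map is a local property. -/
theorem of_local (hK : 1 ≤ K) (hΩ : IsOpen Ω) (hinj : InjOn g Ω)
    (h : ∀ z ∈ Ω, ∃ V, z ∈ V ∧ V ⊆ Ω ∧ IsQC K g V) : IsQC K g Ω := by
  -- A countable cover is enumerated by ℕ below, which requires it to be nonempty.
  rcases Ω.eq_empty_or_nonempty with rfl | hne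
  · refine (HasWeakDiff.mk isOpen_empty (continuousOn_empty _) stronglyMeasurable_zero (D := 0)
      (fun C hC _ => ?_) fun φ _ _ ht v => ?_).isQC hK hinj fun z hz => absurd hz (notMem_empty z)
    · rw [subset_empty_iff.1 hC]; simp
    · have : φ = 0 := by
        ext z
        exact image_eq_zero_of_notMem_tsupport fun hz => ht hz
      simp [this]
  choose! V hzV hVΩ hV using h
  obtain ⟨s, hs, hsc, hsU⟩ := TopologicalSpace.countable_cover_nhdsWithin
    (s := Ω) (f := V) fun z hz => mem_nhdsWithin_of_mem_nhds ((hV z hz).2.1.mem_nhds (hzV z hz))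
  have hsne : s.Nonempty := by
    rcases s.eq_empty_or_nonempty with rfl | h
    · obtain ⟨z, hz⟩ := hne
      simpa using hsU hz
    · exact h
  obtain ⟨e, he⟩ := hsc.exists_eq_range hsne
  have hes : ∀ n, e n ∈ Ω := fun n => hs (he ▸ mem_range_self n)
  choose D hD hdet using fun n => (hV (e n) (hes n)).exists_hasWeakDiff
  obtain ⟨D', hD', hp⟩ := HasWeakDiff.exists_iUnion hD
  have hU : (⋃ n, V (e n)) = Ω := by
    refine Subset.antisymm (iUnion_subset fun n => hVΩ _ (hes n)) fun z hz => ?_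
    obtain ⟨y, hy, hzy⟩ := mem_iUnion₂.1 (hsU hz)
    rw [he] at hy
    obtain ⟨n, rfl⟩ := hy
    exact mem_iUnion.2 ⟨n, hzy⟩
  rw [hU] at hD'
  refine hD'.isQC hK hinj fun z _ => ?_
  rcases hp z with h0 | ⟨n, -, hn⟩
  · rw [h0, det_zero_clm]; simp
  · rw [hn]; exact hdet n z

end IsQC

/-- A finite dilatation is almost attained. -/
theorem IsQC.of_dil_lt {c : ℝ} (hc : 1 ≤ c) (h : Dil g Ω < ENNReal.ofReal c) : IsQC c g Ω := by
  simp only [Dil, iInf_lt_iff] at h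
  obtain ⟨K, hK, hlt⟩ := h
  exact hK.mono_const ((ENNReal.ofReal_lt_ofReal_iff (by linarith)).1 hlt).le

theorem IsQC.dil_le (h : IsQC K g Ω) : Dil g Ω ≤ ENNReal.ofReal K :=
  iInf₂_le K h

end Lyubich

namespace Lyubich

/-! ### The area inequality -/

variable {D : ℂ → ℂ →L[ℝ] ℂ} {Ω : Set ℂ} {K : ℝ}

/-- Otherwise the interiors of `s` and of its complement would disconnect `t`. This is the form in
which connected sets are made to cross curves in what follows. -/
theorem inter_frontier_nonempty {X : Type*} [TopologicalSpace X] {t s : Set X}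
    (ht : IsPreconnected t) (h1 : (t ∩ s).Nonempty) (h2 : (t ∩ sᶜ).Nonempty) :
    (t ∩ frontier s).Nonempty := by
  by_contra hne
  have hcov : t ⊆ interior s ∪ interior sᶜ := by
    intro x hx
    by_contra hx'
    rw [mem_union, not_or, interior_compl, notMem_compl_iff] at hx'
    exact hne ⟨x, hx, hx'.2, hx'.1⟩
  obtain ⟨x, hxt, hxs⟩ := h1
  obtain ⟨y, hyt, hys⟩ := h2
  obtain ⟨z, -, hz1, hz2⟩ := ht _ _ isOpen_interior isOpen_interior hcov
    ⟨x, hxt, (hcov hxt).resolve_right fun h => interior_subset h hxs⟩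
    ⟨y, hyt, (hcov hyt).resolve_left fun h => hys (interior_subset h)⟩
  exact interior_subset hz2 (interior_subset hz1)

/-- The farthest points of a bounded set lie on its frontier. -/
theorem exists_mem_frontier_dist_ge {O : Set ℂ} (hO : Bornology.IsBounded O) {q : ℂ} (hq : q ∈ O)
    (p : ℂ) : ∃ x ∈ frontier O, dist p q ≤ dist p x := by
  -- The ray from `q` pointing away from `p` leaves the bounded set `O` through its frontier, and
  -- the distance to `p` grows along it. If q = p, any direction will do.
  obtain ⟨v, hv0, c, hc0, hqp⟩ : ∃ v : ℂ, v ≠ 0 ∧ ∃ c : ℝ, 0 ≤ c ∧ q - p = c • v := by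
    by_cases h : q = p
    · exact ⟨1, one_ne_zero, 0, le_rfl, by simp [h]⟩
    · exact ⟨q - p, sub_ne_zero.2 h, 1, zero_le_one, by simp⟩
  have hconn : IsPreconnected ((fun t : ℝ => q + t • v) '' Ici 0) :=
    isPreconnected_Ici.image _ (by fun_prop)
  have h1 : ((fun t : ℝ => q + t • v) '' Ici 0 ∩ O).Nonempty :=
    ⟨q, ⟨0, by simp, by simp⟩, hq⟩
  have h2 : ((fun t : ℝ => q + t • v) '' Ici 0 ∩ Oᶜ).Nonempty := by
    obtain ⟨R, hR⟩ := hO.subset_closedBall q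
    refine ⟨q + ((|R| + 1) / ‖v‖) • v, ⟨(|R| + 1) / ‖v‖, ?_, rfl⟩, fun hmem => ?_⟩
    · exact div_nonneg (by positivity) (norm_nonneg _)
    · have := hR hmem
      rw [Metric.mem_closedBall, dist_eq_norm, add_sub_cancel_left, norm_smul, Real.norm_eq_abs,
        abs_of_nonneg (by positivity), div_mul_cancel₀ _ (norm_ne_zero_iff.2 hv0)] at this
      linarith [le_abs_self R]
  obtain ⟨x, ⟨t, ht, rfl⟩, hx⟩ := inter_frontier_nonempty hconn h1 h2
  refine ⟨_, hx, ?_⟩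
  have e1 : dist p q = c * ‖v‖ := by
    rw [dist_comm, dist_eq_norm, hqp, norm_smul, Real.norm_eq_abs, abs_of_nonneg hc0]
  have e2 : dist p (q + t • v) = (c + t) * ‖v‖ := by
    rw [dist_comm, dist_eq_norm, add_sub_right_comm, hqp, ← add_smul, norm_smul, Real.norm_eq_abs,
      abs_of_nonneg (add_nonneg hc0 ht)]
  simp only [e1, e2]
  have : (0 : ℝ) ≤ t := ht
  gcongr
  linarith

theorem exists_frontier_dist_ge {O : Set ℂ} (hO : Bornology.IsBounded O) {p q : ℂ} (hp : p ∈ O)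
    (hq : q ∈ O) : ∃ x ∈ frontier O, ∃ y ∈ frontier O, dist p q ≤ dist x y := by
  obtain ⟨x, hx, h1⟩ := exists_mem_frontier_dist_ge hO hq p
  obtain ⟨y, hy, h2⟩ := exists_mem_frontier_dist_ge hO hp x
  exact ⟨x, hx, y, hy, h1.trans ((dist_comm p x).le.trans h2)⟩

/-- A bounded set has an image of the same diameter as its frontier under a homeomorphism of the
plane. -/
theorem exists_frontier_dist_image_ge (g : ℂ ≃ₜ ℂ) {O : Set ℂ} (hO : Bornology.IsBounded O)
    {p q : ℂ} (hp : p ∈ O) (hq : q ∈ O) :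
    ∃ x ∈ frontier O, ∃ y ∈ frontier O, dist (g p) (g q) ≤ dist (g x) (g y) := by
  have hb : Bornology.IsBounded (g '' O) :=
    (hO.isCompact_closure.image g.continuous).isBounded.subset (image_mono subset_closure)
  obtain ⟨x, hx, y, hy, h⟩ := exists_frontier_dist_ge hb (mem_image_of_mem g hp)
    (mem_image_of_mem g hq)
  rw [← g.image_frontier] at hx hy
  obtain ⟨x', hx', rfl⟩ := hx
  obtain ⟨y', hy', rfl⟩ := hy
  exact ⟨x', hx', y', hy', h⟩

/-- Sobolev homeomorphisms have oscillation bounded by the Dirichlet integral over the double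
disk. -/
theorem HasWeakDiff.dist_sq_le {g : ℂ ≃ₜ ℂ} (h : HasWeakDiff g D Ω) {x y : ℂ} {r : ℝ} (hr : 0 < r)
    (hΩ : Metric.ball x (2 * r) ⊆ Ω) (hy : dist y x ≤ r) :
    ENNReal.ofReal (dist (g y) (g x)) ^ 2 * ENNReal.ofReal (Real.log 2) ≤
      ENNReal.ofReal (2 * Real.pi) * ∫⁻ w in Metric.ball x (2 * r), ‖D w‖ₑ ^ 2 := by
  have himg : (fun z => x + z) '' ann r (2 * r) ⊆ Metric.ball x (2 * r) := by
    rintro _ ⟨z, hz, rfl⟩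
    simpa [dist_eq_norm] using hz.2
  -- Each circle with radius in (r, 2r) surrounds both `x` and `y`, so its image has diameter at
  -- least the distance of their images.
  have key := length_area h (φ := fun z => x + z) (a := r) (b := 2 * r) (d := dist (g y) (g x)) hr
    (by linarith) (by fun_prop) (fun a _ b _ hab => add_left_cancel hab) (himg.trans hΩ)
    (fun s hs _ => by
      have hs0 : 0 < s := hr.trans hs
      obtain ⟨a, ha, b, hb, hab⟩ := exists_frontier_dist_image_ge g
        (Metric.isBounded_ball (x := x) (r := s)) (p := y) (q := x)
        (Metric.mem_ball.2 (hy.trans_lt hs)) (Metric.mem_ball_self hs0)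
      rw [frontier_ball x hs0.ne'] at ha hb
      refine ⟨a - x, b - x, by simpa [dist_eq_norm] using ha, by simpa [dist_eq_norm] using hb, ?_⟩
      simpa using hab)
  have hlog : Real.log (2 * r) - Real.log r = Real.log 2 := by
    rw [Real.log_mul two_ne_zero hr.ne']; ring
  rw [hlog] at key
  exact key.trans (by gcongr)

/-- Lipschitz maps are Sobolev maps. -/
theorem HasWeakDiff.of_lipschitzWith {G : ℂ → ℂ} {C : NNReal} (hG : LipschitzWith C G) :
    HasWeakDiff G (fderiv ℝ G) univ := by
  have hm : StronglyMeasurable (fderiv ℝ G) := (measurable_fderiv ℝ G).stronglyMeasurable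
  have hb : ∀ z, ‖fderiv ℝ G z‖ ≤ C := fun z => norm_fderiv_le_of_lipschitz ℝ hG
  have hL : ∀ C' : Set ℂ, IsCompact C' → MemLp (fderiv ℝ G) 2 (volume.restrict C') := by
    intro C' hC'
    have : IsFiniteMeasure (volume.restrict C') := ⟨by simpa using hC'.measure_lt_top⟩
    exact MemLp.of_bound hm.aestronglyMeasurable C (Eventually.of_forall hb)
  refine ⟨isOpen_univ, hG.continuous.continuousOn, hm, fun C' _ hC' => hL C' hC',
    fun φ hφ hc _ v => ?_⟩
  have hint1 : Integrable fun z => (fderiv ℝ φ z v) • G z := by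
    refine Continuous.integrable_of_hasCompactSupport ?_ ?_
    · exact ((hφ.continuous_fderiv (by simp)).clm_apply continuous_const).smul hG.continuous
    · exact (hc.fderiv_apply (𝕜 := ℝ) v).smul_right
  have hint2 : Integrable fun z => φ z • fderiv ℝ G z v := by
    have : IsFiniteMeasure (volume.restrict (tsupport φ)) := ⟨by simpa using hc.measure_lt_top⟩
    have h1 : IntegrableOn (fun z => φ z • fderiv ℝ G z v) (tsupport φ) := by
      refine IntegrableOn.continuousOn_smul ?_ hφ.continuous.continuousOn hc
      exact (ContinuousLinearMap.apply ℝ ℂ v).integrable_comp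
        ((hL _ hc).integrable (by norm_num))
    exact h1.integrable_of_forall_notMem_eq_zero fun z hz => by
      rw [image_eq_zero_of_notMem_tsupport hz, zero_smul]
  obtain ⟨B, hφL⟩ := hφ.lipschitzWith_of_hasCompactSupport hc (by simp)
  -- Integration by parts is applied to the real Lipschitz functions L ∘ G, which are differentiable
  -- almost everywhere; the real and imaginary parts then determine the integral.
  have key : ∀ L : ℂ →L[ℝ] ℝ, L (∫ z, (fderiv ℝ φ z v) • G z) = L (- ∫ z, φ z • fderiv ℝ G z v) := by
    intro L
    rw [map_neg, ← L.integral_comp_comm hint1, ← L.integral_comp_comm hint2]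
    have hLG : LipschitzWith (‖L‖₊ * C) fun z => L (G z) := L.lipschitz.comp hG
    have e := hLG.integral_lineDeriv_mul_eq (μ := volume) hφL hc v
    have e1 : ∫ z, lineDeriv ℝ (fun z => L (G z)) z v * φ z = ∫ z, L (φ z • fderiv ℝ G z v) := by
      refine integral_congr_ae ?_
      filter_upwards [hG.ae_differentiableAt (μ := volume)] with z hz
      have : HasFDerivAt (fun z => L (G z)) (L.comp (fderiv ℝ G z)) z :=
        L.hasFDerivAt.comp z hz.hasFDerivAt
      rw [this.hasLineDerivAt v |>.lineDeriv, map_smul, smul_eq_mul, mul_comm]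
      rfl
    have e2 : ∫ z, lineDeriv ℝ φ z (-v) * L (G z) = - ∫ z, L ((fderiv ℝ φ z v) • G z) := by
      rw [← integral_neg]
      congr 1; ext z
      rw [((hφ.differentiable (by simp)) z).lineDeriv_eq_fderiv, map_neg, map_smul, smul_eq_mul,
        neg_mul]
    rw [← e1, e, e2, neg_neg]
  exact Complex.ext (key Complex.reCLM) (key Complex.imCLM)

/-- Almost everywhere, a Sobolev homeomorphism satisfies a pointwise Lipschitz estimate. -/
theorem HasWeakDiff.ae_pointwise_lipschitz {g : ℂ ≃ₜ ℂ} (h : HasWeakDiff g D Ω) :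
    ∀ᵐ x, x ∈ Ω → ∃ k : ℕ, ∀ y, dist y x < 1 / (k + 1) → dist (g y) (g x) ≤ k * dist y x := by
  -- it suffices to treat a small disk
  suffices hloc : ∀ c ∈ Ω, ∃ V ∈ 𝓝[Ω] c, ∀ᵐ x, x ∈ V →
      ∃ k : ℕ, ∀ y, dist y x < 1 / (k + 1) → dist (g y) (g x) ≤ k * dist y x by
    choose! V hV hVae using hloc
    obtain ⟨s, hs, hsc, hsU⟩ := TopologicalSpace.countable_cover_nhdsWithin hV
    have := (ae_ball_iff hsc).2 fun c hc => hVae c (hs hc)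
    filter_upwards [this] with x hx hxΩ
    obtain ⟨c, hc, hxc⟩ := mem_iUnion₂.1 (hsU hxΩ)
    exact hx c hc hxc
  intro c hc
  obtain ⟨ε, hε, hεΩ⟩ := Metric.nhds_basis_closedBall.mem_iff.1 (h.isOpen.mem_nhds hc)
  refine ⟨Metric.ball c ε, mem_nhdsWithin_of_mem_nhds (Metric.ball_mem_nhds c hε), ?_⟩
  -- The energy as a finite measure. By differentiation of measures it has finite density almost
  -- everywhere, so disks of radius r have energy O(r²); together with the length-area bound for the
  -- oscillation this is a Lipschitz estimate at the center.
  set ρ := volume.withDensity ((Metric.closedBall c ε).indicator fun z => ‖D z‖ₑ ^ 2) with hρ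
  have hρfin : IsFiniteMeasure ρ := by
    refine isFiniteMeasure_withDensity ?_
    rw [lintegral_indicator measurableSet_closedBall]
    exact (eLpNorm_two_lt_top_iff.1 (h.memLp _ hεΩ (isCompact_closedBall c ε)).2).ne
  filter_upwards [Besicovitch.ae_tendsto_rnDeriv ρ volume, Measure.rnDeriv_lt_top ρ volume]
    with x hx hfin hxV
  obtain ⟨A, hA⟩ := ENNReal.lt_iff_exists_nnreal_btwn.1 hfin
  have hev := hx.eventually_lt_const hA.1
  obtain ⟨r₀, hr₀, hr₀'⟩ : ∃ r₀ > 0, ∀ r, 0 < r → r < r₀ →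
      ρ (Metric.closedBall x r) / volume (Metric.closedBall x r) < A := by
    rw [eventually_nhdsWithin_iff, Metric.eventually_nhds_iff] at hev
    obtain ⟨r₀, hr₀, h⟩ := hev
    refine ⟨r₀, hr₀, fun r hr hr' => h ?_ hr⟩
    rwa [Real.dist_eq, sub_zero, abs_of_pos hr]
  obtain ⟨r₁, hr₁, hr₁'⟩ := Metric.isOpen_ball.mem_nhds hxV |> Metric.mem_nhds_iff.1
  -- the estimate with a constant
  set B : ℝ := 2 * Real.pi * A * (Real.pi * 4) / Real.log 2 with hB
  have hlog : 0 < Real.log 2 := Real.log_pos one_lt_two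
  have hB0 : 0 ≤ B := by positivity
  have hest : ∀ y, dist y x < min r₀ r₁ / 2 → dist (g y) (g x) ≤ Real.sqrt B * dist y x := by
    intro y hy
    rcases eq_or_ne y x with rfl | hne
    · simp
    have hr : 0 < dist y x := dist_pos.2 hne
    have hlt0 : 2 * dist y x < r₀ := by linarith [min_le_left r₀ r₁]
    have hlt1 : 2 * dist y x < r₁ := by linarith [min_le_right r₀ r₁]
    have hsub : Metric.ball x (2 * dist y x) ⊆ Metric.closedBall c ε :=
      (Metric.ball_subset_ball hlt1.le).trans (hr₁'.trans Metric.ball_subset_closedBall)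
    have h1 := h.dist_sq_le hr (hsub.trans hεΩ) le_rfl
    have h2 := hr₀' _ (by positivity) hlt0
    have h3 : ∫⁻ w in Metric.ball x (2 * dist y x), ‖D w‖ₑ ^ 2 ≤
        ρ (Metric.closedBall x (2 * dist y x)) := by
      rw [hρ, withDensity_apply _ measurableSet_closedBall]
      calc ∫⁻ w in Metric.ball x (2 * dist y x), ‖D w‖ₑ ^ 2
          = ∫⁻ w in Metric.ball x (2 * dist y x),
              (Metric.closedBall c ε).indicator (fun z => ‖D z‖ₑ ^ 2) w := by
            refine setLIntegral_congr_fun measurableSet_ball fun w hw => ?_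
            rw [indicator_of_mem (hsub hw)]
        _ ≤ _ := lintegral_mono_set Metric.ball_subset_closedBall
    have hvol : volume (Metric.closedBall x (2 * dist y x)) =
        ENNReal.ofReal (Real.pi * 4 * dist y x ^ 2) := by
      rw [Complex.volume_closedBall, ← ENNReal.ofReal_coe_nnreal, ← ENNReal.ofReal_pow (by positivity),
        ← ENNReal.ofReal_mul (by positivity)]
      congr 1
      simp only [NNReal.coe_real_pi]; ring
    rw [hvol] at h2
    have h4 : ρ (Metric.closedBall x (2 * dist y x)) ≤
        ENNReal.ofReal (A * (Real.pi * 4 * dist y x ^ 2)) := by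
      rw [ENNReal.ofReal_mul A.coe_nonneg, ENNReal.ofReal_coe_nnreal]
      refine (ENNReal.div_le_iff_le_mul (Or.inl ?_) (Or.inl ENNReal.ofReal_ne_top)).1 h2.le
      exact (ENNReal.ofReal_pos.2 (by positivity)).ne'
    have h5 : ENNReal.ofReal (dist (g y) (g x) ^ 2 * Real.log 2) ≤
        ENNReal.ofReal (2 * Real.pi * (A * (Real.pi * 4 * dist y x ^ 2))) := by
      rw [ENNReal.ofReal_mul (by positivity), ENNReal.ofReal_mul (by positivity),
        ENNReal.ofReal_pow dist_nonneg]
      refine h1.trans ?_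
      gcongr
      exact h3.trans h4
    have h6 := (ENNReal.ofReal_le_ofReal_iff (by positivity)).1 h5
    refine abs_le_of_sq_le_sq' ?_ (by positivity) |>.2
    rw [mul_pow, Real.sq_sqrt hB0, hB, div_mul_eq_mul_div, le_div_iff₀ hlog]
    linarith
  -- A single integer serves as the Lipschitz constant and as the inverse of the scale, which leaves
  -- countably many cases.
  obtain ⟨k, hk⟩ := exists_nat_gt (max (Real.sqrt B) (1 / (min r₀ r₁ / 2)))
  refine ⟨k, fun y hy => (hest y (hy.trans_le ?_)).trans ?_⟩
  · have hm : 0 < min r₀ r₁ / 2 := by positivity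
    rw [div_le_iff₀ (by positivity)]
    have := (le_max_right _ _).trans_lt hk
    rw [div_lt_iff₀ hm] at this
    nlinarith
  · gcongr
    exact (le_max_left _ _).trans hk.le

end Lyubich

/-! ### The area inequality and the gluing of quasiconformal maps. -/

namespace Lyubich

variable {D : ℂ → ℂ →L[ℝ] ℂ} {Ω : Set ℂ} {K : ℝ}

/-- A Sobolev homeomorphism coincides almost everywhere with one of countably many Lipschitz
maps. -/
theorem HasWeakDiff.exists_lipschitz_cover {g : ℂ ≃ₜ ℂ} (h : HasWeakDiff g D Ω) :
    ∃ G : ℕ → ℂ → ℂ, (∀ j, ∃ C, LipschitzWith C (G j)) ∧ ∀ᵐ x, x ∈ Ω → ∃ j, g x = G j x := by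
  set E : ℕ → Set ℂ := fun k =>
    {x | ∀ y, dist y x < 1 / (k + 1) → dist (g y) (g x) ≤ k * dist y x} with hE
  -- Balls of radius 1/(2(k+1)) keep any two points of a piece in the range of the pointwise
  -- estimate.
  have hlip : ∀ p : ℕ × ℕ, LipschitzOnWith (p.1 : NNReal) g
      (E p.1 ∩ Metric.ball (TopologicalSpace.denseSeq ℂ p.2) (1 / (p.1 + 1) / 2)) := by
    intro p
    refine LipschitzOnWith.of_dist_le_mul fun x hx y hy => ?_
    have := hy.1 x (by
      have := dist_triangle_right x y (TopologicalSpace.denseSeq ℂ p.2)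
      have h1 := hx.2
      have h2 := hy.2
      rw [Metric.mem_ball] at h1 h2
      linarith)
    simpa using this
  choose G hG hGeq using fun p => (hlip p).extend_finite_dimension
  refine ⟨fun j => G (Nat.unpair j), fun j => ⟨_, hG _⟩, ?_⟩
  filter_upwards [h.ae_pointwise_lipschitz] with x hx hxΩ
  obtain ⟨k, hk⟩ := hx hxΩ
  obtain ⟨i, hi⟩ := (TopologicalSpace.denseRange_denseSeq ℂ).exists_dist_lt x
    (by positivity : (0 : ℝ) < 1 / (k + 1) / 2)
  refine ⟨Nat.pair k i, ?_⟩
  rw [Nat.unpair_pair]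
  exact hGeq (k, i) ⟨hk, Metric.mem_ball.2 hi⟩

/-- The area inequality for Sobolev homeomorphisms. -/
theorem HasWeakDiff.lintegral_det_le {g : ℂ ≃ₜ ℂ} (h : HasWeakDiff g D Ω) {A : Set ℂ}
    (hA : MeasurableSet A) (hAΩ : A ⊆ Ω) :
    ∫⁻ z in A, ENNReal.ofReal |(D z).det| ≤ volume (g '' A) := by
  obtain ⟨G, hGl, hcov⟩ := h.exists_lipschitz_cover
  have hae : ∀ᵐ x, x ∈ Ω → (∃ j, g x = G j x) ∧
      ∀ j, g x = G j x → DifferentiableAt ℝ (G j) x ∧ D x = fderiv ℝ (G j) x := by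
    have h1 : ∀ᵐ x, ∀ j, x ∈ Ω → g x = G j x →
        DifferentiableAt ℝ (G j) x ∧ D x = fderiv ℝ (G j) x := by
      rw [ae_all_iff]
      intro j
      obtain ⟨C, hC⟩ := hGl j
      -- The Sobolev map g - G j vanishes on {g = G j}, hence so does its weak differential almost
      -- everywhere there: on this set `D` is the classical differential of a Lipschitz map.
      have h2 := (h.sub ((HasWeakDiff.of_lipschitzWith hC).mono h.isOpen
        (subset_univ _))).ae_eq_zero_of_eq_zero
      filter_upwards [h2, hC.ae_differentiableAt (μ := volume)] with x hx hd hxΩ he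
      exact ⟨hd, sub_eq_zero.1 (hx hxΩ (sub_eq_zero.2 he))⟩
    filter_upwards [hcov, h1] with x hx1 hx2 hxΩ
    exact ⟨hx1 hxΩ, fun j hj => hx2 j hxΩ hj⟩
  rw [ae_iff] at hae
  set N := toMeasurable volume {x | ¬ (x ∈ Ω → (∃ j, g x = G j x) ∧
      ∀ j, g x = G j x → DifferentiableAt ℝ (G j) x ∧ D x = fderiv ℝ (G j) x)} with hN
  have hN0 : volume N = 0 := by rw [hN, measure_toMeasurable, hae]
  have hNm : MeasurableSet N := measurableSet_toMeasurable _ _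
  have hgood : ∀ x ∈ A \ N, (∃ j, g x = G j x) ∧
      ∀ j, g x = G j x → DifferentiableAt ℝ (G j) x ∧ D x = fderiv ℝ (G j) x := by
    intro x hx
    by_contra hcon
    exact hx.2 (subset_toMeasurable _ _ fun hh => hcon (hh (hAΩ hx.1)))
  -- On each of these disjoint pieces the area formula for injective differentiable maps is an
  -- equality. The image of the discarded null set `N` is not controlled, so that only an inequality
  -- remains in the end.
  set B : ℕ → Set ℂ := fun j => (A \ N) ∩ disjointed (fun j => {x | g x = G j x}) j with hB
  have hBm : ∀ j, MeasurableSet (B j) := fun j => (hA.diff hNm).inter (MeasurableSet.disjointed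
    (fun i => (isClosed_eq g.continuous (hGl i).choose_spec.continuous).measurableSet) j)
  have hBd : Pairwise (Function.onFun Disjoint B) := fun i j hij =>
    ((disjoint_disjointed _ hij).mono inter_subset_right inter_subset_right)
  have hBU : ⋃ j, B j = A \ N := by
    rw [hB, ← inter_iUnion, iUnion_disjointed, inter_eq_left]
    exact fun x hx => mem_iUnion.2 (hgood x hx).1
  have hBeq : ∀ j, ∀ x ∈ B j, g x = G j x := fun j x hx => disjointed_subset _ j hx.2
  have hpiece : ∀ j, ∫⁻ z in B j, ENNReal.ofReal |(D z).det| = volume (g '' B j) := by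
    intro j
    have h1 : ∀ x ∈ B j, HasFDerivWithinAt (G j) (D x) (B j) x := fun x hx => by
      have := (hgood x hx.1).2 j (hBeq j x hx)
      rw [this.2]
      exact this.1.hasFDerivAt.hasFDerivWithinAt
    have h2 : InjOn (G j) (B j) := fun x hx y hy hxy =>
      g.injective (by rw [hBeq j x hx, hBeq j y hy, hxy])
    rw [lintegral_abs_det_fderiv_eq_addHaar_image volume (hBm j) h1 h2,
      image_congr (fun x hx => hBeq j x hx)]
  have hAN : ∫⁻ z in A, ENNReal.ofReal |(D z).det| = ∫⁻ z in A \ N, ENNReal.ofReal |(D z).det| := by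
    refine setLIntegral_congr ?_
    exact (sdiff_null_ae_eq_self hN0).symm
  rw [hAN, ← hBU, lintegral_iUnion hBm hBd]
  simp_rw [hpiece]
  rw [← measure_iUnion (fun i j hij => ?_) (fun j => ?_)]
  · refine measure_mono (iUnion_subset fun j => image_mono fun x hx => hx.1.1)
  · exact (disjoint_image_iff g.injective).2 (hBd hij)
  · exact (g.toMeasurableEquiv.measurableSet_image).2 (hBm j)

/-- Bound for the Dirichlet integral of a quasiconformal homeomorphism. -/
theorem HasWeakDiff.lintegral_sq_le {g : ℂ ≃ₜ ℂ} (h : HasWeakDiff g D Ω)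
    (hD : ∀ z, ‖D z‖ ^ 2 ≤ K * (D z).det) (hK : 1 ≤ K) {A : Set ℂ} (hA : MeasurableSet A)
    (hAΩ : A ⊆ Ω) :
    ∫⁻ z in A, ‖D z‖ₑ ^ 2 ≤ ENNReal.ofReal K * volume (g '' A) := by
  refine le_trans ?_ (mul_le_mul_right (h.lintegral_det_le hA hAΩ) _)
  rw [← lintegral_const_mul' _ _ ENNReal.ofReal_ne_top]
  refine lintegral_mono fun z => ?_
  rw [← ENNReal.ofReal_mul (by linarith), abs_of_nonneg (det_nonneg_of_norm_sq_le hK (hD z)),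
    ← ofReal_norm, ← ENNReal.ofReal_pow (norm_nonneg _)]
  exact ENNReal.ofReal_le_ofReal (hD z)

/-- Gluing of quasiconformal homeomorphisms: if `g` coincides with `g₀` outside the open set `V`,
`g₀` is quasiconformal on `Ω₀` and `g` is quasiconformal on `V`, then `g` is quasiconformal on
`Ω₀ ∪ V`. -/
theorem IsQC.glue {g g₀ : ℂ ≃ₜ ℂ} {Ω₀ V : Set ℂ} (h₀ : IsQC K g₀ Ω₀) (h : IsQC K g V)
    (heq : ∀ z ∈ Ω₀ \ V, g z = g₀ z) : IsQC K g (Ω₀ ∪ V) := by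
  obtain ⟨D₀, hD₀, hd₀⟩ := h₀.exists_hasWeakDiff
  obtain ⟨D, hD, hd⟩ := h.exists_hasWeakDiff
  -- Square integrability of `D` up to the boundary of `V` is what Sobolev gluing needs. The area
  -- inequality supplies it, as `g` maps compact sets to sets of finite area.
  obtain ⟨D', hD', hp⟩ := hD₀.glue hD g.continuous.continuousOn heq fun C hC hCc => by
    refine (hD.lintegral_sq_le hd h.1 (hCc.isClosed.measurableSet.inter hD.isOpen.measurableSet)
      inter_subset_right).trans_lt ?_
    refine ENNReal.mul_lt_top ENNReal.ofReal_lt_top ?_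
    exact (measure_mono (image_mono inter_subset_left)).trans_lt
      (hCc.image g.continuous).measure_lt_top
  refine hD'.isQC h.1 g.injective.injOn fun z _ => ?_
  rcases hp z with h0 | h0 | h0
  · rw [h0, det_zero_clm]; simp
  · rw [h0]; exact hd₀ z
  · rw [h0]; exact hd z

end Lyubich

namespace Lyubich

/-! ### Removability -/

variable {D : ℂ → ℂ →L[ℝ] ℂ} {Ω : Set ℂ} {K : ℝ}

/-- A closed null set is removable for quasiconformal homeomorphisms if it admits suitable
cutoff functions. -/
theorem IsQC.of_cutoff {g : ℂ ≃ₜ ℂ} {S : Set ℂ} (hΩ : IsOpen Ω) (hS : IsClosed S)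
    (hS0 : volume S = 0) (h : IsQC K g (Ω \ S)) {χ : ℕ → ℂ → ℝ} (hχ : ∀ n, ContDiff ℝ ∞ (χ n))
    (hχ1 : ∀ n, ∀ z ∈ S, χ n =ᶠ[𝓝 z] 1) (hχb : ∀ n z, |χ n z| ≤ 1)
    (hχ0 : ∀ᵐ z, Tendsto (fun n => χ n z) atTop (𝓝 0))
    (hχi : ∀ (φ : ℂ → ℝ) (v : ℂ), ContDiff ℝ ∞ φ → HasCompactSupport φ →
      Tendsto (fun n => ∫ z, (fderiv ℝ (χ n) z v) • φ z • g z) atTop (𝓝 0)) :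
    IsQC K g Ω := by
  obtain ⟨D, hD, hd⟩ := h.exists_hasWeakDiff
  -- As `S` is null, the energy over `C` is the energy over C \ S, at most K times the area of g(C).
  have hL2 : ∀ C ⊆ Ω, IsCompact C → MemLp D 2 (volume.restrict C) := by
    intro C hC hCc
    refine ⟨hD.meas.aestronglyMeasurable, eLpNorm_two_lt_top_iff.2 ?_⟩
    have e : ∫⁻ z in C, ‖D z‖ₑ ^ 2 = ∫⁻ z in C \ S, ‖D z‖ₑ ^ 2 :=
      setLIntegral_congr (sdiff_null_ae_eq_self hS0).symm
    rw [e]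
    refine (hD.lintegral_sq_le hd h.1 (hCc.isClosed.measurableSet.diff hS.measurableSet)
      (sdiff_subset_sdiff_left hC)).trans_lt (ENNReal.mul_lt_top ENNReal.ofReal_lt_top ?_)
    exact (measure_mono (image_mono sdiff_subset)).trans_lt
      (hCc.image g.continuous).measure_lt_top
  have hw : IsWeakDifferential g D Ω := by
    intro φ hφ hc ht v
    have hφ' : Continuous fun z => fderiv ℝ φ z v :=
      (hφ.continuous_fderiv (by simp)).clm_apply continuous_const
    have hint1 : Integrable fun z => (fderiv ℝ φ z v) • g z :=
      Continuous.integrable_of_hasCompactSupport (hφ'.smul g.continuous)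
        ((hc.fderiv_apply (𝕜 := ℝ) v).smul_right)
    have hint2 : Integrable fun z => φ z • D z v := by
      have : IsFiniteMeasure (volume.restrict (tsupport φ)) := ⟨by simpa using hc.measure_lt_top⟩
      have h1 : IntegrableOn (fun z => φ z • D z v) (tsupport φ) := by
        refine IntegrableOn.continuousOn_smul ?_ hφ.continuous.continuousOn hc
        exact (ContinuousLinearMap.apply ℝ ℂ v).integrable_comp
          ((hL2 _ ht hc).integrable (by norm_num))
      exact h1.integrable_of_forall_notMem_eq_zero fun z hz => by
        rw [image_eq_zero_of_notMem_tsupport hz, zero_smul]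
    have hb1 : ∀ n z, ‖1 - χ n z‖ ≤ 2 := fun n z => by
      refine (norm_sub_le _ _).trans ?_
      rw [norm_one, Real.norm_eq_abs]; linarith [hχb n z]
    have hlim : ∀ {u : ℂ → ℂ}, Integrable u →
        Tendsto (fun n => ∫ z, (1 - χ n z) • u z) atTop (𝓝 (∫ z, u z)) := by
      intro u hu
      refine tendsto_integral_of_dominated_convergence (fun z => 2 * ‖u z‖) (fun n => ?_)
        (hu.norm.const_mul 2) (fun n => Eventually.of_forall fun z => ?_) ?_
      · exact (continuous_const.sub (hχ n).continuous).aestronglyMeasurable.smul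
          hu.aestronglyMeasurable
      · rw [norm_smul]; gcongr; exact hb1 n z
      · filter_upwards [hχ0] with z hz
        have : Tendsto (fun n => (1 - χ n z) • u z) atTop (𝓝 (((1 : ℝ) - 0) • u z)) :=
          (tendsto_const_nhds.sub hz).smul_const (u z)
        simpa using this
    -- The weak identity off `S` is tested against (1 - χ n) φ. The term in which the cutoff is
    -- differentiated is the one assumed to tend to 0.
    have heq : ∀ n, (∫ z, (1 - χ n z) • (fderiv ℝ φ z v) • g z) -
        ∫ z, (fderiv ℝ (χ n) z v) • φ z • g z = - ∫ z, (1 - χ n z) • φ z • D z v := by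
      intro n
      have hχ' : Continuous fun z => fderiv ℝ (χ n) z v :=
        ((hχ n).continuous_fderiv (by simp)).clm_apply continuous_const
      have hs : ContDiff ℝ ∞ fun z => (1 - χ n z) * φ z := (contDiff_const.sub (hχ n)).mul hφ
      have hsc : HasCompactSupport fun z => (1 - χ n z) * φ z := hc.mul_left
      have hst : tsupport (fun z => (1 - χ n z) * φ z) ⊆ Ω \ S := by
        intro z hz
        refine ⟨ht (tsupport_mul_subset_right hz), fun hzS => ?_⟩
        refine notMem_tsupport_iff_eventuallyEq.2 ?_ hz
        filter_upwards [hχ1 n z hzS] with w hw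
        simp [hw]
      have e := hD.weak _ hs hsc hst v
      have e2 : ∀ z, fderiv ℝ (fun z => (1 - χ n z) * φ z) z v =
          (1 - χ n z) * fderiv ℝ φ z v - fderiv ℝ (χ n) z v * φ z := by
        intro z
        have h1 : HasFDerivAt (fun z => 1 - χ n z) (-(fderiv ℝ (χ n) z)) z :=
          (((hχ n).differentiable (by simp)) z).hasFDerivAt.const_sub 1
        have h2 : HasFDerivAt (fun z => (1 - χ n z) * φ z) _ z :=
          h1.mul ((hφ.differentiable (by simp)) z).hasFDerivAt
        rw [h2.fderiv]
        simp only [add_apply, smul_apply, neg_apply, smul_eq_mul]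
        ring
      have i1 : Integrable fun z => (1 - χ n z) • (fderiv ℝ φ z v) • g z :=
        Continuous.integrable_of_hasCompactSupport
          ((continuous_const.sub (hχ n).continuous).smul (hφ'.smul g.continuous))
          (HasCompactSupport.intro hc fun z hz => by
            rw [fderiv_eq_zero_of_notMem_tsupport hz, zero_apply, zero_smul, smul_zero])
      have i2 : Integrable fun z => (fderiv ℝ (χ n) z v) • φ z • g z :=
        Continuous.integrable_of_hasCompactSupport
          (hχ'.smul (hφ.continuous.smul g.continuous)) (HasCompactSupport.intro hc fun z hz => by
            rw [image_eq_zero_of_notMem_tsupport hz, zero_smul, smul_zero])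
      rw [← integral_sub i1 i2]
      simp only [mul_smul] at e
      rw [← e]
      refine integral_congr_ae (Eventually.of_forall fun z => ?_)
      simp only [e2, sub_smul, mul_smul]
    have hl := ((hlim hint1).sub (hχi φ v hφ hc))
    rw [sub_zero] at hl
    have hr := (hlim hint2).neg
    simp_rw [heq] at hl
    exact tendsto_nhds_unique hl hr
  exact HasWeakDiff.isQC ⟨hΩ, g.continuous.continuousOn, hD.meas, hL2, hw⟩ h.1
    g.injective.injOn fun z _ => hd z

/-- Points are removable for quasiconformal homeomorphisms. -/
theorem IsQC.of_diff_singleton {g : ℂ ≃ₜ ℂ} (hΩ : IsOpen Ω) (p : ℂ) (h : IsQC K g (Ω \ {p})) :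
    IsQC K g Ω := by
  let ψ : ContDiffBump (0 : ℂ) := ⟨1, 2, one_pos, one_lt_two⟩
  have hψ : ContDiff ℝ ∞ (ψ : ℂ → ℝ) := ψ.contDiff
  set χ : ℕ → ℂ → ℝ := fun n z => ψ (((n : ℝ) + 1) • (z - p)) with hχdef
  have hn0 : ∀ n : ℕ, (0 : ℝ) < (n : ℝ) + 1 := fun n => by positivity
  have hχ : ∀ n, ContDiff ℝ ∞ (χ n) := fun n =>
    hψ.comp ((contDiff_id.sub contDiff_const).const_smul _)
  refine IsQC.of_cutoff hΩ isClosed_singleton (by simp) h (χ := χ) hχ ?_ ?_ ?_ ?_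
  · intro n z hz
    rw [mem_singleton_iff.1 hz]
    have hc : ContinuousAt (fun w : ℂ => ((n : ℝ) + 1) • (w - p)) p := by fun_prop
    have : ∀ᶠ w in 𝓝 (((n : ℝ) + 1) • (p - p)), ψ w = 1 := by
      rw [sub_self, smul_zero]; exact ψ.eventuallyEq_one
    exact hc.eventually this
  · intro n z
    rw [abs_of_nonneg ψ.nonneg]; exact ψ.le_one
  · have : ∀ᵐ z : ℂ, z ≠ p := by simp [ae_iff]
    filter_upwards [this] with z hz
    have hpos : 0 < ‖z - p‖ := norm_pos_iff.2 (sub_ne_zero.2 hz)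
    refine tendsto_const_nhds.congr' ?_
    obtain ⟨k, hk⟩ := exists_nat_gt (2 / ‖z - p‖)
    filter_upwards [eventually_ge_atTop k] with n hn
    refine (ψ.zero_of_le_dist ?_).symm
    rw [dist_zero_right, norm_smul, Real.norm_eq_abs, abs_of_pos (hn0 n)]
    rw [div_lt_iff₀ hpos] at hk
    have : (k : ℝ) ≤ n := by exact_mod_cast hn
    change (2 : ℝ) ≤ _
    nlinarith
  · intro φ v hφ hc
    obtain ⟨B, hB⟩ := (hc.smul_right (f' := (g : ℂ → ℂ))).exists_bound_of_continuous
      (hφ.continuous.smul g.continuous)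
    set I := ∫ z, ‖fderiv ℝ ψ z v‖ with hI
    have hder : ∀ n z, fderiv ℝ (χ n) z v =
        ((n : ℝ) + 1) * fderiv ℝ ψ (((n : ℝ) + 1) • (z - p)) v := by
      intro n z
      have h1 : HasFDerivAt (fun z : ℂ => ((n : ℝ) + 1) • (z - p))
          (((n : ℝ) + 1) • ContinuousLinearMap.id ℝ ℂ) z :=
        HasFDerivAt.fun_const_smul ((hasFDerivAt_id z).sub_const p) _
      have h2 : HasFDerivAt ψ (fderiv ℝ ψ (((n : ℝ) + 1) • (z - p))) (((n : ℝ) + 1) • (z - p)) :=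
        ((hψ.differentiable (by simp)) _).hasFDerivAt
      have h3 := HasFDerivAt.comp z h2 h1
      have h4 : χ n = ψ ∘ fun z : ℂ => ((n : ℝ) + 1) • (z - p) := rfl
      rw [h4, h3.fderiv]
      simp
    -- In dimension two the gradient grows like n while the area of its support decreases like n⁻²,
    -- so its L¹ norm tends to 0.
    have h_integral : ∀ n : ℕ, ∫ z, ‖fderiv ℝ (χ n) z v‖ = ((n : ℝ) + 1)⁻¹ * I := by
      intro n
      have e1 : ∀ z, ‖fderiv ℝ (χ n) z v‖ =
          (fun w => ((n : ℝ) + 1) * ‖fderiv ℝ ψ (((n : ℝ) + 1) • w) v‖) (z - p) := by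
        intro z
        simp only [hder n z, norm_mul, Real.norm_eq_abs, abs_of_pos (hn0 n)]
      simp_rw [e1]
      rw [integral_sub_right_eq_self (fun w => ((n : ℝ) + 1) * ‖fderiv ℝ ψ (((n : ℝ) + 1) • w) v‖),
        integral_const_mul,
        Measure.integral_comp_smul volume (fun w => ‖fderiv ℝ ψ w v‖) ((n : ℝ) + 1)]
      rw [Complex.finrank_real_complex, abs_of_pos (by have := hn0 n; positivity), smul_eq_mul, ← hI]
      have := (hn0 n).ne'
      field_simp
    have hχint : ∀ n, Integrable fun z => ‖fderiv ℝ (χ n) z v‖ := by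
      intro n
      have hcs : HasCompactSupport (χ n) := by
        have h1 := ψ.hasCompactSupport
        refine HasCompactSupport.intro (isCompact_closedBall p (2 / ((n : ℝ) + 1))) fun z hz => ?_
        refine ψ.zero_of_le_dist ?_
        rw [dist_zero_right, norm_smul, Real.norm_eq_abs, abs_of_pos (hn0 n)]
        rw [Metric.mem_closedBall, not_le, dist_eq_norm, div_lt_iff₀ (hn0 n)] at hz
        change (2 : ℝ) ≤ _
        linarith
      exact (Continuous.integrable_of_hasCompactSupport
        (((hχ n).continuous_fderiv (by simp)).clm_apply continuous_const)
        (hcs.fderiv_apply (𝕜 := ℝ) v)).norm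
    refine squeeze_zero_norm (a := fun n : ℕ => (((n : ℝ) + 1)⁻¹ * I) * B) (fun n => ?_) ?_
    · rw [← h_integral n, ← integral_mul_const]
      refine norm_integral_le_of_norm_le ((hχint n).mul_const B) (Eventually.of_forall fun z => ?_)
      rw [norm_smul]
      gcongr
      exact hB z
    · have : Tendsto (fun n : ℕ => ((n : ℝ) + 1)⁻¹) atTop (𝓝 0) := by
        simpa using tendsto_one_div_add_atTop_nhds_zero_nat (𝕜 := ℝ)
      simpa using (this.mul_const I).mul_const B

end Lyubich

namespace Lyubich

/-! ### Inverses of injective holomorphic maps -/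

section Inverse

variable {k : ℂ → ℂ} {V : Set ℂ}

theorem nhds_le_map_of_injOn (hV : IsOpen V) (hk : DifferentiableOn ℂ k V) (hinj : InjOn k V)
    {z : ℂ} (hz : z ∈ V) : 𝓝 (k z) ≤ map k (𝓝 z) := by
  have ha : AnalyticAt ℂ k z := hk.analyticAt (hV.mem_nhds hz)
  refine ha.eventually_constant_or_nhds_le_map_nhds.resolve_left fun hcon => ?_
  have h1 : ∀ᶠ w in 𝓝[≠] z, k w = k z ∧ w ∈ V :=
    (hcon.and (hV.mem_nhds hz)).filter_mono nhdsWithin_le_nhds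
  obtain ⟨w, hw, hne⟩ := (h1.and eventually_mem_nhdsWithin).exists
  exact hne (hinj hw.2 hz hw.1)

theorem isOpen_image_of_injOn (hV : IsOpen V) (hk : DifferentiableOn ℂ k V) (hinj : InjOn k V)
    {W : Set ℂ} (hW : IsOpen W) (hWV : W ⊆ V) : IsOpen (k '' W) := by
  rw [isOpen_iff_mem_nhds]
  rintro _ ⟨z, hz, rfl⟩
  exact nhds_le_map_of_injOn hV hk hinj (hWV hz) (image_mem_map (hW.mem_nhds hz))

theorem continuousOn_invFunOn (hV : IsOpen V) (hk : DifferentiableOn ℂ k V) (hinj : InjOn k V) :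
    ContinuousOn (Function.invFunOn k V) (k '' V) := by
  rw [continuousOn_iff']
  intro W hW
  refine ⟨k '' (W ∩ V), isOpen_image_of_injOn hV hk hinj (hW.inter hV) inter_subset_right, ?_⟩
  ext w
  constructor
  · rintro ⟨hw, ⟨z, hz, rfl⟩⟩
    rw [mem_preimage, hinj.leftInvOn_invFunOn hz] at hw
    exact ⟨⟨z, ⟨hw, hz⟩, rfl⟩, ⟨z, hz, rfl⟩⟩
  · rintro ⟨⟨z, hz, rfl⟩, h2⟩
    refine ⟨?_, h2⟩
    rw [mem_preimage, hinj.leftInvOn_invFunOn hz.2]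
    exact hz.1

/-- The inverse of an injective holomorphic map is holomorphic. -/
theorem differentiableOn_invFunOn (hV : IsOpen V) (hk : DifferentiableOn ℂ k V)
    (hinj : InjOn k V) : DifferentiableOn ℂ (Function.invFunOn k V) (k '' V) := by
  set κ := Function.invFunOn k V with hκ
  have hopen : IsOpen (k '' V) := isOpen_image_of_injOn hV hk hinj hV subset_rfl
  have hcont := continuousOn_invFunOn hV hk hinj
  have hreg : ∀ z ∈ V, deriv k z ≠ 0 → DifferentiableAt ℂ κ (k z) := by
    intro z hz hd
    have hzi : κ (k z) = z := hinj.leftInvOn_invFunOn hz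
    refine (HasDerivAt.of_local_left_inverse (f := k) (f' := deriv k z) ?_ ?_ hd ?_).differentiableAt
    · exact hcont.continuousAt (hopen.mem_nhds ⟨z, hz, rfl⟩)
    · rw [hzi]; exact (hk.differentiableAt (hV.mem_nhds hz)).hasDerivAt
    · filter_upwards [hopen.mem_nhds ⟨z, hz, rfl⟩] with w hw
      exact Function.invFunOn_eq hw
  rintro _ ⟨z, hz, rfl⟩
  -- Zeros of k' are isolated, and a continuous function that is holomorphic off a point is
  -- holomorphic there too; so it need not be shown that `k` has no critical points.
  have ha : AnalyticAt ℂ (deriv k) z := (hk.analyticAt (hV.mem_nhds hz)).deriv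
  have hiso : ∀ᶠ w in 𝓝[≠] z, deriv k w ≠ 0 := by
    refine ha.eventually_eq_zero_or_eventually_ne_zero.resolve_left fun h0 => ?_
    obtain ⟨ε, hε, hb⟩ := Metric.eventually_nhds_iff_ball.1 (h0.and (hV.mem_nhds hz))
    have hconst : ∀ w ∈ Metric.ball z ε, k w = k z := fun w hw =>
      (convex_ball z ε).is_const_of_fderivWithin_eq_zero (𝕜 := ℂ)
        (fun x hx => (hk.differentiableAt (hV.mem_nhds (hb x hx).2)).differentiableWithinAt)
        (fun x hx => by
          rw [fderivWithin_of_isOpen Metric.isOpen_ball hx]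
          ext; simpa using (hb x hx).1) hw (Metric.mem_ball_self hε)
    have h1 : ∀ᶠ w in 𝓝[≠] z, w ∈ Metric.ball z ε :=
      mem_nhdsWithin_of_mem_nhds (Metric.ball_mem_nhds z hε)
    obtain ⟨w, hw, hne⟩ := (h1.and eventually_mem_nhdsWithin).exists
    exact hne (hinj (hb w hw).2 hz (hconst w hw))
  refine (Complex.analyticAt_of_differentiable_on_punctured_nhds_of_continuousAt ?_
    (hcont.continuousAt (hopen.mem_nhds ⟨z, hz, rfl⟩))).differentiableAt.differentiableWithinAt
  rw [eventually_nhdsWithin_iff] at hiso ⊢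
  have hc : Tendsto κ (𝓝 (k z)) (𝓝 z) := by
    have := (hcont.continuousAt (hopen.mem_nhds ⟨z, hz, rfl⟩)).tendsto
    rwa [hinj.leftInvOn_invFunOn hz] at this
  filter_upwards [hc.eventually hiso, hopen.mem_nhds ⟨z, hz, rfl⟩] with w hw hwV hne
  obtain ⟨y, hy, rfl⟩ := hwV
  have hyi : κ (k y) = y := hinj.leftInvOn_invFunOn hy
  rw [hyi] at hw
  exact hreg y hy (hw fun h => hne (by rw [h]; rfl))

end Inverse

/-! ### Collars -/

theorem isPreconnected_norm_preimage {I : Set ℝ} (hI : IsPreconnected I) (h0 : I ⊆ Ici 0) :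
    IsPreconnected {z : ℂ | ‖z‖ ∈ I} := by
  have : {z : ℂ | ‖z‖ ∈ I} =
      (fun p : ℝ × ℝ => (p.1 : ℂ) * Complex.exp (p.2 * Complex.I)) '' (I ×ˢ univ) := by
    ext z
    constructor
    · intro hz
      exact ⟨(‖z‖, z.arg), ⟨hz, mem_univ _⟩, Complex.norm_mul_exp_arg_mul_I z⟩
    · rintro ⟨⟨r, t⟩, ⟨hr, -⟩, rfl⟩
      have hr0 : (0 : ℝ) ≤ r := h0 hr
      simpa [Complex.norm_exp_ofReal_mul_I, abs_of_nonneg hr0] using hr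
  rw [this]
  exact (hI.prod isPreconnected_univ).image _ (by fun_prop)

theorem isPreconnected_ann {a b : ℝ} (ha : 0 ≤ a) : IsPreconnected (ann a b) :=
  isPreconnected_norm_preimage isPreconnected_Ioo fun _ hx => ha.trans hx.1.le

/-- A nonempty bounded set has a frontier point, reached along a ray. The topological arguments
about annuli below end by producing a bounded clopen set. -/
theorem eq_empty_of_frontier_eq_empty {V : Set ℂ} (hb : Bornology.IsBounded V)
    (hf : frontier V = ∅) : V = ∅ := by
  by_contra hne
  obtain ⟨q, hq⟩ := nonempty_iff_ne_empty.2 hne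
  obtain ⟨x, hx, -⟩ := exists_mem_frontier_dist_ge hb hq q
  rw [hf] at hx
  exact hx

/-- The part of a filled annulus inside of the core curve of radius `r`. -/
def fill (E : Set ℂ) (φ : ℂ → ℂ) (r : ℝ) : Set ℂ := E ∪ φ '' ann 1 r

/-- The part of a filled annulus inside of the core curve of radius `r`, with the core curve. -/
def cfill (E : Set ℂ) (φ : ℂ → ℂ) (r : ℝ) : Set ℂ := E ∪ φ '' {z | 1 < ‖z‖ ∧ ‖z‖ ≤ r}

/-- `C \ E` is a conformal annulus parametrized by `φ : {1 < |z| < R} → C \ E`, in such a way that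
the inner boundary corresponds to the boundary of the compact set `E`. -/
structure Collar (C E : Set ℂ) (φ : ℂ → ℂ) (R : ℝ) : Prop where
  one_lt : 1 < R
  holo : DifferentiableOn ℂ φ (ann 1 R)
  inj : InjOn φ (ann 1 R)
  image_eq : φ '' ann 1 R = C \ E
  subset : E ⊆ C
  isOpen : IsOpen C
  isBounded : Bornology.IsBounded C
  isOpen_fill : ∀ r, 1 < r → r < R → IsOpen (fill E φ r)
  isCompact_cfill : ∀ r, 1 < r → r < R → IsCompact (cfill E φ r)

/-- A compact set K₁ between `E` and `C` tells the two ends of the round annulus apart. Filled core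
curves are then obtained from K₁ by adding and removing images of compact or open subannuli, which
gives their openness and compactness. -/
theorem collar_of_inner_outer {C E K₁ : Set ℂ} {φ : ℂ → ℂ} {R s t : ℝ} (hR : 1 < R)
    (hC : IsOpen C) (hCb : Bornology.IsBounded C) (hEC : E ⊆ C) (hK₁ : IsCompact K₁)
    (hEK : E ⊆ interior K₁) (hKC : K₁ ⊆ C) (hφ : DifferentiableOn ℂ φ (ann 1 R))
    (hinj : InjOn φ (ann 1 R)) (himg : φ '' ann 1 R = C \ E) (hs : 1 < s) (htR : t < R)
    (hin : ∀ z, 1 < ‖z‖ → ‖z‖ < R → ‖z‖ < s → φ z ∈ K₁)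
    (hout : ∀ z, 1 < ‖z‖ → ‖z‖ < R → t < ‖z‖ → φ z ∉ K₁) : Collar C E φ R := by
  have hcpt : ∀ a b, 1 < a → b < R → IsCompact (φ '' {z : ℂ | a ≤ ‖z‖ ∧ ‖z‖ ≤ b}) :=
    fun a b ha hb => (isCompact_closed_ann a b).image_of_continuousOn
      (hφ.continuousOn.mono fun z hz => ⟨ha.trans_le hz.1, hz.2.trans_lt hb⟩)
  have hopen : ∀ a b, 1 ≤ a → b ≤ R → IsOpen (φ '' ann a b) := fun a b ha hb =>
    isOpen_image_of_injOn (isOpen_ann 1 R) hφ hinj (isOpen_ann a b) (ann_mono ha hb)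
  have hcase : ∀ x ∈ C, x ∉ E → ∃ w ∈ ann 1 R, φ w = x := fun x hx hxE => by
    have : x ∈ φ '' ann 1 R := by rw [himg]; exact ⟨hx, hxE⟩
    exact this
  refine ⟨hR, hφ, hinj, himg, hEC, hC, hCb, fun r hr hrR => ?_, fun r hr hrR => ?_⟩
  -- Nothing of K₁ lies beyond the radius t, so removing the image of r ≤ |z| ≤ max t r suffices
  -- whichever of r and t is larger.
  · have e : fill E φ r =
        (interior K₁ \ φ '' {z : ℂ | r ≤ ‖z‖ ∧ ‖z‖ ≤ max t r}) ∪ φ '' ann 1 r := by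
      ext x
      constructor
      · rintro (hx | hx)
        · refine Or.inl ⟨hEK hx, ?_⟩
          rintro ⟨z, hz, rfl⟩
          have : φ z ∈ C \ E := himg ▸ ⟨z, ⟨hr.trans_le hz.1, hz.2.trans_lt (max_lt htR hrR)⟩, rfl⟩
          exact this.2 hx
        · exact Or.inr hx
      · rintro (⟨hx1, hx2⟩ | hx)
        · by_cases hxE : x ∈ E
          · exact Or.inl hxE
          · obtain ⟨w, hw, rfl⟩ := hcase x (hKC (interior_subset hx1)) hxE
            refine Or.inr ⟨w, ⟨hw.1, ?_⟩, rfl⟩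
            by_contra hwr
            refine hx2 ⟨w, ⟨not_lt.1 hwr, ?_⟩, rfl⟩
            refine le_max_of_le_left (not_lt.1 fun hwt => ?_)
            exact hout w hw.1 hw.2 hwt (interior_subset hx1)
        · exact Or.inr hx
    rw [e]
    exact (isOpen_interior.sdiff (hcpt _ _ hr (max_lt htR hrR)).isClosed).union
      (hopen 1 r le_rfl hrR.le)
  · have e : cfill E φ r = (K₁ ∪ φ '' {z : ℂ | s ≤ ‖z‖ ∧ ‖z‖ ≤ r}) \ φ '' ann r R := by
      ext x
      constructor
      · rintro (hx | ⟨w, hw, rfl⟩)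
        · refine ⟨Or.inl (interior_subset (hEK hx)), ?_⟩
          rintro ⟨z, hz, rfl⟩
          have : φ z ∈ C \ E := himg ▸ ⟨z, ⟨hr.trans hz.1, hz.2⟩, rfl⟩
          exact this.2 hx
        · refine ⟨?_, ?_⟩
          · by_cases hws : ‖w‖ < s
            · exact Or.inl (hin w hw.1 (hw.2.trans_lt hrR) hws)
            · exact Or.inr ⟨w, ⟨not_lt.1 hws, hw.2⟩, rfl⟩
          · rintro ⟨z, hz, hzw⟩
            have := hinj ⟨hr.trans hz.1, hz.2⟩ ⟨hw.1, hw.2.trans_lt hrR⟩ hzw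
            rw [this] at hz
            exact absurd hz.1 (not_lt.2 hw.2)
      · rintro ⟨hx | ⟨w, hw, rfl⟩, hx2⟩
        · by_cases hxE : x ∈ E
          · exact Or.inl hxE
          · obtain ⟨w, hw, rfl⟩ := hcase x (hKC hx) hxE
            exact Or.inr ⟨w, ⟨hw.1, not_lt.1 fun h => hx2 ⟨w, ⟨h, hw.2⟩, rfl⟩⟩, rfl⟩
        · exact Or.inr ⟨w, ⟨hs.trans_le hw.1, hw.2⟩, rfl⟩
    rw [e]
    refine IsCompact.diff (hK₁.union (hcpt s r hs hrR)) (hopen r R hr.le le_rfl)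

/-- A conformal annulus `C \ E` can be parametrized in the standard orientation. -/
theorem exists_collar {C E : Set ℂ} {δ : ℝ} (hC : IsOpen C) (hCb : Bornology.IsBounded C)
    (hE : IsCompact E) (hne : E.Nonempty) (hEC : E ⊆ C) (h : IsAnnulusOfModulusGE (C \ E) δ) :
    ∃ φ R, Collar C E φ R ∧ 2 * Real.pi * δ ≤ Real.log R := by
  obtain ⟨R, hR, hδ, φ, hφ, hinj, himg⟩ := h
  change DifferentiableOn ℂ φ (ann 1 R) at hφ
  change InjOn φ (ann 1 R) at hinj
  change φ '' ann 1 R = C \ E at himg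
  have hlog : 2 * Real.pi * δ ≤ Real.log R := by
    rw [le_div_iff₀ (by positivity)] at hδ; linarith
  obtain ⟨K₁, hK₁, hEK, hKC⟩ := exists_compact_between hE hC hEC
  have hR0 : 0 < R := by linarith
  -- the frontier of the intermediate compact set lies over a compact subannulus
  have hT : IsCompact (K₁ \ interior K₁) := hK₁.diff isOpen_interior
  have hTA : K₁ \ interior K₁ ⊆ φ '' ann 1 R := by
    rw [himg]; exact fun x hx => ⟨hKC hx.1, fun hxE => hx.2 (hEK hxE)⟩
  have hTc : IsCompact (Function.invFunOn φ (ann 1 R) '' (K₁ \ interior K₁)) :=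
    hT.image_of_continuousOn ((continuousOn_invFunOn (isOpen_ann 1 R) hφ hinj).mono hTA)
  have hTann : Function.invFunOn φ (ann 1 R) '' (K₁ \ interior K₁) ⊆ ann 1 R := by
    rintro _ ⟨x, hx, rfl⟩
    exact Function.invFunOn_mem (hTA hx)
  obtain ⟨s, t, hs, hsR, ht, htR, hst⟩ : ∃ s t, 1 < s ∧ s < R ∧ 1 < t ∧ t < R ∧
      ∀ z ∈ ann 1 R, φ z ∈ K₁ \ interior K₁ → s ≤ ‖z‖ ∧ ‖z‖ ≤ t := by
    rcases (K₁ \ interior K₁).eq_empty_or_nonempty with h0 | h0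
    · refine ⟨(1 + R) / 2, (1 + R) / 2, by linarith, by linarith, by linarith, by linarith,
        fun z _ hz => ?_⟩
      rw [h0] at hz; exact absurd hz (notMem_empty _)
    · obtain ⟨zmin, hzmin, hmin⟩ := hTc.exists_isMinOn (h0.image _) continuous_norm.continuousOn
      obtain ⟨zmax, hzmax, hmax⟩ := hTc.exists_isMaxOn (h0.image _) continuous_norm.continuousOn
      refine ⟨‖zmin‖, ‖zmax‖, (hTann hzmin).1, (hTann hzmin).2, (hTann hzmax).1, (hTann hzmax).2,
        fun z hz hzT => ?_⟩
      have : z ∈ Function.invFunOn φ (ann 1 R) '' (K₁ \ interior K₁) :=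
        ⟨φ z, hzT, hinj.leftInvOn_invFunOn hz⟩
      exact ⟨hmin this, hmax this⟩
  -- A subannulus that avoids the preimage of K₁ \ interior K₁ is mapped either into the interior of
  -- K₁ or off K₁, by connectedness; this applies to both ends.
  have hdich : ∀ a b, 1 ≤ a → b ≤ R → (∀ z ∈ ann a b, φ z ∉ K₁ \ interior K₁) →
      (∀ z ∈ ann a b, φ z ∈ interior K₁) ∨ ∀ z ∈ ann a b, φ z ∉ K₁ := by
    intro a b ha hb hno
    have hpre : IsPreconnected (φ '' ann a b) := (isPreconnected_ann (by linarith)).image φ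
      (hφ.continuousOn.mono (ann_mono ha hb))
    have hcov : φ '' ann a b ⊆ interior K₁ ∪ K₁ᶜ := by
      rintro _ ⟨z, hz, rfl⟩
      by_contra hcon
      rw [mem_union, not_or, notMem_compl_iff] at hcon
      exact hno z hz ⟨hcon.2, hcon.1⟩
    rcases hpre.subset_or_subset isOpen_interior hK₁.isClosed.isOpen_compl
      (disjoint_compl_right.mono_left interior_subset) hcov with h | h
    · exact Or.inl fun z hz => h ⟨z, hz, rfl⟩
    · exact Or.inr fun z hz => h ⟨z, hz, rfl⟩
  have hcomp : IsCompact (φ '' {z : ℂ | s ≤ ‖z‖ ∧ ‖z‖ ≤ t}) :=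
    (isCompact_closed_ann s t).image_of_continuousOn
      (hφ.continuousOn.mono fun z hz => ⟨hs.trans_le hz.1, hz.2.trans_lt htR⟩)
  rcases hdich 1 s le_rfl hsR.le fun z hz h =>
    absurd (hst z (ann_mono le_rfl hsR.le hz) h).1 (not_le.2 hz.2) with h1 | h1
  · rcases hdich t R ht.le le_rfl fun z hz h =>
      absurd (hst z (ann_mono ht.le le_rfl hz) h).2 (not_le.2 hz.1) with h2 | h2
    · exfalso
      -- If both ends go into K₁, then the bounded open set `C` is also compact.
      have hCeq : C = K₁ ∪ φ '' {z : ℂ | s ≤ ‖z‖ ∧ ‖z‖ ≤ t} := by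
        refine Subset.antisymm (fun x hx => ?_) (union_subset hKC ?_)
        · by_cases hxE : x ∈ E
          · exact Or.inl (interior_subset (hEK hxE))
          · have : x ∈ φ '' ann 1 R := by rw [himg]; exact ⟨hx, hxE⟩
            obtain ⟨w, hw, rfl⟩ := this
            by_cases hws : ‖w‖ < s
            · exact Or.inl (interior_subset (h1 w ⟨hw.1, hws⟩))
            · by_cases hwt : t < ‖w‖
              · exact Or.inl (interior_subset (h2 w ⟨hwt, hw.2⟩))
              · exact Or.inr ⟨w, ⟨not_lt.1 hws, not_lt.1 hwt⟩, rfl⟩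
        · rintro _ ⟨w, hw, rfl⟩
          have : φ w ∈ C \ E := himg ▸ ⟨w, ⟨hs.trans_le hw.1, hw.2.trans_lt htR⟩, rfl⟩
          exact this.1
      have hCc : IsCompact C := by rw [hCeq]; exact hK₁.union hcomp
      have := eq_empty_of_frontier_eq_empty hCb (IsClopen.frontier_eq ⟨hCc.isClosed, hC⟩)
      exact (hne.mono hEC).ne_empty this
    · exact ⟨φ, R, collar_of_inner_outer hR hC hCb hEC hK₁ hEK hKC hφ hinj himg hs htR
        (fun z hz _ hzs => interior_subset (h1 z ⟨hz, hzs⟩)) (fun z _ hz hzt => h2 z ⟨hzt, hz⟩), hlog⟩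
  · rcases hdich t R ht.le le_rfl fun z hz h =>
      absurd (hst z (ann_mono ht.le le_rfl hz) h).2 (not_le.2 hz.1) with h2 | h2
    · -- reverse the orientation
      have hn : ∀ z : ℂ, ‖(R : ℂ) / z‖ = R / ‖z‖ := fun z => by
        rw [norm_div, Complex.norm_real, Real.norm_eq_abs, abs_of_pos hR0]
      have hmap : MapsTo (fun z : ℂ => (R : ℂ) / z) (ann 1 R) (ann 1 R) := by
        intro z hz
        have hz0 : 0 < ‖z‖ := zero_lt_one.trans hz.1
        refine ⟨?_, ?_⟩
        · change 1 < ‖(R : ℂ) / z‖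
          rw [hn, one_lt_div hz0]; exact hz.2
        · change ‖(R : ℂ) / z‖ < R
          rw [hn, div_lt_iff₀ hz0]; nlinarith [hz.1]
      have hinv : ∀ z ∈ ann 1 R, (R : ℂ) / ((R : ℂ) / z) = z := fun z _ =>
        div_div_cancel₀ (by exact_mod_cast hR0.ne')
      refine ⟨fun z => φ (R / z), R, collar_of_inner_outer (s := R / t) (t := R / s) hR hC hCb hEC
        hK₁ hEK hKC ?_ ?_ ?_ ?_ ?_ ?_ ?_, hlog⟩
      · refine hφ.comp (fun z hz => ?_) hmap
        have hz0 : z ≠ 0 := norm_pos_iff.1 (zero_lt_one.trans hz.1)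
        exact ((differentiableAt_const _).div differentiableAt_id hz0).differentiableWithinAt
      · intro z hz w hw hzw
        have := hinj (hmap hz) (hmap hw) hzw
        rw [← hinv z hz, ← hinv w hw]
        exact congrArg _ this
      · rw [← himg]
        ext x
        constructor
        · rintro ⟨z, hz, rfl⟩
          exact ⟨_, hmap hz, rfl⟩
        · rintro ⟨z, hz, rfl⟩
          exact ⟨_, hmap hz, by simp only [hinv z hz]⟩
      · rwa [one_lt_div (by linarith)]
      · rw [div_lt_iff₀ (by linarith)]; nlinarith
      · intro z hz1 hzR hzs
        refine interior_subset (h2 _ ⟨?_, (hmap ⟨hz1, hzR⟩).2⟩)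
        rw [hn, lt_div_iff₀ (by linarith)]
        rw [lt_div_iff₀ (by linarith)] at hzs
        linarith
      · intro z hz1 hzR hzt
        refine h1 _ ⟨(hmap ⟨hz1, hzR⟩).1, ?_⟩
        rw [hn, div_lt_iff₀ (by linarith)]
        rw [div_lt_iff₀ (by linarith)] at hzt
        linarith
    · exfalso
      -- If both ends go outside of K₁, then the compact set `E` is also open.
      have hEeq : E = interior K₁ \ φ '' {z : ℂ | s ≤ ‖z‖ ∧ ‖z‖ ≤ t} := by
        refine Subset.antisymm (fun x hx => ⟨hEK hx, ?_⟩) fun x hx => ?_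
        · rintro ⟨w, hw, rfl⟩
          have : φ w ∈ C \ E := himg ▸ ⟨w, ⟨hs.trans_le hw.1, hw.2.trans_lt htR⟩, rfl⟩
          exact this.2 hx
        · by_contra hxE
          have : x ∈ φ '' ann 1 R := by rw [himg]; exact ⟨hKC (interior_subset hx.1), hxE⟩
          obtain ⟨w, hw, rfl⟩ := this
          refine hx.2 ⟨w, ⟨not_lt.1 fun h => ?_, not_lt.1 fun h => ?_⟩, rfl⟩
          · exact h1 w ⟨hw.1, h⟩ (interior_subset hx.1)
          · exact h2 w ⟨h, hw.2⟩ (interior_subset hx.1)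
      have hEo : IsOpen E := by rw [hEeq]; exact isOpen_interior.sdiff hcomp.isClosed
      exact hne.ne_empty (eq_empty_of_frontier_eq_empty hE.isBounded
        (IsClopen.frontier_eq ⟨hE.isClosed, hEo⟩))

end Lyubich

/-! ### Topology and distortion of filled annuli. -/

namespace Lyubich

namespace Collar

variable {C E : Set ℂ} {φ : ℂ → ℂ} {R r s : ℝ}

theorem mem_of_norm (_h : Collar C E φ R) {w : ℂ} (h1 : 1 < ‖w‖) (h2 : ‖w‖ < R) : φ w ∈ C \ E :=
  _h.image_eq ▸ ⟨w, ⟨h1, h2⟩, rfl⟩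

theorem exists_norm (h : Collar C E φ R) {x : ℂ} (hx : x ∈ C) (hxE : x ∉ E) :
    ∃ w, 1 < ‖w‖ ∧ ‖w‖ < R ∧ φ w = x := by
  have : x ∈ φ '' ann 1 R := by rw [h.image_eq]; exact ⟨hx, hxE⟩
  obtain ⟨w, hw, rfl⟩ := this
  exact ⟨w, hw.1, hw.2, rfl⟩

theorem fill_subset_cfill : fill E φ r ⊆ cfill E φ r :=
  union_subset_union_right _ (image_mono fun _ hz => ⟨hz.1, hz.2.le⟩)

theorem cfill_subset_fill (hrs : r < s) : cfill E φ r ⊆ fill E φ s :=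
  union_subset_union_right _ (image_mono fun _ hz => ⟨hz.1, hz.2.trans_lt hrs⟩)

theorem cfill_subset (h : Collar C E φ R) (hr : r < R) : cfill E φ r ⊆ C := by
  rintro x (hx | ⟨w, hw, rfl⟩)
  · exact h.subset hx
  · exact (h.mem_of_norm hw.1 (hw.2.trans_lt hr)).1

theorem fill_subset (h : Collar C E φ R) (hr : r ≤ R) : fill E φ r ⊆ C := by
  rintro x (hx | ⟨w, hw, rfl⟩)
  · exact h.subset hx
  · exact (h.mem_of_norm hw.1 (hw.2.trans_le hr)).1

theorem mem_cfill_iff (h : Collar C E φ R) {w : ℂ} (h1 : 1 < ‖w‖) (h2 : ‖w‖ < R) (hr : r < R) :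
    φ w ∈ cfill E φ r ↔ ‖w‖ ≤ r := by
  constructor
  · rintro (hx | ⟨v, hv, hvw⟩)
    · exact absurd hx (h.mem_of_norm h1 h2).2
    · rw [← h.inj ⟨hv.1, hv.2.trans_lt hr⟩ ⟨h1, h2⟩ hvw]; exact hv.2
  · exact fun hw => Or.inr ⟨w, ⟨h1, hw⟩, rfl⟩

theorem mem_fill_iff (h : Collar C E φ R) {w : ℂ} (h1 : 1 < ‖w‖) (h2 : ‖w‖ < R) (hr : r ≤ R) :
    φ w ∈ fill E φ r ↔ ‖w‖ < r := by
  constructor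
  · rintro (hx | ⟨v, hv, hvw⟩)
    · exact absurd hx (h.mem_of_norm h1 h2).2
    · rw [← h.inj ⟨hv.1, hv.2.trans_le hr⟩ ⟨h1, h2⟩ hvw]; exact hv.2
  · exact fun hw => Or.inr ⟨w, ⟨h1, hw⟩, rfl⟩

theorem isCompact (h : Collar C E φ R) : IsCompact E := by
  have hm : 1 < (1 + R) / 2 ∧ (1 + R) / 2 < R := by constructor <;> linarith [h.one_lt]
  have e : E = cfill E φ ((1 + R) / 2) \ φ '' ann 1 R := by
    ext x
    constructor
    · exact fun hx => ⟨Or.inl hx, fun hx' => (h.image_eq ▸ hx').2 hx⟩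
    · rintro ⟨hx | ⟨w, hw, rfl⟩, hx2⟩
      · exact hx
      · exact absurd ⟨w, ⟨hw.1, hw.2.trans_lt hm.2⟩, rfl⟩ hx2
  rw [e]
  exact (h.isCompact_cfill _ hm.1 hm.2).diff
    (isOpen_image_of_injOn (isOpen_ann 1 R) h.holo h.inj (isOpen_ann 1 R) subset_rfl)

theorem frontier_fill_subset (h : Collar C E φ R) (h1 : 1 < r) (hr : r < R) :
    frontier (fill E φ r) ⊆ φ '' {z | ‖z‖ = r} := by
  intro x hx
  rw [(h.isOpen_fill r h1 hr).frontier_eq] at hx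
  have : x ∈ cfill E φ r :=
    closure_minimal fill_subset_cfill (h.isCompact_cfill r h1 hr).isClosed hx.1
  rcases this with hE | ⟨w, hw, rfl⟩
  · exact absurd (Or.inl hE) hx.2
  · refine ⟨w, le_antisymm hw.2 (not_lt.1 fun hlt => hx.2 (Or.inr ⟨w, ⟨hw.1, hlt⟩, rfl⟩)), rfl⟩

/-- The images of the filled core curves under a Sobolev homeomorphism have diameter bounded by the
Dirichlet integral over the annulus outside of them. -/
theorem dist_sq_le (h : Collar C E φ R) {g : ℂ ≃ₜ ℂ} {D : ℂ → ℂ →L[ℝ] ℂ} {Ω : Set ℂ}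
    (hg : HasWeakDiff g D Ω) {a b : ℝ} (ha : 1 ≤ a) (hab : a < b) (hb : b ≤ R)
    (hsub : φ '' ann a b ⊆ Ω) {p q : ℂ} (hp : ∀ s, a < s → p ∈ fill E φ s)
    (hq : ∀ s, a < s → q ∈ fill E φ s) :
    ENNReal.ofReal (dist (g p) (g q)) ^ 2 * ENNReal.ofReal (Real.log b - Real.log a) ≤
      ENNReal.ofReal (2 * Real.pi) * ∫⁻ w in φ '' ann a b, ‖D w‖ₑ ^ 2 := by
  refine length_area hg (by linarith) hab (h.holo.mono (ann_mono ha hb))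
    (h.inj.mono (ann_mono ha hb)) hsub fun s hs hsb => ?_
  obtain ⟨x, hx, y, hy, hxy⟩ := exists_frontier_dist_image_ge g
    (h.isBounded.subset (h.fill_subset (hsb.le.trans hb))) (hp s hs) (hq s hs)
  obtain ⟨x', hx', rfl⟩ := h.frontier_fill_subset (ha.trans_lt hs) (hsb.trans_le hb) hx
  obtain ⟨y', hy', rfl⟩ := h.frontier_fill_subset (ha.trans_lt hs) (hsb.trans_le hb) hy
  exact ⟨x', y', hx', hy', hxy⟩

/-- The complement of a filled core curve has no bounded components. -/
theorem eq_empty_of_frontier_subset (h : Collar C E φ R) (hs : 1 < s) (hsR : s < R) {V : Set ℂ}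
    (hV : IsOpen V) (hVb : Bornology.IsBounded V) (hdisj : Disjoint V (cfill E φ s))
    (hf : frontier V ⊆ cfill E φ s) : V = ∅ := by
  have hC : ∀ x ∈ C, x ∈ cfill E φ s ∨ x ∈ φ '' ann s R := by
    intro x hx
    by_cases hxE : x ∈ E
    · exact Or.inl (Or.inl hxE)
    · obtain ⟨w, h1, h2, rfl⟩ := h.exists_norm hx hxE
      rcases le_or_gt ‖w‖ s with hw | hw
      · exact Or.inl (Or.inr ⟨w, ⟨h1, hw⟩, rfl⟩)
      · exact Or.inr ⟨w, ⟨hw, h2⟩, rfl⟩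
  have hA : IsPreconnected (φ '' ann s R) := (isPreconnected_ann (by linarith)).image φ
    (h.holo.continuousOn.mono (ann_mono hs.le le_rfl))
  have hAf : ¬ (φ '' ann s R ∩ frontier V).Nonempty := by
    rintro ⟨_, ⟨w, hw, rfl⟩, hwf⟩
    exact not_le.2 hw.1 ((h.mem_cfill_iff (hs.trans hw.1) hw.2 hsR).1 (hf hwf))
  -- The outer annulus misses the frontier of `V`. If it is disjoint from `V`, then `V` has no
  -- frontier; if it is contained in `V`, then `V ∪ C` is clopen.
  rcases (φ '' ann s R ∩ V).eq_empty_or_nonempty with h0 | h0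
  · refine eq_empty_of_frontier_eq_empty hVb (eq_empty_iff_forall_notMem.2 fun x hx => ?_)
    have hxC : x ∈ C := h.cfill_subset hsR (hf hx)
    obtain ⟨y, hyC, hyV⟩ := mem_closure_iff.1 hx.1 C h.isOpen hxC
    rcases hC y hyC with hy | hy
    · exact disjoint_left.1 hdisj hyV hy
    · exact (eq_empty_iff_forall_notMem.1 h0) y ⟨hy, hyV⟩
  · have hAV : φ '' ann s R ⊆ V := by
      intro x hx
      by_contra hxV
      exact hAf (inter_frontier_nonempty hA h0 ⟨x, hx, hxV⟩)
    have e : V ∪ C = V ∪ cfill E φ s := by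
      refine Subset.antisymm (union_subset subset_union_left fun x hx => ?_)
        (union_subset_union_right _ (h.cfill_subset hsR))
      exact (hC x hx).elim Or.inr fun hx => Or.inl (hAV hx)
    have hcl : IsClosed (V ∪ C) := by
      rw [e, ← closure_subset_iff_isClosed, closure_union,
        (h.isCompact_cfill s hs hsR).isClosed.closure_eq, closure_eq_self_union_frontier]
      exact union_subset (union_subset subset_union_left (hf.trans subset_union_right))
        subset_union_right
    have := eq_empty_of_frontier_eq_empty (hVb.union h.isBounded)
      (IsClopen.frontier_eq ⟨hcl, hV.union h.isOpen⟩)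
    exact subset_empty_iff.1 (this ▸ subset_union_left)

/-- A bounded open set whose frontier is inside of a core curve lies inside of the core curve. -/
theorem subset_cfill_of_frontier_subset (h : Collar C E φ R) (hs : 1 < s) (hsR : s < R) {P : Set ℂ}
    (hP : IsOpen P) (hPb : Bornology.IsBounded P) (hf : frontier P ⊆ fill E φ s) :
    P ⊆ cfill E φ s := by
  have hcl := (h.isCompact_cfill s hs hsR).isClosed
  refine sdiff_eq_empty.1 (h.eq_empty_of_frontier_subset hs hsR (hP.sdiff hcl)
    (hPb.subset sdiff_subset) disjoint_sdiff_left fun x hx => ?_)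
  have hxf : x ∉ fill E φ s := fun hxf => by
    obtain ⟨y, hy1, hy2⟩ := mem_closure_iff.1 hx.1 _ (h.isOpen_fill s hs hsR) hxf
    exact hy2.2 (fill_subset_cfill hy1)
  have hxP : x ∈ P := by
    by_contra hxP
    refine hxf (hf ⟨closure_mono sdiff_subset hx.1, ?_⟩)
    rwa [hP.interior_eq]
  by_contra hxc
  rw [(hP.sdiff hcl).frontier_eq] at hx
  exact hx.2 ⟨hxP, hxc⟩

/-- Part of the annulus is traded for a larger core: the annulus up to radius b joins `E`, and the
collar that is left has logarithmic width log R - log b after rescaling. -/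
theorem shrink (h : Collar C E φ R) {b : ℝ} (hb : 1 < b) (hbR : b < R) :
    Collar C (cfill E φ b) (fun z => φ (b * z)) (R / b) := by
  have hb0 : 0 < b := by linarith
  have hn : ∀ z : ℂ, ‖(b : ℂ) * z‖ = b * ‖z‖ := fun z => by
    rw [norm_mul, Complex.norm_real, Real.norm_eq_abs, abs_of_pos hb0]
  have himg : ∀ I : Set ℝ, (fun z => φ (b * z)) '' {z : ℂ | ‖z‖ ∈ I} =
      φ '' {z : ℂ | ‖z‖ / b ∈ I} := by
    intro I
    ext x
    constructor
    · rintro ⟨z, hz, rfl⟩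
      refine ⟨b * z, ?_, rfl⟩
      rw [mem_ofPred_eq, hn, mul_div_cancel_left₀ _ hb0.ne']
      exact hz
    · rintro ⟨z, hz, rfl⟩
      have e : (b : ℂ) * (z / b) = z := mul_div_cancel₀ _ (by exact_mod_cast hb0.ne')
      refine ⟨z / b, ?_, by simp only [e]⟩
      have := hn (z / b)
      rw [e] at this
      rw [mem_ofPred_eq] at hz ⊢
      rwa [this, mul_div_cancel_left₀ _ hb0.ne'] at hz
  have himgo : ∀ r, (fun z => φ (b * z)) '' ann 1 r = φ '' ann b (b * r) := fun r => by
    have := himg (Ioo 1 r)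
    refine this.trans (congrArg _ (Set.ext fun z => ?_))
    rw [mem_ofPred_eq, mem_Ioo, one_lt_div hb0, div_lt_iff₀' hb0]
    rfl
  have himgc : ∀ r, (fun z => φ (b * z)) '' {z | 1 < ‖z‖ ∧ ‖z‖ ≤ r} =
      φ '' {z | b < ‖z‖ ∧ ‖z‖ ≤ b * r} := fun r => by
    have := himg (Ioc 1 r)
    refine this.trans (congrArg _ (Set.ext fun z => ?_))
    rw [mem_ofPred_eq, mem_Ioc, one_lt_div hb0, div_le_iff₀' hb0]
    rfl
  have hmaps : MapsTo (fun z : ℂ => (b : ℂ) * z) (ann 1 (R / b)) (ann 1 R) := by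
    intro z hz
    change 1 < ‖(b : ℂ) * z‖ ∧ ‖(b : ℂ) * z‖ < R
    rw [hn]
    have h2 := hz.2
    rw [lt_div_iff₀' hb0] at h2
    exact ⟨by nlinarith [hz.1], h2⟩
  have hbr : ∀ r, r < R / b → b * r < R := fun r hr => by rwa [lt_div_iff₀' hb0] at hr
  have hfill : ∀ r, 1 < r → fill (cfill E φ b) (fun z => φ (b * z)) r = fill E φ (b * r) := by
    intro r hr
    rw [fill, himgo, cfill, fill, union_assoc, ← image_union]
    congr 2
    ext z
    have : b < b * r := by nlinarith
    constructor
    · rintro (hz | hz)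
      · exact ⟨hz.1, hz.2.trans_lt this⟩
      · exact ⟨hb.trans hz.1, hz.2⟩
    · intro hz
      rcases le_or_gt ‖z‖ b with hzb | hzb
      · exact Or.inl ⟨hz.1, hzb⟩
      · exact Or.inr ⟨hzb, hz.2⟩
  have hcfill : ∀ r, 1 < r → cfill (cfill E φ b) (fun z => φ (b * z)) r = cfill E φ (b * r) := by
    intro r hr
    rw [cfill, himgc, cfill, cfill, union_assoc, ← image_union]
    congr 2
    ext z
    have : b ≤ b * r := by nlinarith
    constructor
    · rintro (hz | hz)
      · exact ⟨hz.1, hz.2.trans this⟩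
      · exact ⟨hb.trans hz.1, hz.2⟩
    · intro hz
      rcases le_or_gt ‖z‖ b with hzb | hzb
      · exact Or.inl ⟨hz.1, hzb⟩
      · exact Or.inr ⟨hzb, hz.2⟩
  refine ⟨by rwa [one_lt_div hb0], h.holo.comp (by fun_prop) hmaps, ?_, ?_, h.cfill_subset hbR,
    h.isOpen, h.isBounded, fun r hr hrR => ?_, fun r hr hrR => ?_⟩
  · intro z hz w hw hzw
    exact mul_left_cancel₀ (by exact_mod_cast hb0.ne') (h.inj (hmaps hz) (hmaps hw) hzw)
  · rw [himgo, mul_div_cancel₀ _ hb0.ne']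
    ext x
    constructor
    · rintro ⟨w, hw, rfl⟩
      refine ⟨(h.mem_of_norm (hb.trans hw.1) hw.2).1, fun hx => ?_⟩
      exact not_le.2 hw.1 ((h.mem_cfill_iff (hb.trans hw.1) hw.2 hbR).1 hx)
    · rintro ⟨hxC, hx⟩
      obtain ⟨w, h1, h2, rfl⟩ := h.exists_norm hxC fun hE => hx (Or.inl hE)
      exact ⟨w, ⟨not_le.1 fun hle => hx (Or.inr ⟨w, ⟨h1, hle⟩, rfl⟩), h2⟩, rfl⟩
  · rw [hfill r hr]
    exact h.isOpen_fill _ (by nlinarith) (hbr r hrR)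
  · rw [hcfill r hr]
    exact h.isCompact_cfill _ (by nlinarith) (hbr r hrR)

end Collar

end Lyubich

namespace Lyubich

/-! ### Logarithmic cutoff functions -/

theorem abs_log_sub_log_le {x y : ℝ} (hx : 1 ≤ x) (hy : 1 ≤ y) :
    |Real.log x - Real.log y| ≤ |x - y| := by
  wlog hxy : y ≤ x generalizing x y
  · rw [abs_sub_comm, abs_sub_comm x]; exact this hy hx (not_le.1 hxy).le
  have hy0 : 0 < y := by linarith
  rw [abs_of_nonneg (sub_nonneg.2 (Real.log_le_log hy0 hxy)), abs_of_nonneg (sub_nonneg.2 hxy),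
    ← Real.log_div (by linarith) hy0.ne']
  refine (Real.log_le_sub_one_of_pos (by positivity)).trans ?_
  rw [div_sub_one hy0.ne', div_le_iff₀ hy0]
  nlinarith

/-- The profile of the logarithmic cutoff functions. -/
theorem exists_log_cutoff_profile {lam : ℝ} (hlam : 0 < lam) :
    ∃ (θ : ℝ → ℝ) (L : NNReal), ContDiff ℝ ∞ θ ∧ LipschitzWith L θ ∧ (∀ x, 0 ≤ θ x ∧ θ x ≤ 1) ∧
      (∀ x, 0 ≤ x → x ≤ lam / 3 → θ x = 1) ∧ ∀ x, 2 * lam / 3 ≤ x → θ x = 0 := by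
  let ψ : ContDiffBump (0 : ℝ) := ⟨1, 2, one_pos, one_lt_two⟩
  have hψ : ContDiff ℝ ∞ (ψ : ℝ → ℝ) := ψ.contDiff
  obtain ⟨L, hL⟩ := hψ.lipschitzWith_of_hasCompactSupport ψ.hasCompactSupport (by simp)
  have hlin : LipschitzWith (Real.toNNReal (3 / lam)) fun x : ℝ => 3 / lam * x := by
    refine LipschitzWith.of_dist_le_mul fun x y => ?_
    rw [Real.coe_toNNReal _ (by positivity), Real.dist_eq, Real.dist_eq, ← mul_sub, abs_mul,
      abs_of_pos (by positivity)]
  -- The factor 3/lam carries the thresholds lam/3 and 2 lam/3 to the radii 1 and 2 of the bump.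
  refine ⟨fun x => ψ (3 / lam * x), L * Real.toNNReal (3 / lam), hψ.comp (by fun_prop),
    hL.comp hlin, fun x => ⟨ψ.nonneg, ψ.le_one⟩, fun x h0 hx => ?_, fun x hx => ?_⟩
  · refine ψ.one_of_mem_closedBall ?_
    rw [mem_closedBall_zero_iff, Real.norm_eq_abs, abs_of_nonneg (by positivity)]
    change _ ≤ (1 : ℝ)
    rw [div_mul_eq_mul_div, div_le_one hlam]; linarith
  · have hx0 : 0 ≤ x := le_trans (by positivity) hx
    refine ψ.zero_of_le_dist ?_
    rw [dist_zero_right, Real.norm_eq_abs, abs_of_nonneg (by positivity)]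
    change (2 : ℝ) ≤ _
    rw [div_mul_eq_mul_div, le_div_iff₀ hlam]; linarith

/-- Annuli of definite modulus carry cutoff functions of bounded Dirichlet integral. -/
theorem exists_cutoff {lam : ℝ} (hlam : 0 < lam) : ∃ c : ℝ, 0 ≤ c ∧
    ∀ {C E : Set ℂ} {φ : ℂ → ℂ} {R : ℝ}, Collar C E φ R → lam ≤ Real.log R →
      ∃ χ : ℂ → ℝ, ContDiff ℝ ∞ χ ∧ (∀ z, 0 ≤ χ z ∧ χ z ≤ 1) ∧
        (∀ z ∈ fill E φ (Real.exp (lam / 3)), χ z = 1) ∧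
        (∀ z ∉ fill E φ (Real.exp (2 * lam / 3)), χ z = 0) ∧
        ∫⁻ z, ‖fderiv ℝ (fun z => (χ z : ℂ)) z‖ₑ ^ 2 ≤ ENNReal.ofReal c := by
  obtain ⟨θ, L, hθ, hθL, hθb, hθ1, hθ0⟩ := exists_log_cutoff_profile hlam
  set ρ := Real.exp (2 * lam / 3) with hρ
  -- In the round annulus the cutoff has gradient at most L and vanishes beyond the radius ρ, so its
  -- energy is at most L² times the area of a disk of radius ρ.
  refine ⟨(L : ℝ) ^ 2 * (Real.pi * ρ ^ 2), by positivity, fun {C E φ R} h hR => ?_⟩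
  classical
  have hR0 : 0 < R := by linarith [h.one_lt]
  have hRe : Real.exp lam ≤ R := by
    rw [← Real.exp_log hR0]; exact Real.exp_le_exp.2 hR
  have he1 : 1 < Real.exp (lam / 3) := Real.one_lt_exp_iff.2 (by positivity)
  have heρ : Real.exp (lam / 3) < ρ := Real.exp_lt_exp.2 (by linarith)
  have hρR : ρ < R := (Real.exp_lt_exp.2 (by linarith)).trans_le hRe
  set κ := Function.invFunOn φ (ann 1 R) with hκ
  have hκφ : ∀ w ∈ ann 1 R, κ (φ w) = w := fun w hw => h.inj.leftInvOn_invFunOn hw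
  have hAo : IsOpen (φ '' ann 1 R) :=
    isOpen_image_of_injOn (isOpen_ann 1 R) h.holo h.inj (isOpen_ann 1 R) subset_rfl
  set χ : ℂ → ℝ := fun z => if z ∈ E then 1 else if z ∈ C then θ (Real.log ‖κ z‖) else 0 with hχ
  have hχA : ∀ w ∈ ann 1 R, χ (φ w) = θ (Real.log ‖w‖) := by
    intro w hw
    have := h.mem_of_norm hw.1 hw.2
    simp only [hχ, if_neg this.2, if_pos this.1, hκφ w hw]
  have h1 : ∀ z ∈ fill E φ (Real.exp (lam / 3)), χ z = 1 := by
    rintro z (hz | ⟨w, hw, rfl⟩)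
    · simp only [hχ, if_pos hz]
    · have hw0 : 0 < ‖w‖ := zero_lt_one.trans hw.1
      rw [hχA w ⟨hw.1, hw.2.trans (heρ.trans hρR)⟩]
      refine hθ1 _ (Real.log_nonneg hw.1.le) ?_
      rw [← Real.log_exp (lam / 3)]
      exact Real.log_le_log hw0 hw.2.le
  have h0 : ∀ z ∉ fill E φ ρ, χ z = 0 := by
    intro z hz
    have hzE : z ∉ E := fun hzE => hz (Or.inl hzE)
    by_cases hzC : z ∈ C
    · obtain ⟨w, hw1, hw2, rfl⟩ := h.exists_norm hzC hzE
      rw [hχA w ⟨hw1, hw2⟩]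
      refine hθ0 _ ?_
      rw [← Real.log_exp (2 * lam / 3)]
      refine Real.log_le_log (Real.exp_pos _) (not_lt.1 fun hlt => hz (Or.inr ⟨w, ⟨hw1, hlt⟩, rfl⟩))
    · simp only [hχ, if_neg hzE, if_neg hzC]
  have hloc1 : ∀ z ∈ E, χ =ᶠ[𝓝 z] fun _ => 1 := fun z hz => by
    filter_upwards [(h.isOpen_fill _ he1 (heρ.trans hρR)).mem_nhds (Or.inl hz)] with w hw
      using h1 w hw
  have hloc0 : ∀ z ∉ C, χ =ᶠ[𝓝 z] fun _ => 0 := fun z hz => by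
    have ho := (h.isCompact_cfill ρ (he1.trans heρ) hρR).isClosed.isOpen_compl
    filter_upwards [ho.mem_nhds fun hz' => hz (h.cfill_subset hρR hz')] with w hw
    exact h0 w fun hw' => hw (Collar.fill_subset_cfill hw')
  have hsmooth : ContDiff ℝ ∞ χ := by
    rw [contDiff_iff_contDiffAt]
    intro z
    by_cases hzE : z ∈ E
    · exact contDiffAt_const.congr_of_eventuallyEq (hloc1 z hzE)
    by_cases hzC : z ∈ C
    · have hzA : z ∈ φ '' ann 1 R := by rw [h.image_eq]; exact ⟨hzC, hzE⟩
      have heq : χ =ᶠ[𝓝 z] fun z => θ (Real.log ‖κ z‖) := by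
        filter_upwards [hAo.mem_nhds hzA] with y hy
        obtain ⟨w, hw, rfl⟩ := hy
        rw [hχA w hw, hκφ w hw]
      refine ContDiffAt.congr_of_eventuallyEq ?_ heq
      have hκz : 1 < ‖κ z‖ := (Function.invFunOn_mem hzA).1
      have hκs : ContDiffAt ℝ ∞ κ z :=
        (((differentiableOn_invFunOn (isOpen_ann 1 R) h.holo h.inj).analyticAt
          (hAo.mem_nhds hzA)).contDiffAt (𝕜 := ℂ)).restrict_scalars ℝ
      have hne : κ z ≠ 0 := norm_pos_iff.1 (zero_lt_one.trans hκz)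
      exact hθ.contDiffAt.comp z ((hκs.norm ℝ hne).log (norm_ne_zero_iff.2 hne))
    · exact contDiffAt_const.congr_of_eventuallyEq (hloc0 z hzC)
  refine ⟨χ, hsmooth, fun z => ?_, h1, h0, ?_⟩
  · simp only [hχ]
    split_ifs
    · exact ⟨zero_le_one, le_rfl⟩
    · exact hθb _
    · exact ⟨le_rfl, zero_le_one⟩
  set X : ℂ → ℂ := fun z => (χ z : ℂ) with hX
  have hXs : ContDiff ℝ ∞ X := Complex.ofRealCLM.contDiff.comp hsmooth
  have hzero : ∀ z ∉ φ '' ann 1 R, fderiv ℝ X z = 0 := by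
    intro z hz
    rw [h.image_eq] at hz
    by_cases hzE : z ∈ E
    · have : X =ᶠ[𝓝 z] fun _ => 1 := (hloc1 z hzE).mono fun w hw => by simp [hX, hw]
      rw [this.fderiv_eq]; simp
    · have hzC : z ∉ C := fun hzC => hz ⟨hzC, hzE⟩
      have : X =ᶠ[𝓝 z] fun _ => 0 := (hloc0 z hzC).mono fun w hw => by simp [hX, hw]
      rw [this.fderiv_eq]; simp
  have hdom : ∫⁻ z, ‖fderiv ℝ X z‖ₑ ^ 2 = ∫⁻ z in φ '' ann 1 R, ‖fderiv ℝ X z‖ₑ ^ 2 := by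
    rw [← lintegral_indicator hAo.measurableSet]
    refine lintegral_congr fun z => ?_
    by_cases hz : z ∈ φ '' ann 1 R
    · rw [indicator_of_mem hz]
    · rw [indicator_of_notMem hz, hzero z hz, enorm_zero_clm]; simp
  -- Conformal invariance moves the energy to the round annulus, where the cutoff is radial.
  rw [hdom, ← lintegral_sq_comp_holomorphic (isOpen_ann 1 R).measurableSet
    (fun z hz => h.holo.differentiableAt ((isOpen_ann 1 R).mem_nhds hz)) h.inj]
  -- the function in the round annulus
  set Θ : ℂ → ℂ := fun w => (θ (Real.log ‖w‖) : ℂ) with hΘ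
  have hΘL : LipschitzOnWith L Θ {w | 1 < ‖w‖} := by
    refine LipschitzOnWith.of_dist_le_mul fun x hx y hy => ?_
    calc dist (Θ x) (Θ y) = dist (θ (Real.log ‖x‖)) (θ (Real.log ‖y‖)) := by
          rw [hΘ, Complex.dist_eq, ← Complex.ofReal_sub, Complex.norm_real, Real.dist_eq,
            Real.norm_eq_abs]
      _ ≤ L * dist (Real.log ‖x‖) (Real.log ‖y‖) := hθL.dist_le_mul _ _
      _ ≤ L * dist x y := by
          gcongr
          rw [Real.dist_eq, dist_eq_norm]
          exact (abs_log_sub_log_le (le_of_lt hx) (le_of_lt hy)).trans (abs_norm_sub_norm_le x y)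
  have hder : ∀ w ∈ ann 1 R, (fderiv ℝ X (φ w)).comp (ContinuousLinearMap.mul ℝ ℂ (deriv φ w)) =
      fderiv ℝ Θ w := by
    intro w hw
    have hc : HasFDerivAt (X ∘ φ) ((fderiv ℝ X (φ w)).comp
        (ContinuousLinearMap.mul ℝ ℂ (deriv φ w))) w :=
      HasFDerivAt.comp w ((hXs.differentiable (by simp)) _).hasFDerivAt
        (hasFDerivAt_real_of_differentiableAt
          (h.holo.differentiableAt ((isOpen_ann 1 R).mem_nhds hw)))
    have heq : Θ =ᶠ[𝓝 w] X ∘ φ := by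
      filter_upwards [(isOpen_ann 1 R).mem_nhds hw] with y hy
      simp only [hΘ, hX, Function.comp, hχA y hy]
    exact (hc.congr_of_eventuallyEq heq).fderiv.symm
  have hbound : ∀ w ∈ ann 1 R, ‖(fderiv ℝ X (φ w)).comp
      (ContinuousLinearMap.mul ℝ ℂ (deriv φ w))‖ₑ ^ 2 ≤
      (Metric.closedBall (0 : ℂ) ρ).indicator (fun _ => ENNReal.ofReal ((L : ℝ) ^ 2)) w := by
    intro w hw
    rw [hder w hw]
    by_cases hwρ : w ∈ Metric.closedBall (0 : ℂ) ρ
    · rw [indicator_of_mem hwρ, ← ofReal_norm, ← ENNReal.ofReal_pow (norm_nonneg _)]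
      refine ENNReal.ofReal_le_ofReal ?_
      have : {w : ℂ | 1 < ‖w‖} ∈ 𝓝 w := (isOpen_lt continuous_const continuous_norm).mem_nhds hw.1
      have := norm_fderiv_le_of_lipschitzOn ℝ this hΘL
      gcongr
    · have : Θ =ᶠ[𝓝 w] fun _ => 0 := by
        filter_upwards [Metric.isClosed_closedBall.isOpen_compl.mem_nhds hwρ] with y hy
        rw [mem_compl_iff, mem_closedBall_zero_iff, not_le] at hy
        have : θ (Real.log ‖y‖) = 0 := by
          refine hθ0 _ ?_
          rw [← Real.log_exp (2 * lam / 3)]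
          exact Real.log_le_log (Real.exp_pos _) hy.le
        simp [hΘ, this]
      rw [this.fderiv_eq, indicator_of_notMem hwρ]
      simp
  calc ∫⁻ w in ann 1 R, ‖(fderiv ℝ X (φ w)).comp (ContinuousLinearMap.mul ℝ ℂ (deriv φ w))‖ₑ ^ 2
      ≤ ∫⁻ w in ann 1 R, (Metric.closedBall (0 : ℂ) ρ).indicator
          (fun _ => ENNReal.ofReal ((L : ℝ) ^ 2)) w :=
        setLIntegral_mono' (isOpen_ann 1 R).measurableSet hbound
    _ ≤ ∫⁻ w, (Metric.closedBall (0 : ℂ) ρ).indicator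
          (fun _ => ENNReal.ofReal ((L : ℝ) ^ 2)) w := setLIntegral_le_lintegral _ _
    _ = ENNReal.ofReal ((L : ℝ) ^ 2 * (Real.pi * ρ ^ 2)) := by
        rw [lintegral_indicator Metric.isClosed_closedBall.measurableSet, lintegral_const,
          Measure.restrict_apply_univ, Complex.volume_closedBall, ENNReal.ofReal_mul (by positivity),
          ENNReal.ofReal_mul (by positivity), ENNReal.ofReal_pow (Real.exp_pos _).le,
          mul_comm (ENNReal.ofReal Real.pi)]
        congr 2
        rw [← ENNReal.ofReal_coe_nnreal, NNReal.coe_real_pi]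

end Lyubich

namespace Lyubich

/-! ### Quadratic-like maps -/

namespace IsQuadraticLike

variable {f : ℂ → ℂ} {U' U : Set ℂ}

theorem mapsTo_filledJulia : MapsTo f (filledJulia f U') (filledJulia f U') := fun z hz n => by
  rw [← Function.iterate_succ_apply]; exact hz (n + 1)

theorem filledJulia_subset : filledJulia f U' ⊆ U' := fun _ hz => hz 0

theorem mem_filledJulia_of_apply {z : ℂ} (hz : z ∈ U') (hfz : f z ∈ filledJulia f U') :
    z ∈ filledJulia f U' := fun n => by
  cases n with
  | zero => exact hz
  | succ n => rw [Function.iterate_succ_apply]; exact hfz n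

theorem dom_subset (h : IsQuadraticLike f U' U) : U' ⊆ U := subset_closure.trans h.closure_subset

/-- Non-escaping orbits stay in the points of U' that `f` sends to the closure of U'. Since this
closure lies in U, properness makes this set compact, and the filled Julia set is cut out of it by
closed conditions. -/
theorem isCompact_filledJulia (h : IsQuadraticLike f U' U) : IsCompact (filledJulia f U') := by
  set A := U' ∩ f ⁻¹' closure U' with hA
  have hAc : IsCompact A := h.proper _ h.closure_subset h.isCompact_closure
  have hcont : ContinuousOn f A := h.holo.continuousOn.mono inter_subset_left
  have hKn : ∀ n : ℕ, IsClosed {z | ∀ j ≤ n, f^[j] z ∈ A} := by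
    intro n
    induction n with
    | zero =>
      convert hAc.isClosed using 1
      ext z; simp
    | succ n ih =>
      have : {z | ∀ j ≤ n + 1, f^[j] z ∈ A} = A ∩ f ⁻¹' {z | ∀ j ≤ n, f^[j] z ∈ A} := by
        ext z
        constructor
        · intro hz
          refine ⟨hz 0 (Nat.zero_le _), fun j hj => ?_⟩
          rw [← Function.iterate_succ_apply]; exact hz (j + 1) (by omega)
        · rintro ⟨h0, hz⟩ j hj
          cases j with
          | zero => exact h0
          | succ j => rw [Function.iterate_succ_apply]; exact hz j (by omega)
      rw [this]
      exact hcont.preimage_isClosed_of_isClosed hAc.isClosed ih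
  have e : filledJulia f U' = A ∩ ⋂ n : ℕ, {z | ∀ j ≤ n, f^[j] z ∈ A} := by
    ext z
    constructor
    · intro hz
      have hzA : ∀ j, f^[j] z ∈ A := fun j => by
        refine ⟨hz j, subset_closure ?_⟩
        rw [← Function.iterate_succ_apply' f j z]; exact hz (j + 1)
      exact ⟨hzA 0, mem_iInter.2 fun n j _ => hzA j⟩
    · rintro ⟨-, hz⟩ n
      exact (mem_iInter.1 hz n n le_rfl).1
  rw [e]
  exact hAc.inter_right (isClosed_iInter hKn)

theorem julia_subset_filledJulia (h : IsQuadraticLike f U' U) : julia f U' ⊆ filledJulia f U' :=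
  h.isCompact_filledJulia.isClosed.frontier_subset

theorem isCompact_julia (h : IsQuadraticLike f U' U) : IsCompact (julia f U') :=
  h.isCompact_filledJulia.of_isClosed_subset isClosed_frontier h.julia_subset_filledJulia

/-- If f z were an interior point of the filled Julia set, then by continuity no point near `z`
would escape. -/
theorem mapsTo_julia (h : IsQuadraticLike f U' U) : MapsTo f (julia f U') (julia f U') := by
  intro z hz
  have hzK := h.julia_subset_filledJulia hz
  have hclosed := h.isCompact_filledJulia.isClosed
  rw [julia, hclosed.frontier_eq] at hz ⊢
  refine ⟨mapsTo_filledJulia hzK, fun h_integral => hz.2 ?_⟩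
  have hzU := h.isOpen_dom.mem_nhds (filledJulia_subset hzK)
  have hc : ContinuousAt f z := h.holo.continuousOn.continuousAt hzU
  rw [mem_interior_iff_mem_nhds] at h_integral ⊢
  filter_upwards [hzU, hc h_integral] with w hw hfw
  exact mem_filledJulia_of_apply hw hfw

theorem exists_preimage (h : IsQuadraticLike f U' U) {w : ℂ} (hw : w ∈ U) : ∃ z ∈ U', f z = w := by
  by_contra hcon
  push Not at hcon
  have h2 := h.degree_two w hw
  have : {z | z ∈ U' ∧ f z = w} = ∅ := eq_empty_iff_forall_notMem.2 fun z hz => hcon z hz.1 hz.2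
  rw [this] at h2
  simp at h2

theorem analyticOnNhd (h : IsQuadraticLike f U' U) : AnalyticOnNhd ℂ f U' :=
  h.holo.analyticOnNhd h.isOpen_dom

/-- A quadratic-like map is nowhere locally constant. -/
theorem not_eventually_const (h : IsQuadraticLike f U' U) {z : ℂ} (hz : z ∈ U') (c : ℂ) :
    ¬ ∀ᶠ w in 𝓝 z, f w = c := by
  intro hev
  have hconst : EqOn f (fun _ => c) U' :=
    h.analyticOnNhd.eqOn_of_preconnected_of_eventuallyEq analyticOnNhd_const
      h.disk_dom.isPathConnected.isConnected.isPreconnected hz hev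
  obtain ⟨w, hw, hwc⟩ : ∃ w ∈ U, w ≠ c := by
    have h0 : (0 : ℂ) ∈ U := h.dom_subset h.zero_mem
    have h1 : ∀ᶠ w in 𝓝[≠] (0 : ℂ), w ∈ U := mem_nhdsWithin_of_mem_nhds (h.isOpen_cod.mem_nhds h0)
    by_cases hc : c = 0
    · obtain ⟨w, hw, hne⟩ := (h1.and eventually_mem_nhdsWithin).exists
      exact ⟨w, hw, by rw [hc]; exact hne⟩
    · exact ⟨0, h0, Ne.symm hc⟩
  obtain ⟨z', hz', hfz'⟩ := h.exists_preimage hw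
  exact hwc (by rw [← hfz', hconst hz'])

end IsQuadraticLike

/-! ### Towers of renormalizations -/

namespace RenormalizationTower

variable {f : ℂ → ℂ} {U' U : Set ℂ} (T : RenormalizationTower f U' U)

/-- The filled Julia set of the `m`-fold renormalization. -/
def littleK (m : ℕ) : Set ℂ := filledJulia f^[T.period m] (T.V' m)

/-- The orbit of little filled Julia sets. -/
def filledOrbit (m : ℕ) : Set ℂ := ⋃ i ∈ Finset.range (T.period m), f^[i] '' T.littleK m

theorem period_zero : T.period 0 = 1 := by simp [period]

theorem period_succ (m : ℕ) : T.period (m + 1) = T.period m * T.q m := by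
  simp [period, Finset.prod_range_succ]

theorem period_pos (m : ℕ) : 0 < T.period m := by
  induction m with
  | zero => simp [period_zero]
  | succ m ih => rw [period_succ]; exact Nat.mul_pos ih (by have := (T.renorm m).two_le; omega)

theorem quadraticLike_iterate (m : ℕ) :
    IsQuadraticLike f^[T.period m] (T.V' m) (T.V m) := by
  cases m with
  | zero => rw [period_zero, Function.iterate_one, T.V'_zero, T.V_zero]; exact T.quadraticLike
  | succ m => rw [period_succ, Function.iterate_mul]; exact (T.renorm m).quadraticLike

theorem mapsTo_dom (m : ℕ) : ∀ i < T.period m, MapsTo f^[i] (T.V' m) U' := by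
  induction m with
  | zero =>
    intro i hi
    rw [period_zero] at hi
    obtain rfl : i = 0 := by omega
    rw [T.V'_zero]; exact mapsTo_id _
  | succ m ih =>
    intro i hi
    rw [period_succ] at hi
    have hp := T.period_pos m
    have e : i = i % T.period m + T.period m * (i / T.period m) := (Nat.mod_add_div _ _).symm
    rw [e, Function.iterate_add, Function.iterate_mul]
    exact (ih _ (Nat.mod_lt _ hp)).comp ((T.renorm m).mapsTo _ (Nat.div_lt_of_lt_mul hi))

theorem differentiableOn_iterate (m : ℕ) {i : ℕ} (hi : i ≤ T.period m) :
    DifferentiableOn ℂ f^[i] (T.V' m) := by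
  induction i with
  | zero => exact differentiableOn_id
  | succ i ih =>
    rw [Function.iterate_succ']
    exact T.quadraticLike.holo.comp (ih (by omega)) (T.mapsTo_dom m i (by omega))

/-- Time is divided by q with remainder: multiples of q keep the orbit in the smaller disk, and
fewer than q further steps keep it in the previous domain. -/
theorem littleK_succ_subset (m : ℕ) : T.littleK (m + 1) ⊆ T.littleK m := by
  intro z hz n
  have hq : 0 < T.q m := by have := (T.renorm m).two_le; omega
  have e : n = n % T.q m + T.q m * (n / T.q m) := (Nat.mod_add_div _ _).symm
  rw [e, Function.iterate_add, Function.comp_apply]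
  refine (T.renorm m).mapsTo _ (Nat.mod_lt _ hq) ?_
  have := hz (n / T.q m)
  rw [period_succ, Function.iterate_mul] at this
  rwa [Function.iterate_mul (f^[T.period m])]

theorem zero_mem_littleK (m : ℕ) : (0 : ℂ) ∈ T.littleK m := by
  refine T.littleK_succ_subset m ?_
  have := (T.renorm m).nonescaping
  rw [littleK, period_succ, Function.iterate_mul]
  exact this

theorem isCompact_littleK (m : ℕ) : IsCompact (T.littleK m) :=
  (T.quadraticLike_iterate m).isCompact_filledJulia

theorem isCompact_image_littleK (m : ℕ) {i : ℕ} (hi : i < T.period m) :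
    IsCompact (f^[i] '' T.littleK m) :=
  (T.isCompact_littleK m).image_of_continuousOn
    ((T.differentiableOn_iterate m hi.le).continuousOn.mono IsQuadraticLike.filledJulia_subset)

theorem isCompact_filledOrbit (m : ℕ) : IsCompact (T.filledOrbit m) :=
  (Finset.range (T.period m)).isCompact_biUnion fun _ hi =>
    T.isCompact_image_littleK m (Finset.mem_range.1 hi)

theorem isCompact_juliaOrbit (m : ℕ) : IsCompact (T.juliaOrbit m) := by
  refine (Finset.range (T.period m)).isCompact_biUnion fun i hi => ?_
  have hq := T.quadraticLike_iterate m
  exact hq.isCompact_julia.image_of_continuousOn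
    ((T.differentiableOn_iterate m (Finset.mem_range.1 hi).le).continuousOn.mono
      (hq.julia_subset_filledJulia.trans IsQuadraticLike.filledJulia_subset))

theorem juliaOrbit_subset_filledOrbit (m : ℕ) : T.juliaOrbit m ⊆ T.filledOrbit m :=
  iUnion₂_mono fun _ _ => image_mono (T.quadraticLike_iterate m).julia_subset_filledJulia

theorem juliaOrbit_zero : T.juliaOrbit 0 = julia f U' := by
  simp [juliaOrbit, period_zero, T.V'_zero]

theorem iterate_mem_filledOrbit {m : ℕ} {z : ℂ} (hz : z ∈ T.littleK m) (n : ℕ) :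
    f^[n] z ∈ f^[n % T.period m] '' T.littleK m := by
  refine ⟨f^[T.period m * (n / T.period m)] z, ?_, ?_⟩
  · rw [Function.iterate_mul]
    exact (IsQuadraticLike.mapsTo_filledJulia.iterate (n / T.period m)) hz
  · rw [← Function.iterate_add_apply, Nat.mod_add_div]

theorem filledOrbit_succ_subset (m : ℕ) : T.filledOrbit (m + 1) ⊆ T.filledOrbit m := by
  refine iUnion₂_subset fun i _ => ?_
  rintro _ ⟨z, hz, rfl⟩
  exact mem_iUnion₂.2 ⟨_, Finset.mem_range.2 (Nat.mod_lt _ (T.period_pos m)),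
    T.iterate_mem_filledOrbit (T.littleK_succ_subset m hz) i⟩

theorem omegaZero_subset_filledOrbit (m : ℕ) : omegaZero f ⊆ T.filledOrbit m := by
  intro z hz
  rw [omegaZero, mem_omegaLimit_iff_frequently] at hz
  rw [← (T.isCompact_filledOrbit m).isClosed.closure_eq, mem_closure_iff_nhds]
  intro W hW
  obtain ⟨n, x, hx, hxW⟩ := (hz W hW).exists
  rw [mem_singleton_iff.1 hx] at hxW
  exact ⟨_, hxW, mem_iUnion₂.2 ⟨_, Finset.mem_range.2 (Nat.mod_lt _ (T.period_pos m)),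
    T.iterate_mem_filledOrbit (T.zero_mem_littleK m) n⟩⟩

/-- The critical orbit visits this compact set at all times congruent to `i` modulo the period, so
it accumulates there. -/
theorem omegaZero_inter_image_nonempty (m : ℕ) {i : ℕ} (hi : i < T.period m) :
    (omegaZero f ∩ f^[i] '' T.littleK m).Nonempty := by
  have hfreq : ∃ᶠ n in atTop, f^[n] 0 ∈ f^[i] '' T.littleK m := by
    rw [frequently_atTop]
    intro n
    refine ⟨i + T.period m * n, ?_, ?_⟩
    · have := T.period_pos m; nlinarith
    · have := T.iterate_mem_filledOrbit (T.zero_mem_littleK m) (i + T.period m * n)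
      rwa [Nat.add_mul_mod_self_left, Nat.mod_eq_of_lt hi] at this
  obtain ⟨a, ha, hcl⟩ := (T.isCompact_image_littleK m hi).exists_mapClusterPt_of_frequently hfreq
  refine ⟨a, ?_, ha⟩
  rw [omegaZero, mem_omegaLimit_iff_frequently]
  intro W hW
  exact (mapClusterPt_iff_frequently.1 hcl W hW).mono fun n hn => ⟨0, rfl, hn⟩

theorem isClosed_omegaZero : IsClosed (omegaZero f) := isClosed_omegaLimit _ _ _

end RenormalizationTower

end Lyubich

/-! ### Connectedness of the little filled Julia sets. -/

namespace Lyubich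

namespace IsQuadraticLike

variable {F : ℂ → ℂ} {V' V : Set ℂ}

/-- The isolated points of the filled Julia set cannot form a finite nonempty set. -/
theorem isolated_eq_empty (h : IsQuadraticLike F V' V)
    (hfin : {x ∈ filledJulia F V' | ∃ W ∈ 𝓝 x, W ∩ filledJulia F V' ⊆ {x}}.Finite) :
    {x ∈ filledJulia F V' | ∃ W ∈ 𝓝 x, W ∩ filledJulia F V' ⊆ {x}} = ∅ := by
  set K := filledJulia F V' with hK
  set I := {x ∈ K | ∃ W ∈ 𝓝 x, W ∩ K ⊆ {x}} with hI
  have hKV : K ⊆ V := filledJulia_subset.trans h.dom_subset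
  -- Backward invariance: near `x` only `x` itself is mapped to F x, so if non-escaping points
  -- accumulated at `x`, their images would accumulate at F x.
  have hpre : ∀ x ∈ V', F x ∈ I → x ∈ I := by
    rintro x hx ⟨hFx, W, hW, hWK⟩
    refine ⟨mem_filledJulia_of_apply hx hFx, ?_⟩
    have ha : AnalyticAt ℂ F x := h.analyticOnNhd x hx
    have hne : ∀ᶠ w in 𝓝[≠] x, F w ≠ F x :=
      (ha.eventually_eq_or_eventually_ne analyticAt_const).resolve_left
        (h.not_eventually_const hx _)
    rw [eventually_nhdsWithin_iff] at hne
    refine ⟨_, hne.and (ha.continuousAt hW), ?_⟩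
    rintro w ⟨⟨hw1, hw2⟩, hwK⟩
    by_contra hwx
    exact hw1 hwx (hWK ⟨hw2, mapsTo_filledJulia hwK⟩)
  have hs : ∀ y ∈ I, ∃ x, x ∈ I ∧ x ∈ V' ∧ F x = y := by
    intro y hy
    obtain ⟨x, hx, hxy⟩ := h.exists_preimage (hKV hy.1)
    exact ⟨x, hpre x hx (hxy ▸ hy), hx, hxy⟩
  choose! s hsI hsV hsF using hs
  have hsinj : InjOn s I := fun x hx y hy hxy => by rw [← hsF x hx, hxy, hsF y hy]
  -- An injection of a finite set into itself is onto; so `F` permutes `I`, and each point of `I`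
  -- has just one preimage.
  have hsurj : SurjOn s I I := by
    have himg : s '' I ⊆ I := image_subset_iff.2 hsI
    exact (eq_of_subset_of_ncard_le himg hsinj.ncard_image.ge hfin).ge
  have hFI : ∀ x ∈ I, F x ∈ I ∧ s (F x) = x := by
    intro x hx
    obtain ⟨y, hy, rfl⟩ := hsurj hx
    rw [hsF y hy]; exact ⟨hy, rfl⟩
  -- A single preimage can account for the degree two only if it is critical. Thus `I` would consist
  -- of superattracting cycles.
  have hder : ∀ x ∈ I, deriv F x = 0 := by
    intro x hx
    by_contra hd
    have hxV : x ∈ V' := filledJulia_subset hx.1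
    have hdeg := h.degree_two (F x) (hKV (hFI x hx).1.1)
    have hset : {z | z ∈ V' ∧ F z = F x} = {x} := by
      ext z
      constructor
      · rintro ⟨hz, hzx⟩
        have hzI := hpre z hz (hzx ▸ (hFI x hx).1)
        rw [mem_singleton_iff, ← (hFI z hzI).2, hzx, (hFI x hx).2]
      · rintro rfl; exact ⟨hxV, rfl⟩
    rw [hset, finsum_mem_singleton, analyticOrderNatAt,
      (h.analyticOnNhd x hxV).analyticOrderAt_sub_eq_one_of_deriv_ne_zero hd] at hdeg
    simp at hdeg
  by_contra hne
  obtain ⟨a, ha⟩ := nonempty_iff_ne_empty.2 hne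
  have hev : ∀ x ∈ I, ∀ᶠ r in 𝓝[>] (0 : ℝ), ∀ z, dist z x < r → z ∈ V' ∧ dist (F z) (F x) ≤ dist z x := by
    intro x hx
    have hxV := h.isOpen_dom.mem_nhds (filledJulia_subset hx.1)
    have hd : HasDerivAt F 0 x := by
      rw [← hder x hx]; exact (h.holo.differentiableAt hxV).hasDerivAt
    have hlo := (hasDerivAt_iff_isLittleO.1 hd).def one_pos
    obtain ⟨ε, hε, hb⟩ := Metric.eventually_nhds_iff.1 (hlo.and hxV)
    filter_upwards [Ioo_mem_nhdsGT hε] with r hr z hz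
    have := hb (hz.trans hr.2)
    refine ⟨this.2, ?_⟩
    simpa [dist_eq_norm] using this.1
  obtain ⟨r, hr, hr0⟩ := (((hfin.eventually_all (l := 𝓝[>] (0 : ℝ))).2 hev).and
    eventually_mem_nhdsWithin).exists
  have hball : ∀ n : ℕ, ∀ x ∈ I, ∀ z, dist z x < r → ∃ y ∈ I, dist (F^[n] z) y < r := by
    intro n
    induction n with
    | zero => exact fun x hx z hz => ⟨x, hx, hz⟩
    | succ n ih =>
      intro x hx z hz
      rw [Function.iterate_succ_apply]
      exact ih (F x) (hFI x hx).1 (F z) ((hr x hx z hz).2.trans_lt hz)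
  -- Under iteration a small ball about a point of `I` stays close to `I`, so it never escapes; this
  -- contradicts the isolation of its center.
  have hsub : Metric.ball a r ⊆ K := fun z hz n => by
    obtain ⟨y, hy, hd⟩ := hball n a ha z hz
    exact (hr y hy _ hd).1
  obtain ⟨-, W, hW, hWK⟩ := ha
  have h1 : ∀ᶠ w in 𝓝[≠] a, w ∈ W ∩ Metric.ball a r :=
    mem_nhdsWithin_of_mem_nhds (inter_mem hW (Metric.ball_mem_nhds a hr0))
  obtain ⟨w, hw, hwne⟩ := (h1.and eventually_mem_nhdsWithin).exists
  exact hwne (hWK ⟨hw.1, hsub hw.2⟩)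

/-- If the filled Julia set is disconnected by no more than one point, it is connected. -/
theorem isPreconnected_of_diff (h : IsQuadraticLike F V' V) {S : Set ℂ}
    (hconn : IsPreconnected (filledJulia F V' \ S)) (hsub : (filledJulia F V' ∩ S).Subsingleton) :
    IsPreconnected (filledJulia F V') := by
  set K := filledJulia F V' with hK
  rcases (K ∩ S).eq_empty_or_nonempty with h0 | ⟨a, haK, haS⟩
  · rwa [sdiff_eq_left.2 (disjoint_iff_inter_eq_empty.2 h0)] at hconn
  have hKa : K ⊆ insert a (K \ S) := fun x hx => by
    by_cases hxS : x ∈ S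
    · exact Or.inl (hsub ⟨hx, hxS⟩ ⟨haK, haS⟩)
    · exact Or.inr ⟨hx, hxS⟩
  by_cases hcl : a ∈ closure (K \ S)
  · exact hconn.subset_closure sdiff_subset
      (hKa.trans (insert_subset hcl subset_closure))
  exfalso
  have haI : a ∈ {x ∈ K | ∃ W ∈ 𝓝 x, W ∩ K ⊆ {x}} := by
    refine ⟨haK, _, isClosed_closure.isOpen_compl.mem_nhds hcl, ?_⟩
    rintro x ⟨hx1, hx2⟩
    exact (hKa hx2).resolve_right fun hx => hx1 (subset_closure hx)
  -- A connected set with more than one point has no isolated points, so only `a` can be isolated;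
  -- otherwise `K` has at most two points.
  have hfin : {x ∈ K | ∃ W ∈ 𝓝 x, W ∩ K ⊆ {x}}.Finite := by
    by_cases hnt : (K \ S).Nontrivial
    · refine (finite_singleton a).subset ?_
      rintro x ⟨hxK, W, hW, hWK⟩
      refine (hKa hxK).resolve_right fun hxS => ?_
      have hacc := hconn.preperfect_of_nontrivial hnt x hxS
      rw [accPt_iff_nhds] at hacc
      obtain ⟨y, ⟨hyW, hyK⟩, hyx⟩ := hacc W hW
      exact hyx (hWK ⟨hyW, hyK.1⟩)
    · refine ((not_nontrivial_iff.1 hnt).finite.insert a).subset fun x hx => hKa hx.1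
  have := h.isolated_eq_empty hfin
  rw [this] at haI
  exact haI

end IsQuadraticLike

namespace RenormalizationTower

variable {f : ℂ → ℂ} {U' U : Set ℂ} (T : RenormalizationTower f U' U)

/-- The indices 0 and 1 are distinct since the period is at least 2. By the non-crossing condition
the little filled Julia set is connected after removal of another one, and by the touching condition
this removes at most one point. -/
theorem isPreconnected_littleK (m : ℕ) : IsPreconnected (T.littleK (m + 1)) := by
  have hR := T.renorm m
  have h2 := hR.two_le
  have e : T.littleK (m + 1) = filledJulia (f^[T.period m])^[T.q m] (T.V' (m + 1)) := by
    rw [littleK, period_succ, Function.iterate_mul]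
  rw [e]
  have hc := hR.not_cross 0 (by omega) 1 (by omega) zero_ne_one
  have ht := hR.touch 0 (by omega) 1 (by omega) zero_ne_one
  rw [Function.iterate_zero, image_id] at hc ht
  exact hR.quadraticLike.isPreconnected_of_diff hc.isPreconnected ht

/-- The iterates of `f` are open maps on the domains of the renormalizations. -/
theorem nhds_le_map_iterate (m : ℕ) {i : ℕ} (hi : i ≤ T.period m) {z : ℂ} (hz : z ∈ T.V' m) :
    𝓝 (f^[i] z) ≤ map f^[i] (𝓝 z) := by
  have hq := T.quadraticLike_iterate m
  have ha : AnalyticAt ℂ f^[i] z :=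
    (T.differentiableOn_iterate m hi).analyticAt (hq.isOpen_dom.mem_nhds hz)
  refine ha.eventually_constant_or_nhds_le_map_nhds.resolve_left fun hcon => ?_
  refine hq.not_eventually_const hz (f^[T.period m] z) (hcon.mono fun w hw => ?_)
  have e : T.period m = (T.period m - i) + i := by omega
  rw [e, Function.iterate_add_apply, Function.iterate_add_apply, hw]

end RenormalizationTower

/-! ### Neighborhood systems -/

namespace IsNeighborhoodSystem

variable {f : ℂ → ℂ} {U' U : Set ℂ} {T : RenormalizationTower f U' U} {l : ℕ} {δ : ℝ}
  {N : ℕ → Set ℂ}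

theorem subset_dom (hN : IsNeighborhoodSystem T l δ N) (n : ℕ) : N n ⊆ U' :=
  subset_closure.trans (hN.closure_subset n)

theorem isBounded (hN : IsNeighborhoodSystem T l δ N) (n : ℕ) : Bornology.IsBounded (N n) :=
  T.quadraticLike.isCompact_closure.isBounded.subset ((hN.subset_dom n).trans subset_closure)

theorem isOpen_comp (hN : IsNeighborhoodSystem T l δ N) (n : ℕ) (z : ℂ) :
    IsOpen (connectedComponentIn (N n) z) := (hN.isOpen n).connectedComponentIn

/-- What is removed from the compact Julia orbit is a union of other components of `N n`, and these
are open. -/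
theorem isCompact_bouquet (hN : IsNeighborhoodSystem T l δ N) (n : ℕ) (z : ℂ) :
    IsCompact (connectedComponentIn (N n) z ∩ T.juliaOrbit n) := by
  have e : connectedComponentIn (N n) z ∩ T.juliaOrbit n = T.juliaOrbit n \
      ⋃ w ∈ N n \ connectedComponentIn (N n) z, connectedComponentIn (N n) w := by
    ext x
    constructor
    · rintro ⟨hx1, hx2⟩
      refine ⟨hx2, fun hx => ?_⟩
      obtain ⟨w, hw, hxw⟩ := mem_iUnion₂.1 hx
      have e1 := connectedComponentIn_eq hx1
      have e2 := connectedComponentIn_eq hxw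
      exact hw.2 (by rw [e1, ← e2]; exact mem_connectedComponentIn hw.1)
    · rintro ⟨hx1, hx2⟩
      refine ⟨?_, hx1⟩
      by_contra hx
      exact hx2 (mem_iUnion₂.2 ⟨x, ⟨hN.julia_subset n hx1, hx⟩,
        mem_connectedComponentIn (hN.julia_subset n hx1)⟩)
  rw [e]
  exact (T.isCompact_juliaOrbit n).diff
    (isOpen_biUnion fun w _ => hN.isOpen_comp n w)

/-- The annulus around a bouquet. -/
theorem exists_collar_bouquet (hN : IsNeighborhoodSystem T l δ N) (n : ℕ) {z : ℂ} (hz : z ∈ N n) :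
    ∃ φ R, Collar (connectedComponentIn (N n) z) (connectedComponentIn (N n) z ∩ T.juliaOrbit n)
      φ R ∧ 2 * Real.pi * δ ≤ Real.log R := by
  refine exists_collar (hN.isOpen_comp n z)
    ((hN.isBounded n).subset (connectedComponentIn_subset _ _)) (hN.isCompact_bouquet n z)
    (hN.bouquet n z hz).nonempty inter_subset_left ?_
  rw [sdiff_self_inter]
  exact hN.annulus n z hz

/-- The annulus between components of consecutive depths. -/
theorem exists_collar_inside (hN : IsNeighborhoodSystem T l δ N) (n : ℕ) {z : ℂ}
    (hz : z ∈ N (n + l)) :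
    ∃ φ R, Collar (connectedComponentIn (N n) z) (closure (connectedComponentIn (N (n + l)) z))
      φ R ∧ 2 * Real.pi * δ ≤ Real.log R := by
  refine exists_collar (hN.isOpen_comp n z)
    ((hN.isBounded n).subset (connectedComponentIn_subset _ _)) ?_
    ⟨z, subset_closure (mem_connectedComponentIn hz)⟩ (hN.closure_inside n z hz)
    (hN.well_inside n z hz)
  exact ((hN.isBounded (n + l)).subset (connectedComponentIn_subset _ _)).isCompact_closure

/-- The complement of a Julia orbit has no bounded components. -/
theorem eq_empty_of_frontier_subset (hN : IsNeighborhoodSystem T l δ N) (n : ℕ) {V : Set ℂ}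
    (hV : IsOpen V) (hVb : Bornology.IsBounded V) (hVJ : Disjoint V (T.juliaOrbit n))
    (hf : frontier V ⊆ T.juliaOrbit n) : V = ∅ := by
  -- The annulus around a bouquet is connected and misses the frontier of `V`, so it is contained in
  -- `V` as soon as `V` enters the component.
  have hA : ∀ x ∈ N n, ∀ y ∈ connectedComponentIn (N n) x, y ∈ V →
      connectedComponentIn (N n) x \ T.juliaOrbit n ⊆ V := by
    intro x hx y hy hyV w hw
    by_contra hwV
    have hpre : IsPreconnected (connectedComponentIn (N n) x \ T.juliaOrbit n) := by
      obtain ⟨R, -, -, φ, hφ, -, himg⟩ := hN.annulus n x hx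
      rw [← himg]
      exact (isPreconnected_ann zero_le_one).image φ hφ.continuousOn
    obtain ⟨u, hu, huf⟩ := inter_frontier_nonempty hpre
      ⟨y, ⟨hy, fun hyJ => disjoint_left.1 hVJ hyV hyJ⟩, hyV⟩ ⟨w, hw, hwV⟩
    exact hu.2 (hf huf)
  -- Adding to `V` all the components whose annulus lies in `V`, bouquets included, yields a bounded
  -- clopen set.
  set S := {x ∈ N n | connectedComponentIn (N n) x \ T.juliaOrbit n ⊆ V} with hS
  have hSo : IsOpen S := by
    rw [isOpen_iff_mem_nhds]
    rintro x ⟨hx, hxV⟩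
    filter_upwards [(hN.isOpen_comp n x).mem_nhds (mem_connectedComponentIn hx)] with y hy
    exact ⟨connectedComponentIn_subset _ _ hy, by rwa [← connectedComponentIn_eq hy]⟩
  have hcl : IsClosed (V ∪ S) := by
    rw [← closure_subset_iff_isClosed]
    intro x hx
    by_contra hxn
    have hxN : x ∉ N n := by
      intro hxN
      obtain ⟨y, hy, hyVS⟩ := mem_closure_iff.1 hx _ (hN.isOpen_comp n x)
        (mem_connectedComponentIn hxN)
      refine hxn (Or.inr ⟨hxN, ?_⟩)
      rcases hyVS with hyV | hyS
      · exact hA x hxN y hy hyV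
      · rw [connectedComponentIn_eq hy]; exact hyS.2
    have hsub : V ∪ S ⊆ closure V ∪ T.juliaOrbit n := by
      rintro y (hy | hy)
      · exact Or.inl (subset_closure hy)
      · by_cases hyJ : y ∈ T.juliaOrbit n
        · exact Or.inr hyJ
        · exact Or.inl (subset_closure (hy.2 ⟨mem_connectedComponentIn hy.1, hyJ⟩))
    have hx2 := closure_minimal hsub
      (isClosed_closure.union (T.isCompact_juliaOrbit n).isClosed) hx
    rcases hx2 with hx2 | hx2
    · refine hxN (hN.julia_subset n (hf ?_))
      rw [hV.frontier_eq]
      exact ⟨hx2, fun h => hxn (Or.inl h)⟩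
    · exact hxN (hN.julia_subset n hx2)
  have := eq_empty_of_frontier_eq_empty (hVb.union ((hN.isBounded n).subset fun x hx => hx.1))
    (IsClopen.frontier_eq ⟨hcl, hV.union hSo⟩)
  exact subset_empty_iff.1 (this ▸ subset_union_left)

/-- A point of the filled orbit off the Julia orbit comes from an interior point of a filled Julia
set. By the open mapping theorem such points form a bounded open set with frontier in the Julia
orbit, whose complement has no bounded components. -/
theorem filledOrbit_eq (hN : IsNeighborhoodSystem T l δ N) (n : ℕ) :
    T.filledOrbit n = T.juliaOrbit n := by
  refine Subset.antisymm (iUnion₂_subset fun i hi => ?_) (T.juliaOrbit_subset_filledOrbit n)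
  have hi' := Finset.mem_range.1 hi
  have hX := T.isCompact_image_littleK n hi'
  set X := f^[i] '' T.littleK n with hXdef
  have hclosed := (T.isCompact_juliaOrbit n).isClosed
  have hVo : IsOpen (X \ T.juliaOrbit n) := by
    rw [isOpen_iff_mem_nhds]
    rintro _ ⟨⟨y, hy, rfl⟩, hyJ⟩
    refine inter_mem ?_ (hclosed.isOpen_compl.mem_nhds hyJ)
    have hyint : T.littleK n ∈ 𝓝 y := by
      rw [← mem_interior_iff_mem_nhds]
      by_contra hyi
      refine hyJ (mem_iUnion₂.2 ⟨i, hi, y, ?_, rfl⟩)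
      rw [julia, ← RenormalizationTower.littleK, (T.isCompact_littleK n).isClosed.frontier_eq]
      exact ⟨hy, hyi⟩
    exact T.nhds_le_map_iterate n hi'.le (IsQuadraticLike.filledJulia_subset hy)
      (image_mem_map hyint)
  refine sdiff_eq_empty.1 (hN.eq_empty_of_frontier_subset n hVo (hX.isBounded.subset sdiff_subset)
    disjoint_sdiff_left fun x hx => ?_)
  rw [hVo.frontier_eq] at hx
  have hxX : x ∈ X := closure_minimal sdiff_subset hX.isClosed hx.1
  by_contra hxJ
  exact hx.2 ⟨hxX, hxJ⟩

/-- Nestedness is clear for the filled sets but not for their boundaries, hence the detour through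
the filled orbits. -/
theorem juliaOrbit_antitone (hN : IsNeighborhoodSystem T l δ N) : Antitone T.juliaOrbit :=
  antitone_nat_of_succ_le fun n => by
    rw [← hN.filledOrbit_eq, ← hN.filledOrbit_eq]; exact T.filledOrbit_succ_subset n

theorem omegaZero_subset (hN : IsNeighborhoodSystem T l δ N) (n : ℕ) :
    omegaZero f ⊆ T.juliaOrbit n := by
  rw [← hN.filledOrbit_eq]; exact T.omegaZero_subset_filledOrbit n

theorem isCompact_omegaZero (hN : IsNeighborhoodSystem T l δ N) : IsCompact (omegaZero f) :=
  (T.isCompact_juliaOrbit 0).of_isClosed_subset RenormalizationTower.isClosed_omegaZero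
    (hN.omegaZero_subset 0)

/-- Each component of `N n` meets the postcritical set. -/
theorem comp_inter_omegaZero_nonempty (hN : IsNeighborhoodSystem T l δ N) {n : ℕ} (hn : 1 ≤ n)
    {z : ℂ} (hz : z ∈ N n) : (connectedComponentIn (N n) z ∩ omegaZero f).Nonempty := by
  obtain ⟨x, hxC, hxJ⟩ := (hN.bouquet n z hz).nonempty
  rw [← hN.filledOrbit_eq] at hxJ
  obtain ⟨i, hi, hxi⟩ := mem_iUnion₂.1 hxJ
  have hi' := Finset.mem_range.1 hi
  obtain ⟨y, hyO, hyi⟩ := T.omegaZero_inter_image_nonempty n hi'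
  refine ⟨y, ?_, hyO⟩
  -- Connectedness of the little filled Julia set has been derived from the renormalization that
  -- produces it, so depth 0 is excluded.
  obtain ⟨m, rfl⟩ : ∃ m, n = m + 1 := ⟨n - 1, by omega⟩
  have hpre : IsPreconnected (f^[i] '' T.littleK (m + 1)) := (T.isPreconnected_littleK m).image _
    ((T.differentiableOn_iterate (m + 1) hi'.le).continuousOn.mono
      IsQuadraticLike.filledJulia_subset)
  have hsub : f^[i] '' T.littleK (m + 1) ⊆ N (m + 1) := fun w hw =>
    hN.julia_subset _ (hN.filledOrbit_eq _ ▸ mem_iUnion₂.2 ⟨i, hi, hw⟩)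
  rw [connectedComponentIn_eq hxC]
  exact hpre.subset_connectedComponentIn hxi hsub hyi

end IsNeighborhoodSystem

end Lyubich

/-! ### Definite annuli off the Julia orbits. -/

namespace Lyubich

theorem sum_setLIntegral_le_lintegral {ι : Type*} (s : Finset ι) {A : ι → Set ℂ}
    (hm : ∀ i ∈ s, MeasurableSet (A i)) (hd : Set.PairwiseDisjoint (s : Set ι) A) {B : Set ℂ}
    (hB : ∀ i ∈ s, A i ⊆ B) (F : ℂ → ℝ≥0∞) :
    ∑ i ∈ s, ∫⁻ z in A i, F z ≤ ∫⁻ z in B, F z := by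
  rw [← lintegral_biUnion_finset hd hm]
  exact lintegral_mono_set (iUnion₂_subset hB)

namespace IsNeighborhoodSystem

variable {f : ℂ → ℂ} {U' U : Set ℂ} {T : RenormalizationTower f U' U} {l : ℕ} {δ : ℝ}
  {N : ℕ → Set ℂ}

theorem comp_subset (hN : IsNeighborhoodSystem T l δ N) {n j : ℕ} {z : ℂ} (hz : z ∈ N (n + j * l)) :
    connectedComponentIn (N (n + j * l)) z ⊆ connectedComponentIn (N n) z := by
  induction j with
  | zero => simp
  | succ j ih =>
    have e : n + (j + 1) * l = n + j * l + l := by ring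
    rw [e] at hz ⊢
    have h1 := subset_closure.trans (hN.closure_inside (n + j * l) z hz)
    have hz' : z ∈ N (n + j * l) :=
      connectedComponentIn_subset _ _ (h1 (mem_connectedComponentIn hz))
    exact h1.trans (ih hz')

theorem mem_of_mem (hN : IsNeighborhoodSystem T l δ N) {n j : ℕ} {z : ℂ} (hz : z ∈ N (n + j * l)) :
    z ∈ N n :=
  connectedComponentIn_subset _ _ (hN.comp_subset hz (mem_connectedComponentIn hz))

theorem comp_subset_of_le (hN : IsNeighborhoodSystem T l δ N) {n i j : ℕ} (hij : i ≤ j) {z : ℂ}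
    (hz : z ∈ N (n + j * l)) :
    z ∈ N (n + i * l) ∧
      connectedComponentIn (N (n + j * l)) z ⊆ connectedComponentIn (N (n + i * l)) z := by
  have e : n + j * l = n + i * l + (j - i) * l := by
    obtain ⟨d, rfl⟩ := Nat.exists_eq_add_of_le hij
    rw [Nat.add_sub_cancel_left]; ring
  rw [e] at hz ⊢
  exact ⟨hN.mem_of_mem hz, hN.comp_subset hz⟩

/-- At a bounded depth, the components of the neighborhoods are separated from the boundary of the
component containing them by a definite annulus in the complement of the Julia orbit. -/
theorem exists_depth (hN : IsNeighborhoodSystem T l δ N) (hδ : 0 < δ) :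
    ∃ k : ℕ, ∀ n, ∀ z ∈ N n, ∃ E φ R, Collar (connectedComponentIn (N n) z) E φ R ∧
      2 * Real.pi * δ / 3 ≤ Real.log R ∧ connectedComponentIn (N n) z ∩ T.juliaOrbit n ⊆ E ∧
      connectedComponentIn (N n) z ∩ N (n + k * l) ⊆ E := by
  set lam := 2 * Real.pi * δ with hlam
  have hlam0 : 0 < lam := by positivity
  obtain ⟨c, hc0, hc⟩ := exists_cutoff hlam0
  -- Each crossing of a cutoff of energy at most c will cost energy lam/(2π), so k₀ crossings are
  -- impossible.
  obtain ⟨k₀, hk₀⟩ := exists_nat_gt (2 * Real.pi * c / lam)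
  refine ⟨k₀ + 1, fun n z hz => ?_⟩
  set C := connectedComponentIn (N n) z with hC
  set B := C ∩ T.juliaOrbit n with hB
  -- every deep component contained in `C` meets `B`
  have hmeet : ∀ j, ∀ y ∈ C, y ∈ N (n + j * l) →
      (connectedComponentIn (N (n + j * l)) y ∩ B).Nonempty := by
    intro j y hyC hy
    obtain ⟨w, hw, hwJ⟩ := (hN.bouquet _ y hy).nonempty
    refine ⟨w, hw, ?_, hN.juliaOrbit_antitone (Nat.le_add_right _ _) hwJ⟩
    rw [hC, connectedComponentIn_eq hyC]
    exact hN.comp_subset hy hw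
  -- If a component of the next depth contains the whole bouquet, the annulus around it is free of
  -- the Julia orbit; and every deeper component in `C`, since it meets the bouquet, lies in that
  -- one.
  by_cases hcase : ∃ x ∈ N (n + l), x ∈ C ∧ B ⊆ connectedComponentIn (N (n + l)) x
  · obtain ⟨x, hx, hxC, hBx⟩ := hcase
    obtain ⟨φ, R, hcol, hR⟩ := hN.exists_collar_inside n hx
    rw [← connectedComponentIn_eq hxC] at hcol
    refine ⟨_, φ, R, hcol, by linarith, hBx.trans subset_closure, ?_⟩
    rintro y ⟨hyC, hy⟩
    obtain ⟨w, hw, hwB⟩ := hmeet (k₀ + 1) y hyC hy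
    have h1 := (hN.comp_subset_of_le (i := 1) (by omega) hy)
    rw [one_mul] at h1
    have e1 := connectedComponentIn_eq (h1.2 hw)
    have e2 := connectedComponentIn_eq (hBx hwB)
    apply subset_closure
    rw [e2, ← e1]
    exact mem_connectedComponentIn h1.1
  -- Otherwise the collar of the bouquet is used, filled up to the radius b. If a component of
  -- relative depth k₀ + 1 left the filled part, each of the k₀ annuli between its successive
  -- ancestors would cross the cutoff from 1 to 0.
  · obtain ⟨φ, R, hcol, hR⟩ := hN.exists_collar_bouquet n hz
    obtain ⟨χ, hχs, hχb, hχ1, hχ0, hχi⟩ := hc hcol hR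
    set b := Real.exp (2 * lam / 3) with hb
    have hR0 : 0 < R := by linarith [hcol.one_lt]
    have hb1 : 1 < b := Real.one_lt_exp_iff.2 (by positivity)
    have hbR : b < R := by
      rw [← Real.exp_log hR0]
      exact Real.exp_lt_exp.2 (by linarith)
    refine ⟨_, _, _, hcol.shrink hb1 hbR, ?_, fun x hx => Or.inl hx, ?_⟩
    · rw [Real.log_div hR0.ne' (by positivity), hb, Real.log_exp]
      linarith
    rintro y ⟨hyC, hy⟩
    apply Collar.fill_subset_cfill
    by_contra hyb
    set Cj : ℕ → Set ℂ := fun j => connectedComponentIn (N (n + j * l)) y with hCj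
    have hyj : ∀ j ≤ k₀ + 1, y ∈ N (n + j * l) := fun j hj => (hN.comp_subset_of_le hj hy).1
    have hanti : ∀ i j, i ≤ j → j ≤ k₀ + 1 → Cj j ⊆ Cj i := fun i j hij hj =>
      (hN.comp_subset_of_le hij (hyj j hj)).2
    obtain ⟨w, hwC, hwB⟩ := hmeet (k₀ + 1) y hyC hy
    have hBC1 : ¬ B ⊆ Cj 1 := by
      intro hsub
      have h1 := hyj 1 (by omega)
      simp only [hCj, one_mul] at hsub h1
      exact hcase ⟨y, h1, hyC, hsub⟩
    have hBfill : ∀ r, B ⊆ fill B φ r := fun r x hx => Or.inl hx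
    have hfillo : IsOpen (fill B φ b) := hcol.isOpen_fill b hb1 hbR
    obtain ⟨x₀, hx₀C, hx₀f⟩ := inter_frontier_nonempty
      (isPreconnected_connectedComponentIn (F := N (n + (k₀ + 1) * l)) (x := y))
      ⟨w, hwC, hBfill b hwB⟩ ⟨y, mem_connectedComponentIn hy, hyb⟩
    have hσ : ∀ u : ℂ, ‖u‖ = b → φ u ∉ fill B φ b := fun u hu hmem => by
      have := (hcol.mem_fill_iff (hu ▸ hb1) (hu ▸ hbR) hbR.le).1 hmem
      exact absurd hu this.ne
    have hσconn : IsPreconnected (φ '' {u : ℂ | ‖u‖ = b}) := by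
      refine IsPreconnected.image ?_ φ (hcol.holo.continuousOn.mono fun u hu => ?_)
      · exact isPreconnected_norm_preimage (I := {b}) isPreconnected_singleton
          (by rintro _ rfl; exact (zero_lt_one.trans hb1).le)
      · have hu' : ‖u‖ = b := hu
        exact ⟨hu' ▸ hb1, hu' ▸ hbR⟩
    -- each intermediate annulus is crossed by the cutoff function
    have hstep : ∀ j ∈ Finset.Icc 1 k₀, ENNReal.ofReal lam ≤ ENNReal.ofReal (2 * Real.pi) *
        ∫⁻ v in Cj j \ closure (Cj (j + 1)), ‖fderiv ℝ (fun z => (χ z : ℂ)) v‖ₑ ^ 2 := by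
      intro j hj
      rw [Finset.mem_Icc] at hj
      have hyj1 : y ∈ N (n + j * l + l) := by
        have := hyj (j + 1) (by omega)
        rwa [add_mul, one_mul, ← add_assoc] at this
      obtain ⟨ψ, S, hψ, hS⟩ := hN.exists_collar_inside (n + j * l) hyj1
      have eC : connectedComponentIn (N (n + j * l + l)) y = Cj (j + 1) := by
        simp only [hCj, add_mul, one_mul, ← add_assoc]
      rw [eC] at hψ
      have hwj : w ∈ closure (Cj (j + 1)) :=
        subset_closure (hanti (j + 1) (k₀ + 1) (by omega) le_rfl hwC)
      have hχW : HasWeakDiff (fun z => (χ z : ℂ)) (fderiv ℝ fun z => (χ z : ℂ)) univ := by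
        have hs : ContDiff ℝ ∞ fun z => (χ z : ℂ) := Complex.ofRealCLM.contDiff.comp hχs
        have hcd := hs.continuous_fderiv (by simp)
        exact HasWeakDiff.of_hasFDerivAt isOpen_univ hcd.stronglyMeasurable hcd.continuousOn
          fun z _ => ((hs.differentiable (by simp)) z).hasFDerivAt
      have key := length_area hχW (φ := ψ) (a := 1) (b := S) (d := 1) one_pos hψ.one_lt hψ.holo
        hψ.inj (subset_univ _) fun s hs hsS => by
        have hWC : cfill (closure (Cj (j + 1))) ψ s ⊆ Cj 1 :=
          (hψ.cfill_subset hsS).trans (hanti 1 j hj.1 (by omega))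
        -- The bouquet is connected, meets the innermost component at `w` and is not contained in
        -- `Cj 1`; so it meets the curve of radius s, at a point where χ = 1.
        have hBpre : IsPreconnected B := (hN.bouquet n z hz).isPreconnected
        obtain ⟨x₁, hx₁B, hx₁f⟩ := inter_frontier_nonempty (s := fill (closure (Cj (j + 1))) ψ s)
          hBpre ⟨w, hwB, Or.inl hwj⟩ (by
            by_contra hne
            refine hBC1 fun x hx => hWC (Collar.fill_subset_cfill ?_)
            by_contra hx'
            exact hne ⟨x, hx, hx'⟩)
        obtain ⟨u₁, hu₁, rfl⟩ := hψ.frontier_fill_subset hs hsS hx₁f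
        -- If the curve stayed in the part filled up to b, it would not meet the core curve of
        -- radius b. This core curve, having the point x₀ inside of the curve, would lie inside
        -- entirely, and with it the bouquet it surrounds.
        obtain ⟨u₂, hu₂, hu₂f⟩ : ∃ u : ℂ, ‖u‖ = s ∧ ψ u ∉ fill B φ b := by
          by_contra hcon
          push Not at hcon
          have hx₀W : x₀ ∈ fill (closure (Cj (j + 1))) ψ s :=
            Or.inl (subset_closure (hanti (j + 1) (k₀ + 1) (by omega) le_rfl hx₀C))
          have hσW : φ '' {u : ℂ | ‖u‖ = b} ⊆ fill (closure (Cj (j + 1))) ψ s := by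
            intro x hx
            by_contra hxW
            obtain ⟨x', hx', hx'f⟩ := inter_frontier_nonempty hσconn
              ⟨x₀, hcol.frontier_fill_subset hb1 hbR hx₀f, hx₀W⟩ ⟨x, hx, hxW⟩
            obtain ⟨u, hu, rfl⟩ := hψ.frontier_fill_subset hs hsS hx'f
            obtain ⟨u', hu', hu'e⟩ := hx'
            exact hσ u' hu' (hu'e ▸ hcon u hu)
          have := hψ.subset_cfill_of_frontier_subset hs hsS hfillo
            (hcol.isBounded.subset (hcol.fill_subset hbR.le))
            ((hcol.frontier_fill_subset hb1 hbR).trans hσW)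
          exact hBC1 ((hBfill b).trans (this.trans hWC))
        refine ⟨u₁, u₂, hu₁, hu₂, ?_⟩
        rw [hχ1 _ (hBfill _ hx₁B), hχ0 _ hu₂f]
        simp
      rw [Real.log_one, sub_zero, ENNReal.ofReal_one, one_pow, one_mul, hψ.image_eq] at key
      exact (ENNReal.ofReal_le_ofReal hS).trans key
    have hsum := Finset.sum_le_sum hstep
    rw [Finset.sum_const, Nat.card_Icc, Nat.add_sub_cancel, ← Finset.mul_sum] at hsum
    have hdisj : ((Finset.Icc 1 k₀ : Finset ℕ) : Set ℕ).PairwiseDisjoint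
        fun j => Cj j \ closure (Cj (j + 1)) := by
      have haux : ∀ i j, i < j → j ≤ k₀ → Disjoint (Cj i \ closure (Cj (i + 1)))
          (Cj j \ closure (Cj (j + 1))) := fun i j hij hj =>
        disjoint_left.2 fun x hx hx' =>
          hx.2 (subset_closure (hanti (i + 1) j (by omega) (by omega) hx'.1))
      intro i hi j hj hij
      rw [Finset.coe_Icc] at hi hj
      rcases lt_or_gt_of_ne hij with h | h
      · exact haux i j h hj.2
      · exact (haux j i h hi.2).symm
    have hle := sum_setLIntegral_le_lintegral (Finset.Icc 1 k₀)
      (fun j _ => ((hN.isOpen_comp _ y).sdiff isClosed_closure).measurableSet) hdisj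
      (fun j _ => subset_univ _) fun v => ‖fderiv ℝ (fun z => (χ z : ℂ)) v‖ₑ ^ 2
    rw [setLIntegral_univ] at hle
    have hfinal : k₀ • ENNReal.ofReal lam ≤ ENNReal.ofReal (2 * Real.pi) * ENNReal.ofReal c :=
      hsum.trans (mul_le_mul_right (hle.trans hχi) _)
    rw [nsmul_eq_mul, ← ENNReal.ofReal_natCast, ← ENNReal.ofReal_mul (by positivity),
      ← ENNReal.ofReal_mul (by positivity), ENNReal.ofReal_le_ofReal_iff (by positivity)] at hfinal
    rw [div_lt_iff₀ hlam0] at hk₀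
    linarith

/-- Quasiconformal images of deep components are small. -/
theorem dist_sq_le_of_depth (hN : IsNeighborhoodSystem T l δ N) {k : ℕ} {lam : ℝ}
    (hk : ∀ n, ∀ z ∈ N n, ∃ E φ R, Collar (connectedComponentIn (N n) z) E φ R ∧
      lam ≤ Real.log R ∧ connectedComponentIn (N n) z ∩ T.juliaOrbit n ⊆ E ∧
      connectedComponentIn (N n) z ∩ N (n + k * l) ⊆ E)
    {g : ℂ ≃ₜ ℂ} {D : ℂ → ℂ →L[ℝ] ℂ} {Ω : Set ℂ} (hg : HasWeakDiff g D Ω) {r j : ℕ}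
    (hΩ : U' \ T.juliaOrbit (r + j * (k * l)) ⊆ Ω) {z p q : ℂ} (hz : z ∈ N (r + j * (k * l)))
    (hp : p ∈ connectedComponentIn (N (r + j * (k * l))) z)
    (hq : q ∈ connectedComponentIn (N (r + j * (k * l))) z) :
    ENNReal.ofReal (dist (g p) (g q)) ^ 2 * ENNReal.ofReal (j * lam) ≤
      ENNReal.ofReal (2 * Real.pi) * ∫⁻ w in U' \ T.juliaOrbit (r + j * (k * l)), ‖D w‖ₑ ^ 2 := by
  set C : ℕ → Set ℂ := fun i => connectedComponentIn (N (r + i * (k * l))) z with hC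
  have hnest : ∀ i i', i ≤ i' → i' ≤ j → z ∈ N (r + i * (k * l)) ∧ C i' ⊆ C i := by
    have hz0 : ∀ i ≤ j, z ∈ N (r + i * (k * l)) := fun i hi => by
      have := (hN.comp_subset_of_le (n := r) (i := i * k) (j := j * k) (z := z)
        (Nat.mul_le_mul_right k hi) (by rwa [mul_assoc])).1
      rwa [mul_assoc] at this
    intro i i' hi hi'
    refine ⟨hz0 i (hi.trans hi'), ?_⟩
    have := (hN.comp_subset_of_le (n := r) (i := i * k) (j := i' * k) (z := z)
      (Nat.mul_le_mul_right k hi) (by rw [mul_assoc]; exact hz0 i' hi')).2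
    rwa [mul_assoc, mul_assoc] at this
  have hcol : ∀ i, i < j → ∃ E φ R, Collar (C i) E φ R ∧ lam ≤ Real.log R ∧
      C i ∩ T.juliaOrbit (r + i * (k * l)) ⊆ E ∧ C (i + 1) ⊆ E := by
    intro i hi
    obtain ⟨E, φ, R, h1, h2, h3, h4⟩ := hk (r + i * (k * l)) z (hnest i i le_rfl hi.le).1
    refine ⟨E, φ, R, h1, h2, h3, fun x hx => h4 ⟨(hnest i (i + 1) (by omega) hi).2 hx, ?_⟩⟩
    have : x ∈ N (r + (i + 1) * (k * l)) := connectedComponentIn_subset _ _ hx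
    rwa [add_mul, one_mul, ← add_assoc] at this
  choose! E φ R hcolE hR hJE hCE using hcol
  have hJ : ∀ i < j, C i \ E i ⊆ U' \ T.juliaOrbit (r + j * (k * l)) := by
    rintro i hi x ⟨hxC, hxE⟩
    refine ⟨hN.subset_dom _ (connectedComponentIn_subset _ _ hxC), fun hxJ => hxE (hJE i hi
      ⟨hxC, hN.juliaOrbit_antitone ?_ hxJ⟩)⟩
    exact Nat.add_le_add_left (Nat.mul_le_mul_right _ hi.le) _
  -- The annuli C i \ E i are disjoint, surround the innermost component and avoid even the Julia
  -- orbit of depth i, so that their energies can be summed.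
  have hstep : ∀ i ∈ Finset.range j, ENNReal.ofReal (dist (g p) (g q)) ^ 2 * ENNReal.ofReal lam ≤
      ENNReal.ofReal (2 * Real.pi) * ∫⁻ w in C i \ E i, ‖D w‖ₑ ^ 2 := by
    intro i hi
    rw [Finset.mem_range] at hi
    have hc := hcolE i hi
    have hin : C j ⊆ E i := ((hnest (i + 1) j hi le_rfl).2).trans (hCE i hi)
    have := hc.dist_sq_le hg le_rfl hc.one_lt le_rfl (by
      rw [hc.image_eq]; exact (hJ i hi).trans hΩ) (p := p) (q := q)
      (fun s _ => Or.inl (hin hp)) (fun s _ => Or.inl (hin hq))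
    rw [Real.log_one, sub_zero, hc.image_eq] at this
    exact (mul_le_mul_right (ENNReal.ofReal_le_ofReal (hR i hi)) _).trans this
  have hsum := Finset.sum_le_sum hstep
  rw [Finset.sum_const, Finset.card_range, ← Finset.mul_sum, nsmul_eq_mul] at hsum
  have hdisj : ((Finset.range j : Finset ℕ) : Set ℕ).PairwiseDisjoint fun i => C i \ E i := by
    have haux : ∀ i i', i < i' → i' < j → Disjoint (C i \ E i) (C i' \ E i') := fun i i' h h' =>
      disjoint_left.2 fun x hx hx' =>
        hx.2 (hCE i (h.trans h') ((hnest (i + 1) i' h h'.le).2 hx'.1))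
    intro i hi i' hi' hne
    rw [Finset.coe_range] at hi hi'
    rcases lt_or_gt_of_ne hne with h | h
    · exact haux i i' h hi'
    · exact (haux i' i h hi).symm
  have hle := sum_setLIntegral_le_lintegral (Finset.range j) (fun i hi =>
    (((hcolE i (Finset.mem_range.1 hi)).isOpen).sdiff
      (hcolE i (Finset.mem_range.1 hi)).isCompact.isClosed).measurableSet) hdisj
    (fun i hi => hJ i (Finset.mem_range.1 hi)) fun w => ‖D w‖ₑ ^ 2
  rw [ENNReal.ofReal_mul (Nat.cast_nonneg _), ENNReal.ofReal_natCast, mul_left_comm]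
  exact hsum.trans (mul_le_mul_right hle _)

end IsNeighborhoodSystem

end Lyubich

/-! ### The neighborhoods shrink, and the postcritical set has zero area. -/

namespace Lyubich

theorem hasWeakDiff_id (Ω : Set ℂ) (hΩ : IsOpen Ω) :
    HasWeakDiff (Homeomorph.refl ℂ) (fun _ => ContinuousLinearMap.id ℝ ℂ) Ω :=
  HasWeakDiff.of_hasFDerivAt hΩ stronglyMeasurable_const continuousOn_const
    fun z _ => hasFDerivAt_id z

theorem lintegral_enorm_id_sq (A : Set ℂ) :
    ∫⁻ _ in A, ‖ContinuousLinearMap.id ℝ ℂ‖ₑ ^ 2 = volume A := by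
  have : ‖ContinuousLinearMap.id ℝ ℂ‖ₑ = 1 := by
    rw [← ofReal_norm, ContinuousLinearMap.norm_id, ENNReal.ofReal_one]
  rw [this, one_pow, setLIntegral_one]

namespace IsNeighborhoodSystem

variable {f : ℂ → ℂ} {U' U : Set ℂ} {T : RenormalizationTower f U' U} {l : ℕ} {δ : ℝ}
  {N : ℕ → Set ℂ}

theorem juliaOrbit_nonempty (hN : IsNeighborhoodSystem T l δ N) (n : ℕ) :
    (T.juliaOrbit n).Nonempty := by
  rw [← hN.filledOrbit_eq]
  exact ⟨_, mem_iUnion₂.2 ⟨0, Finset.mem_range.2 (T.period_pos n), 0, T.zero_mem_littleK n, rfl⟩⟩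

/-- Uniform smallness of the images of deep components under Sobolev homeomorphisms of bounded
Dirichlet integral. -/
theorem exists_dist_lt (hN : IsNeighborhoodSystem T l δ N) (hδ : 0 < δ) {A : ℝ≥0∞} (hA : A ≠ ⊤)
    {ε : ℝ} (hε : 0 < ε) : ∃ n₀, ∀ n ≥ n₀, ∀ (g : ℂ ≃ₜ ℂ) (D : ℂ → ℂ →L[ℝ] ℂ) (Ω : Set ℂ),
      HasWeakDiff g D Ω → U' \ T.juliaOrbit n ⊆ Ω →
      ∫⁻ w in U' \ T.juliaOrbit n, ‖D w‖ₑ ^ 2 ≤ A → ∀ z ∈ N n,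
      ∀ p ∈ connectedComponentIn (N n) z, ∀ q ∈ connectedComponentIn (N n) z,
        dist (g p) (g q) < ε := by
  obtain ⟨k, hk⟩ := hN.exists_depth hδ
  set lam := 2 * Real.pi * δ / 3 with hlam
  have hlam0 : 0 < lam := by positivity
  -- If the step in depth were 0, the core would contain the whole component, whereas the annulus
  -- around the core is nonempty.
  have hL : 0 < k * l := by
    by_contra h0
    have h0' : k * l = 0 := by omega
    obtain ⟨x, hx⟩ := hN.juliaOrbit_nonempty 0
    have hxN := hN.julia_subset 0 hx
    obtain ⟨E, φ, R, hcol, -, -, hsub⟩ := hk 0 x hxN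
    rw [h0'] at hsub
    have hm : 1 < (1 + R) / 2 ∧ (1 + R) / 2 < R := by constructor <;> linarith [hcol.one_lt]
    have hn : ‖(((1 + R) / 2 : ℝ) : ℂ)‖ = (1 + R) / 2 := by
      rw [Complex.norm_real, Real.norm_eq_abs, abs_of_pos (by linarith)]
    have := hcol.mem_of_norm (w := (((1 + R) / 2 : ℝ) : ℂ)) (by rw [hn]; exact hm.1)
      (by rw [hn]; exact hm.2)
    exact this.2 (hsub ⟨this.1, connectedComponentIn_subset _ _ this.1⟩)
  -- With j₀ or more disjoint annuli of width lam, distance ε would require more energy than A. The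
  -- depth n is then divided by the step k * l, and the quotient counts the annuli.
  obtain ⟨j₀, hj₀⟩ := exists_nat_gt (2 * Real.pi * A.toReal / (ε ^ 2 * lam))
  refine ⟨j₀ * (k * l), fun n hn g D Ω hg hΩ hD z hz p hp q hq => ?_⟩
  have e : n = n % (k * l) + n / (k * l) * (k * l) := by
    rw [mul_comm (n / (k * l))]; exact (Nat.mod_add_div _ _).symm
  have hj : j₀ ≤ n / (k * l) := (Nat.le_div_iff_mul_le hL).2 hn
  set j := n / (k * l) with hjdef
  set r := n % (k * l) with hrdef
  clear_value j r
  subst e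
  have key := hN.dist_sq_le_of_depth (lam := lam) hk hg hΩ hz hp hq
  have h2 := key.trans (mul_le_mul_right hD _)
  rw [← ENNReal.ofReal_toReal hA, ← ENNReal.ofReal_pow dist_nonneg,
    ← ENNReal.ofReal_mul (by positivity), ← ENNReal.ofReal_mul (by positivity),
    ENNReal.ofReal_le_ofReal_iff (by positivity)] at h2
  rw [div_lt_iff₀ (by positivity)] at hj₀
  by_contra hcon
  have hj' : (j₀ : ℝ) ≤ j := by exact_mod_cast hj
  have h3 : ε ^ 2 ≤ dist (g p) (g q) ^ 2 := by
    gcongr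
    exact not_lt.1 hcon
  have h4 : ε ^ 2 * (j₀ * lam) ≤ dist (g p) (g q) ^ 2 * (j * lam) := by gcongr
  linarith

theorem volume_dom_lt_top (_hN : IsNeighborhoodSystem T l δ N) : volume U' < ⊤ :=
  (measure_mono subset_closure).trans_lt T.quadraticLike.isCompact_closure.measure_lt_top

/-- The identity is a Sobolev homeomorphism whose energy is area, so the distortion estimate applies
to it. -/
theorem exists_comp_small (hN : IsNeighborhoodSystem T l δ N) (hδ : 0 < δ) {ε : ℝ} (hε : 0 < ε) :
    ∃ n₀, ∀ n ≥ n₀, ∀ z ∈ N n, ∀ p ∈ connectedComponentIn (N n) z,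
      ∀ q ∈ connectedComponentIn (N n) z, dist p q < ε := by
  obtain ⟨n₀, h⟩ := hN.exists_dist_lt hδ hN.volume_dom_lt_top.ne hε
  refine ⟨n₀, fun n hn z hz p hp q hq => ?_⟩
  refine h n hn (Homeomorph.refl ℂ) _ univ (hasWeakDiff_id univ isOpen_univ) (subset_univ _) ?_
    z hz p hp q hq
  rw [lintegral_enorm_id_sq]
  exact measure_mono sdiff_subset

/-- The neighborhoods shrink to the postcritical set. -/
theorem exists_subset_thickening (hN : IsNeighborhoodSystem T l δ N) (hδ : 0 < δ) {ε : ℝ}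
    (hε : 0 < ε) : ∃ n₀, ∀ n ≥ n₀, N n ⊆ Metric.thickening ε (omegaZero f) := by
  obtain ⟨n₀, h⟩ := hN.exists_comp_small hδ hε
  refine ⟨max n₀ 1, fun n hn z hz => ?_⟩
  obtain ⟨o, hoC, hoO⟩ := hN.comp_inter_omegaZero_nonempty (le_trans (le_max_right _ _) hn) hz
  exact Metric.mem_thickening_iff.2 ⟨o, hoO,
    h n (le_trans (le_max_left _ _) hn) z hz z (mem_connectedComponentIn hz) o hoC⟩

theorem exists_subset_of_isOpen (hN : IsNeighborhoodSystem T l δ N) (hδ : 0 < δ) {V : Set ℂ}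
    (hV : IsOpen V) (hOV : omegaZero f ⊆ V) : ∃ n₀, ∀ n ≥ n₀, N n ⊆ V := by
  obtain ⟨ε, hε, hsub⟩ := hN.isCompact_omegaZero.exists_thickening_subset_open hV hOV
  obtain ⟨n₀, h⟩ := hN.exists_subset_thickening hδ hε
  exact ⟨n₀, fun n hn => (h n hn).trans hsub⟩

/-- A point off ω(0) is eventually left behind by the shrinking neighborhoods, hence by the Julia
orbits inside of them. -/
theorem omegaZero_eq_iInter (hN : IsNeighborhoodSystem T l δ N) (hδ : 0 < δ) :
    omegaZero f = ⋂ n, T.juliaOrbit n := by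
  refine Subset.antisymm (subset_iInter hN.omegaZero_subset) fun z hz => ?_
  by_contra hzO
  obtain ⟨n₀, h⟩ := hN.exists_subset_of_isOpen hδ isOpen_compl_singleton
    (V := {z}ᶜ) fun x hx hxz => hzO (mem_singleton_iff.1 hxz ▸ hx)
  exact h n₀ le_rfl (hN.julia_subset n₀ (mem_iInter.1 hz n₀)) rfl

/-- Finitely many components of `N n` cover the postcritical set. -/
theorem exists_finset_comp (hN : IsNeighborhoodSystem T l δ N) (n : ℕ) :
    ∃ 𝒞 : Finset (Set ℂ), (∀ C ∈ 𝒞, ∃ z ∈ N n, C = connectedComponentIn (N n) z) ∧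
      omegaZero f ⊆ ⋃ C ∈ 𝒞, C ∧ ((𝒞 : Set (Set ℂ)).PairwiseDisjoint id) := by
  classical
  have hON : omegaZero f ⊆ N n := (hN.omegaZero_subset n).trans (hN.julia_subset n)
  obtain ⟨t, ht⟩ := hN.isCompact_omegaZero.elim_finite_subcover
    (fun z : N n => connectedComponentIn (N n) z) (fun z => hN.isOpen_comp n z)
    fun x hx => mem_iUnion.2 ⟨⟨x, hON hx⟩, mem_connectedComponentIn (hON hx)⟩
  have hmem : ∀ C ∈ t.image fun z : N n => connectedComponentIn (N n) z,
      ∃ z ∈ N n, C = connectedComponentIn (N n) z := by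
    intro C hC
    obtain ⟨z, -, rfl⟩ := Finset.mem_image.1 hC
    exact ⟨z, z.2, rfl⟩
  refine ⟨t.image fun z : N n => connectedComponentIn (N n) z, hmem, fun x hx => ?_, ?_⟩
  · obtain ⟨z, hz, hxz⟩ := mem_iUnion₂.1 (ht hx)
    exact mem_iUnion₂.2 ⟨_, Finset.mem_image_of_mem _ hz, hxz⟩
  · intro C hC C' hC' hne
    obtain ⟨z, -, rfl⟩ := hmem C hC
    obtain ⟨z', -, rfl⟩ := hmem C' hC'
    refine disjoint_left.2 fun x hx hx' => hne ?_
    rw [connectedComponentIn_eq hx, connectedComponentIn_eq hx']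

theorem tendsto_volume_aux (hN : IsNeighborhoodSystem T l δ N) (hδ : 0 < δ) :
    Tendsto (fun n => volume (N n)) atTop (𝓝 (volume (omegaZero f))) := by
  have hO := hN.isCompact_omegaZero
  have hlim : Tendsto (fun r => volume (Metric.cthickening r (omegaZero f))) (𝓝 0)
      (𝓝 (volume (omegaZero f))) := tendsto_measure_cthickening_of_isCompact hO
  rw [ENNReal.tendsto_nhds hO.measure_lt_top.ne]
  intro η hη
  have h1 := (ENNReal.tendsto_nhds hO.measure_lt_top.ne).1 hlim η hη
  have h2 : ∀ᶠ r in 𝓝[>] (0 : ℝ), volume (Metric.cthickening r (omegaZero f)) ∈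
      Icc (volume (omegaZero f) - η) (volume (omegaZero f) + η) := h1.filter_mono nhdsWithin_le_nhds
  obtain ⟨r, hr, hr0⟩ := (h2.and eventually_mem_nhdsWithin).exists
  obtain ⟨n₀, h⟩ := hN.exists_subset_thickening hδ hr0
  filter_upwards [eventually_ge_atTop n₀] with n hn
  refine ⟨?_, (measure_mono ((h n hn).trans (Metric.thickening_subset_cthickening _ _))).trans hr.2⟩
  exact tsub_le_self.trans
    (measure_mono ((hN.omegaZero_subset n).trans (hN.julia_subset n)))

/-- The postcritical set has zero area. -/
theorem volume_omegaZero (hN : IsNeighborhoodSystem T l δ N) (hδ : 0 < δ) :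
    volume (omegaZero f) = 0 := by
  have hO := hN.isCompact_omegaZero
  set lam := 2 * Real.pi * δ with hlam
  have hlam0 : 0 < lam := by positivity
  set c := ENNReal.ofReal (Real.pi * (2 * Real.pi) / lam) with hc
  -- In each component, the annulus around the bouquet bounds the squared diameter of the bouquet by
  -- a multiple of the area off ω(0). Summing over components bounds the area of ω(0) by a quantity
  -- that tends to 0.
  have hbound : ∀ n, volume (omegaZero f) ≤ c * volume (N n \ omegaZero f) := by
    intro n
    obtain ⟨𝒞, h𝒞, hcov, hdisj⟩ := hN.exists_finset_comp n
    have hC : ∀ C ∈ 𝒞, volume (C ∩ omegaZero f) ≤ c * volume (C \ omegaZero f) := by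
      intro C hC
      obtain ⟨z, hz, rfl⟩ := h𝒞 C hC
      obtain ⟨φ, R, hcol, hR⟩ := hN.exists_collar_bouquet n hz
      set C := connectedComponentIn (N n) z
      obtain ⟨w, hw⟩ := (hN.bouquet n z hz).nonempty
      have hsub : C \ (C ∩ T.juliaOrbit n) ⊆ C \ omegaZero f := fun x hx =>
        ⟨hx.1, fun hxO => hx.2 ⟨hx.1, hN.omegaZero_subset n hxO⟩⟩
      have hvfin : volume (C \ omegaZero f) ≠ ⊤ :=
        ((measure_mono sdiff_subset).trans_lt hcol.isBounded.measure_lt_top).ne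
      set d := Real.sqrt (2 * Real.pi * (volume (C \ omegaZero f)).toReal / lam) with hd
      have hball : C ∩ omegaZero f ⊆ Metric.closedBall w d := by
        intro x hx
        have hxE : x ∈ C ∩ T.juliaOrbit n := ⟨hx.1, hN.omegaZero_subset n hx.2⟩
        have := hcol.dist_sq_le (hasWeakDiff_id univ isOpen_univ) le_rfl hcol.one_lt le_rfl
          (subset_univ _) (p := x) (q := w) (fun s _ => Or.inl hxE) (fun s _ => Or.inl hw)
        rw [Real.log_one, sub_zero, hcol.image_eq, lintegral_enorm_id_sq] at this
        have h1 : ENNReal.ofReal (dist x w) ^ 2 * ENNReal.ofReal lam ≤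
            ENNReal.ofReal (2 * Real.pi) * volume (C \ omegaZero f) :=
          ((mul_le_mul_right (ENNReal.ofReal_le_ofReal hR) _).trans this).trans
            (mul_le_mul_right (measure_mono hsub) _)
        rw [← ENNReal.ofReal_toReal hvfin, ← ENNReal.ofReal_pow dist_nonneg,
          ← ENNReal.ofReal_mul (by positivity), ← ENNReal.ofReal_mul (by positivity),
          ENNReal.ofReal_le_ofReal_iff (by positivity)] at h1
        refine Metric.mem_closedBall.2 (Real.le_sqrt_of_sq_le ?_)
        rwa [le_div_iff₀ hlam0]
      refine (measure_mono hball).trans ?_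
      rw [Complex.volume_closedBall, ← ENNReal.ofReal_pow (Real.sqrt_nonneg _),
        Real.sq_sqrt (by positivity), ← ENNReal.ofReal_coe_nnreal, NNReal.coe_real_pi,
        ← ENNReal.ofReal_mul (by positivity)]
      conv_rhs => rw [← ENNReal.ofReal_toReal hvfin, hc, ← ENNReal.ofReal_mul (by positivity)]
      refine ENNReal.ofReal_le_ofReal (le_of_eq ?_)
      field_simp
    calc volume (omegaZero f) ≤ volume (⋃ C ∈ 𝒞, C ∩ omegaZero f) := by
          refine measure_mono fun x hx => ?_
          obtain ⟨C, hC, hxC⟩ := mem_iUnion₂.1 (hcov hx)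
          exact mem_iUnion₂.2 ⟨C, hC, hxC, hx⟩
      _ ≤ ∑ C ∈ 𝒞, volume (C ∩ omegaZero f) := measure_biUnion_finset_le _ _
      _ ≤ ∑ C ∈ 𝒞, c * volume (C \ omegaZero f) := Finset.sum_le_sum hC
      _ = c * volume (⋃ C ∈ 𝒞, C \ omegaZero f) := by
          rw [← Finset.mul_sum, measure_biUnion_finset]
          · exact fun C hC C' hC' hne => (hdisj hC hC' hne).mono sdiff_subset sdiff_subset
          · intro C hC
            obtain ⟨z, -, rfl⟩ := h𝒞 C hC
            exact (hN.isOpen_comp n z).measurableSet.diff hO.isClosed.measurableSet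
      _ ≤ c * volume (N n \ omegaZero f) := by
          gcongr
          refine iUnion₂_subset fun C hC => ?_
          obtain ⟨z, -, rfl⟩ := h𝒞 C hC
          exact sdiff_subset_sdiff_left (connectedComponentIn_subset _ _)
  have hlim : Tendsto (fun n => c * volume (N n \ omegaZero f)) atTop (𝓝 (c * 0)) := by
    refine ENNReal.Tendsto.const_mul ?_ (Or.inr ENNReal.ofReal_ne_top)
    have h1 := ENNReal.Tendsto.sub (hN.tendsto_volume_aux hδ)
      (tendsto_const_nhds (x := volume (omegaZero f))) (Or.inl hO.measure_lt_top.ne)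
    rw [tsub_self] at h1
    refine h1.congr fun n => ?_
    rw [measure_sdiff ((hN.omegaZero_subset n).trans (hN.julia_subset n))
      hO.isClosed.measurableSet.nullMeasurableSet hO.measure_lt_top.ne]
  rw [mul_zero] at hlim
  exact le_antisymm (ge_of_tendsto' hlim hbound) zero_le

theorem tendsto_volume (hN : IsNeighborhoodSystem T l δ N) (hδ : 0 < δ) :
    Tendsto (fun n => volume (N n)) atTop (𝓝 0) := by
  have := hN.tendsto_volume_aux hδ
  rwa [hN.volume_omegaZero hδ] at this

end IsNeighborhoodSystem

end Lyubich

/-! ### Removability of the postcritical set. -/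

namespace Lyubich

/-- The integral of a directional derivative of a compactly supported function against a function
is bounded by the oscillation of the latter. -/
theorem enorm_integral_fderiv_smul_le {χ : ℂ → ℝ} (hχ : ContDiff ℝ ∞ χ) {A : Set ℂ}
    (hA : IsCompact A) (hχA : ∀ z ∉ A, χ z = 0) {u : ℂ → ℂ} (hu : Continuous u) {w : ℂ} {osc : ℝ}
    (hosc : ∀ z ∈ A, ‖u z - u w‖ ≤ osc) (v : ℂ) :
    ‖∫ z, (fderiv ℝ χ z v) • u z‖ₑ ≤ ENNReal.ofReal osc * ‖v‖ₑ *
      ∫⁻ z in A, ‖fderiv ℝ (fun z => (χ z : ℂ)) z‖ₑ := by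
  have hcs : HasCompactSupport χ := HasCompactSupport.intro hA hχA
  have hts : tsupport χ ⊆ A := closure_minimal (fun z hz => by
    by_contra hzA; exact hz (hχA z hzA)) hA.isClosed
  have hχ' : Continuous fun z => fderiv ℝ χ z v :=
    (hχ.continuous_fderiv (by simp)).clm_apply continuous_const
  have hzero : ∀ z ∉ A, fderiv ℝ χ z v = 0 := fun z hz => by
    rw [fderiv_eq_zero_of_notMem_tsupport fun h => hz (hts h), zero_apply]
  have hi : ∀ {u : ℂ → ℂ}, Continuous u → Integrable fun z => (fderiv ℝ χ z v) • u z :=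
    fun hu => Continuous.integrable_of_hasCompactSupport (hχ'.smul hu)
      (HasCompactSupport.intro hA fun z hz => by rw [hzero z hz, zero_smul])
  -- The derivative of a compactly supported function has integral 0, so a constant may be
  -- subtracted from `u`.
  have hconst : ∫ z, (fderiv ℝ χ z v) • u w = 0 := by
    have h1 : HasWeakDiff (fun _ => u w) (fun _ => 0) univ :=
      HasWeakDiff.of_hasFDerivAt isOpen_univ stronglyMeasurable_const continuousOn_const
        fun z _ => hasFDerivAt_const _ _
    simpa using h1.weak χ hχ hcs (subset_univ _) v
  have e : ∫ z, (fderiv ℝ χ z v) • u z = ∫ z, (fderiv ℝ χ z v) • (u z - u w) := by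
    simp_rw [smul_sub]
    rw [integral_sub (hi hu) (hi continuous_const), hconst, sub_zero]
  rw [e]
  refine (enorm_integral_le_lintegral_enorm _).trans ?_
  have hder : ∀ z, ‖fderiv ℝ χ z v‖ₑ ≤ ‖fderiv ℝ (fun z => (χ z : ℂ)) z‖ₑ * ‖v‖ₑ := by
    intro z
    have h1 : HasFDerivAt (fun z => (χ z : ℂ)) (Complex.ofRealCLM.comp (fderiv ℝ χ z)) z :=
      Complex.ofRealCLM.hasFDerivAt.comp z ((hχ.differentiable (by simp)) z).hasFDerivAt
    have h2 : ‖fderiv ℝ χ z v‖ₑ = ‖(fderiv ℝ (fun z => (χ z : ℂ)) z) v‖ₑ := by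
      rw [h1.fderiv, ContinuousLinearMap.comp_apply, Complex.ofRealCLM_apply, ← ofReal_norm,
        ← ofReal_norm, Complex.norm_real]
    rw [h2, ← ofReal_norm, ← ofReal_norm, ← ofReal_norm, ← ENNReal.ofReal_mul (norm_nonneg _)]
    exact ENNReal.ofReal_le_ofReal (ContinuousLinearMap.le_opNorm _ _)
  rw [← lintegral_const_mul' _ _ (by finiteness), ← lintegral_indicator hA.isClosed.measurableSet]
  refine lintegral_mono fun z => ?_
  by_cases hz : z ∈ A
  · rw [indicator_of_mem hz, enorm_smul]
    calc ‖fderiv ℝ χ z v‖ₑ * ‖u z - u w‖ₑ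
        ≤ (‖fderiv ℝ (fun z => (χ z : ℂ)) z‖ₑ * ‖v‖ₑ) * ENNReal.ofReal osc := by
          gcongr
          · exact hder z
          · rw [← ofReal_norm]; exact ENNReal.ofReal_le_ofReal (hosc z hz)
      _ = _ := by ring
  · rw [indicator_of_notMem hz, hzero z hz]; simp

theorem ennreal_mul_le_sq_add_sq (a b : ℝ≥0∞) : a * b ≤ a ^ 2 + b ^ 2 := by
  rcases le_total a b with h | h
  · exact (mul_le_mul_left h b).trans (by rw [← sq]; exact le_add_self)
  · exact (mul_le_mul_right h a).trans (by rw [← sq]; exact le_self_add)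

theorem ennreal_add_sq_le (a b : ℝ≥0∞) : (a + b) ^ 2 ≤ 4 * (a ^ 2 + b ^ 2) := by
  rcases le_total a b with h | h
  · calc (a + b) ^ 2 ≤ (b + b) ^ 2 := by gcongr
      _ = 4 * b ^ 2 := by ring
      _ ≤ _ := by gcongr; exact le_add_self
  · calc (a + b) ^ 2 ≤ (a + a) ^ 2 := by gcongr
      _ = 4 * a ^ 2 := by ring
      _ ≤ _ := by gcongr; exact le_self_add

namespace IsNeighborhoodSystem

variable {f : ℂ → ℂ} {U' U : Set ℂ} {T : RenormalizationTower f U' U} {l : ℕ} {δ : ℝ}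
  {N : ℕ → Set ℂ}

/-- The postcritical set is removable for quasiconformal homeomorphisms. -/
theorem isQC_of_diff_omegaZero (hN : IsNeighborhoodSystem T l δ N) (hδ : 0 < δ) {g : ℂ ≃ₜ ℂ}
    {K : ℝ} {Ω : Set ℂ} (hΩ : IsOpen Ω) (hU : U' ⊆ Ω) (h : IsQC K g (Ω \ omegaZero f)) :
    IsQC K g Ω := by
  classical
  have hO := hN.isCompact_omegaZero
  set O := omegaZero f with hOdef
  obtain ⟨D, hD, hd⟩ := h.exists_hasWeakDiff
  set lam := 2 * Real.pi * δ with hlam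
  have hlam0 : 0 < lam := by positivity
  obtain ⟨c, hc0, hc⟩ := exists_cutoff hlam0
  set b := Real.exp (2 * lam / 3) with hb
  have hb1 : 1 < b := Real.one_lt_exp_iff.2 (by positivity)
  -- the cutoff functions of the components
  have hcomp : ∀ n, ∀ z ∈ N n, ∃ (χ : ℂ → ℝ) (P : Set ℂ), ContDiff ℝ ∞ χ ∧
      (∀ z, 0 ≤ χ z ∧ χ z ≤ 1) ∧ IsCompact P ∧ P ⊆ connectedComponentIn (N n) z ∧
      (∀ x ∉ P, χ x = 0) ∧ (∀ x ∈ connectedComponentIn (N n) z ∩ O, χ =ᶠ[𝓝 x] 1) ∧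
      ∫⁻ z, ‖fderiv ℝ (fun z => (χ z : ℂ)) z‖ₑ ^ 2 ≤ ENNReal.ofReal c ∧
      (∀ p ∈ P, ∀ q ∈ P, ENNReal.ofReal (dist (g p) (g q)) ^ 2 * ENNReal.ofReal (lam / 3) ≤
        ENNReal.ofReal (2 * Real.pi) * ∫⁻ w in connectedComponentIn (N n) z \ O, ‖D w‖ₑ ^ 2) ∧
      ∀ p ∈ P, ∀ q ∈ P, ENNReal.ofReal (dist p q) ^ 2 * ENNReal.ofReal (lam / 3) ≤
        ENNReal.ofReal (2 * Real.pi) * volume (connectedComponentIn (N n) z) := by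
    intro n z hz
    obtain ⟨φ, R, hcol, hR⟩ := hN.exists_collar_bouquet n hz
    obtain ⟨χ, hχs, hχb, hχ1, hχ0, hχi⟩ := hc hcol hR
    set C := connectedComponentIn (N n) z with hC
    have hR0 : 0 < R := by linarith [hcol.one_lt]
    have hbR : b < R := by
      rw [← Real.exp_log hR0]; exact Real.exp_lt_exp.2 (by linarith)
    have hlog : lam / 3 ≤ Real.log R - Real.log b := by rw [hb, Real.log_exp]; linarith
    have himg : φ '' ann b R ⊆ C \ (C ∩ T.juliaOrbit n) := by
      rw [← hcol.image_eq]; exact image_mono (ann_mono hb1.le le_rfl)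
    have hsub : φ '' ann b R ⊆ C \ O := fun x hx =>
      ⟨(himg hx).1, fun hxO => (himg hx).2 ⟨(himg hx).1, hN.omegaZero_subset n hxO⟩⟩
    have hCU : C ⊆ U' := (connectedComponentIn_subset _ _).trans (hN.subset_dom n)
    have he1 : 1 < Real.exp (lam / 3) := Real.one_lt_exp_iff.2 (by positivity)
    have heb : Real.exp (lam / 3) < b := Real.exp_lt_exp.2 (by linarith)
    -- The set filled up to b carries the support of the cutoff. The remaining outer annulus, of
    -- logarithmic width at least lam/3, controls its diameter and that of its image under `g`.
    refine ⟨χ, cfill _ φ b, hχs, hχb, hcol.isCompact_cfill b hb1 hbR, hcol.cfill_subset hbR,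
      fun x hx => hχ0 x fun hx' => hx (Collar.fill_subset_cfill hx'), fun x hx => ?_, hχi,
      fun p hp q hq => ?_, fun p hp q hq => ?_⟩
    · have ho := hcol.isOpen_fill _ he1 (heb.trans hbR)
      filter_upwards [ho.mem_nhds (Or.inl ⟨hx.1, hN.omegaZero_subset n hx.2⟩)] with y hy
      exact hχ1 y hy
    · have := hcol.dist_sq_le hD hb1.le hbR le_rfl
        (hsub.trans (sdiff_subset_sdiff_left (hCU.trans hU)))
        (fun s hs => Collar.cfill_subset_fill hs hp) (fun s hs => Collar.cfill_subset_fill hs hq)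
      exact ((mul_le_mul_right (ENNReal.ofReal_le_ofReal hlog) _).trans this).trans
        (mul_le_mul_right (lintegral_mono_set hsub) _)
    · have := hcol.dist_sq_le (hasWeakDiff_id univ isOpen_univ) hb1.le hbR le_rfl
        (subset_univ _) (fun s hs => Collar.cfill_subset_fill hs hp)
        (fun s hs => Collar.cfill_subset_fill hs hq)
      rw [lintegral_enorm_id_sq] at this
      exact ((mul_le_mul_right (ENNReal.ofReal_le_ofReal hlog) _).trans this).trans
        (mul_le_mul_right (measure_mono (hsub.trans sdiff_subset)) _)
  choose 𝒞 h𝒞 hcov hdisj using hN.exists_finset_comp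
  have hcomp' : ∀ n, ∀ C ∈ 𝒞 n, ∃ (χ : ℂ → ℝ) (P : Set ℂ), ContDiff ℝ ∞ χ ∧
      (∀ z, 0 ≤ χ z ∧ χ z ≤ 1) ∧ IsCompact P ∧ P ⊆ C ∧
      (∀ x ∉ P, χ x = 0) ∧ (∀ x ∈ C ∩ O, χ =ᶠ[𝓝 x] 1) ∧
      ∫⁻ z, ‖fderiv ℝ (fun z => (χ z : ℂ)) z‖ₑ ^ 2 ≤ ENNReal.ofReal c ∧
      (∀ p ∈ P, ∀ q ∈ P, ENNReal.ofReal (dist (g p) (g q)) ^ 2 * ENNReal.ofReal (lam / 3) ≤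
        ENNReal.ofReal (2 * Real.pi) * ∫⁻ w in C \ O, ‖D w‖ₑ ^ 2) ∧
      ∀ p ∈ P, ∀ q ∈ P, ENNReal.ofReal (dist p q) ^ 2 * ENNReal.ofReal (lam / 3) ≤
        ENNReal.ofReal (2 * Real.pi) * volume C := by
    intro n C hC
    obtain ⟨z, hz, rfl⟩ := h𝒞 n C hC
    exact hcomp n z hz
  choose! χ P hχs hχb hPc hPC hχ0 hχ1 hχi hPg hPd using hcomp'
  have hCN : ∀ n, ∀ C ∈ 𝒞 n, C ⊆ N n := fun n C hC => by
    obtain ⟨z, -, rfl⟩ := h𝒞 n C hC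
    exact connectedComponentIn_subset _ _
  have hCo : ∀ n, ∀ C ∈ 𝒞 n, IsOpen C := fun n C hC => by
    obtain ⟨z, -, rfl⟩ := h𝒞 n C hC
    exact hN.isOpen_comp n z
  -- at most one summand is nonzero
  have hother : ∀ n, ∀ C ∈ 𝒞 n, ∀ x ∈ C, ∀ C' ∈ 𝒞 n, C' ≠ C → χ n C' x = 0 :=
    fun n C hC x hx C' hC' hne => hχ0 n C' hC' x fun hxP =>
      disjoint_left.1 (hdisj n hC' hC hne) (hPC n C' hC' hxP) hx
  have hval : ∀ n, ∀ C ∈ 𝒞 n, ∀ x ∈ C, ∑ C' ∈ 𝒞 n, χ n C' x = χ n C x := fun n C hC x hx =>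
    Finset.sum_eq_single_of_mem C hC fun C' hC' hne => hother n C hC x hx C' hC' hne
  have hval0 : ∀ n x, (∀ C ∈ 𝒞 n, x ∉ C) → ∑ C' ∈ 𝒞 n, χ n C' x = 0 := fun n x hx =>
    Finset.sum_eq_zero fun C' hC' => hχ0 n C' hC' x fun hxP => hx C' hC' (hPC n C' hC' hxP)
  refine IsQC.of_cutoff hΩ hO.isClosed (hN.volume_omegaZero hδ) h
    (χ := fun n z => ∑ C ∈ 𝒞 n, χ n C z) (fun n => ContDiff.sum fun C hC => hχs n C hC) ?_ ?_ ?_ ?_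
  · intro n z hz
    obtain ⟨C, hC, hzC⟩ := mem_iUnion₂.1 (hcov n hz)
    filter_upwards [(hCo n C hC).mem_nhds hzC, hχ1 n C hC z ⟨hzC, hz⟩] with x hxC hx
    rw [hval n C hC x hxC, hx]
  · intro n z
    by_cases hz : ∃ C ∈ 𝒞 n, z ∈ C
    · obtain ⟨C, hC, hzC⟩ := hz
      rw [hval n C hC z hzC, abs_of_nonneg (hχb n C hC z).1]
      exact (hχb n C hC z).2
    · push Not at hz
      rw [hval0 n z hz, abs_zero]; exact zero_le_one
  · have hae : ∀ᵐ z, z ∉ O := measure_eq_zero_iff_ae_notMem.1 (hN.volume_omegaZero hδ)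
    filter_upwards [hae] with z hz
    obtain ⟨n₀, hn₀⟩ := hN.exists_subset_of_isOpen hδ isOpen_compl_singleton
      (V := {z}ᶜ) fun x hx hxz => hz (mem_singleton_iff.1 hxz ▸ hx)
    refine tendsto_const_nhds.congr' ?_
    filter_upwards [eventually_ge_atTop n₀] with n hn
    exact (hval0 n z fun C hC hzC => hn₀ n hn (hCN n C hC hzC) rfl).symm
  · intro φ v hφ hφc
    -- constants
    obtain ⟨B₁, hB₁⟩ := hφc.exists_bound_of_continuous hφ.continuous
    obtain ⟨B₂, hφL⟩ := hφ.lipschitzWith_of_hasCompactSupport hφc (by simp)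
    obtain ⟨B₃, hB₃⟩ := T.quadraticLike.isCompact_closure.exists_bound_of_continuousOn
      g.continuous.continuousOn
    set B : ℝ := max |B₁| (B₂ * |B₃|) with hB
    have hB0 : 0 ≤ B := (abs_nonneg B₁).trans (le_max_left _ _)
    -- On U' the map `g` is bounded, and φ is bounded and Lipschitz; so the oscillation of the
    -- product is controlled by the diameters in source and target.
    have hosc : ∀ n, ∀ C ∈ 𝒞 n, ∀ p ∈ C, ∀ q ∈ C,
        ‖φ p • g p - φ q • g q‖ ≤ B * (dist (g p) (g q) + dist p q) := by
      intro n C hC p hp q hq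
      have hqU : q ∈ closure U' := subset_closure (hN.subset_dom n (hCN n C hC hq))
      have e : φ p • g p - φ q • g q = φ p • (g p - g q) + (φ p - φ q) • g q := by
        rw [smul_sub, sub_smul]; abel
      rw [e, mul_add]
      refine (norm_add_le _ _).trans (add_le_add ?_ ?_)
      · rw [norm_smul, ← dist_eq_norm]
        gcongr
        exact (hB₁ p).trans ((le_abs_self _).trans (le_max_left _ _))
      · rw [norm_smul, ← dist_eq_norm]
        calc dist (φ p) (φ q) * ‖g q‖ ≤ (B₂ * dist p q) * |B₃| := by
              gcongr
              · exact hφL.dist_le_mul p q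
              · exact (hB₃ q hqU).trans (le_abs_self _)
          _ = (B₂ * |B₃|) * dist p q := by ring
          _ ≤ _ := by gcongr; exact le_max_right _ _
    set κ := ENNReal.ofReal (2 * Real.pi) / ENNReal.ofReal (lam / 3) with hκ
    have hl3 : ENNReal.ofReal (lam / 3) ≠ 0 := (ENNReal.ofReal_pos.2 (by positivity)).ne'
    have hκtop : κ ≠ ⊤ := ENNReal.div_ne_top ENNReal.ofReal_ne_top hl3
    -- estimate for one component
    have hone : ∀ n, ∀ C ∈ 𝒞 n, ‖∫ z, (fderiv ℝ (χ n C) z v) • φ z • g z‖ₑ ≤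
        ENNReal.ofReal B * ‖v‖ₑ * (4 * κ * ((∫⁻ w in C \ O, ‖D w‖ₑ ^ 2) + volume C) +
          ENNReal.ofReal c * volume C) := by
      intro n C hC
      rcases (P n C).eq_empty_or_nonempty with hP | ⟨w, hw⟩
      · have : χ n C = fun _ => 0 := funext fun z => hχ0 n C hC z (by rw [hP]; exact notMem_empty z)
        rw [this]; simp
      set dg := Metric.diam (g '' P n C) with hdg
      set di := Metric.diam (P n C) with hdi
      have hbg : Bornology.IsBounded (g '' P n C) := ((hPc n C hC).image g.continuous).isBounded
      have hbi : Bornology.IsBounded (P n C) := (hPc n C hC).isBounded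
      have hω : ∀ z ∈ P n C, ‖φ z • g z - φ w • g w‖ ≤ B * (dg + di) := by
        intro z hz
        refine (hosc n C hC z (hPC n C hC hz) w (hPC n C hC hw)).trans ?_
        gcongr
        · exact Metric.dist_le_diam_of_mem hbg ⟨z, hz, rfl⟩ ⟨w, hw, rfl⟩
        · exact Metric.dist_le_diam_of_mem hbi hz hw
      have h1 := enorm_integral_fderiv_smul_le (hχs n C hC) (hPc n C hC) (hχ0 n C hC)
        (hφ.continuous.smul g.continuous) hω v
      refine h1.trans ?_
      set I := ∫⁻ z in P n C, ‖fderiv ℝ (fun z => (χ n C z : ℂ)) z‖ₑ with hI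
      have hI2 : I ^ 2 ≤ ENNReal.ofReal c * volume C := by
        have hcs := lintegral_mul_sq_le (μ := volume.restrict (P n C)) (u := fun _ => 1)
          (v := fun z => ‖fderiv ℝ (fun z => (χ n C z : ℂ)) z‖ₑ) aemeasurable_const (by
            have hs : ContDiff ℝ ∞ fun z => (χ n C z : ℂ) :=
              Complex.ofRealCLM.contDiff.comp (hχs n C hC)
            exact (hs.continuous_fderiv (by simp)).measurable.enorm.aemeasurable)
        simp only [one_mul, one_pow, lintegral_one, Measure.restrict_apply_univ] at hcs
        refine hcs.trans ?_
        rw [mul_comm]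
        gcongr
        · exact (setLIntegral_le_lintegral _ _).trans (hχi n C hC)
        · exact hPC n C hC
      have hsq : ∀ {d : ℝ} {A : ℝ≥0∞}, ENNReal.ofReal d ^ 2 * ENNReal.ofReal (lam / 3) ≤
          ENNReal.ofReal (2 * Real.pi) * A → ENNReal.ofReal d ^ 2 ≤ κ * A := by
        intro d A hdA
        rw [hκ, ENNReal.mul_comm_div, ← mul_div_assoc]
        exact (ENNReal.le_div_iff_mul_le (Or.inl hl3) (Or.inl ENNReal.ofReal_ne_top)).2 hdA
      have hdiam : ∀ {S : Set ℂ}, IsCompact S → S.Nonempty →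
          ∃ x ∈ S, ∃ y ∈ S, Metric.diam S = dist x y := by
        intro S hS hne
        obtain ⟨⟨x, y⟩, ⟨hx, hy⟩, hmax⟩ := (hS.prod hS).exists_isMaxOn (hne.prod hne)
          (continuous_dist.continuousOn)
        refine ⟨x, hx, y, hy, le_antisymm (Metric.diam_le_of_forall_dist_le dist_nonneg
          fun a ha b' hb' => hmax (mk_mem_prod ha hb')) ?_⟩
        exact Metric.dist_le_diam_of_mem hS.isBounded hx hy
      have hdg2 : ENNReal.ofReal dg ^ 2 ≤ κ * ∫⁻ w in C \ O, ‖D w‖ₑ ^ 2 := by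
        obtain ⟨_, ⟨x, hx, rfl⟩, _, ⟨y, hy, rfl⟩, e⟩ := hdiam ((hPc n C hC).image g.continuous)
          ⟨_, w, hw, rfl⟩
        rw [hdg, e]; exact hsq (hPg n C hC x hx y hy)
      have hdi2 : ENNReal.ofReal di ^ 2 ≤ κ * volume C := by
        obtain ⟨x, hx, y, hy, e⟩ := hdiam (hPc n C hC) ⟨w, hw⟩
        rw [hdi, e]; exact hsq (hPd n C hC x hx y hy)
      -- The oscillation times the L¹ norm of the gradient is at most the sum of their squares. Each
      -- square is bounded by the area or the energy of the component alone, and these quantities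
      -- are additive over components.
      calc ENNReal.ofReal (B * (dg + di)) * ‖v‖ₑ * I
          = ENNReal.ofReal B * ‖v‖ₑ * ((ENNReal.ofReal dg + ENNReal.ofReal di) * I) := by
            rw [ENNReal.ofReal_mul hB0, ENNReal.ofReal_add Metric.diam_nonneg Metric.diam_nonneg]
            ring
        _ ≤ ENNReal.ofReal B * ‖v‖ₑ *
            (4 * (ENNReal.ofReal dg ^ 2 + ENNReal.ofReal di ^ 2) + I ^ 2) := by
            gcongr
            exact (ennreal_mul_le_sq_add_sq _ _).trans (add_le_add_left (ennreal_add_sq_le _ _) _)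
        _ ≤ ENNReal.ofReal B * ‖v‖ₑ *
            (4 * (κ * (∫⁻ w in C \ O, ‖D w‖ₑ ^ 2) + κ * volume C) + ENNReal.ofReal c * volume C) := by
            gcongr
        _ = _ := by ring
    have htot : ∀ n, ‖∫ z, (fderiv ℝ (fun z => ∑ C ∈ 𝒞 n, χ n C z) z v) • φ z • g z‖ₑ ≤
        ENNReal.ofReal B * ‖v‖ₑ * (4 * κ * ((∫⁻ w in N n \ O, ‖D w‖ₑ ^ 2) + volume (N n)) +
          ENNReal.ofReal c * volume (N n)) := by
      intro n
      have e1 : ∀ z, (fderiv ℝ (fun z => ∑ C ∈ 𝒞 n, χ n C z) z v) • φ z • g z =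
          ∑ C ∈ 𝒞 n, (fderiv ℝ (χ n C) z v) • φ z • g z := by
        intro z
        have : HasFDerivAt (fun z => ∑ C ∈ 𝒞 n, χ n C z) (∑ C ∈ 𝒞 n, fderiv ℝ (χ n C) z) z :=
          HasFDerivAt.fun_sum fun C hC => (((hχs n C hC).differentiable (by simp)) z).hasFDerivAt
        rw [this.fderiv, sum_apply, Finset.sum_smul]
      simp_rw [e1]
      rw [integral_finsetSum]
      · refine (enorm_sum_le _ _).trans ((Finset.sum_le_sum (hone n)).trans ?_)
        rw [← Finset.mul_sum, Finset.sum_add_distrib, ← Finset.mul_sum, ← Finset.mul_sum,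
          Finset.sum_add_distrib]
        have hv : ∑ C ∈ 𝒞 n, volume C ≤ volume (N n) := by
          have := sum_setLIntegral_le_lintegral (𝒞 n) (A := id)
            (fun C hC => (hCo n C hC).measurableSet) (hdisj n) (fun C hC => hCN n C hC) (fun _ => 1)
          simpa using this
        have hi : ∑ C ∈ 𝒞 n, ∫⁻ w in C \ O, ‖D w‖ₑ ^ 2 ≤ ∫⁻ w in N n \ O, ‖D w‖ₑ ^ 2 :=
          sum_setLIntegral_le_lintegral (𝒞 n) (A := fun C => C \ O)
            (fun C hC => (hCo n C hC).measurableSet.diff hO.isClosed.measurableSet)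
            (fun C hC C' hC' hne => (hdisj n hC hC' hne).mono sdiff_subset sdiff_subset)
            (fun C hC => sdiff_subset_sdiff_left (hCN n C hC)) _
        gcongr
      · intro C hC
        refine Continuous.integrable_of_hasCompactSupport ?_ (HasCompactSupport.intro hφc
          fun z hz => by rw [image_eq_zero_of_notMem_tsupport hz, zero_smul, smul_zero])
        exact (((hχs n C hC).continuous_fderiv (by simp)).clm_apply continuous_const).smul
          (hφ.continuous.smul g.continuous)
    have hvol := hN.tendsto_volume hδ
    have hfin : ∫⁻ w in U' \ O, ‖D w‖ₑ ^ 2 ≠ ⊤ := by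
      refine ((hD.lintegral_sq_le hd h.1 (T.quadraticLike.isOpen_dom.measurableSet.diff
        hO.isClosed.measurableSet) (sdiff_subset_sdiff_left hU)).trans_lt
        (ENNReal.mul_lt_top ENNReal.ofReal_lt_top ?_)).ne
      exact (measure_mono (image_mono (sdiff_subset.trans subset_closure))).trans_lt
        (T.quadraticLike.isCompact_closure.image g.continuous).measure_lt_top
    -- Absolute continuity of the integral: the energy off ω(0) is finite and the area of `N n`
    -- tends to 0.
    have hDlim : Tendsto (fun n => ∫⁻ w in N n \ O, ‖D w‖ₑ ^ 2) atTop (𝓝 0) := by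
      have h1 : Tendsto ((volume.restrict (U' \ O)) ∘ N) atTop (𝓝 0) :=
        tendsto_of_tendsto_of_tendsto_of_le_of_le tendsto_const_nhds hvol (fun _ => zero_le)
          fun n => Measure.restrict_apply_le _ _
      have h2 := tendsto_setLIntegral_zero hfin h1
      refine h2.congr fun n => ?_
      rw [Measure.restrict_restrict (hN.isOpen n).measurableSet]
      congr 2
      ext x
      exact ⟨fun hx => ⟨hx.1, hx.2.2⟩, fun hx => ⟨hx.1, hN.subset_dom n hx.1, hx.2⟩⟩
    have hlim : Tendsto (fun n => ENNReal.ofReal B * ‖v‖ₑ *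
        (4 * κ * ((∫⁻ w in N n \ O, ‖D w‖ₑ ^ 2) + volume (N n)) +
          ENNReal.ofReal c * volume (N n))) atTop (𝓝 0) := by
      have h1 : Tendsto (fun n => ENNReal.ofReal B * ‖v‖ₑ *
        (4 * κ * ((∫⁻ w in N n \ O, ‖D w‖ₑ ^ 2) + volume (N n)) +
          ENNReal.ofReal c * volume (N n))) atTop (𝓝 (ENNReal.ofReal B * ‖v‖ₑ *
            (4 * κ * (0 + 0) + ENNReal.ofReal c * 0))) := by
        refine ENNReal.Tendsto.const_mul (Tendsto.add ?_ ?_) (Or.inr (by finiteness))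
        · exact ENNReal.Tendsto.const_mul (hDlim.add hvol) (Or.inr (by finiteness))
        · exact ENNReal.Tendsto.const_mul hvol (Or.inr (by finiteness))
      simpa using h1
    rw [tendsto_zero_iff_enorm_tendsto_zero]
    exact tendsto_of_tendsto_of_tendsto_of_le_of_le tendsto_const_nhds hlim (fun _ => zero_le) htot

end IsNeighborhoodSystem

end Lyubich

/-! ### Holomorphic changes of coordinates, and passage from U' to U. -/

namespace Lyubich

/-- Composing with multiplications by `c` and `d` multiplies both sides of the distortion inequality
by |c|²|d|². -/
theorem norm_sq_le_mul_clm_comp {K : ℝ} {A : ℂ →L[ℝ] ℂ} (hA : ‖A‖ ^ 2 ≤ K * A.det) (c d : ℂ) :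
    ‖(ContinuousLinearMap.mul ℝ ℂ c).comp (A.comp (ContinuousLinearMap.mul ℝ ℂ d))‖ ^ 2 ≤
      K * ((ContinuousLinearMap.mul ℝ ℂ c).comp
        (A.comp (ContinuousLinearMap.mul ℝ ℂ d))).det := by
  have h1 : ((ContinuousLinearMap.mul ℝ ℂ c).comp
      (A.comp (ContinuousLinearMap.mul ℝ ℂ d))).det = ‖c‖ ^ 2 * (A.det * ‖d‖ ^ 2) := by
    rw [← det_mul_clm c, ← det_mul_clm d]
    simp only [ContinuousLinearMap.det, ContinuousLinearMap.toLinearMap_comp, LinearMap.det_comp]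
  have h2 := norm_mul_clm_comp (A.comp (ContinuousLinearMap.mul ℝ ℂ d)) c
  rw [norm_comp_mul_clm] at h2
  rw [h1]
  calc _ ≤ (‖c‖ * (‖A‖ * ‖d‖)) ^ 2 := by gcongr
    _ = ‖c‖ ^ 2 * ‖d‖ ^ 2 * ‖A‖ ^ 2 := by ring
    _ ≤ ‖c‖ ^ 2 * ‖d‖ ^ 2 * (K * A.det) := by gcongr
    _ = _ := by ring

/-- A holomorphic map coincides near any point of its domain with a smooth map of the plane. -/
theorem exists_contDiff_eqOn_ball {F : ℂ → ℂ} {W : Set ℂ} (hW : IsOpen W)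
    (hF : DifferentiableOn ℂ F W) {p : ℂ} (hp : p ∈ W) :
    ∃ G : ℂ → ℂ, ContDiff ℝ ∞ G ∧ ∃ r > 0, Metric.ball p r ⊆ W ∧ EqOn G F (Metric.ball p r) := by
  obtain ⟨r, hr, hrW⟩ := Metric.nhds_basis_closedBall.mem_iff.1 (hW.mem_nhds hp)
  let ψ : ContDiffBump p := ⟨r / 2, r, by positivity, by linarith⟩
  have hFs : ContDiffOn ℝ ∞ F W := (hF.contDiffOn hW).restrict_scalars ℝ
  refine ⟨fun z => ψ z • F z, ?_, r / 2, by positivity,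
    (Metric.ball_subset_closedBall.trans (Metric.closedBall_subset_closedBall (by linarith))).trans
      hrW, fun z hz => ?_⟩
  · rw [contDiff_iff_contDiffAt]
    intro z
    by_cases hz : z ∈ tsupport ψ
    · have hzW : z ∈ W := hrW (by rwa [ψ.tsupport_eq] at hz)
      exact ψ.contDiff.contDiffAt.smul (hFs.contDiffAt (hW.mem_nhds hzW))
    · have : (fun z => ψ z • F z) =ᶠ[𝓝 z] fun _ => 0 := by
        filter_upwards [notMem_tsupport_iff_eventuallyEq.1 hz] with y hy
        rw [hy]; simp
      exact contDiffAt_const.congr_of_eventuallyEq this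
  · have : ψ z = 1 := ψ.one_of_mem_closedBall (Metric.ball_subset_closedBall hz)
    simp [this]

/-- Quasiconformality is invariant under local holomorphic changes of coordinates. -/
theorem IsQC.semiconj {K : ℝ} {g G F k : ℂ → ℂ} {V W : Set ℂ} (h : IsQC K g V)
    (hk : DifferentiableOn ℂ k V) (hinj : InjOn k V) (hW : IsOpen W)
    (hF : DifferentiableOn ℂ F W) (hmaps : MapsTo g V W) (hG : ∀ z ∈ V, G (k z) = F (g z))
    (hGinj : InjOn G (k '' V)) : IsQC K G (k '' V) := by
  have hV := h.2.1
  obtain ⟨D, hD, hd⟩ := h.exists_hasWeakDiff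
  refine IsQC.of_local h.1 (isOpen_image_of_injOn hV hk hinj hV subset_rfl) hGinj ?_
  rintro _ ⟨z, hz, rfl⟩
  -- The chain rule for postcomposition asks for a map smooth on the whole plane, so `F` is replaced
  -- near g z by such a map and `V` is shrunk accordingly.
  obtain ⟨F', hF', r, hr, hrW, heq⟩ := exists_contDiff_eqOn_ball hW hF (hmaps hz)
  set V₀ := V ∩ g ⁻¹' Metric.ball (g z) r with hV₀
  have hV₀o : IsOpen V₀ := h.2.2.1.isOpen_inter_preimage hV Metric.isOpen_ball
  have hV₀V : V₀ ⊆ V := inter_subset_left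
  have hk₀ := hk.mono hV₀V
  have hinj₀ := hinj.mono hV₀V
  have hVo : IsOpen (k '' V₀) := isOpen_image_of_injOn hV hk hinj hV₀o hV₀V
  set κ := Function.invFunOn k V₀ with hκ
  have hκmem : ∀ w ∈ k '' V₀, κ w ∈ V₀ := fun w hw => Function.invFunOn_mem hw
  have hκeq : ∀ w ∈ k '' V₀, k (κ w) = w := fun w hw => Function.invFunOn_eq hw
  have hκinj : InjOn κ (k '' V₀) := fun a ha b hb hab => by
    rw [← hκeq a ha, ← hκeq b hb, hab]
  have h1 := ((hD.mono hV₀o hV₀V).comp_left hF').comp_right hVo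
    (differentiableOn_invFunOn hV₀o hk₀ hinj₀) hκinj hκmem
  refine ⟨k '' V₀, mem_image_of_mem _ ⟨hz, Metric.mem_ball_self hr⟩, image_mono hV₀V, ?_⟩
  have hGeq : EqOn G (fun w => F' (g (κ w))) (k '' V₀) := by
    intro w hw
    change G w = F' (g (κ w))
    rw [heq (hκmem w hw).2, ← hG _ (hκmem w hw).1, hκeq w hw]
  have hGinj₀ : InjOn G (k '' V₀) := hGinj.mono (image_mono hV₀V)
  refine IsQC.congr (HasWeakDiff.isQC h1 h.1 (hGinj₀.congr hGeq) fun w hw => ?_) hGeq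
  have hw' := hκmem w hw
  rw [indicator_of_mem hw, indicator_of_mem hw']
  have hball : g (κ w) ∈ Metric.ball (g z) r := hw'.2
  have e : fderiv ℝ F' (g (κ w)) = ContinuousLinearMap.mul ℝ ℂ (deriv F (g (κ w))) := by
    have h2 : F' =ᶠ[𝓝 (g (κ w))] F :=
      heq.eventuallyEq_of_mem (Metric.isOpen_ball.mem_nhds hball)
    rw [h2.fderiv_eq]
    exact (hasFDerivAt_real_of_differentiableAt
      (hF.differentiableAt (hW.mem_nhds (hrW hball)))).fderiv
  rw [e, ContinuousLinearMap.comp_assoc]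
  exact norm_sq_le_mul_clm_comp (hd _) _ _

/-- A conjugacy between quadratic-like maps that is quasiconformal on the domain off the Julia
set is quasiconformal on the range off the Julia set. -/
theorem IsTopConjugacy.isQC_cod {f f₁ : ℂ → ℂ} {U' U U₁' U₁ : Set ℂ}
    (hf : IsQuadraticLike f U' U) (hf₁ : IsQuadraticLike f₁ U₁' U₁) {ψ : ℂ ≃ₜ ℂ}
    (hψ : IsTopConjugacy f U' U f₁ U₁' U₁ ψ) {K : ℝ} (h : IsQC K ψ (U' \ julia f U')) :
    IsQC K ψ (U \ julia f U') := by
  have hJ : IsClosed (julia f U') := isClosed_frontier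
  refine IsQC.of_local h.1 (hf.isOpen_cod.sdiff hJ) ψ.injective.injOn fun w hw => ?_
  obtain ⟨z, hz, rfl⟩ := hf.exists_preimage hw.1
  have hzJ : z ∉ julia f U' := fun hz' => hw.2 (hf.mapsTo_julia hz')
  have ha : AnalyticAt ℂ f z := hf.analyticOnNhd z hz
  have hder : ∀ᶠ y in 𝓝[≠] z, deriv f y ≠ 0 := by
    refine ha.deriv.eventually_eq_zero_or_eventually_ne_zero.resolve_left fun h0 => ?_
    obtain ⟨r, hr, hrb⟩ := Metric.mem_nhds_iff.1 (h0.and (hf.isOpen_dom.mem_nhds hz))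
    refine hf.not_eventually_const hz (f z) ?_
    filter_upwards [Metric.ball_mem_nhds z hr] with y hy
    refine (convex_ball z r).is_const_of_fderivWithin_eq_zero (𝕜 := ℂ) (f := f)
      (fun x hx => (hf.holo.differentiableAt
        (hf.isOpen_dom.mem_nhds (hrb hx).2)).differentiableWithinAt) (fun x hx => ?_) hy
      (Metric.mem_ball_self hr)
    rw [fderivWithin_of_isOpen Metric.isOpen_ball hx]
    ext
    simpa using (hrb hx).1
  have hUJ : U' \ julia f U' ∈ 𝓝 z := (hf.isOpen_dom.sdiff hJ).mem_nhds ⟨hz, hzJ⟩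
  obtain ⟨r, hr, hrb⟩ := Metric.mem_nhds_iff.1
    ((eventually_nhdsWithin_iff.1 hder).and hUJ)
  have hop : 𝓝 (f z) ≤ map f (𝓝 z) :=
    ha.eventually_constant_or_nhds_le_map_nhds.resolve_left (hf.not_eventually_const hz _)
  have hW := hop (image_mem_map (Metric.ball_mem_nhds z hr))
  obtain ⟨s, hs, hsb⟩ := Metric.mem_nhds_iff.1
    (inter_mem hW ((hf.isOpen_cod.sdiff hJ).mem_nhds hw))
  refine ⟨Metric.ball (f z) s, Metric.mem_ball_self hs, fun y hy => (hsb hy).2, ?_⟩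
  -- Away from the possible critical value f z there are local inverse branches of `f`, and ψ is
  -- locally f₁ ∘ ψ ∘ f⁻¹. The point f z itself is removable.
  refine IsQC.of_diff_singleton Metric.isOpen_ball (f z) ?_
  have hballo : IsOpen (Metric.ball (f z) s \ {f z}) := Metric.isOpen_ball.sdiff isClosed_singleton
  refine IsQC.of_local h.1 hballo ψ.injective.injOn ?_
  intro w hw'
  obtain ⟨y, hy, rfl⟩ := (hsb hw'.1).1
  have hyne : y ≠ z := fun e => hw'.2 (by rw [e]; rfl)
  have hy' : y ∈ U' \ julia f U' := (hrb hy).2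
  have hay : AnalyticAt ℂ f y := hf.analyticOnNhd y hy'.1
  have hst : HasStrictDerivAt f (deriv f y) y := hay.hasStrictDerivAt
  have hd : deriv f y ≠ 0 := (hrb hy).1 hyne
  obtain ⟨V, hVn, hVinj⟩ : ∃ V ∈ 𝓝 y, InjOn f V := by
    let e := (hst.hasStrictFDerivAt_equiv hd).toOpenPartialHomeomorph f
    exact ⟨e.source, e.open_source.mem_nhds
      (hst.hasStrictFDerivAt_equiv hd).mem_toOpenPartialHomeomorph_source, e.injOn⟩
  obtain ⟨V₀, hV₀, hV₀o, hyV₀⟩ := mem_nhds_iff.1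
    (inter_mem hVn (inter_mem ((hf.isOpen_dom.sdiff hJ).mem_nhds hy')
      (hay.continuousAt.preimage_mem_nhds (hballo.mem_nhds hw'))))
  refine ⟨f '' V₀, mem_image_of_mem _ hyV₀, ?_, ?_⟩
  · rintro _ ⟨x, hx, rfl⟩
    exact (hV₀ hx).2.2
  · refine IsQC.semiconj (h.mono hV₀o fun x hx => (hV₀ hx).2.1)
      (hf.holo.mono fun x hx => (hV₀ hx).2.1.1) (hVinj.mono fun x hx => (hV₀ hx).1)
      hf₁.isOpen_dom hf₁.holo (fun x hx => ?_) (fun x hx => hψ.2.2 x (hV₀ hx).2.1.1)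
      ψ.injective.injOn
    rw [← hψ.2.1]
    exact mem_image_of_mem _ (hV₀ hx).2.1.1

end Lyubich

/-! ### Deformations: uniform dilatation and convergence. -/

namespace Lyubich

theorem image_eq_of_eqOn_compl {g g' : ℂ ≃ₜ ℂ} {S : Set ℂ} (h : ∀ z ∉ S, g z = g' z) :
    g '' S = g' '' S := by
  have h1 : g '' Sᶜ = g' '' Sᶜ := image_congr fun z hz => h z hz
  rw [image_compl_eq g.bijective, image_compl_eq g'.bijective] at h1
  exact compl_injective h1

section level

variable {f : ℂ → ℂ} {U' U : Set ℂ} {T : RenormalizationTower f U' U} {l : ℕ} {δ : ℝ}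
  {N : ℕ → Set ℂ}

theorem level_of_neg {n : ℤ} (hn : n < 0) : level U' N n = U' := if_pos hn

theorem level_natCast (n : ℕ) : level U' N (n : ℤ) = N n := by
  simp [level]

namespace IsNeighborhoodSystem

theorem level_subset_dom (hN : IsNeighborhoodSystem T l δ N) (n : ℤ) : level U' N n ⊆ U' := by
  unfold level; split_ifs
  · exact subset_rfl
  · exact hN.subset_dom _

theorem juliaOrbit_subset_level (hN : IsNeighborhoodSystem T l δ N) {m : ℕ} {n : ℤ} (h : n ≤ m) :
    T.juliaOrbit m ⊆ level U' N n := by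
  unfold level; split_ifs with hn
  · exact (hN.julia_subset m).trans (hN.subset_dom m)
  · exact (hN.juliaOrbit_antitone (show n.toNat ≤ m by omega)).trans (hN.julia_subset _)

end IsNeighborhoodSystem

end level

/-- A sequence of homeomorphisms that successively deforms a topological conjugacy between two
infinitely renormalizable maps near the little Julia orbits, with controlled dilatation. -/
structure IsDeformation {f f₁ : ℂ → ℂ} {U' U U₁' U₁ : Set ℂ} (T : RenormalizationTower f U' U)
    (T₁ : RenormalizationTower f₁ U₁' U₁) (l : ℕ) (δ : ℝ) (N N₁ : ℕ → Set ℂ) (K : ℝ)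
    (h : ℕ → ℂ ≃ₜ ℂ) : Prop where
  pos : 0 < δ
  sys : IsNeighborhoodSystem T l δ N
  sys₁ : IsNeighborhoodSystem T₁ l δ N₁
  julia : ∀ m, h m '' T.juliaOrbit m = T₁.juliaOrbit m
  conj : IsTopConjugacy f U' U f₁ U₁' U₁ (h 0)
  homotopic : ∀ m : ℕ, HomotopicRel univ
    (T.juliaOrbit (m + 1) ∪ (level U' N ((m : ℤ) - l))ᶜ) (h m) (h (m + 1))
  qc : ∀ m : ℕ, IsQC K (h m) (level U' N ((m : ℤ) - 1) \ T.juliaOrbit m)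
  dil : ∀ m : ℕ, ∀ n : ℤ, (m : ℤ) - l ≤ n → n ≤ m →
    Dil (h (m + 1)) (level U' N n \ T.juliaOrbit (m + 1)) ≤
      ENNReal.ofReal (4 * K ^ 4) * Dil (h m) (level U' N n \ T.juliaOrbit m)

namespace IsDeformation

variable {f f₁ : ℂ → ℂ} {U' U U₁' U₁ : Set ℂ} {T : RenormalizationTower f U' U}
  {T₁ : RenormalizationTower f₁ U₁' U₁} {l : ℕ} {δ : ℝ} {N N₁ : ℕ → Set ℂ} {K : ℝ}
  {h : ℕ → ℂ ≃ₜ ℂ}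

theorem succ_apply (hd : IsDeformation T T₁ l δ N N₁ K h) {m : ℕ} {z : ℂ}
    (hz : z ∈ T.juliaOrbit (m + 1) ∪ (level U' N ((m : ℤ) - l))ᶜ) : h (m + 1) z = h m z := by
  obtain ⟨H, -, -, h1, hA, -⟩ := hd.homotopic m
  rw [← h1 z (mem_univ z), hA 1 (by simp) z hz]

theorem apply_of_notMem_dom (hd : IsDeformation T T₁ l δ N N₁ K h) (m : ℕ) {z : ℂ}
    (hz : z ∉ U') : h m z = h 0 z := by
  induction m with
  | zero => rfl
  | succ m ih =>
    rw [hd.succ_apply (Or.inr fun hz' => hz (hd.sys.level_subset_dom _ hz')), ih]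

theorem apply_of_mem_juliaOrbit (hd : IsDeformation T T₁ l δ N N₁ K h) {m : ℕ} {z : ℂ}
    (hz : z ∈ T.juliaOrbit m) : h m z = h 0 z := by
  induction m with
  | zero => rfl
  | succ m ih =>
    rw [hd.succ_apply (Or.inl hz), ih (hd.sys.juliaOrbit_antitone m.le_succ hz)]

theorem apply_of_mem_omegaZero (hd : IsDeformation T T₁ l δ N N₁ K h) (m : ℕ) {z : ℂ}
    (hz : z ∈ omegaZero f) : h m z = h 0 z :=
  hd.apply_of_mem_juliaOrbit (hd.sys.omegaZero_subset m hz)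

theorem image_dom (hd : IsDeformation T T₁ l δ N N₁ K h) (m : ℕ) : h m '' U' = U₁' := by
  rw [image_eq_of_eqOn_compl fun z hz => hd.apply_of_notMem_dom m hz, hd.conj.2.1]

/-- ω(0) is the intersection of the Julia orbits for both maps, and `h 0` agrees with `h m` on 𝕁^m.
-/
theorem image_omegaZero (hd : IsDeformation T T₁ l δ N N₁ K h) :
    h 0 '' omegaZero f = omegaZero f₁ := by
  rw [hd.sys.omegaZero_eq_iInter hd.pos, hd.sys₁.omegaZero_eq_iInter hd.pos,
    image_iInter (h 0).bijective]
  refine iInter_congr fun m => ?_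
  rw [← hd.julia m]
  exact image_congr fun z hz => (hd.apply_of_mem_juliaOrbit hz).symm

theorem one_le (hd : IsDeformation T T₁ l δ N N₁ K h) : 1 ≤ K := (hd.qc 0).1

theorem one_le_four_mul_pow (hd : IsDeformation T T₁ l δ N N₁ K h) : 1 ≤ 4 * K ^ 4 := by
  have := one_le_pow₀ hd.one_le (n := 4)
  linarith

/-- Hypothesis (iv) lowers m at a fixed level n, at the price of a factor 4K⁴, until n = m - 1,
where (iii) applies; this takes m - 1 - n steps. When m = 0 all admissible levels are U', and (iii)
is enough. -/
theorem dil_le (hd : IsDeformation T T₁ l δ N N₁ K h) (m : ℕ) (n : ℤ)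
    (h1 : (m : ℤ) - 1 - l ≤ n) (h2 : n ≤ m - 1) :
    Dil (h m) (level U' N n \ T.juliaOrbit m) ≤
      ENNReal.ofReal ((4 * K ^ 4) ^ (m - 1 - n).toNat * K) := by
  have hC := hd.one_le_four_mul_pow
  have hK := hd.one_le
  induction m generalizing n with
  | zero =>
    have hq := hd.qc 0
    rw [level_of_neg (by simp)] at hq
    rw [level_of_neg (by simp at h2; omega)]
    refine hq.dil_le.trans (ENNReal.ofReal_le_ofReal ?_)
    exact le_mul_of_one_le_left (by linarith) (one_le_pow₀ hC)
  | succ m ih =>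
    push_cast at h1 h2 ⊢
    rcases eq_or_ne n m with rfl | hne
    · have hq := hd.qc (m + 1)
      push_cast at hq
      rw [add_sub_cancel_right] at hq
      simpa using hq.dil_le
    · refine (hd.dil m n (by omega) (by omega)).trans ?_
      have e : ((m : ℤ) + 1 - 1 - n).toNat = ((m : ℤ) - 1 - n).toNat + 1 := by omega
      rw [e, pow_succ' (4 * K ^ 4), mul_assoc (4 * K ^ 4), ENNReal.ofReal_mul (p := 4 * K ^ 4) (by linarith)]
      exact mul_le_mul_right (ih n (by omega) (by omega)) _

/-- From `h (m + 1)` at the level m - l the descent takes exactly l steps, whatever m. -/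
theorem exists_isQC_level (hd : IsDeformation T T₁ l δ N N₁ K h) :
    ∃ M : ℝ, ∀ m : ℕ,
      IsQC M (h (m + 1)) (level U' N ((m : ℤ) - l) \ T.juliaOrbit (m + 1)) := by
  have hK := hd.one_le
  have hpos : 1 ≤ (4 * K ^ 4) ^ l * K := by
    have := one_le_pow₀ hd.one_le_four_mul_pow (n := l)
    nlinarith
  -- The dilatation is an infimum; adding 1 gives the strict inequality from which an actual
  -- constant is extracted.
  refine ⟨(4 * K ^ 4) ^ l * K + 1, fun m => IsQC.of_dil_lt (by linarith) ?_⟩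
  have := hd.dil_le (m + 1) (m - l) (by push_cast; omega) (by push_cast; omega)
  rw [show (((m + 1 : ℕ) : ℤ) - 1 - (m - l)).toNat = l by push_cast; omega] at this
  exact this.trans_lt ((ENNReal.ofReal_lt_ofReal_iff (by linarith)).2 (by linarith))

/-- The maps of the sequence are uniformly quasiconformal off the little Julia orbits. -/
theorem exists_isQC (hd : IsDeformation T T₁ l δ N N₁ K h) {K₀ : ℝ} {Ω : Set ℂ} (hU : U' ⊆ Ω)
    (h₀ : IsQC K₀ (h 0) (Ω \ T.juliaOrbit 0)) :
    ∃ M : ℝ, ∀ m : ℕ, IsQC M (h m) (Ω \ T.juliaOrbit m) := by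
  obtain ⟨M, hM⟩ := hd.exists_isQC_level
  refine ⟨max M K₀, fun m => ?_⟩
  induction m with
  | zero => exact h₀.mono_const (le_max_right _ _)
  | succ m ih =>
    have hsub : T.juliaOrbit (m + 1) ⊆ T.juliaOrbit m := hd.sys.juliaOrbit_antitone m.le_succ
    -- The constant does not deteriorate under gluing. The new open set also recovers the points of
    -- 𝕁^m outside of 𝕁^{m+1}.
    have hg := ih.glue ((hM m).mono_const (le_max_left _ _)) fun z hz =>
      hd.succ_apply (Or.inr fun hz' => hz.2 ⟨hz', fun hJ => hz.1.2 (hsub hJ)⟩)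
    convert hg using 1
    ext z
    constructor
    · intro hz
      by_cases hJ : z ∈ T.juliaOrbit m
      · exact Or.inr ⟨hd.sys.juliaOrbit_subset_level (by omega) hJ, hz.2⟩
      · exact Or.inl ⟨hz.1, hJ⟩
    · rintro (hz | hz)
      · exact ⟨hz.1, fun hJ => hz.2 (hsub hJ)⟩
      · exact ⟨hU (hd.sys.level_subset_dom _ hz.1), hz.2⟩

theorem isQC_zero_dom (hd : IsDeformation T T₁ l δ N N₁ K h) :
    IsQC K (h 0) (U' \ T.juliaOrbit 0) := by
  have := hd.qc 0
  rwa [level_of_neg (by simp)] at this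

/-- The images of the components of deep neighborhoods are uniformly small. -/
theorem exists_dist_lt (hd : IsDeformation T T₁ l δ N N₁ K h) {ε : ℝ} (hε : 0 < ε) :
    ∃ n₀, ∀ n ≥ n₀, ∀ m ≥ n, ∀ z ∈ N n, ∀ p ∈ connectedComponentIn (N n) z,
      ∀ q ∈ connectedComponentIn (N n) z, dist (h m p) (h m q) < ε := by
  obtain ⟨M, hM⟩ := hd.exists_isQC subset_rfl hd.isQC_zero_dom
  -- All the `h m` map U' onto U₁', so their energies over U' off the Julia orbit have the common
  -- bound M · area(U₁').
  obtain ⟨n₀, hn₀⟩ := hd.sys.exists_dist_lt hd.pos (A := ENNReal.ofReal M * volume U₁')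
    (ENNReal.mul_ne_top ENNReal.ofReal_ne_top hd.sys₁.volume_dom_lt_top.ne) hε
  refine ⟨n₀, fun n hn m hm => ?_⟩
  obtain ⟨D, hD, hDn⟩ := (hM m).exists_hasWeakDiff
  have hsub : U' \ T.juliaOrbit n ⊆ U' \ T.juliaOrbit m :=
    sdiff_subset_sdiff_right (hd.sys.juliaOrbit_antitone hm)
  refine hn₀ n hn (h m) D _ hD hsub ?_
  refine (hD.lintegral_sq_le hDn (hM m).1 ?_ hsub).trans (mul_le_mul_right ?_ _)
  · exact (T.quadraticLike.isOpen_dom.sdiff (T.isCompact_juliaOrbit n).isClosed).measurableSet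
  · rw [← hd.image_dom m]
    exact measure_mono (image_mono sdiff_subset)

/-- Away from a neighborhood of the postcritical set the sequence is eventually constant. -/
theorem exists_stable (hd : IsDeformation T T₁ l δ N N₁ K h) (n : ℕ) :
    ∃ m₀ ≥ n, ∀ m ≥ m₀, ∀ z ∉ N n, h m z = h m₀ z := by
  obtain ⟨n₁, hn₁⟩ := hd.sys.exists_subset_of_isOpen hd.pos (hd.sys.isOpen n)
    ((hd.sys.omegaZero_subset n).trans (hd.sys.julia_subset n))
  -- The maps of index m and m + 1 agree off 𝕌^{m-l}, so it is m - l that has to reach the depth n₁.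
  refine ⟨max n (n₁ + l), le_max_left _ _, fun m hm z hz => ?_⟩
  induction m, hm using Nat.le_induction with
  | base => rfl
  | succ m hm ih =>
    rw [hd.succ_apply (Or.inr fun hz' => hz ?_), ih]
    have hm' : n₁ + l ≤ m := (le_max_right _ _).trans hm
    rw [show (m : ℤ) - l = ((m - l : ℕ) : ℤ) by omega, level_natCast] at hz'
    exact hn₁ _ (by omega) hz'

/-- Off `N n` the sequence is constant from some index on. A point of `N n` shares its component
with a point of ω(0), whose image does not depend on m, and the images of the component are small.
-/
theorem exists_cauchy (hd : IsDeformation T T₁ l δ N N₁ K h) {ε : ℝ} (hε : 0 < ε) :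
    ∃ m₀, ∀ m ≥ m₀, ∀ m' ≥ m₀, ∀ z, dist (h m z) (h m' z) < ε := by
  obtain ⟨n₀, hn₀⟩ := hd.exists_dist_lt (half_pos hε)
  set n := max n₀ 1 with hn
  obtain ⟨m₀, hm₀, hst⟩ := hd.exists_stable n
  refine ⟨m₀, fun m hm m' hm' z => ?_⟩
  by_cases hz : z ∈ N n
  · obtain ⟨o, hoC, ho⟩ := hd.sys.comp_inter_omegaZero_nonempty (le_max_right _ _) hz
    have hzC := mem_connectedComponentIn hz
    have h1 := hn₀ n (le_max_left _ _) m (hm₀.trans hm) z hz z hzC o hoC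
    have h2 := hn₀ n (le_max_left _ _) m' (hm₀.trans hm') z hz o hoC z hzC
    rw [hd.apply_of_mem_omegaZero _ ho] at h1 h2
    linarith [dist_triangle (h m z) (h 0 o) (h m' z)]
  · rw [hst m hm z hz, hst m' hm' z hz, dist_self]; exact hε

/-- Near a point off the postcritical set the sequence is eventually constant. -/
theorem exists_stable_nhds (hd : IsDeformation T T₁ l δ N N₁ K h) {z : ℂ}
    (hz : z ∉ omegaZero f) : ∃ W, IsOpen W ∧ z ∈ W ∧ ∃ m₀, Disjoint W (T.juliaOrbit m₀) ∧
      ∀ m ≥ m₀, ∀ p ∈ W, h m p = h m₀ p := by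
  obtain ⟨r, hr, hrb⟩ := Metric.nhds_basis_closedBall.mem_iff.1
    (RenormalizationTower.isClosed_omegaZero.isOpen_compl.mem_nhds hz)
  obtain ⟨n, hn⟩ := hd.sys.exists_subset_of_isOpen hd.pos
    (Metric.isClosed_closedBall (x := z) (ε := r)).isOpen_compl
    (fun x hx hx' => hrb hx' hx)
  have hdisj : ∀ p ∈ Metric.ball z r, p ∉ N n := fun p hp hp' =>
    hn n le_rfl hp' (Metric.ball_subset_closedBall hp)
  obtain ⟨m₀, hm₀, hst⟩ := hd.exists_stable n
  refine ⟨Metric.ball z r, Metric.isOpen_ball, Metric.mem_ball_self hr, m₀, ?_,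
    fun m hm p hp => hst m hm p (hdisj p hp)⟩
  exact disjoint_left.2 fun p hp hJ =>
    hdisj p hp (hd.sys.julia_subset n (hd.sys.juliaOrbit_antitone hm₀ hJ))

theorem exists_eventually_eq (hd : IsDeformation T T₁ l δ N N₁ K h) (z : ℂ) :
    ∃ w, ∀ᶠ m in atTop, h m z = w := by
  by_cases hz : z ∈ omegaZero f
  · exact ⟨h 0 z, Eventually.of_forall fun m => hd.apply_of_mem_omegaZero m hz⟩
  · obtain ⟨W, -, hzW, m₀, -, hst⟩ := hd.exists_stable_nhds hz
    exact ⟨h m₀ z, eventually_atTop.2 ⟨m₀, fun m hm => hst m hm z hzW⟩⟩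

/-- The sequence converges uniformly to a homeomorphism, and is eventually constant at every
point. -/
theorem exists_limit (hd : IsDeformation T T₁ l δ N N₁ K h) :
    ∃ g : ℂ ≃ₜ ℂ, TendstoUniformly (fun m z => h m z) g atTop ∧
      ∀ z, ∀ᶠ m in atTop, h m z = g z := by
  choose g hg using hd.exists_eventually_eq
  have hdist : ∀ ε > 0, ∃ m₀, ∀ m ≥ m₀, ∀ z, dist (g z) (h m z) < ε := by
    intro ε hε
    obtain ⟨m₀, hm₀⟩ := hd.exists_cauchy hε
    refine ⟨m₀, fun m hm z => ?_⟩
    obtain ⟨m', hm', hge⟩ := ((hg z).and (eventually_ge_atTop m₀)).exists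
    rw [← hm']
    exact hm₀ m' hge m hm z
  have hunif : TendstoUniformly (fun m z => h m z) g atTop := by
    rw [Metric.tendstoUniformly_iff]
    intro ε hε
    obtain ⟨m₀, hm₀⟩ := hdist ε hε
    exact eventually_atTop.2 ⟨m₀, hm₀⟩
  have hcont : Continuous g :=
    hunif.continuous (Frequently.of_forall fun m => (h m).continuous)
  have hoff : ∀ z ∉ U', g z = h 0 z := fun z hz => by
    obtain ⟨m, hm⟩ := (hg z).exists
    rw [← hm, hd.apply_of_notMem_dom m hz]
  -- For large m the map `h m` has the limit values at both points, and it is injective.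
  have hinj : Function.Injective g := fun a b hab => by
    obtain ⟨m, ha, hb⟩ := ((hg a).and (hg b)).exists
    exact (h m).injective (by rw [ha, hb, hab])
  -- The preimages under `h m` of a point of U₁' stay in the compact closure of U'; by uniform
  -- convergence an accumulation point is a preimage under `g`.
  have hsurj : Function.Surjective g := fun y => by
    by_cases hy : y ∈ U₁'
    · have hmem : ∀ m, (h m).symm y ∈ closure U' := fun m => by
        rw [← hd.image_dom m] at hy
        obtain ⟨x, hx, rfl⟩ := hy
        simpa using subset_closure hx
      obtain ⟨z, -, φ, hφ, hlim⟩ := T.quadraticLike.isCompact_closure.tendsto_subseq hmem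
      refine ⟨z, tendsto_nhds_unique (hcont.continuousAt.tendsto.comp hlim) ?_⟩
      rw [Metric.tendsto_atTop]
      intro ε hε
      obtain ⟨m₀, hm₀⟩ := hdist ε hε
      refine ⟨m₀, fun n hn => ?_⟩
      have := hm₀ (φ n) (hn.trans hφ.le_apply) ((h (φ n)).symm y)
      rwa [(h (φ n)).apply_symm_apply] at this
    · refine ⟨(h 0).symm y, ?_⟩
      rw [hoff, (h 0).apply_symm_apply]
      intro hx
      exact hy (by rw [← hd.image_dom 0]; exact ⟨_, hx, (h 0).apply_symm_apply y⟩)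
  have hclosed : IsClosedMap g := by
    intro C hC
    -- Over the closure of U' closedness follows from compactness, and off U' the limit is the
    -- homeomorphism `h 0`.
    have e : g '' C = g '' (C ∩ closure U') ∪ h 0 '' (C \ U') := by
      have h1 : h 0 '' (C \ U') = g '' (C \ U') := image_congr fun z hz => (hoff z hz.2).symm
      rw [h1, ← image_union]
      congr 1
      ext z
      by_cases hz : z ∈ U'
      · simp [hz, subset_closure hz]
      · simp only [mem_union, mem_inter_iff, Set.mem_sdiff, hz]; tauto
    rw [e]
    refine IsClosed.union ?_ ?_
    · exact ((T.quadraticLike.isCompact_closure.inter_left hC).image hcont).isClosed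
    · exact (h 0).isClosedMap _ (hC.inter T.quadraticLike.isOpen_dom.isClosed_compl)
  exact ⟨(Equiv.ofBijective g ⟨hinj, hsurj⟩).toHomeomorphOfContinuousClosed hcont hclosed,
    hunif, hg⟩

section limit

variable {g : ℂ ≃ₜ ℂ}

theorem limit_apply_of_notMem_dom (hd : IsDeformation T T₁ l δ N N₁ K h)
    (hg : ∀ z, ∀ᶠ m in atTop, h m z = g z) {z : ℂ} (hz : z ∉ U') : g z = h 0 z := by
  obtain ⟨m, hm⟩ := (hg z).exists
  rw [← hm, hd.apply_of_notMem_dom m hz]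

theorem limit_apply_of_mem_omegaZero (hd : IsDeformation T T₁ l δ N N₁ K h)
    (hg : ∀ z, ∀ᶠ m in atTop, h m z = g z) {z : ℂ} (hz : z ∈ omegaZero f) : g z = h 0 z := by
  obtain ⟨m, hm⟩ := (hg z).exists
  rw [← hm, hd.apply_of_mem_omegaZero m hz]

theorem limit_image (hd : IsDeformation T T₁ l δ N N₁ K h)
    (hg : ∀ z, ∀ᶠ m in atTop, h m z = g z) {S : Set ℂ} (hS : U' ⊆ S) : g '' S = h 0 '' S :=
  image_eq_of_eqOn_compl fun _ hz =>
    hd.limit_apply_of_notMem_dom hg fun hz' => hz (hS hz')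

theorem limit_image_omegaZero (hd : IsDeformation T T₁ l δ N N₁ K h)
    (hg : ∀ z, ∀ᶠ m in atTop, h m z = g z) : g '' omegaZero f = omegaZero f₁ := by
  rw [← hd.image_omegaZero]
  exact image_congr fun z hz => hd.limit_apply_of_mem_omegaZero hg hz

/-- Off ω(0) the limit coincides locally with some `h m`, whose constant is uniform; then ω(0) is
removed. -/
theorem limit_isQC (hd : IsDeformation T T₁ l δ N N₁ K h)
    (hg : ∀ z, ∀ᶠ m in atTop, h m z = g z) {K₀ : ℝ} {Ω : Set ℂ} (hΩ : IsOpen Ω) (hU : U' ⊆ Ω)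
    (h₀ : IsQC K₀ (h 0) (Ω \ T.juliaOrbit 0)) : ∃ M : ℝ, IsQC M g Ω := by
  obtain ⟨M, hM⟩ := hd.exists_isQC hU h₀
  refine ⟨M, hd.sys.isQC_of_diff_omegaZero hd.pos hΩ hU ?_⟩
  have hO : IsOpen (Ω \ omegaZero f) := hΩ.sdiff RenormalizationTower.isClosed_omegaZero
  refine IsQC.of_local (hM 0).1 hO g.injective.injOn fun z hz => ?_
  obtain ⟨W, hW, hzW, m₀, hdisj, hst⟩ := hd.exists_stable_nhds hz.2
  refine ⟨W ∩ (Ω \ omegaZero f), ⟨hzW, hz⟩, inter_subset_right, ?_⟩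
  refine ((hM m₀).mono (hW.inter hO) fun p hp =>
    ⟨hp.2.1, disjoint_left.1 hdisj hp.1⟩).congr fun p hp => ?_
  obtain ⟨m, hm, hge⟩ := ((hg p).and (eventually_ge_atTop m₀)).exists
  rw [← hm, hst m hge p hp.1]

end limit

end IsDeformation

end Lyubich

/-! ### Concatenation of the homotopies and the theorem. -/

namespace Lyubich

/-- Infinite concatenation of homotopies: if `H n` joins `a n` to `a (n + 1)` and the `H n` shrink
to the map `g`, then they can be joined to a homotopy from `a 0` to `g`. -/
theorem exists_concat_homotopy {H : ℕ → ℝ × ℂ → ℂ} {a : ℕ → ℂ → ℂ} {g : ℂ → ℂ}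
    (hH : ∀ n, ContinuousOn (H n) (Icc 0 1 ×ˢ univ)) (h0 : ∀ n z, H n (0, z) = a n z)
    (h1 : ∀ n z, H n (1, z) = a (n + 1) z) (ha : ∀ n, Continuous (a n)) (hg : Continuous g)
    (hlim : ∀ ε > 0, ∃ n₀, ∀ n ≥ n₀, ∀ t ∈ Icc (0 : ℝ) 1, ∀ z, dist (H n (t, z)) (g z) < ε) :
    ∃ G : ℝ × ℂ → ℂ, ContinuousOn G (Icc 0 1 ×ˢ univ) ∧ (∀ z, G (0, z) = a 0 z) ∧
      (∀ z, G (1, z) = g z) ∧ ∀ t ∈ Icc (0 : ℝ) 1, ∀ z,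
        G (t, z) = g z ∨ ∃ n, ∃ s ∈ Icc (0 : ℝ) 1, G (t, z) = H n (s, z) := by
  -- Clamping freezes each homotopy before its start and after its end.
  set c : ℝ → ℝ := fun t => max 0 (min 1 t) with hc
  have hcI : ∀ t, c t ∈ Icc (0 : ℝ) 1 := fun t =>
    ⟨le_max_left _ _, max_le zero_le_one (min_le_left _ _)⟩
  have hc0 : ∀ t ≤ 0, c t = 0 := fun t ht => max_eq_left ((min_le_right _ _).trans ht)
  have hc1 : ∀ t, 1 ≤ t → c t = 1 := fun t ht => by simp [hc, ht]
  have hcid : ∀ t ∈ Icc (0 : ℝ) 1, c t = t := fun t ht => by simp [hc, ht.1, ht.2]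
  have hcc : Continuous c := by fun_prop
  -- The first N homotopies run one after the other, written as a telescoping sum so that continuity
  -- is immediate; at time s in [0, N) only the term of index ⌊s⌋ is in motion.
  set Q : ℕ → ℝ × ℂ → ℂ := fun N p =>
    a 0 p.2 + ∑ n ∈ Finset.range N, (H n (c (p.1 - n), p.2) - a n p.2) with hQ
  have hQc : ∀ N, Continuous (Q N) := by
    intro N
    refine ((ha 0).comp continuous_snd).add (continuous_finsetSum _ fun n _ => ?_)
    refine Continuous.sub ?_ ((ha n).comp continuous_snd)
    exact (hH n).comp_continuous (by fun_prop) fun p => ⟨hcI _, mem_univ _⟩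
  have hQle : ∀ (N : ℕ) (s : ℝ) (z : ℂ), (N : ℝ) ≤ s → Q N (s, z) = a N z := by
    intro N s z
    induction N with
    | zero => intro _; simp [hQ]
    | succ N ih =>
      intro hs
      push_cast at hs
      have h2 := ih (by linarith)
      simp only [hQ] at h2 ⊢
      rw [Finset.sum_range_succ, ← add_assoc, h2, hc1 _ (by linarith), h1]
      ring
  have hQeq : ∀ (N : ℕ) (s : ℝ) (z : ℂ), 0 ≤ s → s < N →
      Q N (s, z) = H ⌊s⌋₊ (s - ⌊s⌋₊, z) := by
    intro N s z hs hN
    have hfl := Nat.floor_le hs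
    have hlt := Nat.lt_floor_add_one s
    have hkN : ⌊s⌋₊ + 1 ≤ N := (Nat.floor_lt hs).2 hN
    clear hN
    induction N, hkN using Nat.le_induction with
    | base =>
      have h2 := hQle ⌊s⌋₊ s z hfl
      simp only [hQ] at h2 ⊢
      rw [Finset.sum_range_succ, ← add_assoc, h2,
        hcid _ ⟨by linarith, by linarith⟩]
      ring
    | succ N hN ih =>
      simp only [hQ] at ih ⊢
      have : (⌊s⌋₊ : ℝ) + 1 ≤ N := by exact_mod_cast hN
      rw [Finset.sum_range_succ, ← add_assoc, ih, hc0 _ (by linarith), h0]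
      ring
  -- This maps [0, 1) onto [0, ∞). At t = 1 the quotient is 0 by convention, which is harmless as
  -- the value of the homotopy there is prescribed separately.
  set σ : ℝ → ℝ := fun t => t / (1 - t) with hσ
  have hσ0 : ∀ t ∈ Icc (0 : ℝ) 1, 0 ≤ σ t := fun t ht =>
    div_nonneg ht.1 (by linarith [ht.2])
  have hfr : ∀ s : ℝ, 0 ≤ s → s - ⌊s⌋₊ ∈ Icc (0 : ℝ) 1 := fun s hs =>
    ⟨by linarith [Nat.floor_le hs], by linarith [Nat.lt_floor_add_one s]⟩
  set G : ℝ × ℂ → ℂ := fun p =>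
    if p.1 < 1 then H ⌊σ p.1⌋₊ (σ p.1 - ⌊σ p.1⌋₊, p.2) else g p.2 with hG
  have hG1 : ∀ p : ℝ × ℂ, p.1 < 1 → G p = H ⌊σ p.1⌋₊ (σ p.1 - ⌊σ p.1⌋₊, p.2) :=
    fun p hp => if_pos hp
  have hG2 : ∀ p : ℝ × ℂ, ¬ p.1 < 1 → G p = g p.2 := fun p hp => if_neg hp
  refine ⟨G, ?_, fun z => ?_, fun z => hG2 _ (by simp), fun t ht z => ?_⟩
  · rintro ⟨t, z⟩ ⟨ht, -⟩
    change t ∈ Icc (0 : ℝ) 1 at ht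
    rcases ht.2.lt_or_eq with hlt | rfl
    · obtain ⟨M, hM⟩ := exists_nat_gt (σ t)
      have hσc : ContinuousAt σ t :=
        continuousAt_id.div (continuousAt_const.sub continuousAt_id)
          (by linarith)
      have hcont : ContinuousAt (fun p : ℝ × ℂ => Q M (σ p.1, p.2)) (t, z) :=
        (hQc M).continuousAt.comp ((ContinuousAt.comp (f := Prod.fst) (x := (t, z)) hσc
          continuousAt_fst).prodMk continuousAt_snd)
      refine hcont.continuousWithinAt.congr_of_eventuallyEq ?_ ?_
      · have e1 : ∀ᶠ p : ℝ × ℂ in 𝓝 (t, z), p.1 < 1 :=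
          continuousAt_fst.eventually_lt continuousAt_const hlt
        have e2 : ∀ᶠ p : ℝ × ℂ in 𝓝 (t, z), σ p.1 < M :=
          (ContinuousAt.comp (f := Prod.fst) (x := (t, z)) hσc continuousAt_fst).eventually_lt
            continuousAt_const hM
        filter_upwards [mem_nhdsWithin_of_mem_nhds e1, mem_nhdsWithin_of_mem_nhds e2,
          self_mem_nhdsWithin] with p hp1 hp2 hp3
        rw [hG1 p hp1, hQeq M _ _ (hσ0 _ hp3.1) hp2]
      · rw [hG1 _ hlt, hQeq M _ _ (hσ0 _ ht) hM]
    · rw [Metric.continuousWithinAt_iff']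
      intro ε hε
      obtain ⟨n₀, hn₀⟩ := hlim (ε / 2) (half_pos hε)
      have e1 : ∀ᶠ p : ℝ × ℂ in 𝓝 ((1 : ℝ), z), dist (g p.2) (g z) < ε / 2 :=
        (hg.comp continuous_snd).continuousAt.eventually (Metric.ball_mem_nhds _ (half_pos hε))
      -- For t < 1 this says n₀ < σ t; without the division it is an open condition that holds at t
      -- = 1.
      have e2 : ∀ᶠ p : ℝ × ℂ in 𝓝 ((1 : ℝ), z), (n₀ : ℝ) * (1 - p.1) < p.1 :=
        ContinuousAt.eventually_lt (by fun_prop) continuousAt_fst (by simp)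
      filter_upwards [mem_nhdsWithin_of_mem_nhds e1, mem_nhdsWithin_of_mem_nhds e2,
        self_mem_nhdsWithin] with p hp1 hp2 hp3
      rw [hG2 (1, z) (by simp)]
      by_cases hp : p.1 < 1
      · rw [hG1 p hp]
        have hs : (n₀ : ℝ) ≤ σ p.1 := by
          rw [hσ, le_div_iff₀ (by linarith)]; exact hp2.le
        have h2 := hn₀ ⌊σ p.1⌋₊ (Nat.le_floor hs) _ (hfr _ (hσ0 _ hp3.1)) p.2
        linarith [dist_triangle (H ⌊σ p.1⌋₊ (σ p.1 - ⌊σ p.1⌋₊, p.2)) (g p.2) (g z)]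
      · rw [hG2 p hp]; linarith
  · rw [hG1 _ (by simp)]
    simp [hσ, h0]
  · by_cases hp : t < 1
    · exact Or.inr ⟨_, _, hfr _ (hσ0 _ ht), hG1 (t, z) hp⟩
    · exact Or.inl (hG2 (t, z) hp)

namespace IsDeformation

variable {f f₁ : ℂ → ℂ} {U' U U₁' U₁ : Set ℂ} {T : RenormalizationTower f U' U}
  {T₁ : RenormalizationTower f₁ U₁' U₁} {l : ℕ} {δ : ℝ} {N N₁ : ℕ → Set ℂ} {K : ℝ}
  {h : ℕ → ℂ ≃ₜ ℂ}

/-- The homotopies between consecutive maps of the sequence shrink to its limit. -/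
theorem exists_homotopies (hd : IsDeformation T T₁ l δ N N₁ K h) {g : ℂ ≃ₜ ℂ}
    (hgu : TendstoUniformly (fun m z => h m z) g atTop) :
    ∃ H : ℕ → ℝ × ℂ → ℂ, (∀ n, ContinuousOn (H n) (Icc 0 1 ×ˢ univ)) ∧
      (∀ n z, H n (0, z) = h n z) ∧ (∀ n z, H n (1, z) = h (n + 1) z) ∧
      (∀ n, ∀ t ∈ Icc (0 : ℝ) 1, ∀ z, H n (t, z) = h n z ∨
        z ∈ U' \ omegaZero f ∧ H n (t, z) ∈ h n '' (U' \ omegaZero f)) ∧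
      ∀ ε > 0, ∃ n₀, ∀ n ≥ n₀, ∀ t ∈ Icc (0 : ℝ) 1, ∀ z, dist (H n (t, z)) (g z) < ε := by
  choose H hc h0 h1 hA him using hd.homotopic
  refine ⟨H, hc, fun n z => h0 n z (mem_univ z), fun n z => h1 n z (mem_univ z),
    fun n t ht z => ?_, fun ε hε => ?_⟩
  · have hsub : univ \ (T.juliaOrbit (n + 1) ∪ (level U' N ((n : ℤ) - l))ᶜ) ⊆
        U' \ omegaZero f := by
      rintro p ⟨-, hp⟩
      simp only [mem_union, mem_compl_iff, not_or, not_not] at hp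
      exact ⟨hd.sys.level_subset_dom _ hp.2, fun hO => hp.1 (hd.sys.omegaZero_subset _ hO)⟩
    by_cases hz : z ∈ T.juliaOrbit (n + 1) ∪ (level U' N ((n : ℤ) - l))ᶜ
    · exact Or.inl (hA n t ht z hz)
    · exact Or.inr ⟨hsub ⟨mem_univ z, hz⟩, image_mono hsub (him n t ht z ⟨mem_univ z, hz⟩)⟩
  · obtain ⟨n₀, hn₀⟩ := hd.exists_dist_lt (half_pos hε)
    obtain ⟨m₀, hm₀⟩ := eventually_atTop.1
      ((Metric.tendstoUniformly_iff.1 hgu) (ε / 2) (half_pos hε))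
    refine ⟨max (n₀ + l) m₀, fun n hn t ht z => ?_⟩
    have hn1 : n₀ + l ≤ n := (le_max_left _ _).trans hn
    have hclose := hm₀ n ((le_max_right _ _).trans hn) z
    rw [dist_comm] at hclose
    by_cases hz : z ∈ T.juliaOrbit (n + 1) ∪ (level U' N ((n : ℤ) - l))ᶜ
    · rw [hA n t ht z hz]; linarith
    have hlev : level U' N ((n : ℤ) - l) = N (n - l) := by
      rw [show (n : ℤ) - l = ((n - l : ℕ) : ℤ) by omega, level_natCast]
    -- Pulled back by `h n`, the track of `z` is a path in `N (n - l)` that starts at `z`. It stays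
    -- in one component, so the track itself lies in the small image of this component.
    have hval : ∀ s ∈ Icc (0 : ℝ) 1, (h n).symm (H n (s, z)) ∈ N (n - l) := by
      intro s hs
      obtain ⟨p, ⟨-, hp⟩, hpe⟩ := him n s hs z ⟨mem_univ z, hz⟩
      simp only [mem_union, mem_compl_iff, not_or, not_not] at hp
      rw [← hpe, (h n).symm_apply_apply, ← hlev]
      exact hp.2
    have hpath : ContinuousOn (fun s => (h n).symm (H n (s, z))) (Icc (0 : ℝ) 1) :=
      (h n).symm.continuous.comp_continuousOn
        ((hc n).comp (by fun_prop) fun s hs => ⟨hs, mem_univ _⟩)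
    have hz0 : (h n).symm (H n (0, z)) = z := by
      rw [h0 n z (mem_univ z), (h n).symm_apply_apply]
    have hzI : z ∈ (fun s => (h n).symm (H n (s, z))) '' Icc (0 : ℝ) 1 := ⟨0, by simp, hz0⟩
    have hsub := (isPreconnected_Icc.image _ hpath).subset_connectedComponentIn hzI
      (image_subset_iff.2 hval)
    have hzN : z ∈ N (n - l) := by have := hval 0 (by simp); rwa [hz0] at this
    have h2 := hn₀ (n - l) (by omega) n (by omega) z hzN _ (hsub (mem_image_of_mem _ ht)) z
      (mem_connectedComponentIn hzN)
    rw [(h n).apply_symm_apply] at h2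
    linarith [dist_triangle (H n (t, z)) (h n z) (g z)]

/-- The homotopies move only points of U' \ ω(0), and keep them in the image of this set, which is
the same for all `h m` and for the limit. So only the part of `A` inside U' matters, and one
homotopy serves the plane rel ω(0) as well as the closure of U rel the boundaries and ω(0). -/
theorem limit_homotopicRel (hd : IsDeformation T T₁ l δ N N₁ K h) {g : ℂ ≃ₜ ℂ}
    (hgu : TendstoUniformly (fun m z => h m z) g atTop)
    (hg : ∀ z, ∀ᶠ m in atTop, h m z = g z) {X A : Set ℂ} (hX : U' ⊆ X)
    (hA : ∀ z ∈ A, z ∈ U' → z ∈ omegaZero f) : HomotopicRel X A (h 0) g := by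
  obtain ⟨H, hHc, hH0, hH1, hHv, hHlim⟩ := hd.exists_homotopies hgu
  obtain ⟨G, hGc, hG0, hG1, hGv⟩ := exists_concat_homotopy hHc hH0 hH1
    (fun n => (h n).continuous) g.continuous hHlim
  have himg : ∀ g' : ℂ ≃ₜ ℂ, (∀ z ∉ U', g' z = h 0 z) → (∀ z ∈ omegaZero f, g' z = h 0 z) →
      g' '' (U' \ omegaZero f) = h 0 '' (U' \ omegaZero f) := by
    intro g' hU' hO'
    rw [image_sdiff g'.injective, image_sdiff (h 0).injective, image_eq_of_eqOn_compl hU',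
      image_congr hO']
  have himh := fun n => himg (h n) (fun z hz => hd.apply_of_notMem_dom n hz)
    (fun z hz => hd.apply_of_mem_omegaZero n hz)
  have himl := himg g (fun z hz => hd.limit_apply_of_notMem_dom hg hz)
    (fun z hz => hd.limit_apply_of_mem_omegaZero hg hz)
  have hconst : ∀ t ∈ Icc (0 : ℝ) 1, ∀ z, z ∉ U' \ omegaZero f → G (t, z) = h 0 z := by
    intro t ht z hz
    have hz' : z ∉ U' ∨ z ∈ omegaZero f := by
      by_cases hzU : z ∈ U'
      · exact Or.inr (by_contra fun hzO => hz ⟨hzU, hzO⟩)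
      · exact Or.inl hzU
    rcases hGv t ht z with e | ⟨n, s, hs, e⟩
    · rw [e]
      exact hz'.elim (hd.limit_apply_of_notMem_dom hg) (hd.limit_apply_of_mem_omegaZero hg)
    · rw [e, (hHv n s hs z).resolve_right fun hc => hz hc.1]
      exact hz'.elim (hd.apply_of_notMem_dom n) (hd.apply_of_mem_omegaZero n)
  refine ⟨G, hGc.mono (prod_mono_right (subset_univ _)), fun z _ => hG0 z, fun z _ => hG1 z,
    fun t ht z hz => hconst t ht z fun hz' => hz'.2 (hA z hz hz'.1), fun t ht z hz => ?_⟩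
  by_cases hzU : z ∈ U' \ omegaZero f
  · have hmem : G (t, z) ∈ h 0 '' (U' \ omegaZero f) := by
      rcases hGv t ht z with e | ⟨n, s, hs, e⟩
      · rw [e, ← himl]; exact mem_image_of_mem _ hzU
      · rw [e, ← himh n]
        rcases hHv n s hs z with e' | e'
        · rw [e']; exact mem_image_of_mem _ hzU
        · exact e'.2
    have hsub : U' \ omegaZero f ⊆ X \ A := fun p hp =>
      ⟨hX hp.1, fun hpA => hp.2 (hA p hpA hp.1)⟩
    exact image_mono hsub hmem
  · rw [hconst t ht z hzU]
    exact mem_image_of_mem _ hz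

end IsDeformation

end Lyubich

theorem mainTheorem6
    (f f₁ : ℂ → ℂ) (U' U U₁' U₁ : Set ℂ)
    (T : Lyubich.RenormalizationTower f U' U)
    (T₁ : Lyubich.RenormalizationTower f₁ U₁' U₁)
    (l : ℕ) (δ : ℝ) (hδ : 0 < δ) (N N₁ : ℕ → Set ℂ)
    (hN : Lyubich.IsNeighborhoodSystem T l δ N)
    (hN₁ : Lyubich.IsNeighborhoodSystem T₁ l δ N₁)
    (K : ℝ) (h : ℕ → ℂ ≃ₜ ℂ)
    -- `h_m` maps the triple `(ℂ, 𝕌^m, 𝕁^m)` to the corresponding one for `f₁`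
    (h_nbhd : ∀ m, h m '' N m = N₁ m)
    (h_julia : ∀ m, h m '' T.juliaOrbit m = T₁.juliaOrbit m)
    -- (i)
    (h_conj : Lyubich.IsTopConjugacy f U' U f₁ U₁' U₁ (h 0))
    -- (ii)
    (h_homotopic : ∀ m : ℕ, Lyubich.HomotopicRel Set.univ
      (T.juliaOrbit (m + 1) ∪ (Lyubich.level U' N ((m : ℤ) - l))ᶜ) (h m) (h (m + 1)))
    -- (iii)
    (h_qc : ∀ m : ℕ,
      Lyubich.IsQC K (h m) (Lyubich.level U' N ((m : ℤ) - 1) \ T.juliaOrbit m))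
    -- (iv)
    (h_dil : ∀ m : ℕ, ∀ n : ℤ, (m : ℤ) - l ≤ n → n ≤ m →
      Lyubich.Dil (h (m + 1)) (Lyubich.level U' N n \ T.juliaOrbit (m + 1)) ≤
        ENNReal.ofReal (4 * K ^ 4) *
          Lyubich.Dil (h m) (Lyubich.level U' N n \ T.juliaOrbit m)) :
    ∃ h_lim : ℂ ≃ₜ ℂ,
      TendstoUniformly (fun m z => h m z) h_lim Filter.atTop ∧
      Lyubich.IsThurstonConjugacy f U' U f₁ U₁' U₁ h_lim ∧
      Lyubich.HomotopicRel Set.univ (Lyubich.omegaZero f) (h 0) h_lim ∧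
      -- if `h_0` is quasiconformal on the whole plane off the Julia set, so is the limit on `ℂ`
      ((∃ K₀ : ℝ, Lyubich.IsQC K₀ (h 0) (T.juliaOrbit 0)ᶜ) →
        ∃ K₁ : ℝ, Lyubich.IsQC K₁ h_lim Set.univ) := by
  have hd : Lyubich.IsDeformation T T₁ l δ N N₁ K h :=
    ⟨hδ, hN, hN₁, h_julia, h_conj, h_homotopic, h_qc, h_dil⟩
  have hq := T.quadraticLike
  obtain ⟨g, hgu, hg⟩ := hd.exists_limit
  refine ⟨g, hgu, ⟨?_, ?_, ?_, hd.limit_image_omegaZero hg, h 0, h_conj, hd.image_omegaZero, ?_⟩,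
    ?_, ?_⟩
  -- Hypothesis (iii) for m = 0 concerns U' only; the functional equation carries it to U.
  · have h₀ := hd.isQC_zero_dom
    rw [T.juliaOrbit_zero] at h₀
    refine hd.limit_isQC hg hq.isOpen_cod hq.dom_subset (K₀ := K) ?_
    rw [T.juliaOrbit_zero]
    exact h_conj.isQC_cod hq T₁.quadraticLike h₀
  · rw [hd.limit_image hg hq.dom_subset, h_conj.1]
  · rw [hd.limit_image hg subset_rfl, h_conj.2.1]
  · refine hd.limit_homotopicRel hgu hg (hq.dom_subset.trans subset_closure) ?_
    -- The frontiers of the open sets U and U' are disjoint from U', so only ω(0) contributes.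
    rintro z ((hz | hz) | hz) hzU
    · rw [hq.isOpen_cod.frontier_eq] at hz
      exact absurd (hq.dom_subset hzU) hz.2
    · rw [hq.isOpen_dom.frontier_eq] at hz
      exact absurd hzU hz.2
    · exact hz
  · exact hd.limit_homotopicRel hgu hg (subset_univ _) fun _ hz _ => hz
  · rintro ⟨K₀, hK₀⟩
    exact hd.limit_isQC hg isOpen_univ (subset_univ _) (K₀ := K₀) (by rwa [← compl_eq_univ_sdiff])
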